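/- **Notation.** Let $q=e^{h/2}\in\mathbf C[[h]]$ and $[x]=\dfrac{q^x-q^{-x}}{q-q^{-1}}$, let $\theta(i)=1$ for $i\ge 0$ and $\theta(i)=0$ for $i<0$, and let $\mathbf Z_+$ be the set of non-negative integers. **The algebra.** $U_h(a_\infty)$ is the $h$-adically complete $\mathbf C[[h]]$-algebra topologically generated by $e_i,f_i,h_i,c$ ($i\in\mathbf Z$) (the completed free algebra modulo the closure of the ideal of relations) with relations $c$ central; $[h_i,h_j]=0$; $[h_i,e_j]=(\delta_{ij}-\delta_{i,j+1})e_j$; $[h_i,f_j]=-(\delta_{ij}-\delta_{i,j+1})f_j$; $e_if_i-f_ie_i=[\,h_i-h_{i+1}+(\theta(-i)-\theta(-i-1))c\,]$, the right-hand side being a $q$-bracket; $e_if_j=f_je_i$ for $i\neq j$; $e_ie_j=e_je_i$ and $f_if_j=f_jf_i$ for $|i-j|\ne1$; and $x_i^2x_j-(q+q^{-1})x_ix_jx_i+x_jx_i^2=0$ for $|i-j|=1$, $x\in\{e,f\}$. **The module.** Let $\xi_0,\xi_1\in\mathbf C[h]$ and let $\{M_i\}_{i\in\mathbf Z}$ be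 a sequence in $\mathbf C[h]$ with $M_i-M_j\in\mathbf Z_+$ for all $i<j$. A *$C$-pattern* $|M)$ is a family $M_{i,2k+\theta-1}\in\mathbf C[h]$ ($k\ge1$, $\theta\in\{0,1\}$, $1-\theta-k\le i\le k-1$) such that $M_{i,p}=M_i$ for all $p$ larger than some $N$ depending on the pattern, and such that $M_{i+\theta-1,2k+\theta}-M_{i,2k+\theta-1}\in\mathbf Z_+$ and $M_{i,2k+\theta-1}-M_{i+\theta,2k+\theta}\in\mathbf Z_+$ for all such $i,k,\theta$. Let $V=V(\{M\};\xi_0,\xi_1)$ be the $h$-adic completion of the free $\mathbf C[[h]]$-module on the set of $C$-patterns. **The action.** Put $L_{i,p}=M_{i,p}-i$, $e_i^0=f_i$, $e_i^1=e_i$, and $S(j,l;\nu)=(-1)^\nu,\,1,\,-1$ for $j=l$, $j<l$, $j>l$ respectively. Let $|M)_{s\{j,p\}}$ denote the pattern obtained by $M_{j,p}\mapsto M_{j,p}+s$. Terms whose array is not a $C$-pattern are deleted, and square roots in $\mathbf C[[h]]$ are taken with positive constant term ($0^{1/2}=0$). Consider, for all $C$-patterns $|M)$, the formulas $$e_{-1}^{1-\mu}|M)=\big([L_{-1,2}-L_{0,1}-\mu][L_{0,1}-L_{0,2}+\mu]\big)^{1/2}|M)_{-(-1)^\mu\{0,1\}},\qquad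 \mu=0,1,\tag{19}$$ $$e^{\mu}_{(-1)^\nu i-1}|M)=-\sum_{j=1-i-\nu}^{i-1}\ \sum_{l=-i}^{i+\nu-1}S(j,l;\nu)\,R_{j,l}^{1/2}\,|M)_{-(-1)^{\mu+\nu}\{j,2i-1+\nu\}}^{-(-1)^{\mu+\nu}\{l,2i+\nu\}},\qquad i\ge1,\ \mu,\nu\in\{0,1\},\tag{20}$$ $$\begin{aligned}R_{j,l}=&-\frac{\prod_{k=-i,\,k\ne l}^{i+\nu-1}[L_{k,2i+\nu}-L_{j,2i+\nu-1}-(-1)^\nu\mu]\ \prod_{k=1-i}^{i+\nu-2}[L_{k,2i+\nu-2}-L_{j,2i+\nu-1}-(-1)^\nu\mu]}{\prod_{k=1-i-\nu,\,k\ne j}^{i-1}[L_{k,2i+\nu-1}-L_{j,2i+\nu-1}][L_{k,2i+\nu-1}-L_{j,2i+\nu-1}+(-1)^{\mu+\nu}]}\\&\times\frac{\prod_{k=-i-\nu}^{i}[L_{k,2i+\nu+1}-L_{l,2i+\nu}+(-1)^\nu(1-\mu)]\ \prod_{k=1-i-\nu,\,k\ne j}^{i-1}[L_{k,2i+\nu-1}-L_{l,2i+\nu}+(-1)^\nu(1-\mu)]}{\prod_{k=-i,\,k\ne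 l}^{i+\nu-1}[L_{k,2i+\nu}-L_{l,2i+\nu}][L_{k,2i+\nu}-L_{l,2i+\nu}+(-1)^{\mu+\nu}]},\end{aligned}$$ $$h_i|M)=\Big(\sum_{j=-|i|}^{|i|+\theta(i)-1}M_{j,2|i|+\theta(i)}-\sum_{j=-|i|+1-\theta(i)}^{|i|-1}M_{j,2|i|+\theta(i)-1}+(\xi_1-\xi_0)\theta(-i)-\xi_1\Big)|M),\qquad i\in\mathbf Z,\tag{21}$$ $$c|M)=(\xi_0-\xi_1)|M).\tag{22}$$ **Proposition 2.** There is a unique homomorphism of $\mathbf C[[h]]$-algebras $\rho:U_h(a_\infty)\to\operatorname{End}_{\mathbf C[[h]]}V$ for which the generators act on the $C$-patterns by (19)–(22), and it is $h$-adically continuous; so $V$ is a $U_h(a_\infty)$-module. It is a highest weight module: the $C$-pattern $|\hat M)$ with $\hat M_{i,p}=M_i$ for all $i,p$ is a nonzero vector with $\rho(e_i)|\hat M)=0$ and $\rho(h_i)|\hat M)=(M_i+(\xi_1-\xi_0)\theta(-i)-\xi_1)|\hat M)$ for all $i\in\mathbf Z$, and $\rho(U_h(a_\infty))|\hat M)=V$.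 It is irreducible, in the sense appropriate to modules over $\mathbf C[[h]]$ (where $h^nV$ is always a submodule): $V\neq0$, and every nonzero $\rho$-invariant $\mathbf C[[h]]$-submodule of $V$ is $h^nV$ for some $n\ge0$; in particular, for all $x,y\in V$ with $x\ne0$ there are $u\in U_h(a_\infty)$ and $0\neq a\in\mathbf C[[h]]$ with $\rho(u)x=a\,y$. -/

import Mathlib

open scoped Polynomial PowerSeries

noncomputable section

namespace UhaInfinity

/-! ### `q`-numbers; the deformation parameter `h` is `PowerSeries.X` -/

section QNumbers

variable {A : Type*} [Ring A] [Algebra ℂ A]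

/-- `q ^ x = exp (h x / 2) = ∑ₖ (h x) ^ k / (2 ^ k k!)` for `x` in `A⟦h⟧`. The `n`-th coefficient
only involves the terms with `k ≤ n`. -/
def qPow (x : A⟦X⟧) : A⟦X⟧ :=
  PowerSeries.mk fun n => ∑ k ∈ Finset.range (n + 1),
    ((2 : ℂ) ^ k * (k.factorial : ℂ))⁻¹ • PowerSeries.coeff n ((PowerSeries.X * x) ^ k)

/-- Division by `h` of a series without constant term. -/
def divH (f : A⟦X⟧) : A⟦X⟧ :=
  PowerSeries.mk fun n => PowerSeries.coeff (n + 1) f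

/-- `[x] = (q ^ x - q ^ (-x)) / (q - q ^ (-1))`. Numerator and denominator are both divisible
by `h`; after division by `h` the denominator is a series over `ℂ` with constant term `1`. -/
def qBracket (x : A⟦X⟧) : A⟦X⟧ :=
  PowerSeries.map (algebraMap ℂ A) (divH (qPow (1 : ℂ⟦X⟧) - qPow (-1 : ℂ⟦X⟧)))⁻¹ *
    divH (qPow x - qPow (-x))

end QNumbers

open Classical in
/-- The square root in `ℂ⟦h⟧` whose constant term is a positive real number; it is `0` if there is
no such root, in particular `psSqrt 0 = 0`. -/
def psSqrt (r : ℂ⟦X⟧) : ℂ⟦X⟧ :=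
  if hr : ∃ s : ℂ⟦X⟧, s ^ 2 = r ∧ ∃ a : ℝ, 0 < a ∧ PowerSeries.constantCoeff s = (a : ℂ) then
    hr.choose
  else 0

/-- `θ i = 1` for `i ≥ 0` and `θ i = 0` for `i < 0`. -/
def theta (i : ℤ) : ℤ := if 0 ≤ i then 1 else 0

/-! ### The algebra `U_h(a_∞)` -/

/-- The Chevalley generators. -/
inductive Gen : Type
  | e (i : ℤ) : Gen
  | f (i : ℤ) : Gen
  | h (i : ℤ) : Gen
  | c : Gen

/-- The `h`-adic completion of the free `ℂ⟦h⟧`-algebra on the Chevalley generators: formal power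
series in a central variable `h` with coefficients noncommutative polynomials over `ℂ`. -/
abbrev FreeSeries : Type := PowerSeries (FreeAlgebra ℂ Gen)

instance : Algebra ℂ⟦X⟧ FreeSeries :=
  RingHom.toAlgebra' (PowerSeries.map (algebraMap ℂ (FreeAlgebra ℂ Gen))) (by
    intro c x
    ext n
    rw [PowerSeries.coeff_mul, PowerSeries.coeff_mul, ← Finset.Nat.sum_antidiagonal_swap]
    refine Finset.sum_congr rfl fun p _ => ?_
    simp only [Prod.fst_swap, Prod.snd_swap, PowerSeries.coeff_map]
    exact Algebra.commutes _ _)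

/-- A generator as an element of the completed free algebra. -/
def gen (g : Gen) : FreeSeries := PowerSeries.C (FreeAlgebra.ι ℂ g)

open Gen in
/-- The elements that the defining relations set to zero (Cartan, `e`-Serre and `f`-Serre
relations). -/
inductive IsRelator : FreeSeries → Prop
  | c_e (i : ℤ) : IsRelator (gen c * gen (e i) - gen (e i) * gen c)
  | c_f (i : ℤ) : IsRelator (gen c * gen (f i) - gen (f i) * gen c)
  | c_h (i : ℤ) : IsRelator (gen c * gen (h i) - gen (h i) * gen c)
  | h_h (i j : ℤ) : IsRelator (gen (h i) * gen (h j) - gen (h j) * gen (h i))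
  | h_e (i j : ℤ) : IsRelator (gen (h i) * gen (e j) - gen (e j) * gen (h i) -
      ((if i = j then 1 else 0) - (if i = j + 1 then 1 else 0) : ℤ) • gen (e j))
  | h_f (i j : ℤ) : IsRelator (gen (h i) * gen (f j) - gen (f j) * gen (h i) +
      ((if i = j then 1 else 0) - (if i = j + 1 then 1 else 0) : ℤ) • gen (f j))
  | e_f (i : ℤ) : IsRelator (gen (e i) * gen (f i) - gen (f i) * gen (e i) -
      qBracket (gen (h i) - gen (h (i + 1)) + (theta (-i) - theta (-i - 1)) • gen c))
  | e_f_ne (i j : ℤ) (hij : i ≠ j) : IsRelator (gen (e i) * gen (f j) - gen (f j) * gen (e i))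
  | e_e (i j : ℤ) (hij : |i - j| ≠ 1) : IsRelator (gen (e i) * gen (e j) - gen (e j) * gen (e i))
  | e_serre (i j : ℤ) (hij : |i - j| = 1) : IsRelator (gen (e i) ^ 2 * gen (e j) -
      (qPow (1 : ℂ⟦X⟧) + qPow (-1 : ℂ⟦X⟧)) • (gen (e i) * gen (e j) * gen (e i)) +
      gen (e j) * gen (e i) ^ 2)
  | f_f (i j : ℤ) (hij : |i - j| ≠ 1) : IsRelator (gen (f i) * gen (f j) - gen (f j) * gen (f i))
  | f_serre (i j : ℤ) (hij : |i - j| = 1) : IsRelator (gen (f i) ^ 2 * gen (f j) -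
      (qPow (1 : ℂ⟦X⟧) + qPow (-1 : ℂ⟦X⟧)) • (gen (f i) * gen (f j) * gen (f i)) +
      gen (f j) * gen (f i) ^ 2)

/-- The `h`-adic closure `⋂ₙ (J + hⁿ)` of the two-sided ideal `J` generated by the relators. -/
def relIdeal : TwoSidedIdeal FreeSeries :=
  ⨅ n : ℕ, TwoSidedIdeal.span {x | IsRelator x} ⊔
    TwoSidedIdeal.span {(PowerSeries.X : FreeSeries) ^ n}

/-- `U_h(a_∞)`: the `h`-adically complete `ℂ⟦h⟧`-algebra topologically generated by the Chevalley
generators, subject to the Cartan and Serre relations. -/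
def Uh : Type := relIdeal.ringCon.Quotient

instance : Ring Uh := inferInstanceAs (Ring relIdeal.ringCon.Quotient)

instance : Algebra ℂ⟦X⟧ Uh := inferInstanceAs (Algebra ℂ⟦X⟧ relIdeal.ringCon.Quotient)

/-- A Chevalley generator as an element of `U_h(a_∞)`. -/
def Uh.of (g : Gen) : Uh := relIdeal.ringCon.mk' (gen g)

/-- `e_i^0 = f_i`, `e_i^1 = e_i`. -/
def Uh.chev (μ : ℕ) (i : ℤ) : Uh := if μ = 0 then Uh.of (Gen.f i) else Uh.of (Gen.e i)

/-! ### `C`-patterns and the module `V({M}; ξ₀, ξ₁)` -/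

/-- The element lies in `ℤ₊ ⊆ ℂ[h]`. -/
def IsNatConst (x : ℂ[X]) : Prop := ∃ n : ℕ, x = (n : ℂ[X])

/-- The column indices of the row `p`: these are `[1 - θ - k; k - 1]` for `p = 2k + θ - 1`,
`k ≥ 1`, `θ ∈ {0, 1}`, and there are none for `p ≤ 0`. -/
def rowIdx (p : ℤ) : Finset ℤ := Finset.Icc (-(p / 2)) ((p - 1) / 2)

/-- `m i p` is the entry `M_{i,p}` of a `C`-pattern with signature `M`. The positions outside the
triangle are not part of the pattern; to have one function per pattern, the value there is fixed
to be `M i`. -/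
structure IsCPattern (M : ℤ → ℂ[X]) (m : ℤ → ℤ → ℂ[X]) : Prop where
  outside : ∀ i p : ℤ, i ∉ rowIdx p → m i p = M i
  stable : ∃ N : ℤ, 1 < N ∧ ∀ p : ℤ, N ≤ p → ∀ i ∈ rowIdx p, m i p = M i
  interlace : ∀ k θ : ℤ, 1 ≤ k → (θ = 0 ∨ θ = 1) → ∀ i ∈ Finset.Icc (1 - θ - k) (k - 1),
    IsNatConst (m (i + θ - 1) (2 * k + θ) - m i (2 * k + θ - 1)) ∧
    IsNatConst (m i (2 * k + θ - 1) - m (i + θ) (2 * k + θ))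

/-- The set `Γ({M})` of all `C`-patterns. -/
abbrev CPattern (M : ℤ → ℂ[X]) : Type := {m : ℤ → ℤ → ℂ[X] // IsCPattern M m}

/-- The module `V({M}; ξ₀, ξ₁)`: the `h`-adic completion of the free `ℂ⟦h⟧`-module on the
`C`-patterns. The parameters `ξ₀`, `ξ₁` only enter the action. -/
abbrev V (M : ℤ → ℂ[X]) : Type :=
  AdicCompletion (Ideal.span {(PowerSeries.X : ℂ⟦X⟧)}) (CPattern M →₀ ℂ⟦X⟧)

open Classical in
/-- The basis vector of a `C`-pattern, and `0` for an array that is not a `C`-pattern (such terms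
are deleted). -/
def ket (M : ℤ → ℂ[X]) (m : ℤ → ℤ → ℂ[X]) : V M :=
  if hm : IsCPattern M m then
    AdicCompletion.of (Ideal.span {(PowerSeries.X : ℂ⟦X⟧)}) (CPattern M →₀ ℂ⟦X⟧)
      (Finsupp.single ⟨m, hm⟩ 1)
  else 0

/-- The array obtained by `M_{j,p} ↦ M_{j,p} + s`. -/
def shift (m : ℤ → ℤ → ℂ[X]) (s j p : ℤ) : ℤ → ℤ → ℂ[X] :=
  fun i r => if i = j ∧ r = p then m i r + (s : ℂ[X]) else m i r

/-- `L_{i,p} = M_{i,p} - i`. -/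
def L (m : ℤ → ℤ → ℂ[X]) (i p : ℤ) : ℂ[X] := m i p - (i : ℂ[X])

/-- `[x]` for `x ∈ ℂ[h]`. -/
def br (x : ℂ[X]) : ℂ⟦X⟧ := qBracket (x : ℂ⟦X⟧)

/-- `S(j, l; ν)`. -/
def S (j l : ℤ) (ν : ℕ) : ℤ := if j = l then (-1) ^ ν else if j < l then 1 else -1

/-- The expression under the square root in the action of `e_{-1}^{1-μ}`. -/
def radicandMid (m : ℤ → ℤ → ℂ[X]) (μ : ℕ) : ℂ⟦X⟧ :=
  br (L m (-1) 2 - L m 0 1 - (μ : ℂ[X])) * br (L m 0 1 - L m 0 2 + (μ : ℂ[X]))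

/-- The expression under the square root in the term `(j, l)` of the action of
`e^μ_{(-1)^ν i - 1}`. -/
def radicand (m : ℤ → ℤ → ℂ[X]) (i : ℤ) (μ ν : ℕ) (j l : ℤ) : ℂ⟦X⟧ :=
  -(((∏ k ∈ (Finset.Icc (-i) (i + ν - 1)).erase l,
        br (L m k (2 * i + ν) - L m j (2 * i + ν - 1) - (-1) ^ ν * (μ : ℂ[X]))) *
      (∏ k ∈ Finset.Icc (1 - i) (i + ν - 2),
        br (L m k (2 * i + ν - 2) - L m j (2 * i + ν - 1) - (-1) ^ ν * (μ : ℂ[X])))) *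
    (∏ k ∈ (Finset.Icc (1 - i - ν) (i - 1)).erase j,
        br (L m k (2 * i + ν - 1) - L m j (2 * i + ν - 1)) *
        br (L m k (2 * i + ν - 1) - L m j (2 * i + ν - 1) + (-1) ^ (μ + ν)))⁻¹ *
    ((∏ k ∈ Finset.Icc (-i - ν) i,
        br (L m k (2 * i + ν + 1) - L m l (2 * i + ν) + (-1) ^ ν * (1 - (μ : ℂ[X])))) *
      (∏ k ∈ (Finset.Icc (1 - i - ν) (i - 1)).erase j,
        br (L m k (2 * i + ν - 1) - L m l (2 * i + ν) + (-1) ^ ν * (1 - (μ : ℂ[X]))))) *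
    (∏ k ∈ (Finset.Icc (-i) (i + ν - 1)).erase l,
        br (L m k (2 * i + ν) - L m l (2 * i + ν)) *
        br (L m k (2 * i + ν) - L m l (2 * i + ν) + (-1) ^ (μ + ν)))⁻¹)

/-- The eigenvalue of `h_i` on the pattern `m`. -/
def weight (ξ₀ ξ₁ : ℂ[X]) (m : ℤ → ℤ → ℂ[X]) (i : ℤ) : ℂ[X] :=
  (∑ j ∈ Finset.Icc (-|i|) (|i| + theta i - 1), m j (2 * |i| + theta i)) -
    (∑ j ∈ Finset.Icc (-|i| + 1 - theta i) (|i| - 1), m j (2 * |i| + theta i - 1)) +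
    (ξ₁ - ξ₀) * (theta (-i) : ℂ[X]) - ξ₁

/-! ### Representations in `V` -/

/-- The `ℂ⟦h⟧`-linear representations of `U_h(a_∞)` in `V`. -/
abbrev Rep (M : ℤ → ℂ[X]) : Type := Uh →ₐ[ℂ⟦X⟧] Module.End ℂ⟦X⟧ (V M)

/-- The Chevalley generators act on the `C`-basis by the explicit transformation formulas. -/
structure ActsOnBasis {M : ℤ → ℂ[X]} (ξ₀ ξ₁ : ℂ[X]) (ρ : Rep M) : Prop where
  mid : ∀ (m : CPattern M) (μ : ℕ), μ ≤ 1 →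
    ρ (Uh.chev (1 - μ) (-1)) (ket M m.1) =
      psSqrt (radicandMid m.1 μ) • ket M (shift m.1 (-(-1) ^ μ) 0 1)
  outer : ∀ (m : CPattern M) (i : ℤ) (μ ν : ℕ), 1 ≤ i → μ ≤ 1 → ν ≤ 1 →
    ρ (Uh.chev μ ((-1) ^ ν * i - 1)) (ket M m.1) =
      -∑ j ∈ Finset.Icc (1 - i - ν) (i - 1), ∑ l ∈ Finset.Icc (-i) (i + ν - 1),
        S j l ν • psSqrt (radicand m.1 i μ ν j l) •
          ket M (shift (shift m.1 (-(-1) ^ (μ + ν)) j (2 * i - 1 + ν))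
            (-(-1) ^ (μ + ν)) l (2 * i + ν))
  cartan : ∀ (m : CPattern M) (i : ℤ),
    ρ (Uh.of (Gen.h i)) (ket M m.1) = (weight ξ₀ ξ₁ m.1 i : ℂ⟦X⟧) • ket M m.1
  central : ∀ m : CPattern M,
    ρ (Uh.of Gen.c) (ket M m.1) = ((ξ₀ - ξ₁ : ℂ[X]) : ℂ⟦X⟧) • ket M m.1

/-- Continuity for the `h`-adic topologies of `U_h(a_∞)` and `End V`. -/
def IsHAdicContinuous {M : ℤ → ℂ[X]} (ρ : Rep M) : Prop :=
  ∀ (u : Uh) (n : ℕ), ∃ k : ℕ, ∀ w : Uh, ∃ T : Module.End ℂ⟦X⟧ (V M),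
    ρ (u + (PowerSeries.X : ℂ⟦X⟧) ^ k • w) = ρ u + (PowerSeries.X : ℂ⟦X⟧) ^ n • T

/-- `V` is a highest weight module with highest weight vector `v` and highest weight `Λ`. -/
structure IsHighestWeight {M : ℤ → ℂ[X]} (ρ : Rep M) (v : V M) (Λ : ℤ → ℂ⟦X⟧) : Prop where
  ne_zero : v ≠ 0
  raise : ∀ i : ℤ, ρ (Uh.of (Gen.e i)) v = 0
  eigen : ∀ i : ℤ, ρ (Uh.of (Gen.h i)) v = Λ i • v
  generates : ∀ y : V M, ∃ u : Uh, ρ u v = y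

/-- Irreducibility of a topologically free module. The submodules `hⁿ V` are always invariant, so
irreducible means that `0` and the `hⁿ V` are the only invariant submodules. -/
structure IsIrreducible {M : ℤ → ℂ[X]} (ρ : Rep M) : Prop where
  nontrivial : Nontrivial (V M)
  eq_hPow : ∀ W : Submodule ℂ⟦X⟧ (V M), (∀ u : Uh, ∀ w ∈ W, ρ u w ∈ W) → W ≠ ⊥ →
    ∃ n : ℕ, ∀ v : V M, v ∈ W ↔ ∃ w : V M, v = (PowerSeries.X : ℂ⟦X⟧) ^ n • w

end UhaInfinity

end

open scoped Polynomial PowerSeries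

noncomputable section

namespace UhaInfinity

/-! ### `q`-numbers of integers -/

section QNum

open PowerSeries

/-! All `M i` differ by integers, and the formulas involve differences of entries only. A C-pattern
is therefore a triangular array of integers: row `p` has `p` entries and interlaces with row `p +
1`. On such arrays there are Gelfand–Zetlin operators x_p (`xop`) and y_p (`yop`) which raise or
lower one entry of row `p`, with coefficients that are quotients of products of q-numbers and
contain no roots. They satisfy the Chevalley–Serre relations for the Dynkin diagram with nodes 1, 2,
3, ... The relation for [x_p, y_p] is a partial fraction identity (`sum_residues`, `xop_comm_yop`);
the Serre relations are three-term identities between q-numbers (`Governs.serre`, `Governs.serre'`).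
Arrays violating interlacing cause no trouble, because the numerators vanish where a path would
leave the set of patterns.

The rows successively add the weights 0, -1, 1, -2, 2, ... In this order a simple root of a_∞ is, up
to sign, the first simple root or the sum of two neighbouring ones. Accordingly e_i and f_i become
q-commutators of neighbouring x_p or y_p (`eop`, `fop`), and the relations between them follow
formally from those of the x_p and y_p. The exponent of q alternates with the row, so that
overlapping composite root vectors commute. At the apex, where raising meets lowering, a power of q
in the entry of the first row turns commutators into q-commutators.

The prescribed formulas have square roots instead. Interlacing fixes the sign of every q-number that
occurs, so up to explicit signs the coefficients have positive constant term. Conjugation by a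
diagonal gauge factor, the root of a product of q-factorials times a power of q, makes them
symmetric: `Raise.gaugeSq_mul` and `Raise.phase_eq` say how this factor changes along a transition.
The factor uses the first `P` rows only, which suffices since each relation involves finitely many
rows.

The rest of the existence proof is topological. Operators on the free module extend to its
completion, noncommutative series in the generators can be evaluated there, and the closed ideal of
relations is killed because the completion is separated. Uniqueness holds because the patterns span
a dense submodule and the generators are topologically dense.

Irreducibility is an argument modulo h. There the commutators of e's, f's, x's and y's give back all
x_p and y_p (`xop_yop_mem`). A vector not divisible by h can be raised until only the largest array
survives modulo h (`exists_flat_mem`), and from it lowering reaches every array (`kz_mem_of_lower`);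
both steps are triangular with respect to the first row that differs from the beginning of the next
one. Hence a vector not divisible by h is sent to any given vector modulo h, and by successive
approximation exactly (`exists_repn`). This yields cyclicity and the list of invariant submodules.
-/

lemma qPow_C (a : ℂ) : qPow (C a : ℂ⟦X⟧) = rescale (a / 2) (exp ℂ) := by
  ext n
  rw [qPow, coeff_mk, coeff_rescale, coeff_exp, Finset.sum_eq_single n]
  · rw [mul_pow, ← map_pow, coeff_mul_C, coeff_X_pow_self]
    simp only [smul_eq_mul, one_mul, div_pow, map_div₀, map_one, map_natCast]
    field_simp
  · intro k _ hk
    rw [mul_pow, ← map_pow, coeff_mul_C, coeff_X_pow, if_neg (Ne.symm hk)]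
    simp
  · simp

/-- The unit `q` of `ℂ⟦h⟧`. -/
def qUnit : ℂ⟦X⟧ˣ where
  val := qPow 1
  inv := qPow (-1)
  val_inv := by
    have h1 : (1 : ℂ⟦X⟧) = C 1 := by simp
    have h2 : (-1 : ℂ⟦X⟧) = C (-1) := by simp
    rw [h2, h1, qPow_C, qPow_C, exp_mul_exp_eq_exp_add]
    norm_num
  inv_val := by
    have h1 : (1 : ℂ⟦X⟧) = C 1 := by simp
    have h2 : (-1 : ℂ⟦X⟧) = C (-1) := by simp
    rw [h2, h1, qPow_C, qPow_C, exp_mul_exp_eq_exp_add]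
    norm_num

/-- `q ^ n` for an integer `n`. -/
def qz (n : ℤ) : ℂ⟦X⟧ := ((qUnit ^ n : ℂ⟦X⟧ˣ) : ℂ⟦X⟧)

lemma qz_add (a b : ℤ) : qz (a + b) = qz a * qz b := by simp [qz, zpow_add]

@[simp] lemma qz_zero : qz 0 = 1 := by simp [qz]

lemma qz_mul_neg (a : ℤ) : qz a * qz (-a) = 1 := by rw [← qz_add]; simp

lemma qz_one : qz 1 = qPow 1 := by simp [qz, qUnit]

lemma qz_neg_one : qz (-1) = qPow (-1) := by simp [qz]; rfl

lemma qz_sum {ι : Type*} (s : Finset ι) (f : ι → ℤ) : qz (∑ i ∈ s, f i) = ∏ i ∈ s, qz (f i) := by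
  classical
  induction s using Finset.induction_on with
  | empty => simp
  | insert a s ha ih => rw [Finset.sum_insert ha, Finset.prod_insert ha, qz_add, ih]

lemma qPow_natCast (n : ℕ) : qPow ((n : ℤ) : ℂ⟦X⟧) = qz n := by
  induction n with
  | zero =>
    have : ((0 : ℕ) : ℤ) = 0 := rfl
    rw [this]
    have h2 : ((0 : ℤ) : ℂ⟦X⟧) = C 0 := by simp
    rw [h2, qPow_C]
    simp
  | succ n ih =>
    have h0 (k : ℕ) : ((k : ℤ) : ℂ⟦X⟧) = C (k : ℂ) := by simp
    have h1 : (1 : ℂ⟦X⟧) = C 1 := by simp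
    rw [h0, qPow_C, Nat.cast_succ, add_div, ← exp_mul_exp_eq_exp_add, ← qPow_C, ← h0, ih,
      ← qPow_C, ← h1, ← qz_one, Nat.cast_succ, qz_add]

lemma qPow_intCast (n : ℤ) : qPow (n : ℂ⟦X⟧) = qz n := by
  obtain ⟨k, rfl | rfl⟩ := n.eq_nat_or_neg
  · exact qPow_natCast k
  · have h0 : (((-(k : ℤ)) : ℤ) : ℂ⟦X⟧) = C (-(k : ℂ)) := by simp
    have h0' : ((k : ℤ) : ℂ⟦X⟧) = C (k : ℂ) := by simp
    have h3 : qPow (((-(k : ℤ)) : ℤ) : ℂ⟦X⟧) * qz k = 1 := by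
      rw [← qPow_natCast, h0, h0', qPow_C, qPow_C, exp_mul_exp_eq_exp_add]
      simp [← add_div]
    calc _ = qPow (((-(k : ℤ)) : ℤ) : ℂ⟦X⟧) * (qz k * qz (-k)) := by rw [qz_mul_neg, mul_one]
      _ = _ := by rw [← mul_assoc, h3, one_mul]

lemma X_mul_divH {A : Type*} [Ring A] [Algebra ℂ A] (f : A⟦X⟧) (hf : constantCoeff f = 0) :
    X * divH f = f := by
  ext n
  cases n with
  | zero => simp [hf]
  | succ n => rw [coeff_succ_X_mul, divH, coeff_mk]

lemma constantCoeff_qPow {A : Type*} [Ring A] [Algebra ℂ A] (x : A⟦X⟧) :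
    constantCoeff (qPow x) = 1 := by
  rw [← coeff_zero_eq_constantCoeff_apply, qPow, coeff_mk]
  simp

lemma constantCoeff_qz (n : ℤ) : constantCoeff (qz n) = 1 := by
  rw [← qPow_intCast, constantCoeff_qPow]

/-- The `q`-number of an integer. -/
def qnum (n : ℤ) : ℂ⟦X⟧ := br (n : ℂ[X])

lemma coeff_one_qPow_intCast (n : ℤ) : coeff 1 (qPow (n : ℂ⟦X⟧)) = n / 2 := by
  have h0 : (n : ℂ⟦X⟧) = C (n : ℂ) := by simp
  rw [h0, qPow_C, coeff_rescale, coeff_exp]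
  simp

lemma constantCoeff_divH_qPow (n : ℤ) :
    constantCoeff (divH (qPow (n : ℂ⟦X⟧) - qPow (-n : ℂ⟦X⟧))) = n := by
  rw [← coeff_zero_eq_constantCoeff_apply, divH, coeff_mk, map_sub, coeff_one_qPow_intCast]
  have := coeff_one_qPow_intCast (-n)
  push_cast at this
  rw [this]
  ring

lemma qnum_eq (n : ℤ) : qnum n =
    (divH (qPow (1 : ℂ⟦X⟧) - qPow (-1 : ℂ⟦X⟧)))⁻¹ * divH (qPow (n : ℂ⟦X⟧) - qPow (-n : ℂ⟦X⟧)) := by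
  rw [qnum, br, qBracket]
  have h : ((n : ℂ[X]) : ℂ⟦X⟧) = (n : ℂ⟦X⟧) :=
    map_intCast (Polynomial.coeToPowerSeries.ringHom (R := ℂ)) n
  rw [h]
  rfl

lemma divH_one_ne : constantCoeff (divH (qPow (1 : ℂ⟦X⟧) - qPow (-1 : ℂ⟦X⟧))) = 1 := by
  have := constantCoeff_divH_qPow 1
  simpa using this

/-- At h = 0 a q-number becomes the integer itself. So [n] is a unit for n ≠ 0 and has positive
constant term for n > 0; all invertibility and positivity below rests on this. -/
lemma constantCoeff_qnum (n : ℤ) : constantCoeff (qnum n) = n := by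
  rw [qnum_eq, map_mul, constantCoeff_divH_qPow, constantCoeff_inv, divH_one_ne]
  simp

/-- `q - q⁻¹`. -/
def qdiff : ℂ⟦X⟧ := qz 1 - qz (-1)

lemma qdiff_eq : qdiff = X * divH (qPow (1 : ℂ⟦X⟧) - qPow (-1 : ℂ⟦X⟧)) := by
  rw [X_mul_divH, qdiff, qz_one, qz_neg_one]
  rw [map_sub, constantCoeff_qPow, constantCoeff_qPow, sub_self]

lemma qdiff_ne_zero : qdiff ≠ 0 := by
  rw [qdiff_eq]
  refine mul_ne_zero X_ne_zero fun h => ?_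
  have := divH_one_ne
  rw [h] at this
  simp at this

/-- The defining quotient with the denominator cleared. Identities between q-numbers are proved by
multiplying with the nonzero element q - q⁻¹ of the domain ℂ⟦h⟧ and expanding in powers of q. -/
lemma qdiff_mul_qnum (n : ℤ) : qdiff * qnum n = qz n - qz (-n) := by
  rw [qdiff_eq, qnum_eq]
  have h := divH_one_ne
  have h2 := PowerSeries.mul_inv_cancel (divH (qPow (1 : ℂ⟦X⟧) - qPow (-1 : ℂ⟦X⟧)))
    (by rw [h]; exact one_ne_zero)
  rw [mul_mul_mul_comm, mul_assoc, mul_comm X, ]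
  calc _ = divH (qPow (1 : ℂ⟦X⟧) - qPow (-1 : ℂ⟦X⟧)) *
        (divH (qPow (1 : ℂ⟦X⟧) - qPow (-1 : ℂ⟦X⟧)))⁻¹ *
        (X * divH (qPow (n : ℂ⟦X⟧) - qPow (-n : ℂ⟦X⟧))) := by ring
    _ = _ := by
      rw [h2, one_mul, X_mul_divH, qPow_intCast, ← qPow_intCast (-n)]
      · push_cast; rfl
      · rw [map_sub, constantCoeff_qPow, constantCoeff_qPow, sub_self]

lemma qnum_ne_zero {n : ℤ} (hn : n ≠ 0) : qnum n ≠ 0 := by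
  intro h
  have := constantCoeff_qnum n
  rw [h] at this
  simp at this
  exact hn (by exact_mod_cast this.symm)

@[simp] lemma qnum_zero : qnum 0 = 0 := by
  apply mul_left_cancel₀ qdiff_ne_zero
  rw [qdiff_mul_qnum]; simp

lemma qnum_neg (n : ℤ) : qnum (-n) = -qnum n := by
  apply mul_left_cancel₀ qdiff_ne_zero
  rw [mul_neg, qdiff_mul_qnum, qdiff_mul_qnum]; simp

lemma qnum_two : qnum 2 = qz 1 + qz (-1) := by
  apply mul_left_cancel₀ qdiff_ne_zero
  rw [qdiff_mul_qnum, qdiff, show (2 : ℤ) = 1 + 1 by rfl, qz_add, neg_add, qz_add]; ring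

lemma qnum_two_mul (a : ℤ) : qnum 2 * qnum a = qnum (a + 1) + qnum (a - 1) := by
  apply mul_left_cancel₀ qdiff_ne_zero
  rw [mul_left_comm, mul_add, qdiff_mul_qnum, qdiff_mul_qnum, qdiff_mul_qnum, qnum_two,
    sub_eq_add_neg a 1, neg_add, neg_add, qz_add, qz_add, qz_add, qz_add, neg_neg]
  ring

lemma qnum_mul_sub_mul (a b : ℤ) :
    qnum (a + 1) * qnum (b + 1) - qnum a * qnum (b + 2) = qnum (b - a + 1) := by
  apply mul_left_cancel₀ (mul_ne_zero qdiff_ne_zero qdiff_ne_zero)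
  have e : qdiff * qdiff * (qnum (a + 1) * qnum (b + 1) - qnum a * qnum (b + 2)) =
    (qdiff * qnum (a + 1)) * (qdiff * qnum (b + 1)) - (qdiff * qnum a) * (qdiff * qnum (b + 2)) := by
    ring
  rw [e, mul_assoc qdiff qdiff (qnum (b - a + 1)), qdiff_mul_qnum, qdiff_mul_qnum, qdiff_mul_qnum, qdiff_mul_qnum, qdiff_mul_qnum,
    qdiff]
  rw [show b + 2 = b + 1 + 1 by ring, show b - a + 1 = b + -a + 1 by ring]
  simp only [neg_add, neg_neg, qz_add]
  ring

/-- The two terms of a q-commutator collapse to one power of q by this identity and its mirror image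
under q ↦ q⁻¹. -/
lemma qnum_succ_sub (x : ℤ) : qnum (x + 1) - qz 1 * qnum x = qz (-x) := by
  apply mul_left_cancel₀ qdiff_ne_zero
  rw [mul_sub, mul_left_comm, qdiff_mul_qnum, qdiff_mul_qnum, qdiff]
  simp only [neg_add, qz_add]
  ring

lemma qnum_succ_sub' (x : ℤ) : qnum (x + 1) - qz (-1) * qnum x = qz x := by
  apply mul_left_cancel₀ qdiff_ne_zero
  rw [mul_sub, mul_left_comm, qdiff_mul_qnum, qdiff_mul_qnum, qdiff]
  simp only [neg_add, qz_add]
  ring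

end QNum

/-! ### Series with positive constant term -/

section Positive

open PowerSeries

/-- The constant term is a positive real number. -/
def IsPos (r : ℂ⟦X⟧) : Prop := ∃ a : ℝ, 0 < a ∧ constantCoeff r = (a : ℂ)

lemma IsPos.constantCoeff_ne_zero {r : ℂ⟦X⟧} (h : IsPos r) : constantCoeff r ≠ 0 := by
  obtain ⟨a, ha, h⟩ := h
  rw [h]; exact_mod_cast ha.ne'

lemma IsPos.ne_zero {r : ℂ⟦X⟧} (h : IsPos r) : r ≠ 0 := by
  rintro rfl; exact h.constantCoeff_ne_zero (map_zero _)

lemma IsPos.one : IsPos 1 := ⟨1, one_pos, by simp⟩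

lemma IsPos.mul {r s : ℂ⟦X⟧} : IsPos r → IsPos s → IsPos (r * s)
  | ⟨a, ha, h⟩, ⟨b, hb, h'⟩ => ⟨a * b, mul_pos ha hb, by rw [map_mul, h, h']; push_cast; rfl⟩

lemma IsPos.inv {r : ℂ⟦X⟧} : IsPos r → IsPos r⁻¹
  | ⟨a, ha, h⟩ => ⟨a⁻¹, inv_pos.2 ha, by rw [constantCoeff_inv, h]; push_cast; rfl⟩

lemma IsPos.add {r s : ℂ⟦X⟧} : IsPos r → IsPos s → IsPos (r + s)
  | ⟨a, ha, h⟩, ⟨b, hb, h'⟩ => ⟨a + b, add_pos ha hb, by rw [map_add, h, h']; push_cast; rfl⟩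

lemma IsPos.prod {ι : Type*} {s : Finset ι} {f : ι → ℂ⟦X⟧} (h : ∀ i ∈ s, IsPos (f i)) :
    IsPos (∏ i ∈ s, f i) :=
  Finset.prod_induction f IsPos (fun _ _ => IsPos.mul) IsPos.one h

lemma IsPos.qz (n : ℤ) : IsPos (qz n) := ⟨1, one_pos, by simp [constantCoeff_qz]⟩

lemma IsPos.qnum {n : ℤ} (hn : 0 < n) : IsPos (qnum n) :=
  ⟨n, by exact_mod_cast hn, by simp [constantCoeff_qnum]⟩

lemma IsPos.of_mul_left {r s : ℂ⟦X⟧} (hr : IsPos r) (h : IsPos (r * s)) : IsPos s := by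
  have := hr.inv.mul h
  rwa [← mul_assoc, PowerSeries.inv_mul_cancel _ hr.constantCoeff_ne_zero, one_mul] at this

lemma IsPos.eq_of_sq {r s : ℂ⟦X⟧} (hr : IsPos r) (hs : IsPos s) (h : r ^ 2 = s ^ 2) : r = s := by
  have h1 : (r - s) * (r + s) = 0 := by linear_combination h
  rcases mul_eq_zero.1 h1 with h1 | h1
  · exact sub_eq_zero.1 h1
  · exact absurd h1 (hr.add hs).ne_zero

/-- Hensel's lemma for Y² - r, starting at the positive real root of the constant term; the
derivative there is 2√a, a unit. -/
lemma IsPos.exists_sqrt {r : ℂ⟦X⟧} (hr : IsPos r) : ∃ s : ℂ⟦X⟧, s ^ 2 = r ∧ IsPos s := by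
  obtain ⟨a, ha, h⟩ := hr
  have hen : HenselianRing ℂ⟦X⟧ (Ideal.span {(X : ℂ⟦X⟧)}) := inferInstance
  have hC : (C ((√a : ℝ) : ℂ) : ℂ⟦X⟧) ^ 2 = C (a : ℂ) := by
    rw [← map_pow]; congr 1; exact_mod_cast Real.sq_sqrt ha.le
  obtain ⟨s, h1, h2⟩ := hen.is_henselian (Polynomial.X ^ 2 - Polynomial.C r)
    (Polynomial.monic_X_pow_sub_C r two_ne_zero) (C ((√a : ℝ) : ℂ)) (by
      rw [Ideal.mem_span_singleton, X_dvd_iff]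
      simp only [Polynomial.eval_sub, Polynomial.eval_pow, Polynomial.eval_X, Polynomial.eval_C,
        hC, map_sub, h]
      simp) (by
      refine IsUnit.map _ ?_
      rw [isUnit_iff_constantCoeff]
      simp [ha.le, ha.ne'])
  refine ⟨s, ?_, √a, Real.sqrt_pos.2 ha, ?_⟩
  · rw [Polynomial.IsRoot] at h1
    simpa [sub_eq_zero] using h1
  · rw [Ideal.mem_span_singleton, X_dvd_iff] at h2
    simpa [sub_eq_zero] using h2

lemma psSqrt_sq {r : ℂ⟦X⟧} (hr : IsPos r) : psSqrt r ^ 2 = r := by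
  have h : ∃ s : ℂ⟦X⟧, s ^ 2 = r ∧ ∃ a : ℝ, 0 < a ∧ constantCoeff s = (a : ℂ) := hr.exists_sqrt
  rw [psSqrt, dif_pos h]
  exact h.choose_spec.1

lemma IsPos.psSqrt {r : ℂ⟦X⟧} (hr : IsPos r) : IsPos (psSqrt r) := by
  have h : ∃ s : ℂ⟦X⟧, s ^ 2 = r ∧ ∃ a : ℝ, 0 < a ∧ constantCoeff s = (a : ℂ) := hr.exists_sqrt
  rw [UhaInfinity.psSqrt, dif_pos h]
  exact h.choose_spec.2

end Positive

/-! ### `q`-commutators and Serre relations in an algebra -/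

section Algebra

variable {R A : Type*} [CommRing R] [Ring A] [Algebra R A]

/-- The `q`-commutator `a b - q b a`. -/
def qComm (q : R) (a b : A) : A := a * b - q • (b * a)

/-- The quantum Serre relation `a² b - c a b a + b a² = 0`. -/
def Serre (c : R) (a b : A) : Prop := a * a * b - c • (a * b * a) + b * a * a = 0

variable {q q' c : R} {a b d : A}

/-- For c = q + q⁻¹ the Serre expression is an iterated q-commutator, namely a [a,b]_q - q⁻¹ [a,b]_q
a. -/
lemma mul_qComm_left (hq : q * q' = 1) (h : Serre (q + q') a b) :
    a * qComm q a b = q' • (qComm q a b * a) := by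
  simp only [qComm, Serre, mul_sub, sub_mul, smul_mul_assoc, mul_smul_comm, smul_sub, smul_smul,
    mul_assoc] at h ⊢
  linear_combination (norm := module) h + hq • (b * (a * a))

lemma qComm_mul_right (hq : q * q' = 1) (h : Serre (q + q') b a) :
    qComm q a b * b = q' • (b * qComm q a b) := by
  simp only [qComm, Serre, mul_sub, sub_mul, smul_mul_assoc, mul_smul_comm, smul_sub, smul_smul,
    mul_assoc] at h ⊢
  linear_combination (norm := module) h + hq • (b * (b * a))

lemma qComm_eq_smul (hq : q * q' = 1) : qComm q a b = (-q) • qComm q' b a := by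
  simp only [qComm, smul_sub, smul_smul]
  linear_combination (norm := module) -hq • (a * b)

lemma Serre.smul_left (h : Serre c a b) (r : R) : Serre c (r • a) b := by
  simp only [Serre, smul_mul_assoc, mul_smul_comm, smul_smul, mul_assoc] at h ⊢
  linear_combination (norm := module) (r * r) • h

lemma Serre.smul_right (h : Serre c a b) (r : R) : Serre c a (r • b) := by
  simp only [Serre, smul_mul_assoc, mul_smul_comm, smul_smul, mul_assoc] at h ⊢
  linear_combination (norm := module) r • h

/-- The Serre expression is linear in its second argument, and a factor `d` commuting with `a` can
be pulled out on either side. -/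
lemma Serre.qComm_right (h : Serre c a b) (hd : Commute a d) (r : R) :
    Serre c a (qComm r b d) := by
  have h1 : Serre c a (b * d) := by
    simp only [Serre, ← mul_assoc] at h ⊢
    rw [mul_assoc (a * b) d a, ← hd.eq, mul_assoc b d a, ← hd.eq]
    have := congrArg (· * d) h
    simp only [add_mul, sub_mul, smul_mul_assoc, zero_mul, mul_assoc] at this ⊢
    rw [← hd.eq]
    exact this
  have h2 : Serre c a (d * b) := by
    have e1 : a * a * (d * b) = d * (a * a * b) := by
      rw [← mul_assoc, mul_assoc a a d, hd.eq, ← mul_assoc, hd.eq]; simp only [mul_assoc]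
    have e2 : a * (d * b) * a = d * (a * b * a) := by
      rw [← mul_assoc, hd.eq]; simp only [mul_assoc]
    have := congrArg (d * ·) h
    simp only [mul_add, mul_sub, mul_smul_comm, mul_zero] at this
    rw [Serre, e1, e2, ← this]
    simp only [mul_assoc]
  simp only [Serre, qComm, mul_sub, sub_mul, smul_mul_assoc, mul_smul_comm, smul_sub, smul_smul,
    mul_assoc] at h1 h2 ⊢
  linear_combination (norm := module) h1 - r • h2

/-- The Serre relation of a composite root vector with the next simple root vector. -/
lemma serre_qComm_left (hq : q * q' = 1) (hreg : ∀ x : A, (q + q') • x = 0 → x = 0)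
    (hab : Serre (q + q') a b) (hbd : Serre (q + q') b d) (had : Commute a d) :
    Serre (q + q') (qComm q a b) d := by
  have hae := mul_qComm_left hq hab
  have hab1 : a * b = qComm q a b + q • (b * a) := by simp [qComm]
  generalize qComm q a b = e at *
  have hab2 (x : A) : a * (b * x) = e * x + q • (b * (a * x)) := by
    rw [← mul_assoc, hab1, add_mul, smul_mul_assoc, mul_assoc]
  have hae2 (x : A) : a * (e * x) = q' • (e * (a * x)) := by
    rw [← mul_assoc, hae, smul_mul_assoc, mul_assoc]
  have had2 (x : A) : a * (d * x) = d * (a * x) := by rw [← mul_assoc, had.eq, mul_assoc]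
  -- The Serre relation of `b` and `d`, multiplied by `a` on the left minus q² times its multiple by
  -- `a` on the right: one of the two factors `b` is turned into `e`.
  have s1 : e * (b * d) + q • (b * (e * d)) - (q + q') • (e * (d * b) + q • (b * (d * e)))
      + d * (e * b) + q • (d * (b * e)) = 0 := by
    have h1 := congrArg (a * ·) hbd
    have h2 := congrArg (· * a) hbd
    simp only [mul_add, add_mul, mul_sub, sub_mul, smul_mul_assoc, mul_smul_comm, smul_add,
      smul_smul, mul_assoc, hab1, hab2, had.eq, had2, mul_zero, zero_mul]
      at h1 h2 ⊢
    linear_combination (norm := module) h1 - (q ^ 2) • h2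
  -- A second commutation with `a` turns the remaining `b` into `e`. The result is q + q⁻¹ times the
  -- Serre relation of `e` and `d`, which is why this scalar has to be cancelled by `hreg`.
  have h1 := congrArg (a * ·) s1
  have h2 := congrArg (· * a) s1
  refine hreg _ ?_
  simp only [mul_add, add_mul, mul_sub, sub_mul, smul_mul_assoc, mul_smul_comm, smul_add,
    smul_sub, smul_smul, mul_assoc, hab1, hab2, hae, hae2, had.eq, had2, mul_zero, zero_mul]
    at h1 h2 ⊢
  linear_combination (norm := module) h1 - (q * q') • h2

/-- Composite root vectors of overlapping roots, taken with opposite conventions, commute. -/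
lemma commute_qComm_qComm (hq : q * q' = 1) (hreg : ∀ x : A, (1 + q ^ 2) • x = 0 → x = 0)
    (hab : Serre (q + q') b a) (hbd : Serre (q + q') b d) (had : Commute a d) :
    Commute (qComm q a b) (qComm q' b d) := by
  have heb := qComm_mul_right hq hab
  have hbg := mul_qComm_left hq hbd
  have hab1 : a * b = qComm q a b + q • (b * a) := by simp [qComm]
  have hbd1 : b * d = qComm q b d + q • (d * b) := by simp [qComm]
  -- As `a` and `d` commute, both bracketings of the triple q-commutator agree.
  have hE : qComm q (qComm q a b) d = qComm q a (qComm q b d) := by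
    have h1 (x : A) : a * (d * x) = d * (a * x) := by rw [← mul_assoc, had.eq, mul_assoc]
    simp only [qComm, mul_sub, sub_mul, smul_mul_assoc, mul_smul_comm, smul_sub, smul_smul,
      mul_assoc, had.eq, h1]
    module
  -- Moving `b` through the two bracketings gives two expressions with the same error terms. Their
  -- sum is (1 + q²) times the commutator.
  have hc : Commute b (qComm q (qComm q a b) d) := by
    have h1 : b * qComm q (qComm q a b) d = q • (qComm q a b * qComm q b d)
        - q • (qComm q b d * qComm q a b) + (q ^ 2) • (qComm q (qComm q a b) d * b) := by
      generalize qComm q b d = g at *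
      generalize qComm q a b = e at *
      have hbe : b * e = q • (e * b) := by
        rw [heb, smul_smul, hq, one_smul]
      have hbe2 (x : A) : b * (e * x) = q • (e * (b * x)) := by
        rw [← mul_assoc, hbe, smul_mul_assoc, mul_assoc]
      have hbd2 (x : A) : b * (d * x) = g * x + q • (d * (b * x)) := by
        rw [← mul_assoc, hbd1, add_mul, smul_mul_assoc, mul_assoc]
      simp only [qComm, mul_sub, sub_mul, smul_mul_assoc, mul_smul_comm, smul_sub, smul_smul,
        mul_assoc, hbe, hbe2, hbd1, hbd2, mul_add, smul_add]
      module
    have h2 : (q ^ 2) • (b * qComm q a (qComm q b d)) = qComm q a (qComm q b d) * b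
        - q • (qComm q a b * qComm q b d) + q • (qComm q b d * qComm q a b) := by
      generalize qComm q b d = g at *
      generalize qComm q a b = e at *
      have hgb : g * b = q • (b * g) := by
        rw [hbg, smul_smul, hq, one_smul]
      have hgb2 (x : A) : g * (b * x) = q • (b * (g * x)) := by
        rw [← mul_assoc, hgb, smul_mul_assoc, mul_assoc]
      have hab2 (x : A) : a * (b * x) = e * x + q • (b * (a * x)) := by
        rw [← mul_assoc, hab1, add_mul, smul_mul_assoc, mul_assoc]
      simp only [qComm, mul_sub, sub_mul, smul_mul_assoc, mul_smul_comm, smul_sub, smul_smul,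
        mul_assoc, hgb, hgb2, hab1, hab2, mul_add, smul_add]
      module
    rw [← hE] at h2
    refine sub_eq_zero.1 (hreg _ ?_)
    linear_combination (norm := module) h1 + h2
  -- Expanded with `b e = q e b`, the commutation of `b` with the triple q-commutator is q times the
  -- commutation of `e` with `[b,d]` for the inverse parameter.
  have hcomm := hc.eq
  have hbe : b * qComm q a b = q • (qComm q a b * b) := by rw [heb, smul_smul, hq, one_smul]
  generalize qComm q a b = e at *
  have heb2 (x : A) : e * (b * x) = q' • (b * (e * x)) := by
    rw [← mul_assoc, heb, smul_mul_assoc, mul_assoc]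
  rw [commute_iff_eq]
  simp only [qComm, mul_sub, sub_mul, smul_mul_assoc, mul_smul_comm, smul_smul,
    mul_assoc, hbe, heb2] at hcomm ⊢
  linear_combination (norm := module) q' • hcomm + hq • (b * (d * e))

/-! ### Commutators of composite root vectors of opposite signs -/

section Cartan

variable {x₁ x₂ x₃ y₁ y₂ y₃ b₁ b₂ k₁ k₂ k₁' k₂' : A}

/-- Only `x₁` fails to commute with `y₁`, so the commutator is a q-commutator of `b₁` with `x₂`. In
the applications `b₁` is [h₁] and `k₁` a power of q^{h₁}; the hypothesis `hb` says that the
q-commutator is a single term. -/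
lemma qComm_comm_y₁ (h1 : x₁ * y₁ - y₁ * x₁ = b₁) (h21 : Commute x₂ y₁)
    (hb : b₁ * x₂ - q • (x₂ * b₁) = -(x₂ * k₁)) :
    qComm q x₁ x₂ * y₁ - y₁ * qComm q x₁ x₂ = -(x₂ * k₁) := by
  have h21' (z : A) : x₂ * (y₁ * z) = y₁ * (x₂ * z) := by rw [← mul_assoc, h21.eq, mul_assoc]
  rw [← hb, ← h1]
  simp only [qComm, mul_sub, sub_mul, smul_mul_assoc, mul_smul_comm, smul_sub,
    mul_assoc, h21.eq, h21']
  module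

lemma qComm_comm_y₂ (h2 : x₂ * y₂ - y₂ * x₂ = b₂) (h12 : Commute x₁ y₂)
    (hb : x₁ * b₂ - q • (b₂ * x₁) = q • (x₁ * k₂')) :
    qComm q x₁ x₂ * y₂ - y₂ * qComm q x₁ x₂ = q • (x₁ * k₂') := by
  have h12' (z : A) : x₁ * (y₂ * z) = y₂ * (x₁ * z) := by rw [← mul_assoc, h12.eq, mul_assoc]
  rw [← hb, ← h2]
  simp only [qComm, mul_sub, sub_mul, smul_mul_assoc, mul_smul_comm, smul_sub,
    mul_assoc, h12.eq, h12']
  module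

/-- The composite lowering operator is expanded and each factor is moved through by the two
preceding lemmas. The terms in which a simple root vector remains combine into `b₁` and `b₂`. For b
= [h] and k a power of q^h the right-hand side is the addition formula for [h₁ + h₂]. -/
lemma qComm_comm_qComm (hq : q * q' = 1)
    (h1 : x₁ * y₁ - y₁ * x₁ = b₁) (h2 : x₂ * y₂ - y₂ * x₂ = b₂)
    (h12 : Commute x₁ y₂) (h21 : Commute x₂ y₁)
    (hb₁ : b₁ * x₂ - q • (x₂ * b₁) = -(x₂ * k₁)) (hb₂ : x₁ * b₂ - q • (b₂ * x₁) = q • (x₁ * k₂'))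
    (hk₂ : k₂' * y₁ = q' • (y₁ * k₂')) (hk₁ : k₁ * y₂ = q • (y₂ * k₁)) :
    qComm q x₁ x₂ * qComm q' y₂ y₁ - qComm q' y₂ y₁ * qComm q x₁ x₂ = b₁ * k₂' + b₂ * k₁ := by
  have e1 := qComm_comm_y₁ h1 h21 hb₁
  have e2 := qComm_comm_y₂ h2 h12 hb₂
  rw [← h1, ← h2]
  generalize qComm q x₁ x₂ = e at *
  have i1 : e * (y₂ * y₁) = y₂ * (y₁ * e) - y₂ * (x₂ * k₁) + q • (x₁ * (k₂' * y₁)) := by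
    rw [← mul_assoc, eq_add_of_sub_eq e2, add_mul, mul_assoc y₂, eq_add_of_sub_eq e1, mul_add,
      smul_mul_assoc, mul_assoc x₁, mul_neg]
    abel
  have i2 : e * (y₁ * y₂) = y₁ * (y₂ * e) + q • (y₁ * (x₁ * k₂')) - x₂ * (k₁ * y₂) := by
    rw [← mul_assoc, eq_add_of_sub_eq e1, add_mul, mul_assoc y₁, eq_add_of_sub_eq e2, mul_add,
      mul_smul_comm, neg_mul, mul_assoc x₂]
    abel
  simp only [qComm, mul_sub, sub_mul, mul_smul_comm, smul_mul_assoc, i1, i2, hk₁, hk₂, smul_sub,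
    smul_add, smul_smul, mul_assoc]
  linear_combination (norm := module) hq • (x₁ * (y₁ * k₂')) - hq • (y₁ * (x₁ * k₂'))
    + hq • (x₂ * (y₂ * k₁))

/-- Only `x₂` and `y₂` interact. They leave `x₁ k₂'` next to `y₃` in both orders, and the
q-commutator with `y₃` vanishes by `hk`. -/
lemma commute_qComm_y (h2 : x₂ * y₂ - y₂ * x₂ = b₂) (h12 : Commute x₁ y₂)
    (hb : x₁ * b₂ - q • (b₂ * x₁) = q • (x₁ * k₂')) (h13 : Commute x₁ y₃) (h23 : Commute x₂ y₃)
    (hk : y₃ * k₂' = q • (k₂' * y₃)) :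
    Commute (qComm q x₁ x₂) (qComm q y₃ y₂) := by
  have e2 := qComm_comm_y₂ h2 h12 hb
  have e3 : qComm q x₁ x₂ * y₃ = y₃ * qComm q x₁ x₂ := by
    have h13' (z : A) : x₁ * (y₃ * z) = y₃ * (x₁ * z) := by rw [← mul_assoc, h13.eq, mul_assoc]
    have h23' (z : A) : x₂ * (y₃ * z) = y₃ * (x₂ * z) := by rw [← mul_assoc, h23.eq, mul_assoc]
    simp only [qComm, mul_sub, sub_mul, smul_mul_assoc, mul_smul_comm, mul_assoc, h13.eq, h23.eq,
      h13', h23']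
  generalize qComm q x₁ x₂ = e at *
  have i1 : e * (y₃ * y₂) = y₃ * (y₂ * e) + q • (x₁ * (y₃ * k₂')) := by
    rw [← mul_assoc, e3, mul_assoc, eq_add_of_sub_eq e2, mul_add, mul_smul_comm, ← mul_assoc y₃ x₁,
      ← h13.eq, mul_assoc x₁]
    abel
  have i2 : e * (y₂ * y₃) = y₂ * (y₃ * e) + q • (x₁ * (k₂' * y₃)) := by
    rw [← mul_assoc, eq_add_of_sub_eq e2, add_mul, smul_mul_assoc, mul_assoc x₁, mul_assoc, e3]
    abel
  rw [commute_iff_eq]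
  simp only [qComm, mul_sub, sub_mul, smul_mul_assoc, mul_smul_comm, i1, i2, hk, mul_assoc]
  module

lemma commute_qComm_x (h2 : x₂ * y₂ - y₂ * x₂ = b₂) (h21 : Commute x₂ y₁)
    (hb : b₂ * y₁ - q' • (y₁ * b₂) = y₁ * k₂) (h31 : Commute x₃ y₁) (h32 : Commute x₃ y₂)
    (hk : k₂ * x₃ = q' • (x₃ * k₂)) :
    Commute (qComm q' y₂ y₁) (qComm q' x₂ x₃) := by
  have h21' (z : A) : x₂ * (y₁ * z) = y₁ * (x₂ * z) := by rw [← mul_assoc, h21.eq, mul_assoc]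
  have h31' (z : A) : x₃ * (y₁ * z) = y₁ * (x₃ * z) := by rw [← mul_assoc, h31.eq, mul_assoc]
  have h32' (z : A) : x₃ * (y₂ * z) = y₂ * (x₃ * z) := by rw [← mul_assoc, h32.eq, mul_assoc]
  have e2 : qComm q' y₂ y₁ * x₂ - x₂ * qComm q' y₂ y₁ = -(y₁ * k₂) := by
    rw [← hb, ← h2]
    simp only [qComm, mul_sub, sub_mul, smul_mul_assoc, mul_smul_comm, smul_sub,
      mul_assoc, h21.eq, h21']
    module
  have e3 : qComm q' y₂ y₁ * x₃ = x₃ * qComm q' y₂ y₁ := by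
    simp only [qComm, mul_sub, sub_mul, smul_mul_assoc, mul_smul_comm, mul_assoc, h31.eq, h32.eq,
      h31', h32']
  generalize qComm q' y₂ y₁ = f at *
  have i1 : f * (x₂ * x₃) = x₂ * (x₃ * f) - y₁ * (k₂ * x₃) := by
    rw [← mul_assoc, eq_add_of_sub_eq e2, add_mul, mul_assoc x₂, e3, neg_mul, mul_assoc y₁]
    abel
  have i2 : f * (x₃ * x₂) = x₃ * (x₂ * f) - y₁ * (x₃ * k₂) := by
    rw [← mul_assoc, e3, mul_assoc, eq_add_of_sub_eq e2, mul_add, mul_neg, h31']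
    abel
  rw [commute_iff_eq]
  simp only [qComm, mul_sub, sub_mul, smul_mul_assoc, mul_smul_comm, i1, i2, hk, mul_assoc]
  module

end Cartan

/-- Converse to the factorization of the Serre expression: it suffices to know the inner
q-commutator `G` and that `G` commutes with `E` up to the factor q⁻¹. -/
lemma serre_of_qComm_eq (hq : q * q' = 1) {e E G : A} (h : e * E - q • (E * e) = G)
    (hG : G * E = q' • (E * G)) : Serre (q + q') E e := by
  rw [← h] at hG
  simp only [Serre, mul_sub, sub_mul, smul_mul_assoc, mul_smul_comm, smul_sub, smul_smul,
    mul_assoc] at hG ⊢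
  linear_combination (norm := module) hG - hq • (E * (E * e))

lemma serre_of_qComm_eq' (hq : q * q' = 1) {e E G : A} (h : e * E - q • (E * e) = G)
    (hG : e * G = q' • (G * e)) : Serre (q + q') e E := by
  rw [← h] at hG
  simp only [Serre, mul_sub, sub_mul, smul_mul_assoc, mul_smul_comm, smul_sub, smul_smul,
    mul_assoc] at hG ⊢
  linear_combination (norm := module) hG - hq • (E * (e * e))

end Algebra

/-! ### A partial fraction identity -/

section PartialFractions

variable {K ι : Type*} [Field K] [DecidableEq ι]

/-- The difference of the monic polynomials with roots `z` and with roots `y` has degree below the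
number of nodes `y`, so Lagrange interpolation at the `y` reproduces it. The identity is its value
at 0. -/
lemma sum_prod_nodes_of_injOn (s : Finset ι) (y z : ι → K) (hy : Set.InjOn y s)
    (h0 : ∀ i ∈ s, y i ≠ 0) :
    ∑ i ∈ s, (y i)⁻¹ * (∏ k ∈ s, (y i - z k)) * (∏ k ∈ s.erase i, (y i - y k))⁻¹ =
      1 - (∏ k ∈ s, z k) * (∏ k ∈ s, y k)⁻¹ := by
  classical
  have hY : ∏ k ∈ s, y k ≠ 0 := Finset.prod_ne_zero_iff.2 h0
  set P : K[X] := (∏ k ∈ s, (Polynomial.X - Polynomial.C (z k))) -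
    ∏ k ∈ s, (Polynomial.X - Polynomial.C (y k)) with hP
  have hdeg : P.degree < s.card := by
    have m1 := Polynomial.monic_prod_of_monic s (fun k => Polynomial.X - Polynomial.C (z k))
      fun i _ => Polynomial.monic_X_sub_C _
    have m2 := Polynomial.monic_prod_of_monic s (fun k => Polynomial.X - Polynomial.C (y k))
      fun i _ => Polynomial.monic_X_sub_C _
    have d1 : (∏ k ∈ s, (Polynomial.X - Polynomial.C (z k))).degree = (s.card : WithBot ℕ) := by
      rw [Polynomial.degree_prod]; simp
    have d2 : (∏ k ∈ s, (Polynomial.X - Polynomial.C (y k))).degree = (s.card : WithBot ℕ) := by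
      rw [Polynomial.degree_prod]; simp
    rw [← d1]
    refine Polynomial.degree_sub_lt_left (d1.trans d2.symm) m1.ne_zero ?_
    rw [m1.leadingCoeff, m2.leadingCoeff]
  have hev (i : ι) (hi : i ∈ s) : P.eval (y i) = ∏ k ∈ s, (y i - z k) := by
    rw [hP, Polynomial.eval_sub, Polynomial.eval_prod, Polynomial.eval_prod,
      Finset.prod_eq_zero (s := s) (f := fun j => Polynomial.eval (y i)
        (Polynomial.X - Polynomial.C (y j))) hi (by simp), sub_zero]
    simp
  have h := congrArg (Polynomial.eval 0) (Lagrange.eq_interpolate hy hdeg)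
  rw [Lagrange.interpolate_apply, Polynomial.eval_finsetSum] at h
  have hterm (i : ι) (hi : i ∈ s) : Polynomial.eval 0
      (Polynomial.C (P.eval (y i)) * Lagrange.basis s y i) = -(∏ k ∈ s, (-y k)) *
        ((y i)⁻¹ * (∏ k ∈ s, (y i - z k)) * (∏ k ∈ s.erase i, (y i - y k))⁻¹) := by
    rw [Polynomial.eval_mul, Polynomial.eval_C, hev i hi, Lagrange.basis, Polynomial.eval_prod,
      ← Finset.mul_prod_erase s (fun k => -y k) hi]
    have : ∏ j ∈ s.erase i, Polynomial.eval 0 (Lagrange.basisDivisor (y i) (y j)) =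
        (∏ k ∈ s.erase i, (y i - y k))⁻¹ * ∏ k ∈ s.erase i, (-y k) := by
      rw [← Finset.prod_inv_distrib, ← Finset.prod_mul_distrib]
      refine Finset.prod_congr rfl fun k _ => ?_
      simp [Lagrange.basisDivisor]
    rw [this]
    have := h0 i hi
    field_simp
  rw [Finset.sum_congr rfl hterm, ← Finset.mul_sum, hP, Polynomial.eval_sub, Polynomial.eval_prod,
    Polynomial.eval_prod] at h
  simp only [Polynomial.eval_sub, Polynomial.eval_X, Polynomial.eval_C, zero_sub] at h
  have hn : ∏ k ∈ s, (-y k) ≠ 0 := Finset.prod_ne_zero_iff.2 fun i hi => neg_ne_zero.2 (h0 i hi)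
  have hquot : (∏ k ∈ s, z k) * (∏ k ∈ s, y k)⁻¹ = (∏ k ∈ s, (-z k)) * (∏ k ∈ s, (-y k))⁻¹ := by
    rw [← Finset.prod_inv_distrib, ← Finset.prod_mul_distrib, ← Finset.prod_inv_distrib,
      ← Finset.prod_mul_distrib]
    refine Finset.prod_congr rfl fun k _ => ?_
    rw [inv_neg, neg_mul_neg]
  rw [hquot]
  refine mul_left_cancel₀ (neg_ne_zero.2 hn) (h.symm.trans ?_)
  field_simp
  ring

/-- The identity survives coinciding nodes, provided that each of them is cancelled by a zero. -/
lemma sum_prod_nodes (s : Finset ι) (y z : ι → K)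
    (hdeg : ∀ i ∈ s, ∀ k ∈ s, i ≠ k → y i = y k → z i = y i) (h0 : ∀ i ∈ s, y i ≠ 0) :
    ∑ i ∈ s, (y i)⁻¹ * (∏ k ∈ s, (y i - z k)) * (∏ k ∈ s.erase i, (y i - y k))⁻¹ =
      1 - (∏ k ∈ s, z k) * (∏ k ∈ s, y k)⁻¹ := by
  classical
  -- The indices whose node occurs twice; there `z = y`. Their summands contain the factor `y i - z
  -- i = 0`, and in the other summands their factors cancel, so the identity for the remaining
  -- distinct nodes applies.
  set p : ι → Prop := fun i => ∃ k ∈ s, i ≠ k ∧ y i = y k with hp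
  have hB (i : ι) (hi : i ∈ s.filter p) : z i = y i := by
    obtain ⟨hi, k, hk, h1, h2⟩ := Finset.mem_filter.1 hi
    exact hdeg i hi k hk h1 h2
  have hsplit (f : ι → K) : ∏ k ∈ s, f k =
      (∏ k ∈ s.filter p, f k) * ∏ k ∈ s.filter (fun i => ¬ p i), f k :=
    (Finset.prod_filter_mul_prod_filter_not s p f).symm
  have hmain := sum_prod_nodes_of_injOn (s.filter fun i => ¬ p i) y z (by
    intro i hi k hk hik
    by_contra hne
    exact (Finset.mem_filter.1 hi).2 ⟨k, (Finset.mem_filter.1 hk).1, hne, hik⟩)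
    (fun i hi => h0 i (Finset.mem_filter.1 hi).1)
  have hBne : ∏ k ∈ s.filter p, y k ≠ 0 :=
    Finset.prod_ne_zero_iff.2 fun i hi => h0 i (Finset.mem_filter.1 hi).1
  have hquot : (∏ k ∈ s, z k) * (∏ k ∈ s, y k)⁻¹ =
      (∏ k ∈ s.filter (fun i => ¬ p i), z k) * (∏ k ∈ s.filter (fun i => ¬ p i), y k)⁻¹ := by
    rw [hsplit z, hsplit y, Finset.prod_congr rfl hB, mul_inv]
    field_simp
  rw [hquot, ← hmain, ← Finset.sum_filter_add_sum_filter_not s p, Finset.sum_eq_zero, zero_add]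
  · refine Finset.sum_congr rfl fun i hi => ?_
    obtain ⟨his, hip⟩ := Finset.mem_filter.1 hi
    have he : s.erase i = s.filter p ∪ (s.filter (fun i => ¬ p i)).erase i := by
      ext k
      simp only [Finset.mem_erase, Finset.mem_union, Finset.mem_filter]
      by_cases hk : p k
      · simp only [hk, and_true, not_true_eq_false, and_false, or_false]
        exact ⟨fun h => h.2, fun h => ⟨fun h' => hip (h' ▸ hk), h⟩⟩
      · simp [hk]
    have hd : Disjoint (s.filter p) ((s.filter (fun i => ¬ p i)).erase i) :=
      Finset.disjoint_of_subset_right (Finset.erase_subset _ _)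
        (Finset.disjoint_filter_filter_not s s p)
    have hne : ∏ k ∈ s.filter p, (y i - y k) ≠ 0 := by
      refine Finset.prod_ne_zero_iff.2 fun k hk => sub_ne_zero.2 fun h => hip ?_
      obtain ⟨hk, hpk⟩ := Finset.mem_filter.1 hk
      exact ⟨k, hk, fun h' => hip (h' ▸ hpk), h⟩
    rw [he, Finset.prod_union hd, hsplit, Finset.prod_congr rfl fun k hk => by rw [hB k hk],
      mul_inv]
    field_simp
  · intro i hi
    rw [Finset.prod_eq_zero (Finset.mem_filter.1 hi).1 (by rw [hB i hi, sub_self])]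
    simp

/-- The preceding identity on a disjoint union of two copies of `s`. Below, the second family of
nodes is the first one shifted by one step of q², so coincidences across the families do occur. -/
lemma sum_prod_two_nodes (s : Finset ι) (u v a b : ι → K) (hu : Set.InjOn u s) (hv : Set.InjOn v s)
    (huv : ∀ i ∈ s, ∀ k ∈ s, u i = v k → a i = u i ∧ b k = v k)
    (hu0 : ∀ i ∈ s, u i ≠ 0) (hv0 : ∀ i ∈ s, v i ≠ 0) :
    ∑ i ∈ s, ((u i)⁻¹ * (∏ k ∈ s, (u i - a k) * (u i - b k)) *
        ((u i - v i) * ∏ k ∈ s.erase i, (u i - u k) * (u i - v k))⁻¹ +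
      (v i)⁻¹ * (∏ k ∈ s, (v i - a k) * (v i - b k)) *
        ((v i - u i) * ∏ k ∈ s.erase i, (v i - u k) * (v i - v k))⁻¹) =
      1 - (∏ k ∈ s, a k * b k) * (∏ k ∈ s, u k * v k)⁻¹ := by
  classical
  have h := sum_prod_nodes (s.disjSum s) (Sum.elim u v) (Sum.elim a b) (by
    rintro (i | i) hi (k | k) hk hne heq
    · exact absurd (congrArg Sum.inl (hu (by simpa using hi) (by simpa using hk) heq)) hne
    · exact (huv i (by simpa using hi) k (by simpa using hk) heq).1
    · exact (huv k (by simpa using hk) i (by simpa using hi) heq.symm).2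
    · exact absurd (congrArg Sum.inr (hv (by simpa using hi) (by simpa using hk) heq)) hne)
    (by
      rintro (i | i) hi
      · exact hu0 i (by simpa using hi)
      · exact hv0 i (by simpa using hi))
  have e1 (i : ι) : (s.disjSum s).erase (Sum.inl i) = (s.erase i).disjSum s := by
    ext (k | k) <;> simp
  have e2 (i : ι) : (s.disjSum s).erase (Sum.inr i) = s.disjSum (s.erase i) := by
    ext (k | k) <;> simp
  simp only [Finset.sum_disjSum, Finset.prod_disjSum, Sum.elim_inl, Sum.elim_inr, e1, e2] at h
  simp only [Finset.prod_mul_distrib]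
  rw [← h, Finset.sum_add_distrib]
  congr 1
  · refine Finset.sum_congr rfl fun i hi => ?_
    rw [← Finset.mul_prod_erase s (fun k => u i - v k) hi]
    congr 2
    ring
  · refine Finset.sum_congr rfl fun i hi => ?_
    rw [← Finset.mul_prod_erase s (fun k => v i - u k) hi]
    congr 2
    ring

end PartialFractions

/-! ### The residue identity for q-numbers -/

section QPartialFractions

variable {K : Type*} [Field K] {toK : ℂ⟦X⟧ →+* K}

lemma toK_qz_ne_zero (hK : Function.Injective toK) (n : ℤ) : toK (qz n) ≠ 0 :=
  (map_ne_zero_iff _ hK).2 (IsPos.qz n).ne_zero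

/-- Either zero or invertible. -/
def ZeroOrUnit (r : ℂ⟦X⟧) : Prop := r = 0 ∨ PowerSeries.constantCoeff r ≠ 0

lemma ZeroOrUnit.qnum (n : ℤ) : ZeroOrUnit (qnum n) := by
  by_cases h : n = 0
  · left; simp [h]
  · right; rw [constantCoeff_qnum]; exact_mod_cast h

lemma ZeroOrUnit.mul {r s : ℂ⟦X⟧} : ZeroOrUnit r → ZeroOrUnit s → ZeroOrUnit (r * s) := by
  rintro (rfl | h) (rfl | h')
  · left; simp
  · left; simp
  · left; simp
  · right; rw [map_mul]; exact mul_ne_zero h h'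

lemma ZeroOrUnit.prod {ι : Type*} {s : Finset ι} {f : ι → ℂ⟦X⟧} (h : ∀ i ∈ s, ZeroOrUnit (f i)) :
    ZeroOrUnit (∏ i ∈ s, f i) :=
  Finset.prod_induction f ZeroOrUnit (fun _ _ => ZeroOrUnit.mul) (Or.inr (by simp)) h

/-- The inverse of a power series without constant term is 0 by convention. Passing to the fraction
field is compatible with inversion only because products of q-numbers are zero or units. -/
lemma ZeroOrUnit.toK_inv {r : ℂ⟦X⟧} (h : ZeroOrUnit r) : toK r⁻¹ = (toK r)⁻¹ := by
  rcases h with rfl | h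
  · simp
  · refine eq_inv_of_mul_eq_one_left ?_
    rw [← map_mul, PowerSeries.inv_mul_cancel _ h, map_one]

lemma toK_qdiff_ne_zero (hK : Function.Injective toK) : toK qdiff ≠ 0 := (map_ne_zero_iff _ hK).2 qdiff_ne_zero

/-- Up to a monomial in q, a q-number [c - l] is the difference of the nodes q^{2l} and q^{2c}. This
turns sums of products of q-numbers into partial fractions. -/
lemma toK_qnum_sub (hK : Function.Injective toK) (c l : ℤ) : toK (qnum (c - l)) =
    -((toK qdiff)⁻¹ * toK (qz (-(c + l)))) * (toK (qz (2 * l)) - toK (qz (2 * c))) := by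
  have h := congrArg toK (qdiff_mul_qnum (c - l))
  rw [map_mul, map_sub] at h
  have h1 : toK (qz (-(c + l))) * toK (qz (2 * l)) = toK (qz (-(c - l))) := by
    rw [← map_mul, ← qz_add]; congr 2; ring
  have h2 : toK (qz (-(c + l))) * toK (qz (2 * c)) = toK (qz (c - l)) := by
    rw [← map_mul, ← qz_add]; congr 2; ring
  have hd := toK_qdiff_ne_zero hK
  field_simp
  linear_combination h + h1 - h2

lemma toK_ratio (hK : Function.Injective toK) (l a b c d : ℤ) : toK (qnum (a - l)) * toK (qnum (b - l)) *
    (toK (qnum (c - l)) * toK (qnum (d - l)))⁻¹ =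
    toK (qz (c + d - a - b)) * ((toK (qz (2 * l)) - toK (qz (2 * a))) *
      (toK (qz (2 * l)) - toK (qz (2 * b))) * ((toK (qz (2 * l)) - toK (qz (2 * c))) *
      (toK (qz (2 * l)) - toK (qz (2 * d))))⁻¹) := by
  simp only [toK_qnum_sub hK]
  have h1 : toK (qz (-(a + l))) * toK (qz (-(b + l))) =
      toK (qz (c + d - a - b)) * (toK (qz (-(c + l))) * toK (qz (-(d + l)))) := by
    rw [← map_mul, ← map_mul, ← map_mul, ← qz_add, ← qz_add, ← qz_add]; congr 2; ring
  have hd := toK_qdiff_ne_zero hK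
  have h2 := toK_qz_ne_zero hK (-(c + l))
  have h3 := toK_qz_ne_zero hK (-(d + l))
  simp only [mul_inv, inv_neg, inv_inv]
  generalize toK (qz (-(a + l))) = A at *
  generalize toK (qz (-(b + l))) = B at *
  generalize toK (qz (-(c + l))) = C at *
  generalize toK (qz (-(d + l))) = D at *
  generalize (toK (qz (2 * l)) - toK (qz (2 * a))) = x
  generalize (toK (qz (2 * l)) - toK (qz (2 * b))) = y
  generalize (toK (qz (2 * l)) - toK (qz (2 * c)))⁻¹ = z
  generalize (toK (qz (2 * l)) - toK (qz (2 * d)))⁻¹ = w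
  field_simp
  linear_combination (x * y * z * w) * h1

/-- The residue sum behind the relation `[X, Y] = [H]`. -/
lemma sum_residues (p : ℕ) (l a b : ℕ → ℤ) (hl : Set.InjOn l (Finset.range p))
    (hdeg : ∀ i ∈ Finset.range p, ∀ k ∈ Finset.range p, l i = l k - 1 →
      a i = l i ∧ b k = l k - 1) :
    ∑ j ∈ Finset.range p,
      ((∏ k ∈ Finset.range p, qnum (a k - l j) * qnum (b k - l j)) *
        (∏ k ∈ (Finset.range p).erase j, qnum (l k - l j) * qnum (l k - 1 - l j))⁻¹ -
      (∏ k ∈ Finset.range p, qnum (a k - (l j - 1)) * qnum (b k - (l j - 1))) *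
        (∏ k ∈ (Finset.range p).erase j, qnum (l k - (l j - 1)) * qnum (l k - 1 - (l j - 1)))⁻¹) =
      qnum (∑ k ∈ Finset.range p, (2 * l k - 1 - a k - b k)) := by
  set s := Finset.range p
  set E := ∑ k ∈ s, (2 * l k - 1 - a k - b k) with hE
  obtain ⟨K, _, toK, hK⟩ : ∃ (K : Type) (_ : Field K) (f : ℂ⟦X⟧ →+* K), Function.Injective f :=
    ⟨FractionRing ℂ⟦X⟧, inferInstance, algebraMap _ _, IsFractionRing.injective _ _⟩
  apply hK
  rw [map_sum]
  have hinj (x y : ℤ) (h : toK (qz (2 * x)) = toK (qz (2 * y))) : x = y := by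
    by_contra hne
    have h1 := toK_qnum_sub hK x y
    rw [h, sub_self, mul_zero] at h1
    exact qnum_ne_zero (sub_ne_zero.2 hne) (hK (h1.trans (map_zero _).symm))
  -- Nodes q^{2 l_j} and q^{2 (l_j - 1)}, zeros q^{2 a_j} and q^{2 b_j}. If two nodes coincide, then
  -- `hdeg` provides the cancelling zeros.
  have hfrac := sum_prod_two_nodes s (fun j => toK (qz (2 * l j))) (fun j => toK (qz (2 * (l j - 1))))
    (fun j => toK (qz (2 * a j))) (fun j => toK (qz (2 * b j)))
    (fun i hi k hk h => hl hi hk (hinj _ _ h))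
    (fun i hi k hk h => hl hi hk (by have := hinj _ _ h; omega))
    (fun i hi k hk h => by
      obtain ⟨h1, h2⟩ := hdeg i hi k hk (hinj _ _ h)
      rw [h1, h2]; exact ⟨rfl, rfl⟩)
    (fun i _ => toK_qz_ne_zero hK _) (fun i _ => toK_qz_ne_zero hK _)
  have hd := toK_qdiff_ne_zero hK
  have hinv (j : ℕ) (x : ℤ) : toK ((∏ k ∈ s.erase j, qnum (l k - x) * qnum (l k - 1 - x))⁻¹) =
      ∏ k ∈ s.erase j, (toK (qnum (l k - x)) * toK (qnum (l k - 1 - x)))⁻¹ := by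
    rw [(ZeroOrUnit.prod fun k _ => (ZeroOrUnit.qnum _).mul (ZeroOrUnit.qnum _)).toK_inv, map_prod,
      Finset.prod_inv_distrib]
    simp only [map_mul]
  have hterm (j : ℕ) (hj : j ∈ s) (x : ℤ) :
      toK ((∏ k ∈ s, qnum (a k - x) * qnum (b k - x)) *
        (∏ k ∈ s.erase j, qnum (l k - x) * qnum (l k - 1 - x))⁻¹) =
      toK (qz E) * (toK qdiff)⁻¹ ^ 2 * toK (qz (-(2 * x + 2 * l j - 1))) *
      ((∏ k ∈ s, (toK (qz (2 * x)) - toK (qz (2 * a k))) * (toK (qz (2 * x)) - toK (qz (2 * b k)))) *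
       (∏ k ∈ s.erase j, (toK (qz (2 * x)) - toK (qz (2 * l k))) *
          (toK (qz (2 * x)) - toK (qz (2 * (l k - 1)))))⁻¹) := by
    rw [map_mul, hinv, map_prod, ← Finset.mul_prod_erase s _ hj, mul_assoc,
      ← Finset.prod_mul_distrib]
    simp only [map_mul]
    rw [Finset.prod_congr rfl fun k _ => toK_ratio hK x (a k) (b k) (l k) (l k - 1),
      Finset.prod_mul_distrib, ← map_prod, ← qz_sum, Finset.prod_mul_distrib,
      Finset.prod_inv_distrib, ← Finset.mul_prod_erase s (fun k => (toK (qz (2 * x)) -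
        toK (qz (2 * a k))) * (toK (qz (2 * x)) - toK (qz (2 * b k)))) hj,
      toK_qnum_sub hK, toK_qnum_sub hK]
    have hE' : toK (qz (-(a j + x))) * toK (qz (-(b j + x))) *
        toK (qz (∑ i ∈ s.erase j, (l i + (l i - 1) - a i - b i))) =
        toK (qz E) * toK (qz (-(2 * x + 2 * l j - 1))) := by
      rw [← map_mul, ← map_mul, ← map_mul, ← qz_add, ← qz_add, ← qz_add]
      congr 2
      rw [hE, ← Finset.add_sum_erase s _ hj, Finset.sum_congr rfl fun k _ =>
        show l k + (l k - 1) - a k - b k = 2 * l k - 1 - a k - b k by ring]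
      ring
    linear_combination ((toK qdiff)⁻¹ ^ 2 * (toK (qz (2 * x)) - toK (qz (2 * a j))) *
      (toK (qz (2 * x)) - toK (qz (2 * b j))) * ((∏ k ∈ s.erase j, (toK (qz (2 * x)) -
        toK (qz (2 * a k))) * (toK (qz (2 * x)) - toK (qz (2 * b k)))) *
       (∏ k ∈ s.erase j, (toK (qz (2 * x)) - toK (qz (2 * l k))) *
          (toK (qz (2 * x)) - toK (qz (2 * (l k - 1)))))⁻¹)) * hE'
  have hdiff (x : ℤ) : toK (qz (2 * x)) - toK (qz (2 * (x - 1))) =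
      toK qdiff * toK (qz (2 * x - 1)) := by
    rw [qdiff, ← map_sub, ← map_mul, sub_mul, ← qz_add, ← qz_add]; congr 3 <;> ring_nf
  have hsum : ∀ j ∈ s, toK
      ((∏ k ∈ s, qnum (a k - l j) * qnum (b k - l j)) *
        (∏ k ∈ s.erase j, qnum (l k - l j) * qnum (l k - 1 - l j))⁻¹ -
      (∏ k ∈ s, qnum (a k - (l j - 1)) * qnum (b k - (l j - 1))) *
        (∏ k ∈ s.erase j, qnum (l k - (l j - 1)) * qnum (l k - 1 - (l j - 1)))⁻¹) =
      toK (qz E) * (toK qdiff)⁻¹ *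
      ((toK (qz (2 * l j)))⁻¹ * (∏ k ∈ s, (toK (qz (2 * l j)) - toK (qz (2 * a k))) *
          (toK (qz (2 * l j)) - toK (qz (2 * b k)))) *
        ((toK (qz (2 * l j)) - toK (qz (2 * (l j - 1)))) *
          ∏ k ∈ s.erase j, (toK (qz (2 * l j)) - toK (qz (2 * l k))) *
            (toK (qz (2 * l j)) - toK (qz (2 * (l k - 1)))))⁻¹ +
      (toK (qz (2 * (l j - 1))))⁻¹ * (∏ k ∈ s, (toK (qz (2 * (l j - 1))) - toK (qz (2 * a k))) *
          (toK (qz (2 * (l j - 1))) - toK (qz (2 * b k)))) *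
        ((toK (qz (2 * (l j - 1))) - toK (qz (2 * l j))) *
          ∏ k ∈ s.erase j, (toK (qz (2 * (l j - 1))) - toK (qz (2 * l k))) *
            (toK (qz (2 * (l j - 1))) - toK (qz (2 * (l k - 1)))))⁻¹) := by
    intro j hj
    rw [map_sub, hterm j hj, hterm j hj, ← neg_sub (toK (qz (2 * l j))) (toK (qz (2 * (l j - 1)))),
      hdiff, mul_inv, mul_inv _ (∏ k ∈ s.erase j, _)]
    have q1 : toK (qz (-(2 * l j + 2 * l j - 1))) =
        (toK (qz (2 * l j)))⁻¹ * (toK (qz (2 * l j - 1)))⁻¹ := by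
      rw [← mul_inv]
      refine eq_inv_of_mul_eq_one_left ?_
      rw [← map_mul, ← map_mul, ← qz_add, ← qz_add]
      ring_nf
      simp
    have q2 : toK (qz (-(2 * (l j - 1) + 2 * l j - 1))) =
        (toK (qz (2 * (l j - 1))))⁻¹ * (toK (qz (2 * l j - 1)))⁻¹ := by
      rw [← mul_inv]
      refine eq_inv_of_mul_eq_one_left ?_
      rw [← map_mul, ← map_mul, ← qz_add, ← qz_add]
      ring_nf
      simp
    rw [q1, q2, inv_neg, mul_inv]
    ring
  rw [Finset.sum_congr rfl hsum, ← Finset.mul_sum, hfrac]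
  -- The quotient of the product of the zeros by the product of the nodes is q^{-2E}, so the partial
  -- fraction sum is 1 - q^{-2E} = q^{-E} (q^E - q^{-E}).
  have hP : (∏ k ∈ s, toK (qz (2 * a k)) * toK (qz (2 * b k))) *
      (∏ k ∈ s, toK (qz (2 * l k)) * toK (qz (2 * (l k - 1))))⁻¹ = toK (qz (-(2 * E))) := by
    rw [mul_inv_eq_iff_eq_mul₀ (Finset.prod_ne_zero_iff.2 fun k _ =>
      mul_ne_zero (toK_qz_ne_zero hK _) (toK_qz_ne_zero hK _))]
    simp only [← map_mul, ← qz_add, ← map_prod, ← qz_sum]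
    congr 2
    rw [hE, Finset.mul_sum, ← Finset.sum_neg_distrib, ← Finset.sum_add_distrib]
    exact Finset.sum_congr rfl fun k _ => by ring
  rw [hP]
  have h := congrArg toK (qdiff_mul_qnum E)
  rw [map_mul, map_sub] at h
  have h3 : toK (qz E) * toK (qz (-(2 * E))) = toK (qz (-E)) := by
    rw [← map_mul, ← qz_add]; congr 2; ring
  field_simp
  linear_combination -h - h3

end QPartialFractions

/-! ### Integral Gelfand–Zetlin arrays -/

section Arrays

/-- `t p a` is the entry with index `a` in the row `p`; the row `p` has the indices `a < p`. -/
abbrev Arr : Type := ℕ → ℕ → ℤ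

/-- Add `s` to the entry `a` of the row `p`. -/
def bump (t : Arr) (s : ℤ) (p a : ℕ) : Arr :=
  fun r b => if r = p ∧ b = a then t r b + s else t r b

lemma bump_comm (t : Arr) (s s' : ℤ) (p a p' a' : ℕ) :
    bump (bump t s p a) s' p' a' = bump (bump t s' p' a') s p a := by
  funext r b
  simp only [bump]
  split_ifs <;> ring

lemma bump_neg_bump (t : Arr) (s : ℤ) (p a : ℕ) : bump (bump t (-s) p a) s p a = t := by
  funext r b
  simp only [bump]
  split_ifs <;> ring

lemma bump_bump_neg (t : Arr) (s : ℤ) (p a : ℕ) : bump (bump t s p a) (-s) p a = t := by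
  funext r b
  simp only [bump]
  split_ifs <;> ring

lemma bump_row_ne (t : Arr) (s : ℤ) {p r : ℕ} (a : ℕ) (h : r ≠ p) : bump t s p a r = t r := by
  funext b
  simp [bump, h]

/-- The entries shifted by their index. -/
def lv (t : Arr) (p a : ℕ) : ℤ := t p a - a

lemma lv_bump_row_ne (t : Arr) (s : ℤ) {p r : ℕ} (a : ℕ) (h : r ≠ p) :
    lv (bump t s p a) r = lv t r := by
  funext b
  simp [lv, bump_row_ne t s a h]

lemma lv_bump_ne (t : Arr) (s : ℤ) (p : ℕ) {a b : ℕ} (h : b ≠ a) :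
    lv (bump t s p a) p b = lv t p b := by
  simp [lv, bump, h]

lemma lv_bump_self (t : Arr) (s : ℤ) (p a : ℕ) : lv (bump t s p a) p a = lv t p a + s := by
  simp [lv, bump]; ring

/-- The upper interlacing condition between the rows `m` and `m + 1`. -/
def Upper (t : Arr) (m : ℕ) : Prop := ∀ j < m, t m j ≤ t (m + 1) j

/-- The lower interlacing condition between the rows `m` and `m + 1`. -/
def Lower (t : Arr) (m : ℕ) : Prop := ∀ j < m, t (m + 1) (j + 1) ≤ t m j

/-- The conditions on an array that are not interlacing conditions. -/
structure IsFrame (μ : ℤ → ℤ) (t : Arr) : Prop where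
  outside : ∀ p a : ℕ, p ≤ a → t p a = 0
  stable : ∃ N : ℕ, ∀ p : ℕ, N ≤ p → ∀ a < p, t p a = μ ((a : ℤ) - ((p / 2 : ℕ) : ℤ))

/-- Gelfand–Zetlin arrays whose rows are eventually given by `μ`. -/
structure IsGT (μ : ℤ → ℤ) (t : Arr) : Prop extends IsFrame μ t where
  upper : ∀ m, Upper t m
  lower : ∀ m, Lower t m

/-- The interlacing conditions except those between the rows `m` and `m + 1`. -/
structure InterlacesOff (m : ℕ) (t : Arr) : Prop where
  upper : ∀ r, r ≠ m → Upper t r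
  lower : ∀ r, r ≠ m → Lower t r

variable {μ : ℤ → ℤ} {t : Arr}

lemma IsGT.interlacesOff (h : IsGT μ t) (m : ℕ) : InterlacesOff m t :=
  ⟨fun r _ => h.upper r, fun r _ => h.lower r⟩

lemma IsFrame.bump (h : IsFrame μ t) (s : ℤ) {p a : ℕ} (ha : a < p) : IsFrame μ (bump t s p a) where
  outside r b hb := by
    have : ¬ (r = p ∧ b = a) := by omega
    simp [UhaInfinity.bump, this, h.outside r b hb]
  stable := by
    obtain ⟨N, hN⟩ := h.stable
    refine ⟨max N (p + 1), fun r hr b hb => ?_⟩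
    have h1 : ¬ (r = p ∧ b = a) := by
      have := le_max_right N (p + 1); omega
    simp only [UhaInfinity.bump, h1, if_false]
    exact hN r (le_trans (le_max_left _ _) hr) b hb

lemma IsGT.of_interlacesOff (hf : IsFrame μ t) {m : ℕ} (ho : InterlacesOff m t) (hu : Upper t m)
    (hl : Lower t m) : IsGT μ t where
  toIsFrame := hf
  upper r := if h : r = m then h ▸ hu else ho.upper r h
  lower r := if h : r = m then h ▸ hl else ho.lower r h

/-- Interlacing off a pair of rows is inherited by arrays between two given ones, if only the two
rows vary. -/
lemma InterlacesOff.of_between {m : ℕ} {t' t'' : Arr} (h : InterlacesOff m t)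
    (h'' : InterlacesOff m t'') (hrow : ∀ r, r ≠ m → r ≠ m + 1 → t' r = t r ∧ t' r = t'' r)
    (hb : (∀ r a, t r a ≤ t' r a ∧ t' r a ≤ t'' r a) ∨ ∀ r a, t'' r a ≤ t' r a ∧ t' r a ≤ t r a) :
    InterlacesOff m t' := by
  have key : ∀ (r : ℕ), r ≠ m → ∀ a b : ℕ, (t r a ≤ t (r + 1) b → t'' r a ≤ t'' (r + 1) b →
      t' r a ≤ t' (r + 1) b) ∧ (t (r + 1) b ≤ t r a → t'' (r + 1) b ≤ t'' r a →
      t' (r + 1) b ≤ t' r a) := by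
    intro r hr a b
    have e1 : (t' r = t r ∧ t' r = t'' r) ∨ (t' (r + 1) = t (r + 1) ∧ t' (r + 1) = t'' (r + 1)) := by
      by_cases h1 : r = m + 1
      · right; exact hrow _ (by omega) (by omega)
      · left; exact hrow _ hr h1
    rcases hb with hb | hb <;> rcases e1 with ⟨e, e'⟩ | ⟨e, e'⟩ <;>
      have h1 := hb r a <;> have h2 := hb (r + 1) b <;>
      first
      | (have e := congrFun e a; have e' := congrFun e' a; constructor <;> intros <;> omega)
      | (have e := congrFun e b; have e' := congrFun e' b; constructor <;> intros <;> omega)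
  exact ⟨fun r hr j hj => (key r hr j j).1 (h.upper r hr j hj) (h''.upper r hr j hj),
    fun r hr j hj => (key r hr j (j + 1)).2 (h.lower r hr j hj) (h''.lower r hr j hj)⟩

/-- Consecutive entries are separated by an entry of an adjacent row. Both versions, with the row
above and with the row below, are needed: when interlacing between rows `m` and `m + 1` is unknown,
row `m` is controlled from below and row `m + 1` from above. -/
lemma antitone_row_of_above {p : ℕ} (hu : Upper t (p + 1)) (hl : Lower t (p + 1)) {a b : ℕ}
    (hab : a ≤ b) (hb : b < p + 1) : t (p + 1) b ≤ t (p + 1) a := by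
  induction b, hab using Nat.le_induction with
  | base => exact le_rfl
  | succ n hn ih =>
    exact ((hu (n + 1) hb).trans (hl n (by omega))).trans (ih (by omega))

lemma antitone_row_of_below {p : ℕ} (hu : Upper t p) (hl : Lower t p) {a b : ℕ} (hab : a ≤ b)
    (hb : b < p + 1) : t (p + 1) b ≤ t (p + 1) a := by
  induction b, hab using Nat.le_induction with
  | base => exact le_rfl
  | succ n hn ih => exact ((hl n (by omega)).trans (hu n (by omega))).trans (ih (by omega))

lemma lv_ne_of_antitone {p : ℕ} (h : ∀ a b, a ≤ b → b < p → t p b ≤ t p a) {a b : ℕ} (ha : a < p)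
    (hb : b < p) (hab : a ≠ b) : lv t p a ≠ lv t p b := by
  simp only [lv]
  rcases lt_or_gt_of_ne hab with h1 | h1
  · have := h a b h1.le hb; omega
  · have := h b a h1.le ha; omega

lemma InterlacesOff.lv_ne {m p : ℕ} (h : InterlacesOff m t) (hp : p = m ∨ p = m + 1) {a b : ℕ}
    (ha : a < p) (hb : b < p) (hab : a ≠ b) : lv t p a ≠ lv t p b := by
  refine lv_ne_of_antitone ?_ ha hb hab
  obtain ⟨k, rfl⟩ : ∃ k, p = k + 1 := ⟨p - 1, by omega⟩
  intro a b hab hb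
  rcases hp with hp | hp
  · exact antitone_row_of_below (h.upper k (by omega)) (h.lower k (by omega)) hab hb
  · exact antitone_row_of_above (h.upper (k + 1) (by omega)) (h.lower (k + 1) (by omega)) hab hb

lemma IsGT.lv_ne (h : IsGT μ t) {p a b : ℕ} (ha : a < p) (hb : b < p) (hab : a ≠ b) :
    lv t p a ≠ lv t p b :=
  (h.interlacesOff p).lv_ne (Or.inl rfl) ha hb hab

lemma IsGT.antitone (h : IsGT μ t) {p a b : ℕ} (hab : a ≤ b) (hb : b < p) : t p b ≤ t p a := by
  obtain ⟨k, rfl⟩ : ∃ k, p = k + 1 := ⟨p - 1, by omega⟩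
  exact antitone_row_of_below (h.upper k) (h.lower k) hab hb

/-- If two entries are moved in opposite directions, then the intermediate arrays interlace. -/
lemma IsGT.bump_of_opposite (h : IsGT μ t) {s : ℤ} (hs : s = 1 ∨ s = -1) {p j p' l : ℕ}
    (hj : j < p) (hne : ¬ (p = p' ∧ j = l)) (h' : IsGT μ (bump (bump t s p j) (-s) p' l)) :
    IsGT μ (bump t s p j) := by
  have key : ∀ r a b : ℕ, (t r a ≤ t (r + 1) b →
      bump (bump t s p j) (-s) p' l r a ≤ bump (bump t s p j) (-s) p' l (r + 1) b →
      bump t s p j r a ≤ bump t s p j (r + 1) b) ∧ (t (r + 1) b ≤ t r a →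
      bump (bump t s p j) (-s) p' l (r + 1) b ≤ bump (bump t s p j) (-s) p' l r a →
      bump t s p j (r + 1) b ≤ bump t s p j r a) := by
    intro r a b
    simp only [bump]
    rcases hs with rfl | rfl <;> split_ifs <;> constructor <;> intros <;> omega
  exact
    { toIsFrame := h.toIsFrame.bump s hj
      upper := fun m a ha => (key m a a).1 (h.upper m a ha) (h'.upper m a ha)
      lower := fun m a ha => (key m a (a + 1)).2 (h.lower m a ha) (h'.lower m a ha) }

/-- Moves in rows that are not neighbours do not interfere. -/
lemma IsGT.bump_of_far (h : IsGT μ t) {s s' : ℤ} {p j p' l : ℕ}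
    (hj : j < p) (hne : p ≠ p') (h1 : p + 1 ≠ p') (h2 : p' + 1 ≠ p)
    (h' : IsGT μ (bump (bump t s p j) s' p' l)) : IsGT μ (bump t s p j) := by
  have key : ∀ r a b : ℕ, (t r a ≤ t (r + 1) b →
      bump (bump t s p j) s' p' l r a ≤ bump (bump t s p j) s' p' l (r + 1) b →
      bump t s p j r a ≤ bump t s p j (r + 1) b) ∧ (t (r + 1) b ≤ t r a →
      bump (bump t s p j) s' p' l (r + 1) b ≤ bump (bump t s p j) s' p' l r a →
      bump t s p j (r + 1) b ≤ bump t s p j r a) := by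
    intro r a b
    simp only [bump]
    split_ifs <;> constructor <;> intros <;> omega
  exact
    { toIsFrame := h.toIsFrame.bump s hj
      upper := fun m a ha => (key m a a).1 (h.upper m a ha) (h'.upper m a ha)
      lower := fun m a ha => (key m a (a + 1)).2 (h.lower m a ha) (h'.lower m a ha) }

end Arrays

/-! ### Operators that move one entry of a row -/

section Operators

/-- The Gelfand–Zetlin arrays with signature `μ`. -/
abbrev GT (μ : ℤ → ℤ) : Type := {t : Arr // IsGT μ t}

/-- The free `ℂ⟦h⟧`-module on the Gelfand–Zetlin arrays. -/
abbrev Mod (μ : ℤ → ℤ) : Type := GT μ →₀ ℂ⟦X⟧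

variable {μ : ℤ → ℤ}

open Classical in
/-- The basis vector of an array, and `0` if it is not a Gelfand–Zetlin array. -/
def kz (μ : ℤ → ℤ) (t : Arr) : Mod μ := if h : IsGT μ t then Finsupp.single ⟨t, h⟩ 1 else 0

lemma kz_of (g : GT μ) : kz μ g.1 = Finsupp.single g 1 := by
  rw [kz, dif_pos g.2]

lemma kz_eq_zero {t : Arr} (h : ¬ IsGT μ t) : kz μ t = 0 := by rw [kz, dif_neg h]

lemma Mod.hom_ext {N : Type*} [AddCommGroup N] [Module ℂ⟦X⟧ N] {S T : Mod μ →ₗ[ℂ⟦X⟧] N}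
    (h : ∀ t, IsGT μ t → S (kz μ t) = T (kz μ t)) : S = T := by
  refine Finsupp.lhom_ext' fun g => LinearMap.ext_ring ?_
  have := h g.1 g.2
  rwa [kz_of] at this

/-- The operator with `kz t ↦ ∑ j, c t j • kz (t + s δ_{p,j})`. -/
def shiftOp (μ : ℤ → ℤ) (s : ℤ) (p : ℕ) (c : Arr → ℕ → ℂ⟦X⟧) : Module.End ℂ⟦X⟧ (Mod μ) :=
  Finsupp.linearCombination ℂ⟦X⟧ fun g : GT μ =>
    ∑ j ∈ Finset.range p, c g.1 j • kz μ (bump g.1 s p j)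

open Classical in
/-- The coefficients of `shiftOp` as a function on all arrays. -/
def hat (μ : ℤ → ℤ) (s : ℤ) (p : ℕ) (c : Arr → ℕ → ℂ⟦X⟧) (t : Arr) (j : ℕ) : ℂ⟦X⟧ :=
  if IsGT μ t ∧ IsGT μ (bump t s p j) then c t j else 0

lemma hat_of {s : ℤ} {p : ℕ} {c : Arr → ℕ → ℂ⟦X⟧} {t : Arr} {j : ℕ} (h : IsGT μ t)
    (h' : IsGT μ (bump t s p j)) : hat μ s p c t j = c t j := if_pos ⟨h, h'⟩

lemma shiftOp_kz (s : ℤ) (p : ℕ) (c : Arr → ℕ → ℂ⟦X⟧) (t : Arr) :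
    shiftOp μ s p c (kz μ t) =
      ∑ j ∈ Finset.range p, hat μ s p c t j • kz μ (bump t s p j) := by
  by_cases h : IsGT μ t
  · rw [show t = (⟨t, h⟩ : GT μ).1 from rfl, kz_of, shiftOp, Finsupp.linearCombination_single,
      one_smul]
    refine Finset.sum_congr rfl fun j _ => ?_
    by_cases h' : IsGT μ (bump t s p j)
    · rw [hat_of h h']
    · rw [kz_eq_zero h', smul_zero, smul_zero]
  · rw [kz_eq_zero h, map_zero, Finset.sum_eq_zero]
    intro j _
    rw [hat, if_neg fun h' => h h'.1, zero_smul]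

lemma shiftOp_mul_kz (s s' : ℤ) (p p' : ℕ) (c d : Arr → ℕ → ℂ⟦X⟧) (t : Arr) :
    (shiftOp μ s p c * shiftOp μ s' p' d) (kz μ t) =
      ∑ j ∈ Finset.range p, ∑ l ∈ Finset.range p',
        (hat μ s' p' d t l * hat μ s p c (bump t s' p' l) j) •
          kz μ (bump (bump t s' p' l) s p j) := by
  rw [Module.End.mul_apply, shiftOp_kz, map_sum, Finset.sum_comm]
  refine Finset.sum_congr rfl fun l _ => ?_
  rw [map_smul, shiftOp_kz, Finset.smul_sum]
  exact Finset.sum_congr rfl fun j _ => smul_smul _ _ _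

lemma commute_shiftOp {s s' : ℤ} {p p' : ℕ} {c d : Arr → ℕ → ℂ⟦X⟧}
    (h : ∀ t, IsGT μ t → ∀ j < p, ∀ l < p', IsGT μ (bump (bump t s p j) s' p' l) →
      hat μ s' p' d t l * hat μ s p c (bump t s' p' l) j =
        hat μ s p c t j * hat μ s' p' d (bump t s p j) l) :
    Commute (shiftOp μ s p c) (shiftOp μ s' p' d) := by
  refine Mod.hom_ext fun t ht => ?_
  rw [shiftOp_mul_kz, shiftOp_mul_kz, Finset.sum_comm]
  refine Finset.sum_congr rfl fun l hl => Finset.sum_congr rfl fun j hj => ?_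
  rw [bump_comm t s']
  by_cases hT : IsGT μ (bump (bump t s p j) s' p' l)
  · rw [h t ht j (Finset.mem_range.1 hj) l (Finset.mem_range.1 hl) hT]
  · rw [kz_eq_zero hT, smul_zero, smul_zero]

lemma eq_zero_of_add_self {x : Mod μ} (h : x + x = 0) : x = 0 := by
  have h2 : (PowerSeries.C (2⁻¹ : ℂ) : ℂ⟦X⟧) • (x + x) = 0 := by rw [h, smul_zero]
  rw [← two_smul ℂ⟦X⟧ x, smul_smul] at h2
  have h3 : (PowerSeries.C (2⁻¹ : ℂ) : ℂ⟦X⟧) * 2 = 1 := by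
    rw [show (2 : ℂ⟦X⟧) = PowerSeries.C (2 : ℂ) from
      (map_ofNat (PowerSeries.C (R := ℂ)) 2).symm, ← map_mul]
    simp
  rwa [h3, one_smul] at h2

/-- A criterion for the Serre relation, in terms of symmetrized matrix coefficients. -/
lemma serre_shiftOp {s : ℤ} {p r : ℕ} {c d : Arr → ℕ → ℂ⟦X⟧} {z : ℂ⟦X⟧}
    {F : Arr → ℕ → ℕ → ℕ → ℂ⟦X⟧}
    (hF : ∀ t, IsGT μ t → ∀ j < p, ∀ j' < p, ∀ l < r,
      IsGT μ (bump (bump (bump t s p j) s p j') s r l) →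
      hat μ s r d t l * hat μ s p c (bump t s r l) j *
          hat μ s p c (bump (bump t s r l) s p j) j' -
        z * (hat μ s p c t j * hat μ s r d (bump t s p j) l *
          hat μ s p c (bump (bump t s p j) s r l) j') +
        hat μ s p c t j * hat μ s p c (bump t s p j) j' *
          hat μ s r d (bump (bump t s p j) s p j') l = F t j j' l)
    (h : ∀ t, IsGT μ t → ∀ j < p, ∀ j' < p, ∀ l < r,
      IsGT μ (bump (bump (bump t s p j) s p j') s r l) → F t j j' l + F t j' j l = 0) :
    Serre z (shiftOp μ s p c) (shiftOp μ s r d) := by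
  refine Mod.hom_ext fun t ht => ?_
  have e1 : (shiftOp μ s p c * shiftOp μ s p c * shiftOp μ s r d) (kz μ t) =
      ∑ l ∈ Finset.range r, ∑ j ∈ Finset.range p, ∑ j' ∈ Finset.range p,
        (hat μ s r d t l * hat μ s p c (bump t s r l) j *
          hat μ s p c (bump (bump t s r l) s p j) j') •
          kz μ (bump (bump (bump t s p j) s p j') s r l) := by
    rw [Module.End.mul_apply, shiftOp_kz, map_sum]
    refine Finset.sum_congr rfl fun l _ => ?_
    rw [map_smul, shiftOp_mul_kz, Finset.sum_comm, Finset.smul_sum]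
    refine Finset.sum_congr rfl fun j _ => ?_
    rw [Finset.smul_sum]
    refine Finset.sum_congr rfl fun j' _ => ?_
    rw [smul_smul, ← mul_assoc, bump_comm (bump t s p j) s s p j' r l, bump_comm t s s p j r l]
  have e2 : (shiftOp μ s p c * shiftOp μ s r d * shiftOp μ s p c) (kz μ t) =
      ∑ l ∈ Finset.range r, ∑ j ∈ Finset.range p, ∑ j' ∈ Finset.range p,
        (hat μ s p c t j * hat μ s r d (bump t s p j) l *
          hat μ s p c (bump (bump t s p j) s r l) j') •
          kz μ (bump (bump (bump t s p j) s p j') s r l) := by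
    rw [Module.End.mul_apply, shiftOp_kz, map_sum, Finset.sum_comm]
    refine Finset.sum_congr rfl fun j _ => ?_
    rw [map_smul, shiftOp_mul_kz, Finset.sum_comm, Finset.smul_sum]
    refine Finset.sum_congr rfl fun l _ => ?_
    rw [Finset.smul_sum]
    refine Finset.sum_congr rfl fun j' _ => ?_
    rw [smul_smul, ← mul_assoc, bump_comm (bump t s p j) s s p j' r l]
  have e3 : (shiftOp μ s r d * shiftOp μ s p c * shiftOp μ s p c) (kz μ t) =
      ∑ l ∈ Finset.range r, ∑ j ∈ Finset.range p, ∑ j' ∈ Finset.range p,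
        (hat μ s p c t j * hat μ s p c (bump t s p j) j' *
          hat μ s r d (bump (bump t s p j) s p j') l) •
          kz μ (bump (bump (bump t s p j) s p j') s r l) := by
    rw [Module.End.mul_apply, shiftOp_kz, map_sum, Finset.sum_comm]
    refine Finset.sum_congr rfl fun j _ => ?_
    rw [map_smul, shiftOp_mul_kz, Finset.smul_sum]
    refine Finset.sum_congr rfl fun l _ => ?_
    rw [Finset.smul_sum]
    refine Finset.sum_congr rfl fun j' _ => ?_
    rw [smul_smul, ← mul_assoc]
  rw [LinearMap.add_apply, LinearMap.sub_apply, LinearMap.smul_apply, e1, e2, e3,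
    LinearMap.zero_apply, Finset.smul_sum, ← Finset.sum_sub_distrib, ← Finset.sum_add_distrib]
  refine Finset.sum_eq_zero fun l hl => ?_
  rw [Finset.smul_sum, ← Finset.sum_sub_distrib, ← Finset.sum_add_distrib]
  have e4 : ∀ j ∈ Finset.range p, (∑ j' ∈ Finset.range p,
        (hat μ s r d t l * hat μ s p c (bump t s r l) j *
          hat μ s p c (bump (bump t s r l) s p j) j') •
          kz μ (bump (bump (bump t s p j) s p j') s r l)) -
      z • (∑ j' ∈ Finset.range p, (hat μ s p c t j * hat μ s r d (bump t s p j) l *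
          hat μ s p c (bump (bump t s p j) s r l) j') •
          kz μ (bump (bump (bump t s p j) s p j') s r l)) +
      (∑ j' ∈ Finset.range p, (hat μ s p c t j * hat μ s p c (bump t s p j) j' *
          hat μ s r d (bump (bump t s p j) s p j') l) •
          kz μ (bump (bump (bump t s p j) s p j') s r l)) =
      ∑ j' ∈ Finset.range p, F t j j' l • kz μ (bump (bump (bump t s p j) s p j') s r l) := by
    intro j hj
    rw [Finset.smul_sum, ← Finset.sum_sub_distrib, ← Finset.sum_add_distrib]
    refine Finset.sum_congr rfl fun j' hj' => ?_
    by_cases hT : IsGT μ (bump (bump (bump t s p j) s p j') s r l)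
    · rw [smul_smul, ← sub_smul, ← add_smul, hF t ht j (Finset.mem_range.1 hj) j'
        (Finset.mem_range.1 hj') l (Finset.mem_range.1 hl) hT]
    · simp [kz_eq_zero hT]
  rw [Finset.sum_congr rfl e4]
  -- The target array is symmetric in `j` and `j'`, so the sum may be doubled and symmetrized; only
  -- `F t j j' l + F t j' j l` matters.
  apply eq_zero_of_add_self
  nth_rewrite 2 [Finset.sum_comm]
  rw [← Finset.sum_add_distrib]
  refine Finset.sum_eq_zero fun j hj => ?_
  rw [← Finset.sum_add_distrib]
  refine Finset.sum_eq_zero fun j' hj' => ?_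
  rw [bump_comm t s s p j' p j, ← add_smul]
  by_cases hT : IsGT μ (bump (bump (bump t s p j) s p j') s r l)
  · rw [h t ht j (Finset.mem_range.1 hj) j' (Finset.mem_range.1 hj') l (Finset.mem_range.1 hl) hT,
      zero_smul]
  · rw [kz_eq_zero hT, smul_zero]

end Operators

/-! ### The coefficients of the Gelfand–Zetlin operators -/

section Coefficients

open Finset

/-- `-∏ [a k - u] / ∏ [b k - u]`. -/
def xg (N : Finset ℕ) (a : ℕ → ℤ) (D : Finset ℕ) (b : ℕ → ℤ) (u : ℤ) : ℂ⟦X⟧ :=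
  -(∏ k ∈ N, qnum (a k - u)) * (∏ k ∈ D, qnum (b k - u))⁻¹

/-- The coefficient at the entry `j` of the row `p` that is governed by the row `r`. -/
def cg (p r : ℕ) (t : Arr) (j : ℕ) : ℂ⟦X⟧ :=
  xg (range r) (lv t r) ((range p).erase j) (lv t p) (lv t p j)

lemma xg_congr {N D : Finset ℕ} {a a' b b' : ℕ → ℤ} (ha : ∀ k ∈ N, a k = a' k)
    (hb : ∀ k ∈ D, b k = b' k) (u : ℤ) : xg N a D b u = xg N a' D b' u := by
  have h1 : ∏ k ∈ N, qnum (a k - u) = ∏ k ∈ N, qnum (a' k - u) :=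
    prod_congr rfl fun k hk => by rw [ha k hk]
  have h2 : ∏ k ∈ D, qnum (b k - u) = ∏ k ∈ D, qnum (b' k - u) :=
    prod_congr rfl fun k hk => by rw [hb k hk]
  rw [xg, xg, h1, h2]

lemma xg_erase_left {N D : Finset ℕ} {a b : ℕ → ℤ} {u : ℤ} {l : ℕ} (hl : l ∈ N) :
    xg N a D b u = qnum (a l - u) * xg (N.erase l) a D b u := by
  rw [xg, xg, ← mul_prod_erase N _ hl]
  ring

lemma xg_erase_right {N D : Finset ℕ} {a b : ℕ → ℤ} {u : ℤ} {j : ℕ} (hj : j ∈ D) :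
    xg N a D b u = (qnum (b j - u))⁻¹ * xg N a (D.erase j) b u := by
  rw [xg, xg, ← mul_prod_erase D _ hj, PowerSeries.mul_inv_rev]
  ring

lemma xg_eq_zero {N D : Finset ℕ} {a b : ℕ → ℤ} {u : ℤ} {l : ℕ} (hl : l ∈ N) (h : a l = u) :
    xg N a D b u = 0 := by
  rw [xg_erase_left hl, h, sub_self, qnum_zero, zero_mul]

variable {p r : ℕ} {t T : Arr} {j j' l l' : ℕ}

/-- The zeros of the numerator: an entry of the governing row meets the moved one. These zeros
replace the deletion of arrays that violate interlacing with that row. -/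
lemma cg_eq_zero (hl : l < r) (h : lv t r l = lv t p j) : cg p r t j = 0 :=
  xg_eq_zero (mem_range.2 hl) h

lemma cg_congr (hp : lv T p = lv t p) (hr : lv T r = lv t r) (j : ℕ) : cg p r T j = cg p r t j := by
  rw [cg, cg, hp, hr]

lemma cg_bump_row_ne (s : ℤ) {p' a : ℕ} (h : p' ≠ p) (h' : p' ≠ r) (j : ℕ) :
    cg p r (bump t s p' a) j = cg p r t j :=
  cg_congr (lv_bump_row_ne t s a h.symm) (lv_bump_row_ne t s a h'.symm) j

/-- Isolate the dependence on the entry `l` of the row `r`. -/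
lemma cg_split_left (hl : l < r) (hr : ∀ k, k ≠ l → lv T r k = lv t r k)
    (hp : ∀ k, k ≠ j → lv T p k = lv t p k) :
    cg p r T j = qnum (lv T r l - lv T p j) *
      xg ((range r).erase l) (lv t r) ((range p).erase j) (lv t p) (lv T p j) := by
  rw [cg, xg_erase_left (mem_range.2 hl)]
  refine congrArg (HMul.hMul (α := ℂ⟦X⟧) (β := ℂ⟦X⟧) _) ?_
  exact xg_congr (fun k hk => hr k (ne_of_mem_erase hk)) (fun k hk => hp k (ne_of_mem_erase hk)) _

/-- Isolate the dependence on the entry `l` of the row `r` and on the entry `j'` of the row `p`. -/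
lemma cg_split_left_right (hl : l < r) (hj' : j' < p) (hjj' : j' ≠ j)
    (hr : ∀ k, k ≠ l → lv T r k = lv t r k)
    (hp : ∀ k, k ≠ j → k ≠ j' → lv T p k = lv t p k) :
    cg p r T j = qnum (lv T r l - lv T p j) * (qnum (lv T p j' - lv T p j))⁻¹ *
      xg ((range r).erase l) (lv t r) (((range p).erase j).erase j') (lv t p) (lv T p j) := by
  rw [cg, xg_erase_left (mem_range.2 hl),
    xg_erase_right (mem_erase.2 ⟨hjj', mem_range.2 hj'⟩), ← mul_assoc]
  refine congrArg (HMul.hMul (α := ℂ⟦X⟧) (β := ℂ⟦X⟧) _) ?_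
  exact xg_congr (fun k hk => hr k (ne_of_mem_erase hk)) (fun k hk =>
    hp k (ne_of_mem_erase (mem_of_mem_erase hk)) (ne_of_mem_erase hk)) _

/-- Isolate the dependence on two entries of the row `r`. -/
lemma cg_split_left_left (hl : l < r) (hl' : l' < r) (hll' : l' ≠ l)
    (hr : ∀ k, k ≠ l → k ≠ l' → lv T r k = lv t r k) (hp : lv T p = lv t p) :
    cg p r T j = qnum (lv T r l - lv t p j) * qnum (lv T r l' - lv t p j) *
      xg (((range r).erase l).erase l') (lv t r) ((range p).erase j) (lv t p) (lv t p j) := by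
  rw [cg, hp, xg_erase_left (mem_range.2 hl), xg_erase_left (mem_erase.2 ⟨hll', mem_range.2 hl'⟩),
    ← mul_assoc]
  refine congrArg (HMul.hMul (α := ℂ⟦X⟧) (β := ℂ⟦X⟧) _) ?_
  exact xg_congr (fun k hk => hr k (ne_of_mem_erase (mem_of_mem_erase hk))
    (ne_of_mem_erase hk)) (fun k _ => rfl) _

/-- Isolate the dependence on another entry of the row `p`. -/
lemma cg_split_right (hj' : j' < p) (hjj' : j' ≠ j) (hr : lv T r = lv t r)
    (hp : ∀ k, k ≠ j → k ≠ j' → lv T p k = lv t p k) :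
    cg p r T j = (qnum (lv T p j' - lv T p j))⁻¹ *
      xg (range r) (lv t r) (((range p).erase j).erase j') (lv t p) (lv T p j) := by
  rw [cg, hr, xg_erase_right (mem_erase.2 ⟨hjj', mem_range.2 hj'⟩)]
  refine congrArg (HMul.hMul (α := ℂ⟦X⟧) (β := ℂ⟦X⟧) _) ?_
  exact xg_congr (fun k _ => rfl) (fun k hk =>
    hp k (ne_of_mem_erase (mem_of_mem_erase hk)) (ne_of_mem_erase hk)) _

lemma qnum_mul_inv {n : ℤ} (hn : n ≠ 0) : qnum n * (qnum n)⁻¹ = 1 :=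
  PowerSeries.mul_inv_cancel _ (by rw [constantCoeff_qnum]; exact_mod_cast hn)

lemma qnum_sub_inv (a b : ℤ) : (qnum (a - b))⁻¹ = -(qnum (b - a))⁻¹ := by
  by_cases h : b - a = 0
  · rw [← neg_sub b a, h]; simp
  · have h1 := qnum_mul_inv h
    have h2 : qnum (a - b) * (qnum (a - b))⁻¹ = 1 := qnum_mul_inv (by omega)
    have h3 : qnum (a - b) = -qnum (b - a) := by rw [← qnum_neg, neg_sub]
    rw [h3] at h2 ⊢
    apply mul_left_cancel₀ (qnum_ne_zero h)
    linear_combination -h2 + h1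

/-- This identity carries the Serre relations when two different entries are moved: the right-hand
side depends on the difference of the two entries only. The case s = -1 is the case s = 1 at the
negated arguments. -/
lemma qnum_serre {s : ℤ} (hs : s = 1 ∨ s = -1) (a b : ℤ) :
    qnum (a + s) * qnum (b + s) - qnum 2 * (qnum a * qnum (b + s)) + qnum a * qnum b =
      s * qnum (b - a + s) := by
  rcases hs with rfl | rfl
  · have h1 := qnum_two_mul (b + 1)
    have h2 := qnum_mul_sub_mul a b
    rw [show b + 1 + 1 = b + 2 by ring, show b + 1 - 1 = b by ring] at h1
    push_cast
    linear_combination h2 - qnum a * h1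
  · have h1 := qnum_two_mul (-b + 1)
    have h2 := qnum_mul_sub_mul (-a) (-b)
    rw [show -b + 1 + 1 = -b + 2 by ring, show -b + 1 - 1 = -b by ring] at h1
    rw [show a + -1 = -(-a + 1) by ring, show b + -1 = -(-b + 1) by ring,
      show b - a + -1 = -(-b - -a + 1) by ring]
    simp only [qnum_neg] at h1 h2 ⊢
    push_cast
    linear_combination h2 + qnum a * h1

lemma qnum_string {s : ℤ} (hs : s = 1 ∨ s = -1) (a : ℤ) :
    qnum (a + s) - qnum 2 * qnum a + qnum (a - s) = 0 := by
  have := qnum_two_mul a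
  rcases hs with rfl | rfl
  · linear_combination -this
  · rw [sub_neg_eq_add, ← sub_eq_add_neg]; linear_combination -this

end Coefficients

/-! ### Neighbouring rows, moved in the same direction -/

section Neighbours

/-- The row `p`, moved by `s`, is governed by the row `r`; together they are the rows `m`, `m + 1`,
and the row `r` is governed by the row `r'`. -/
def Governs (s : ℤ) (m p r r' : ℕ) : Prop :=
  (s = 1 ∧ p = m ∧ r = m + 1 ∧ r' = m + 2) ∨ (s = -1 ∧ p = m + 1 ∧ r = m ∧ r' + 1 = m)

variable {s : ℤ} {m p r r' : ℕ} {t : Arr} {j l : ℕ}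

lemma Governs.sign (h : Governs s m p r r') : s = 1 ∨ s = -1 := by
  rcases h with h | h
  · exact Or.inl h.1
  · exact Or.inr h.1

/-- Along a path with nonzero coefficients the upper inequalities propagate forwards and the lower
ones backwards. A move of row `p` could break this only where an entry of row `r` equals the moved
one after the index shift, and there the coefficient vanishes; moves of row `r` preserve it anyway.
So a path between two interlacing arrays stays inside if no coefficient vanishes. -/
lemma Governs.upper_bump (h : Governs s m p r r') (hj : j < p) (hU : Upper t m)
    (hc : cg p r t j ≠ 0) : Upper (bump t s p j) m := by
  intro a ha
  have h1 := hU a ha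
  have h2 : a = j → j < r → lv t r j ≠ lv t p j := fun _ hr he => hc (cg_eq_zero hr he)
  simp only [lv] at h2
  rcases h with ⟨rfl, rfl, rfl, -⟩ | ⟨rfl, rfl, rfl, -⟩ <;> simp only [bump] <;> split_ifs <;> try omega
  · rename_i h3 _
    have := h2 h3.2 (by omega)
    obtain ⟨-, rfl⟩ := h3
    omega
  · rename_i _ h3
    have := h2 h3.2 (by omega)
    obtain ⟨-, rfl⟩ := h3
    omega

lemma Governs.lower_of_bump (h : Governs s m p r r') (hj : j < p)
    (hL : Lower (bump t s p j) m) (hc : cg p r t j ≠ 0) : Lower t m := by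
  intro a ha
  have h1 := hL a ha
  have h2 : ∀ b, b < r → lv t r b ≠ lv t p j := fun _ hr he => hc (cg_eq_zero hr he)
  simp only [lv] at h2
  rcases h with ⟨rfl, rfl, rfl, -⟩ | ⟨rfl, rfl, rfl, -⟩ <;> simp only [bump] at h1 <;>
    split_ifs at h1 <;> try omega
  · rename_i _ h3
    have := h2 (a + 1) (by omega)
    obtain ⟨-, rfl⟩ := h3
    push_cast at this
    omega
  · rename_i h3 _
    have := h2 a (by omega)
    obtain ⟨-, rfl⟩ := h3
    push_cast at this
    omega

lemma Governs.upper_bump' (h : Governs s m p r r') (hU : Upper t m) :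
    Upper (bump t s r l) m := by
  intro a ha
  have h1 := hU a ha
  rcases h with ⟨rfl, rfl, rfl, -⟩ | ⟨rfl, rfl, rfl, -⟩ <;> simp only [bump] <;> split_ifs <;> omega

lemma Governs.lower_of_bump' (h : Governs s m p r r') (hL : Lower (bump t s r l) m) :
    Lower t m := by
  intro a ha
  have h1 := hL a ha
  rcases h with ⟨rfl, rfl, rfl, -⟩ | ⟨rfl, rfl, rfl, -⟩ <;> simp only [bump] at h1 <;>
    split_ifs at h1 <;> omega

/-- `t'` arises from `t` by moves in the direction `s` in the rows `m` and `m + 1`. -/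
structure Moves (s : ℤ) (m : ℕ) (t t' : Arr) : Prop where
  row : ∀ r, r ≠ m → r ≠ m + 1 → t' r = t r
  le : ∀ r a, s * t r a ≤ s * t' r a

lemma Moves.trans {t' t'' : Arr} (h : Moves s m t t') (h' : Moves s m t' t'') : Moves s m t t'' :=
  ⟨fun r h1 h2 => (h'.row r h1 h2).trans (h.row r h1 h2), fun r a => (h.le r a).trans (h'.le r a)⟩

lemma Moves.bump {q : ℕ} (hq : q = m ∨ q = m + 1) (t : Arr) (a : ℕ) :
    Moves s m t (bump t s q a) where
  row r h1 h2 := bump_row_ne t s a (by omega)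
  le r b := by
    simp only [UhaInfinity.bump]
    split_ifs
    · nlinarith [mul_self_nonneg s]
    · exact le_rfl

lemma InterlacesOff.of_moves {t' t'' : Arr} (hs : s = 1 ∨ s = -1) (h : InterlacesOff m t)
    (h'' : InterlacesOff m t'') (h1 : Moves s m t t') (h2 : Moves s m t' t'') :
    InterlacesOff m t' := by
  refine h.of_between h'' (fun r hr hr' => ⟨h1.row r hr hr', (h2.row r hr hr').symm⟩) ?_
  rcases hs with rfl | rfl
  · left; intro r a
    have := h1.le r a; have := h2.le r a; omega
  · right; intro r a
    have := h1.le r a; have := h2.le r a; omega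

lemma Governs.row_p (h : Governs s m p r r') : p = m ∨ p = m + 1 := by
  rcases h with h | h <;> omega

lemma Governs.row_r (h : Governs s m p r r') : r = m ∨ r = m + 1 := by
  rcases h with h | h <;> omega

lemma Governs.ne (h : Governs s m p r r') : p ≠ r := by
  rcases h with h | h <;> omega

lemma Governs.ne' (h : Governs s m p r r') : p ≠ r' := by
  rcases h with h | h <;> omega

lemma Governs.ne'' (h : Governs s m p r r') : r ≠ r' := by
  rcases h with h | h <;> omega

variable {μ : ℤ → ℤ}

-- If an intermediate array does not interlace, then one of the plain coefficients vanishes as well.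
-- The truncated coefficients may therefore be replaced by plain ones, which are rational
-- expressions and can be computed with.
open Classical in
lemma hat_mul_hat {t₀ t₁ t₂ : Arr} {k₁ k₂ : ℂ⟦X⟧} (h₀ : IsGT μ t₀) (h₂ : IsGT μ t₂)
    (h : k₁ ≠ 0 → k₂ ≠ 0 → IsGT μ t₁) :
    (if IsGT μ t₀ ∧ IsGT μ t₁ then k₁ else 0) * (if IsGT μ t₁ ∧ IsGT μ t₂ then k₂ else 0) =
      k₁ * k₂ := by
  by_cases h1 : k₁ = 0
  · simp [h1]
  by_cases h2 : k₂ = 0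
  · simp [h2]
  simp [h₀, h₂, h h1 h2]

open Classical in
lemma hat_mul_hat_mul_hat {t₀ t₁ t₂ t₃ : Arr} {k₁ k₂ k₃ : ℂ⟦X⟧} (h₀ : IsGT μ t₀) (h₃ : IsGT μ t₃)
    (h : k₁ ≠ 0 → k₂ ≠ 0 → k₃ ≠ 0 → IsGT μ t₁ ∧ IsGT μ t₂) :
    (if IsGT μ t₀ ∧ IsGT μ t₁ then k₁ else 0) * (if IsGT μ t₁ ∧ IsGT μ t₂ then k₂ else 0) *
      (if IsGT μ t₂ ∧ IsGT μ t₃ then k₃ else 0) = k₁ * k₂ * k₃ := by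
  by_cases h1 : k₁ = 0
  · simp [h1]
  by_cases h2 : k₂ = 0
  · simp [h2]
  by_cases h3 : k₃ = 0
  · simp [h3]
  simp [h₀, h₃, h h1 h2 h3]

/-- A step of a path: an entry of one of the two rows is moved. -/
structure Step (s : ℤ) (m : ℕ) (t t' : Arr) (k : ℂ⟦X⟧) : Prop where
  moves : Moves s m t t'
  frame : ∀ μ, IsFrame μ t → IsFrame μ t'
  upper : k ≠ 0 → Upper t m → Upper t' m
  lower : k ≠ 0 → Lower t' m → Lower t m

lemma Governs.step (h : Governs s m p r r') (hj : j < p) (t : Arr) :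
    Step s m t (bump t s p j) (cg p r t j) :=
  ⟨Moves.bump h.row_p t j, fun _ hf => hf.bump s hj, fun hc hU => h.upper_bump hj hU hc,
    fun hc hL => h.lower_of_bump hj hL hc⟩

lemma Governs.step' (h : Governs s m p r r') (hl : l < r) (t : Arr) (k : ℂ⟦X⟧) :
    Step s m t (bump t s r l) k :=
  ⟨Moves.bump h.row_r t l, fun _ hf => hf.bump s hl, fun _ hU => h.upper_bump' hU,
    fun _ hL => h.lower_of_bump' hL⟩

/-- Away from the two rows, the middle array lies entrywise between two interlacing ones. Between
the two rows, the upper inequalities come from the start and the lower ones from the end. -/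
lemma Step.isGT_mid (hs : s = 1 ∨ s = -1) {t₀ t₁ t₂ : Arr} {k₁ k₂ : ℂ⟦X⟧}
    (s₁ : Step s m t₀ t₁ k₁) (s₂ : Step s m t₁ t₂ k₂) (h₀ : IsGT μ t₀) (h₂ : IsGT μ t₂)
    (hk₁ : k₁ ≠ 0) (hk₂ : k₂ ≠ 0) : IsGT μ t₁ :=
  IsGT.of_interlacesOff (s₁.frame μ h₀.toIsFrame)
    ((h₀.interlacesOff m).of_moves hs (h₂.interlacesOff m) s₁.moves s₂.moves)
    (s₁.upper hk₁ (h₀.upper m)) (s₂.lower hk₂ (h₂.lower m))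

lemma Step.isGT_mid₂ (hs : s = 1 ∨ s = -1) {t₀ t₁ t₂ t₃ : Arr} {k₁ k₂ k₃ : ℂ⟦X⟧}
    (s₁ : Step s m t₀ t₁ k₁) (s₂ : Step s m t₁ t₂ k₂) (s₃ : Step s m t₂ t₃ k₃)
    (h₀ : IsGT μ t₀) (h₃ : IsGT μ t₃)
    (hk₁ : k₁ ≠ 0) (hk₂ : k₂ ≠ 0) (hk₃ : k₃ ≠ 0) : IsGT μ t₁ ∧ IsGT μ t₂ := by
  have f₁ := s₁.frame μ h₀.toIsFrame
  have u₁ := s₁.upper hk₁ (h₀.upper m)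
  have l₂ := s₃.lower hk₃ (h₃.lower m)
  exact ⟨IsGT.of_interlacesOff f₁ ((h₀.interlacesOff m).of_moves hs (h₃.interlacesOff m) s₁.moves
      (s₂.moves.trans s₃.moves)) u₁ (s₂.lower hk₂ l₂),
    IsGT.of_interlacesOff (s₂.frame μ f₁) ((h₀.interlacesOff m).of_moves hs (h₃.interlacesOff m)
      (s₁.moves.trans s₂.moves) s₃.moves) (s₂.upper hk₂ u₁) l₂⟩

/-- The Serre relation, the governed row occurring twice. -/
lemma Governs.serre (h : Governs s m p r r') :
    Serre (qnum 2) (shiftOp μ s p (cg p r)) (shiftOp μ s r (cg r r')) := by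
  have hs := h.sign
  refine serre_shiftOp (F := fun t j j' l => cg r r' t l *
    (cg p r (bump t s r l) j * cg p r (bump (bump t s r l) s p j) j' -
      qnum 2 * (cg p r t j * cg p r (bump (bump t s r l) s p j) j') +
      cg p r t j * cg p r (bump t s p j) j')) ?_ ?_
  · intro t ht j hj j' hj' l hl hT
    have hT1 : IsGT μ (bump (bump (bump t s r l) s p j) s p j') := by
      rwa [bump_comm t s s r l, bump_comm _ s s r l]
    have hT2 : IsGT μ (bump (bump (bump t s p j) s r l) s p j') := by rwa [bump_comm _ s s r l]
    have e1 : cg r r' (bump t s p j) l = cg r r' t l := cg_bump_row_ne s h.ne h.ne' l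
    have e2 : cg r r' (bump (bump t s p j) s p j') l = cg r r' t l := by
      rw [cg_bump_row_ne s h.ne h.ne' l, e1]
    simp only [hat]
    rw [hat_mul_hat_mul_hat ht hT1 fun a b c => Step.isGT_mid₂ hs (h.step' hl t _)
        (h.step hj _) (h.step hj' _) ht hT1 a b c,
      hat_mul_hat_mul_hat ht hT2 fun a b c => Step.isGT_mid₂ hs (h.step hj _) (h.step' hl _ _)
        (h.step hj' _) ht hT2 a b c,
      hat_mul_hat_mul_hat ht hT fun a b c => Step.isGT_mid₂ hs (h.step hj _) (h.step hj' _)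
        (h.step' hl _ _) ht hT a b c, e1, e2, bump_comm t s s p j r l]
    ring
  · intro t ht j hj j' hj' l hl hT
    have ho := ht.interlacesOff m
    have hoT := hT.interlacesOff m
    rw [← mul_add]
    convert mul_zero _
    have hne := h.ne
    -- If the same entry is moved twice, the three-term recurrence of q-numbers gives zero.
    -- Otherwise the expression has a closed form that is antisymmetric in the two entries.
    by_cases hjj : j = j'
    · subst hjj
      have c1 : cg p r t j = _ := cg_split_left (t := t) (j := j) hl (fun _ _ => rfl) fun _ _ => rfl
      have c2 : cg p r (bump t s r l) j = _ := cg_split_left (t := t) (j := j) hl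
        (fun k hk => lv_bump_ne t s r hk) (fun k hk => by rw [lv_bump_row_ne t s l hne])
      have c3 : cg p r (bump t s p j) j = _ := cg_split_left (t := t) (j := j) hl
        (fun k hk => by rw [lv_bump_row_ne t s j hne.symm]) (fun k hk => lv_bump_ne t s p hk)
      have c4 : cg p r (bump (bump t s r l) s p j) j = _ := cg_split_left (t := t) (j := j) hl
        (fun k hk => by rw [lv_bump_row_ne _ s j hne.symm, lv_bump_ne t s r hk])
        (fun k hk => by rw [lv_bump_ne _ s p hk, lv_bump_row_ne t s l hne])
      rw [c1, c2, c3, c4]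
      simp only [lv_bump_self, lv_bump_row_ne _ s _ hne, lv_bump_row_ne _ s _ hne.symm]
      have e := qnum_string hs (lv t r l - lv t p j)
      rw [show lv t r l + s - lv t p j = lv t r l - lv t p j + s by ring,
        show lv t r l + s - (lv t p j + s) = lv t r l - lv t p j by ring,
        show lv t r l - (lv t p j + s) = lv t r l - lv t p j - s by ring]
      generalize xg _ _ _ _ (lv t p j) = x
      generalize xg _ _ _ _ (lv t p j + s) = y
      linear_combination (2 * x * y * qnum (lv t r l - lv t p j)) * e
    · have d1 : lv t p j + s ≠ lv t p j' := by
        have := (ho.of_moves hs hoT (Moves.bump h.row_p t j) ((Moves.bump h.row_p _ j').trans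
          (Moves.bump h.row_r _ l))).lv_ne h.row_p hj hj' hjj
        rwa [lv_bump_self, lv_bump_ne t s p (Ne.symm hjj)] at this
      have d2 : lv t p j' + s ≠ lv t p j := by
        have hT' := hoT
        rw [bump_comm t] at hT'
        have := (ho.of_moves hs hT' (Moves.bump h.row_p t j') ((Moves.bump h.row_p _ j).trans
          (Moves.bump h.row_r _ l))).lv_ne h.row_p hj' hj (Ne.symm hjj)
        rwa [lv_bump_self, lv_bump_ne t s p hjj] at this
      -- `qnum_serre` produces exactly the q-number in the denominator of the second move. What
      -- remains, apart from symmetric factors, is `s / [l_j' - l_j]`, which changes sign when `j`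
      -- and `j'` are exchanged.
      have key : ∀ j j' : ℕ, j < p → j' < p → j ≠ j' → lv t p j + s ≠ lv t p j' →
          cg p r (bump t s r l) j * cg p r (bump (bump t s r l) s p j) j' -
            qnum 2 * (cg p r t j * cg p r (bump (bump t s r l) s p j) j') +
            cg p r t j * cg p r (bump t s p j) j' =
          s * (qnum (lv t p j' - lv t p j))⁻¹ *
          xg ((Finset.range r).erase l) (lv t r) (((Finset.range p).erase j).erase j') (lv t p)
            (lv t p j) *
          xg ((Finset.range r).erase l) (lv t r) (((Finset.range p).erase j').erase j) (lv t p)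
            (lv t p j') := by
        intro j j' hj hj' hjj hd
        have c1 : cg p r t j = _ := cg_split_left_right (t := t) hl hj' (Ne.symm hjj)
          (fun _ _ => rfl) fun _ _ _ => rfl
        have c2 : cg p r (bump t s r l) j = _ := cg_split_left_right (t := t) hl hj' (Ne.symm hjj)
          (fun k hk => lv_bump_ne t s r hk) (fun k _ _ => by rw [lv_bump_row_ne t s l hne])
        have c3 : cg p r (bump t s p j) j' = _ := cg_split_left_right (t := t) hl hj hjj
          (fun k hk => by rw [lv_bump_row_ne t s j hne.symm])
          (fun k _ hk => lv_bump_ne t s p hk)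
        have c4 : cg p r (bump (bump t s r l) s p j) j' = _ :=
          cg_split_left_right (t := t) hl hj hjj
          (fun k hk => by rw [lv_bump_row_ne _ s j hne.symm, lv_bump_ne t s r hk])
          (fun k _ hk => by rw [lv_bump_ne _ s p hk, lv_bump_row_ne t s l hne])
        rw [c1, c2, c3, c4]
        simp only [lv_bump_self, lv_bump_row_ne _ s _ hne, lv_bump_row_ne _ s _ hne.symm,
          lv_bump_ne _ s p (Ne.symm hjj)]
        have e := qnum_serre hs (lv t r l - lv t p j) (lv t r l - lv t p j')
        rw [show lv t r l - lv t p j' - (lv t r l - lv t p j) + s =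
            lv t p j + s - lv t p j' by ring] at e
        rw [show lv t r l + s - lv t p j = lv t r l - lv t p j + s by ring,
          show lv t r l + s - lv t p j' = lv t r l - lv t p j' + s by ring]
        have f := qnum_mul_inv (sub_ne_zero.2 hd)
        generalize xg _ _ _ _ (lv t p j) = x
        generalize xg _ _ _ _ (lv t p j') = y
        linear_combination (x * y * (qnum (lv t p j' - lv t p j))⁻¹ *
          (qnum (lv t p j + s - lv t p j'))⁻¹) * e +
          (s * x * y * (qnum (lv t p j' - lv t p j))⁻¹) * f
      rw [key j j' hj hj' hjj d1, bump_comm t s s p j p j'] at *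
      rw [key j' j hj' hj (Ne.symm hjj) d2, qnum_sub_inv (lv t p j) (lv t p j')]
      ring

/-- The Serre relation, the governing row occurring twice. -/
lemma Governs.serre' (h : Governs s m p r r') :
    Serre (qnum 2) (shiftOp μ s r (cg r r')) (shiftOp μ s p (cg p r)) := by
  have hs := h.sign
  refine serre_shiftOp (F := fun t l l' j => cg r r' t l * cg r r' (bump t s r l) l' *
    (cg p r t j - qnum 2 * cg p r (bump t s r l) j + cg p r (bump (bump t s r l) s r l') j)) ?_ ?_
  · intro t ht l hl l' hl' j hj hT
    have hT1 : IsGT μ (bump (bump (bump t s p j) s r l) s r l') := by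
      rwa [bump_comm t s s p j, bump_comm _ s s p j]
    have hT2 : IsGT μ (bump (bump (bump t s r l) s p j) s r l') := by rwa [bump_comm _ s s p j]
    have e1 : cg r r' (bump t s p j) l = cg r r' t l := cg_bump_row_ne s h.ne h.ne' l
    have e2 : cg r r' (bump (bump t s p j) s r l) l' = cg r r' (bump t s r l) l' := by
      rw [bump_comm t, cg_bump_row_ne s h.ne h.ne' l']
    have e3 : cg r r' (bump (bump t s r l) s p j) l' = cg r r' (bump t s r l) l' := by
      rw [cg_bump_row_ne s h.ne h.ne' l']
    simp only [hat]
    rw [hat_mul_hat_mul_hat ht hT1 fun a b c => Step.isGT_mid₂ hs (h.step hj t)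
        (h.step' hl _ _) (h.step' hl' _ _) ht hT1 a b c,
      hat_mul_hat_mul_hat ht hT2 fun a b c => Step.isGT_mid₂ hs (h.step' hl _ _) (h.step hj _)
        (h.step' hl' _ _) ht hT2 a b c,
      hat_mul_hat_mul_hat ht hT fun a b c => Step.isGT_mid₂ hs (h.step' hl _ _) (h.step' hl' _ _)
        (h.step hj _) ht hT a b c, e1, e2, e3]
    ring
  · intro t ht l hl l' hl' j hj hT
    have ho := ht.interlacesOff m
    have hoT := hT.interlacesOff m
    have hne := h.ne
    have hne' := h.ne''
    by_cases hll : l = l'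
    · subst hll
      rw [← mul_add]
      convert mul_zero _
      have c1 : cg p r t j = _ := cg_split_left (t := t) (j := j) hl (fun _ _ => rfl) fun _ _ => rfl
      have c2 : cg p r (bump t s r l) j = _ := cg_split_left (t := t) (j := j) hl
        (fun k hk => lv_bump_ne t s r hk) (fun k hk => by rw [lv_bump_row_ne t s l hne])
      have c3 : cg p r (bump (bump t s r l) s r l) j = _ := cg_split_left (t := t) (j := j) hl
        (fun k hk => by rw [lv_bump_ne _ s r hk, lv_bump_ne t s r hk])
        (fun k hk => by rw [lv_bump_row_ne _ s l hne, lv_bump_row_ne t s l hne])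
      rw [c1, c2, c3]
      simp only [lv_bump_self, lv_bump_row_ne _ s _ hne]
      have e := qnum_string hs (lv t r l + s - lv t p j)
      rw [show lv t r l + s - lv t p j - s = lv t r l - lv t p j by ring,
        show lv t r l + s - lv t p j + s = lv t r l + s + s - lv t p j by ring] at e
      generalize xg _ _ _ _ (lv t p j) = x
      linear_combination (2 * x) * e
    · have d1 : lv t r l + s ≠ lv t r l' := by
        have := (ho.of_moves hs hoT (Moves.bump h.row_r t l) ((Moves.bump h.row_r _ l').trans
          (Moves.bump h.row_p _ j))).lv_ne h.row_r hl hl' hll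
        rwa [lv_bump_self, lv_bump_ne t s r (Ne.symm hll)] at this
      have d2 : lv t r l' + s ≠ lv t r l := by
        have hT' := hoT
        rw [bump_comm t] at hT'
        have := (ho.of_moves hs hT' (Moves.bump h.row_r t l') ((Moves.bump h.row_r _ l).trans
          (Moves.bump h.row_p _ j))).lv_ne h.row_r hl' hl (Ne.symm hll)
        rwa [lv_bump_self, lv_bump_ne t s r hll] at this
      -- Here the two moves of row `r` provide the denominators and the move of row `p` the
      -- three-term sum. The closed form is again antisymmetric in `l` and `l'`.
      have key : ∀ l l' : ℕ, l < r → l' < r → l ≠ l' → lv t r l + s ≠ lv t r l' →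
          cg r r' t l * cg r r' (bump t s r l) l' *
          (cg p r t j - qnum 2 * cg p r (bump t s r l) j +
            cg p r (bump (bump t s r l) s r l') j) =
          s * (qnum (lv t r l' - lv t r l))⁻¹ *
          xg (Finset.range r') (lv t r') (((Finset.range r).erase l).erase l') (lv t r)
            (lv t r l) *
          xg (Finset.range r') (lv t r') (((Finset.range r).erase l').erase l) (lv t r)
            (lv t r l') *
          xg (((Finset.range r).erase l).erase l') (lv t r) ((Finset.range p).erase j) (lv t p)
            (lv t p j) := by
        intro l l' hl hl' hll hd
        have c1 : cg p r t j = _ := cg_split_left_left (t := t) hl hl' (Ne.symm hll)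
          (fun _ _ _ => rfl) rfl
        have c2 : cg p r (bump t s r l) j = _ := cg_split_left_left (t := t) hl hl' (Ne.symm hll)
          (fun k hk _ => lv_bump_ne t s r hk) (lv_bump_row_ne t s l hne)
        have c3 : cg p r (bump (bump t s r l) s r l') j = _ :=
          cg_split_left_left (t := t) hl hl' (Ne.symm hll)
          (fun k hk hk' => by rw [lv_bump_ne _ s r hk', lv_bump_ne t s r hk])
          (by rw [lv_bump_row_ne _ s l' hne, lv_bump_row_ne t s l hne])
        have c4 : cg r r' t l = _ := cg_split_right (t := t) hl' (Ne.symm hll) rfl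
          fun _ _ _ => rfl
        have c5 : cg r r' (bump t s r l) l' = _ := cg_split_right (t := t) hl hll
          (lv_bump_row_ne t s l hne'.symm) fun k _ hk => lv_bump_ne t s r hk
        rw [c1, c2, c3, c4, c5]
        simp only [lv_bump_self, lv_bump_ne _ s r (Ne.symm hll), lv_bump_ne _ s r hll]
        have e := qnum_serre hs (lv t r l' - lv t p j) (lv t r l - lv t p j)
        -- In this sum the shifts occur in the reverse order, so the identity is used at negated
        -- arguments shifted by `s`.
        have e' := qnum_serre hs (-(lv t r l - lv t p j) - s) (-(lv t r l' - lv t p j) - s)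
        rw [show -(lv t r l - lv t p j) - s + s = -(lv t r l - lv t p j) by ring,
          show -(lv t r l' - lv t p j) - s + s = -(lv t r l' - lv t p j) by ring,
          show -(lv t r l - lv t p j) - s = -(lv t r l + s - lv t p j) by ring,
          show -(lv t r l' - lv t p j) - s = -(lv t r l' + s - lv t p j) by ring,
          show -(lv t r l' + s - lv t p j) - -(lv t r l + s - lv t p j) + s =
            lv t r l + s - lv t r l' by ring] at e'
        simp only [qnum_neg] at e'
        have f := qnum_mul_inv (sub_ne_zero.2 hd)
        generalize xg _ _ _ _ (lv t p j) = x
        generalize xg _ _ _ _ (lv t r l) = y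
        generalize xg _ _ _ _ (lv t r l') = z
        linear_combination (x * y * z * (qnum (lv t r l' - lv t r l))⁻¹ *
          (qnum (lv t r l + s - lv t r l'))⁻¹) * e' +
          (s * x * y * z * (qnum (lv t r l' - lv t r l))⁻¹) * f
      rw [key l l' hl hl' hll d1, key l' l hl' hl (Ne.symm hll) d2,
        qnum_sub_inv (lv t r l) (lv t r l'), Finset.erase_right_comm (a := l') (b := l)]
      ring

end Neighbours

/-! ### Diagonal operators -/

section Diagonal

variable {μ : ℤ → ℤ}

instance opRing (μ : ℤ → ℤ) : Ring (Module.End ℂ⟦X⟧ (Mod μ)) := inferInstance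

/-- The operator with `kz t ↦ f t • kz t`. -/
def diag (μ : ℤ → ℤ) (f : Arr → ℂ⟦X⟧) : Module.End ℂ⟦X⟧ (Mod μ) :=
  Finsupp.linearCombination ℂ⟦X⟧ fun g : GT μ => f g.1 • kz μ g.1

lemma diag_kz (f : Arr → ℂ⟦X⟧) (t : Arr) : diag μ f (kz μ t) = f t • kz μ t := by
  by_cases h : IsGT μ t
  · rw [show t = (⟨t, h⟩ : GT μ).1 from rfl]
    nth_rewrite 1 [kz_of]
    rw [diag, Finsupp.linearCombination_single, one_smul]
  · rw [kz_eq_zero h, map_zero, smul_zero]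

lemma diag_mul (f g : Arr → ℂ⟦X⟧) : diag μ f * diag μ g = diag μ fun t => f t * g t := by
  refine Mod.hom_ext fun t _ => ?_
  rw [Module.End.mul_apply, diag_kz, map_smul, diag_kz, diag_kz, smul_smul, mul_comm]

lemma diag_add (f g : Arr → ℂ⟦X⟧) : diag μ f + diag μ g = diag μ fun t => f t + g t := by
  refine Mod.hom_ext fun t _ => ?_
  rw [LinearMap.add_apply, diag_kz, diag_kz, diag_kz, add_smul]

lemma diag_neg (f : Arr → ℂ⟦X⟧) : -diag μ f = diag μ fun t => -f t := by
  refine Mod.hom_ext fun t _ => ?_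
  rw [LinearMap.neg_apply, diag_kz, diag_kz, neg_smul]

lemma diag_one : diag μ (fun _ => 1) = 1 := by
  refine Mod.hom_ext fun t _ => ?_
  rw [diag_kz, one_smul, Module.End.one_apply]

lemma diag_congr {f g : Arr → ℂ⟦X⟧} (h : ∀ t, IsGT μ t → f t = g t) : diag μ f = diag μ g := by
  refine Mod.hom_ext fun t ht => ?_
  rw [diag_kz, diag_kz, h t ht]

lemma commute_diag (f g : Arr → ℂ⟦X⟧) : Commute (diag μ f) (diag μ g) := by
  rw [Commute, SemiconjBy, diag_mul, diag_mul]
  exact diag_congr fun t _ => mul_comm _ _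

/-- Admitting different functions `f` and `f'` on the two sides covers commutators, q-commutators
and rescalings at once. -/
lemma diag_shiftOp_sub {s : ℤ} {p : ℕ} {c : Arr → ℕ → ℂ⟦X⟧} {f f' g : Arr → ℂ⟦X⟧}
    (h : ∀ t, ∀ j < p, f (bump t s p j) - f' t = g t) :
    diag μ f * shiftOp μ s p c - shiftOp μ s p c * diag μ f' = shiftOp μ s p c * diag μ g := by
  refine Mod.hom_ext fun t _ => ?_
  simp only [LinearMap.sub_apply, Module.End.mul_apply, diag_kz, map_smul, shiftOp_kz, map_sum,
    Finset.smul_sum]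
  rw [← Finset.sum_sub_distrib]
  refine Finset.sum_congr rfl fun j hj => ?_
  rw [← h t j (Finset.mem_range.1 hj), sub_smul, smul_comm]

lemma diag_smul (z : ℂ⟦X⟧) (f : Arr → ℂ⟦X⟧) : z • diag μ f = diag μ fun t => z * f t := by
  refine Mod.hom_ext fun t _ => ?_
  rw [LinearMap.smul_apply, diag_kz, diag_kz, smul_smul]

/-- A weight function that is shifted by a move scales the operator. -/
lemma diag_mul_shiftOp {s : ℤ} {p : ℕ} {c : Arr → ℕ → ℂ⟦X⟧} {f : Arr → ℂ⟦X⟧} {z : ℂ⟦X⟧}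
    (h : ∀ t, ∀ j < p, f (bump t s p j) = z * f t) :
    diag μ f * shiftOp μ s p c = z • (shiftOp μ s p c * diag μ f) := by
  have := diag_shiftOp_sub (μ := μ) (c := c) (f := f) (f' := fun t => z * f t) (g := fun _ => 0)
    (s := s) (p := p) fun t j hj => by rw [h t j hj, sub_self]
  rw [show diag μ (fun _ => 0) = 0 from Mod.hom_ext fun t _ => by simp [diag_kz], mul_zero] at this
  rw [sub_eq_zero] at this
  rw [this, ← diag_smul, mul_smul_comm]

lemma commute_diag_shiftOp {s : ℤ} {p : ℕ} {c : Arr → ℕ → ℂ⟦X⟧} {f : Arr → ℂ⟦X⟧}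
    (h : ∀ t, ∀ j < p, f (bump t s p j) = f t) : Commute (diag μ f) (shiftOp μ s p c) := by
  have := diag_mul_shiftOp (μ := μ) (s := s) (p := p) (c := c) (f := f) (z := 1)
    fun t j hj => by rw [one_mul, h t j hj]
  rw [one_smul] at this
  exact this

end Diagonal

/-! ### The relations between the Gelfand–Zetlin operators -/

section Relations

open Finset

variable {μ : ℤ → ℤ} {t : Arr}

/-- Raise an entry of the row `p`. -/
def xop (μ : ℤ → ℤ) (p : ℕ) : Module.End ℂ⟦X⟧ (Mod μ) := shiftOp μ 1 p (cg p (p + 1))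

/-- Lower an entry of the row `p`. -/
def yop (μ : ℤ → ℤ) (p : ℕ) : Module.End ℂ⟦X⟧ (Mod μ) := -shiftOp μ (-1) p (cg p (p - 1))

/-- The sum of the row `p`. -/
def rs (t : Arr) (p : ℕ) : ℤ := ∑ k ∈ range p, t p k

lemma rs_bump_self (t : Arr) (s : ℤ) {p j : ℕ} (hj : j < p) : rs (bump t s p j) p = rs t p + s := by
  rw [rs, rs, ← add_sum_erase _ _ (mem_range.2 hj), ← add_sum_erase _ _ (mem_range.2 hj)]
  have : ∑ k ∈ (range p).erase j, bump t s p j p k = ∑ k ∈ (range p).erase j, t p k :=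
    sum_congr rfl fun k hk => by simp [bump, ne_of_mem_erase hk]
  rw [this]
  simp [bump]; ring

lemma rs_bump_ne (t : Arr) (s : ℤ) {p r : ℕ} (j : ℕ) (h : r ≠ p) : rs (bump t s p j) r = rs t r := by
  rw [rs, rs, bump_row_ne t s j h]

/-- The weight of the row `p`. -/
def hw (t : Arr) (p : ℕ) : ℤ := 2 * rs t p - rs t (p - 1) - rs t (p + 1)

lemma hw_bump_self (t : Arr) (s : ℤ) {p j : ℕ} (hj : j < p) : hw (bump t s p j) p = hw t p + 2 * s := by
  rw [hw, hw, rs_bump_self t s hj, rs_bump_ne t s j (by omega), rs_bump_ne t s j (by omega)]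
  ring

lemma hw_bump_succ (t : Arr) (s : ℤ) {p j : ℕ} (hj : j < p + 1) :
    hw (bump t s (p + 1) j) p = hw t p - s := by
  rw [hw, hw, rs_bump_self t s hj, rs_bump_ne t s j (by omega), rs_bump_ne t s j (by omega)]
  ring

lemma hw_bump_pred (t : Arr) (s : ℤ) {p j : ℕ} (hj : j < p) :
    hw (bump t s p j) (p + 1) = hw t (p + 1) - s := by
  rw [hw, hw, add_tsub_cancel_right, rs_bump_self t s hj, rs_bump_ne t s j (by omega),
    rs_bump_ne t s j (by omega)]
  ring

lemma serre_neg {R A : Type*} [CommRing R] [Ring A] [Algebra R A] {c : R} {a b : A}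
    (h : Serre c a b) : Serre c (-a) (-b) := by
  have := (h.smul_left (-1)).smul_right (-1)
  rwa [neg_one_smul, neg_one_smul] at this

lemma serre_xop (m : ℕ) : Serre (qnum 2) (xop μ m) (xop μ (m + 1)) :=
  Governs.serre (m := m) (r' := m + 2) (Or.inl ⟨rfl, rfl, rfl, rfl⟩)

lemma serre_xop' (m : ℕ) : Serre (qnum 2) (xop μ (m + 1)) (xop μ m) :=
  Governs.serre' (m := m) (r' := m + 2) (Or.inl ⟨rfl, rfl, rfl, rfl⟩)

lemma serre_yop (m : ℕ) : Serre (qnum 2) (yop μ (m + 2)) (yop μ (m + 1)) :=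
  serre_neg (Governs.serre (m := m + 1) (r' := m) (Or.inr ⟨rfl, rfl, rfl, rfl⟩))

lemma serre_yop' (m : ℕ) : Serre (qnum 2) (yop μ (m + 1)) (yop μ (m + 2)) :=
  serre_neg (Governs.serre' (m := m + 1) (r' := m) (Or.inr ⟨rfl, rfl, rfl, rfl⟩))

/-- Operators in distant rows commute if the coefficients do not interfere. -/
lemma commute_shiftOp_of_far {s s' : ℤ} {p p' r r' : ℕ} (hne : p ≠ p') (h1 : p + 1 ≠ p')
    (h2 : p' + 1 ≠ p) (h3 : p ≠ r') (h4 : p' ≠ r) :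
    Commute (shiftOp μ s p (cg p r)) (shiftOp μ s' p' (cg p' r')) := by
  refine commute_shiftOp fun t ht j hj l hl hT => ?_
  have m1 : IsGT μ (bump t s p j) := ht.bump_of_far hj hne h1 h2 hT
  have hT' := hT
  rw [bump_comm] at hT'
  have m2 : IsGT μ (bump t s' p' l) := ht.bump_of_far hl hne.symm h2 h1 hT'
  rw [hat_of ht m2, hat_of m2 hT', hat_of ht m1, hat_of m1 hT, cg_bump_row_ne s' hne.symm h4,
    cg_bump_row_ne s hne h3, mul_comm]

lemma commute_xop {p p' : ℕ} (h : p + 2 ≤ p') : Commute (xop μ p) (xop μ p') :=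
  commute_shiftOp_of_far (by omega) (by omega) (by omega) (by omega) (by omega)

lemma commute_yop {p p' : ℕ} (h : p + 2 ≤ p') : Commute (yop μ p) (yop μ p') :=
  Commute.neg_left (Commute.neg_right (commute_shiftOp_of_far (r := p - 1) (r' := p' - 1)
    (by omega) (by omega) (by omega) (by omega) (by omega)))

/-- For moves in opposite directions the intermediate arrays interlace as soon as both ends do, so
only plain coefficients are compared. These interact for `p' = p + 1` only, where each coefficient
contains one q-number involving the entry moved by the other operator. The two shifts match after
reversing signs. -/
lemma commute_xop_yop {p p' : ℕ} (h : p ≠ p') : Commute (xop μ p) (yop μ p') := by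
  suffices H : Commute (xop μ p) (shiftOp μ (-1) p' (cg p' (p' - 1))) from Commute.neg_right H
  refine commute_shiftOp fun t ht j hj l hl hT => ?_
  have m1 : IsGT μ (bump t 1 p j) := ht.bump_of_opposite (Or.inl rfl) hj (by tauto) hT
  have hT' := hT
  rw [bump_comm] at hT'
  have m2 : IsGT μ (bump t (-1) p' l) :=
    ht.bump_of_opposite (Or.inr rfl) hl (by tauto) (by rwa [neg_neg])
  rw [hat_of ht m2, hat_of m2 hT', hat_of ht m1, hat_of m1 hT]
  by_cases h1 : p' = p + 1
  · subst h1
    rw [add_tsub_cancel_right]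
    have c1 : cg p (p + 1) t j = _ :=
      cg_split_left (t := t) (j := j) hl (fun _ _ => rfl) fun _ _ => rfl
    have c2 : cg p (p + 1) (bump t (-1) (p + 1) l) j = _ := cg_split_left (t := t) (j := j) hl
      (fun k hk => lv_bump_ne t (-1) (p + 1) hk) (fun k hk => by rw [lv_bump_row_ne t _ l h])
    have c3 : cg (p + 1) p t l = _ :=
      cg_split_left (t := t) (j := l) hj (fun _ _ => rfl) fun _ _ => rfl
    have c4 : cg (p + 1) p (bump t 1 p j) l = _ := cg_split_left (t := t) (j := l) hj
      (fun k hk => lv_bump_ne t 1 p hk) (fun k hk => by rw [lv_bump_row_ne t _ j h.symm])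
    rw [c1, c2, c3, c4]
    simp only [lv_bump_self, lv_bump_row_ne _ _ _ h, lv_bump_row_ne _ _ _ h.symm]
    rw [show lv t p j - lv t (p + 1) l = -(lv t (p + 1) l - lv t p j) by ring,
      show lv t p j + 1 - lv t (p + 1) l = -(lv t (p + 1) l + -1 - lv t p j) by ring, qnum_neg,
      qnum_neg]
    ring
  · rw [cg_bump_row_ne _ h.symm h1, cg_bump_row_ne _ h (by omega), mul_comm]

lemma IsGT.bump_neg (h : IsGT μ t) {p j : ℕ} (hj : j < p)
    (h1 : ∀ r, r + 1 = p → j < r → t r j ≠ t p j) (h2 : t (p + 1) (j + 1) ≠ t p j) :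
    IsGT μ (bump t (-1) p j) where
  toIsFrame := h.toIsFrame.bump _ hj
  upper m a ha := by
    have := h.upper m a ha
    have := h1 m
    simp only [bump]
    split_ifs with c1 c2 c2 <;> try omega
    obtain ⟨rfl, rfl⟩ := c2
    have := h1 m rfl ha
    omega
  lower m a ha := by
    have := h.lower m a ha
    simp only [bump]
    split_ifs with c1 c2 c2 <;> try omega
    obtain ⟨rfl, rfl⟩ := c2
    omega

lemma IsGT.bump_one (h : IsGT μ t) {p j : ℕ} (hj : j < p)
    (h1 : ∀ r a, r + 1 = p → a + 1 = j → t r a ≠ t p j) (h2 : t (p + 1) j ≠ t p j) :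
    IsGT μ (bump t 1 p j) where
  toIsFrame := h.toIsFrame.bump _ hj
  upper m a ha := by
    have := h.upper m a ha
    simp only [bump]
    split_ifs with c1 c2 c2 <;> try omega
    obtain ⟨rfl, rfl⟩ := c1
    omega
  lower m a ha := by
    have := h.lower m a ha
    simp only [bump]
    split_ifs with c1 c2 c2 <;> try omega
    obtain ⟨rfl, rfl⟩ := c1
    have := h1 m a rfl rfl
    omega

/-- If lowering is blocked by the row below, the lowering coefficient vanishes; if it is blocked by
the row above, the coefficient of raising back vanishes. -/
lemma hat_mul_hat_down (ht : IsGT μ t) {p j : ℕ} (hj : j < p) :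
    hat μ (-1) p (cg p (p - 1)) t j * hat μ 1 p (cg p (p + 1)) (bump t (-1) p j) j =
      cg p (p - 1) t j * cg p (p + 1) (bump t (-1) p j) j := by
  refine hat_mul_hat ht (by rwa [bump_neg_bump]) fun h1 h2 => ht.bump_neg hj ?_ fun h => h2 ?_
  · rintro r rfl hr h
    exact h1 (cg_eq_zero (l := j) (by simpa using hr) (by simp [lv, h]))
  · refine cg_eq_zero (l := j + 1) (by omega) ?_
    rw [lv_bump_self, lv_bump_row_ne _ _ _ (by omega)]
    simp [lv, h]; ring

lemma hat_mul_hat_up (ht : IsGT μ t) {p j : ℕ} (hj : j < p) :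
    hat μ 1 p (cg p (p + 1)) t j * hat μ (-1) p (cg p (p - 1)) (bump t 1 p j) j =
      cg p (p + 1) t j * cg p (p - 1) (bump t 1 p j) j := by
  refine hat_mul_hat ht (by rwa [bump_bump_neg]) fun h1 h2 => ht.bump_one hj ?_ fun h => h1 ?_
  · rintro r a rfl rfl h
    refine h2 (cg_eq_zero (l := a) (by simp; omega) ?_)
    rw [lv_bump_self, add_tsub_cancel_right, lv_bump_row_ne _ _ _ (by omega)]
    simp [lv, h]; ring
  · exact cg_eq_zero (l := j) (by omega) (by simp [lv, h])

lemma cg_mul_cg (t : Arr) (p j r r' : ℕ) {s : ℤ} (hr : p ≠ r') :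
    cg p r t j * cg p r' (bump t s p j) j =
      (∏ k ∈ range r, qnum (lv t r k - lv t p j)) *
        (∏ k ∈ range r', qnum (lv t r' k - (lv t p j + s))) *
      (∏ k ∈ (range p).erase j, qnum (lv t p k - lv t p j) *
        qnum (lv t p k - (lv t p j + s)))⁻¹ := by
  have h1 : cg p r' (bump t s p j) j = xg (range r') (lv t r') ((range p).erase j) (lv t p)
      (lv t p j + s) := by
    rw [cg, lv_bump_self, lv_bump_row_ne t s j hr.symm]
    exact xg_congr (fun _ _ => rfl) (fun k hk => lv_bump_ne t s p (ne_of_mem_erase hk)) _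
  rw [h1, cg, xg, xg, prod_mul_distrib, PowerSeries.mul_inv_rev]
  ring

lemma sum_lv (t : Arr) (p : ℕ) : ∑ k ∈ range p, lv t p k = rs t p - ∑ k ∈ range p, (k : ℤ) := by
  rw [rs, ← sum_sub_distrib]
  rfl

lemma sum_cg_mul_cg (ht : IsGT μ t) {p : ℕ} (hp : 0 < p) :
    ∑ j ∈ range p, (cg p (p + 1) t j * cg p (p - 1) (bump t 1 p j) j -
      cg p (p - 1) t j * cg p (p + 1) (bump t (-1) p j) j) = qnum (hw t p) := by
  obtain ⟨n, rfl⟩ : ∃ n, p = n + 1 := ⟨p - 1, by omega⟩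
  rw [add_tsub_cancel_right]
  -- `sum_residues` wants two families of `n + 1` zeros, while the neighbouring rows have `n + 2`
  -- and `n` entries. The last entry of the row above joins the row below, whose entries are shifted
  -- by one because their factors are evaluated at `u + 1`.
  set b : ℕ → ℤ := fun k => if k < n then lv t n k - 1 else lv t (n + 2) (n + 1) with hb
  have hbn : b n = lv t (n + 2) (n + 1) := by simp [hb]
  have hbk : ∀ k ∈ range n, b k = lv t n k - 1 := fun k hk => by simp [hb, mem_range.1 hk]
  have h := sum_residues (n + 1) (lv t (n + 1)) (lv t (n + 2)) b
    (fun a ha a' ha' e => by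
      by_contra hne
      exact ht.lv_ne (mem_range.1 ha) (mem_range.1 ha') hne e) ?_
  · have hprod : ∀ u, ∏ k ∈ range (n + 1), qnum (lv t (n + 2) k - u) * qnum (b k - u) =
        (∏ k ∈ range (n + 2), qnum (lv t (n + 2) k - u)) *
          ∏ k ∈ range n, qnum (lv t n k - (u + 1)) := by
      intro u
      have e : ∏ k ∈ range n, qnum (b k - u) = ∏ k ∈ range n, qnum (lv t n k - (u + 1)) :=
        prod_congr rfl fun k hk => by
          rw [hbk k hk, show lv t n k - 1 - u = lv t n k - (u + 1) by ring]
      rw [prod_mul_distrib, prod_range_succ (fun k => qnum (b k - u)), hbn,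
        prod_range_succ _ (n + 1), e]
      ring
    have hsum : ∑ k ∈ range (n + 1), (2 * lv t (n + 1) k - 1 - lv t (n + 2) k - b k) =
        hw t (n + 1) := by
      have e1 := sum_lv t n
      have e2 := sum_lv t (n + 1)
      have e3 := sum_lv t (n + 2)
      rw [sum_range_succ _ (n + 1)] at e3
      rw [sum_range_succ (fun k : ℕ => (k : ℤ)) (n + 1)] at e3
      rw [sum_range_succ (fun k : ℕ => (k : ℤ)) n] at e2 e3
      have e4 : ∑ k ∈ range n, b k = ∑ k ∈ range n, lv t n k - n := by
        rw [sum_congr rfl hbk, sum_sub_distrib]; simp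
      simp only [sum_sub_distrib, ← mul_sum]
      rw [sum_range_succ b, e4, hbn, hw, add_tsub_cancel_right]
      simp only [sum_const, card_range, nsmul_eq_mul, mul_one]
      push_cast at *
      linarith
    rw [← hsum, ← h]
    refine sum_congr rfl fun j hj => ?_
    rw [cg_mul_cg t _ _ _ _ (by omega), cg_mul_cg t _ _ _ _ (by omega), hprod, hprod]
    have d1 : ∏ k ∈ (range (n + 1)).erase j, qnum (lv t (n + 1) k - lv t (n + 1) j) *
        qnum (lv t (n + 1) k - 1 - lv t (n + 1) j) =
        ∏ k ∈ (range (n + 1)).erase j, qnum (lv t (n + 1) k - lv t (n + 1) j) *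
        qnum (lv t (n + 1) k - (lv t (n + 1) j + 1)) :=
      prod_congr rfl fun k _ => by
        rw [show lv t (n + 1) k - 1 - lv t (n + 1) j = lv t (n + 1) k - (lv t (n + 1) j + 1) by ring]
    have d2 : ∏ k ∈ (range (n + 1)).erase j, qnum (lv t (n + 1) k - (lv t (n + 1) j - 1)) *
        qnum (lv t (n + 1) k - 1 - (lv t (n + 1) j - 1)) =
        ∏ k ∈ (range (n + 1)).erase j, qnum (lv t (n + 1) k - lv t (n + 1) j) *
        qnum (lv t (n + 1) k - (lv t (n + 1) j + -1)) :=
      prod_congr rfl fun k _ => by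
        rw [show lv t (n + 1) k - 1 - (lv t (n + 1) j - 1) = lv t (n + 1) k - lv t (n + 1) j by ring,
          ← sub_eq_add_neg, mul_comm]
    rw [d1, d2, sub_add_cancel, ← sub_eq_add_neg]
    ring
  -- Coinciding nodes belong to consecutive equal entries of the row. Interlacing squeezes the
  -- entries of both adjacent rows between them to the same value, which supplies the required
  -- zeros.
  · intro i hi k hk hik
    rw [mem_range] at hi hk
    have hki : i = k + 1 := by
      rcases lt_trichotomy i k with h1 | h1 | h1
      · have := ht.antitone h1.le hk; simp only [lv] at hik; omega
      · subst h1; simp only [lv] at hik; omega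
      · have := ht.antitone h1.le hi; simp only [lv] at hik; omega
    subst hki
    have h1 := ht.upper n k (by omega)
    have h2 := ht.lower n k (by omega)
    have h3 : t (n + 1) (k + 1) ≤ t (n + 2) (k + 1) := ht.upper (n + 1) (k + 1) (by omega)
    have h4 : t (n + 2) (k + 1) ≤ t (n + 1) k := ht.lower (n + 1) k (by omega)
    rw [hbk k (mem_range.2 (by omega))]
    simp only [lv] at hik ⊢
    push_cast at *
    constructor <;> omega

/-- Moves of two different entries of the row commute, since their denominators match. Moves of one
entry up and down return to the array, and their coefficients add up to the residue sum. -/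
lemma xop_comm_yop (p : ℕ) (hp : 0 < p) :
    xop μ p * yop μ p - yop μ p * xop μ p = diag μ fun t => qnum (hw t p) := by
  have e : xop μ p * yop μ p - yop μ p * xop μ p =
      shiftOp μ (-1) p (cg p (p - 1)) * shiftOp μ 1 p (cg p (p + 1)) -
      shiftOp μ 1 p (cg p (p + 1)) * shiftOp μ (-1) p (cg p (p - 1)) := by
    rw [xop, yop, mul_neg, neg_mul]
    abel
  rw [e]
  refine Mod.hom_ext fun t ht => ?_
  rw [LinearMap.sub_apply, shiftOp_mul_kz, shiftOp_mul_kz, diag_kz, sum_comm, ← sum_sub_distrib,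
    ← sum_cg_mul_cg ht hp, sum_smul]
  refine sum_congr rfl fun j hj => ?_
  rw [mem_range] at hj
  rw [← sum_sub_distrib, sum_eq_single_of_mem j (mem_range.2 hj)]
  · rw [bump_neg_bump, bump_bump_neg, hat_mul_hat_down ht hj, hat_mul_hat_up ht hj, sub_smul]
  · intro l hl hlj
    rw [mem_range] at hl
    rw [bump_comm t (-1)]
    by_cases hT : IsGT μ (bump (bump t 1 p j) (-1) p l)
    · have m1 : IsGT μ (bump t 1 p j) := ht.bump_of_opposite (Or.inl rfl) hj (by tauto) hT
      have hT' := hT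
      rw [bump_comm] at hT'
      have m2 : IsGT μ (bump t (-1) p l) :=
        ht.bump_of_opposite (Or.inr rfl) hl (by tauto) (by rwa [neg_neg])
      rw [hat_of ht m2, hat_of m2 hT', hat_of ht m1, hat_of m1 hT, ← sub_smul]
      convert zero_smul ℂ⟦X⟧ (kz μ _)
      have c1 : cg p (p + 1) t j = _ := cg_split_right (t := t) hl hlj rfl fun _ _ _ => rfl
      have c2 : cg p (p + 1) (bump t (-1) p l) j = _ := cg_split_right (t := t) hl hlj
        (lv_bump_row_ne t _ l (by omega)) fun k _ hk => lv_bump_ne t _ p hk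
      have c3 : cg p (p - 1) t l = _ := cg_split_right (t := t) hj hlj.symm rfl fun _ _ _ => rfl
      have c4 : cg p (p - 1) (bump t 1 p j) l = _ := cg_split_right (t := t) hj hlj.symm
        (lv_bump_row_ne t _ j (by omega)) fun k _ hk => lv_bump_ne t _ p hk
      rw [c1, c2, c3, c4]
      simp only [lv_bump_self, lv_bump_ne _ _ _ hlj, lv_bump_ne _ _ _ hlj.symm]
      rw [qnum_sub_inv (lv t p j + 1), qnum_sub_inv (lv t p l),
        show lv t p l - (lv t p j + 1) = lv t p l + -1 - lv t p j by ring]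
      ring
    · rw [kz_eq_zero hT, smul_zero, smul_zero, sub_zero]

end Relations

/-! ### Relations at the boundary of the pattern -/

section Boundary

variable {R A : Type*} [CommRing R] [Ring A] [Algebra R A] {q q' : R} {x y e f k κ : A}

lemma Commute.qComm_right {z a b : A} (ha : Commute z a) (hb : Commute z b) (r : R) :
    Commute z (qComm r a b) :=
  (ha.mul_right hb).sub_right ((hb.mul_right ha).smul_right r)

lemma qComm_scale {z a b : A} {r s : R} (ha : z * a = r • (a * z)) (hb : z * b = s • (b * z))
    (c : R) : z * qComm c a b = (r * s) • (qComm c a b * z) := by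
  have h1 : z * (a * b) = (r * s) • (a * b * z) := by
    rw [← mul_assoc, ha, smul_mul_assoc, mul_assoc, hb, mul_smul_comm, smul_smul, mul_assoc]
  have h2 : z * (b * a) = (r * s) • (b * a * z) := by
    rw [← mul_assoc, hb, smul_mul_assoc, mul_assoc, ha, mul_smul_comm, smul_smul, mul_assoc,
      mul_comm]
  rw [qComm, mul_sub, mul_smul_comm, h1, h2, sub_mul, smul_sub, smul_mul_assoc, smul_comm c]

/-- The factor `κ` turns the ordinary commutator of `e` and `y` into a q-commutator. In the
application `e` is `eop 1`, `y` is `yop 1` and `κ` a power of q in the entry of the first row; this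
is the purpose of `rop` in `eop 0` and `fop 0`. -/
lemma qComm_boundary (hq : q * q' = 1) (he : e * y - y * e = -(x * k))
    (hκe : κ * e = q' • (e * κ)) :
    e * (y * κ) - q • (y * κ * e) = -(x * k * κ) := by
  have h := congrArg (· * κ) he
  simp only [sub_mul, neg_mul] at h
  rw [mul_assoc y κ e, hκe, mul_smul_comm, smul_smul, hq, one_smul, ← h, mul_assoc, mul_assoc]

lemma serre_boundary (hq : q * q' = 1) (he : e * y - y * e = -(x * k))
    (hκe : κ * e = q' • (e * κ)) (hky : k * y = (q' * q') • (y * k)) (hκy : κ * y = q • (y * κ))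
    (hxy : Commute x y) (hκx : Commute κ x) (hκk : Commute κ k) :
    Serre (q + q') (y * κ) e := by
  refine serre_of_qComm_eq hq (qComm_boundary hq he hκe) ?_
  rw [neg_mul, mul_neg, smul_neg, neg_inj]
  calc x * k * κ * (y * κ) = x * k * (κ * y) * κ := by simp only [mul_assoc]
    _ = q • (x * (k * y) * κ * κ) := by
      rw [hκy, mul_smul_comm, smul_mul_assoc]; simp only [mul_assoc]
    _ = (q * (q' * q')) • ((x * y) * k * κ * κ) := by
      rw [hky, mul_smul_comm, smul_mul_assoc, smul_mul_assoc, smul_smul]; simp only [mul_assoc]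
    _ = q' • (y * (x * (k * κ)) * κ) := by
      rw [hxy.eq, ← mul_assoc q, hq, one_mul]; simp only [mul_assoc]
    _ = q' • (y * κ * (x * k * κ)) := by
      rw [← hκk.eq, ← mul_assoc x, ← hκx.eq]; simp only [mul_assoc]

lemma serre_boundary' (hq : q * q' = 1) (he : e * y - y * e = -(x * k))
    (hκe : κ * e = q' • (e * κ)) (hex : e * x = q' • (x * e)) (hke : k * e = q • (e * k)) :
    Serre (q + q') e (y * κ) := by
  refine serre_of_qComm_eq' hq (qComm_boundary hq he hκe) ?_
  rw [neg_mul, mul_neg, smul_neg, neg_inj]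
  have h : k * κ * e = e * (k * κ) := by
    rw [mul_assoc, hκe, mul_smul_comm, ← mul_assoc, hke, smul_mul_assoc, smul_smul, mul_comm q', hq,
      one_smul, mul_assoc]
  rw [mul_assoc x k κ, mul_assoc x (k * κ) e, h, ← mul_assoc, hex, smul_mul_assoc]
  simp only [mul_assoc]

lemma qComm_boundary_left (hq : q * q' = 1) (hf : f * x - x * f = q' • (y * k))
    (hκf : κ * f = q' • (f * κ)) :
    f * (κ * x) - q • (κ * x * f) = κ * y * k := by
  have h : f * κ = q • (κ * f) := by rw [hκf, smul_smul, hq, one_smul]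
  have h2 := congrArg (fun z => q • (κ * z)) hf
  simp only [mul_sub, smul_sub, mul_smul_comm, smul_smul, hq, one_smul] at h2
  rw [← mul_assoc, h, smul_mul_assoc, mul_assoc κ f x, mul_assoc κ x f, h2, mul_assoc]

lemma serre_boundary_left (hq : q * q' = 1) (hf : f * x - x * f = q' • (y * k))
    (hκf : κ * f = q' • (f * κ)) (hkx : k * x = (q' * q') • (x * k)) (hκx : κ * x = q • (x * κ))
    (hxy : Commute x y) (hκy : Commute κ y) (hκk : Commute κ k) :
    Serre (q + q') (κ * x) f := by
  refine serre_of_qComm_eq hq (qComm_boundary_left hq hf hκf) ?_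
  calc κ * y * k * (κ * x) = κ * y * (k * (κ * x)) := by simp only [mul_assoc]
    _ = q • (κ * y * (k * x) * κ) := by
      rw [hκx, mul_smul_comm, mul_smul_comm]; simp only [mul_assoc]
    _ = q' • (κ * (y * x) * k * κ) := by
      rw [hkx, mul_smul_comm, smul_mul_assoc, smul_smul, ← mul_assoc q, hq, one_mul]
      simp only [mul_assoc]
    _ = q' • (κ * x * (κ * y * k)) := by
      rw [← hxy.eq, mul_assoc _ k κ, ← hκk.eq, hκy.eq]; simp only [mul_assoc]

lemma serre_boundary_left' (hq : q * q' = 1) (hf : f * x - x * f = q' • (y * k))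
    (hκf : κ * f = q' • (f * κ)) (hfy : f * y = q' • (y * f)) (hkf : k * f = q • (f * k)) :
    Serre (q + q') f (κ * x) := by
  refine serre_of_qComm_eq' hq (qComm_boundary_left hq hf hκf) ?_
  have h : f * κ = q • (κ * f) := by rw [hκf, smul_smul, hq, one_smul]
  calc f * (κ * y * k) = q • (κ * (f * y) * k) := by
        rw [← mul_assoc, ← mul_assoc, h, smul_mul_assoc, smul_mul_assoc]; simp only [mul_assoc]
    _ = κ * y * (f * k) := by
        rw [hfy, mul_smul_comm, smul_mul_assoc, smul_smul, hq, one_smul]; simp only [mul_assoc]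
    _ = q' • (κ * y * k * f) := by
        rw [mul_assoc _ k f, hkf, mul_smul_comm, smul_smul, mul_comm q', hq, one_smul]

/-- All three terms contain the first argument twice, so a factor `κ` that commutes with `x` up to a
scalar contributes the same scalar and the same power of `κ` to each. -/
lemma Serre.scaled_left {c r : R} (h : Serre c x e) (hκx : κ * x = r • (x * κ))
    (hκe : Commute κ e) : Serre c (κ * x) e := by
  have hκx' (z : A) : κ * (x * z) = r • (x * (κ * z)) := by
    rw [← mul_assoc, hκx, smul_mul_assoc, mul_assoc]
  have hκe' (z : A) : κ * (e * z) = e * (κ * z) := by rw [← mul_assoc, hκe.eq, mul_assoc]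
  have h' := congrArg (fun z => (r * r * r) • (z * (κ * κ))) h
  simp only [Serre, hκx, hκx', hκe.eq, hκe', mul_assoc, smul_mul_assoc, mul_smul_comm, smul_smul,
    add_mul, sub_mul, smul_add, smul_sub, zero_mul, smul_zero] at h' ⊢
  linear_combination (norm := module) h'

lemma Serre.scaled_right {c : R} (h : Serre c e x) (hκe : Commute κ e) : Serre c e (κ * x) := by
  have hκe' (z : A) : κ * (e * z) = e * (κ * z) := by rw [← mul_assoc, hκe.eq, mul_assoc]
  have h' := congrArg (fun z => κ * z) h
  simp only [Serre, hκe', mul_assoc, mul_smul_comm, mul_add, mul_sub, mul_zero] at h' ⊢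
  exact h'

end Boundary

/-! ### Operators that move entries of two neighbouring rows -/

section TwoRows

variable {μ : ℤ → ℤ}

/-- The alternating exponent of `q`. -/
def eps (p : ℕ) : ℤ := (-1) ^ p

/-- Composite root vectors with overlapping rows commute only if they are formed with inverse
parameters; hence the alternation. -/
lemma eps_succ (p : ℕ) : eps (p + 1) = -eps p := by rw [eps, pow_succ, eps]; ring

lemma eps_sign (p : ℕ) : eps p = 1 ∨ eps p = -1 := neg_one_pow_eq_or ℤ p

lemma qz_add_qz_neg {ε : ℤ} (h : ε = 1 ∨ ε = -1) : qz ε + qz (-ε) = qnum 2 := by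
  rcases h with rfl | rfl
  · exact qnum_two.symm
  · rw [qnum_two, neg_neg, add_comm]

lemma qnum_succ_sub_qz {ε : ℤ} (h : ε = 1 ∨ ε = -1) (x : ℤ) :
    qnum (x + 1) - qz ε * qnum x = qz (-ε * x) := by
  rcases h with rfl | rfl
  · rw [qnum_succ_sub, neg_one_mul]
  · rw [qnum_succ_sub', neg_neg, one_mul]

/-- The diagonal operator with eigenvalues `q ^ (a * hw)`. -/
def kop (μ : ℤ → ℤ) (p : ℕ) (a : ℤ) : Module.End ℂ⟦X⟧ (Mod μ) := diag μ fun t => qz (a * hw t p)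

/-- The diagonal operator with eigenvalues `q ^ (a * rs)` for the first row. -/
def rop (μ : ℤ → ℤ) (a : ℤ) : Module.End ℂ⟦X⟧ (Mod μ) := diag μ fun t => qz (a * rs t 1)

/-- The diagonal operator with eigenvalues `[hw]`. -/
def bop (μ : ℤ → ℤ) (p : ℕ) : Module.End ℂ⟦X⟧ (Mod μ) := diag μ fun t => qnum (hw t p)

/-- Raise entries of the rows `p` and `p + 1`. -/
def eop (μ : ℤ → ℤ) : ℕ → Module.End ℂ⟦X⟧ (Mod μ)
  | 0 => rop μ (eps 1) * xop μ 1
  | p + 1 => qComm (qz (eps (p + 1))) (xop μ (p + 1)) (xop μ (p + 2))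

/-- Lower entries of the rows `p` and `p + 1`. -/
def fop (μ : ℤ → ℤ) : ℕ → Module.End ℂ⟦X⟧ (Mod μ)
  | 0 => yop μ 1 * rop μ (-eps 1)
  | p + 1 => qComm (qz (-eps (p + 1))) (yop μ (p + 2)) (yop μ (p + 1))

lemma bop_eq (p : ℕ) (hp : 0 < p) : xop μ p * yop μ p - yop μ p * xop μ p = bop μ p :=
  xop_comm_yop p hp

lemma bop_eq' (p : ℕ) (hp : 0 < p) : yop μ p * xop μ p - xop μ p * yop μ p = -bop μ p := by
  rw [← bop_eq p hp, neg_sub]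

/-- How a diagonal operator passes an operator `-shiftOp`. -/
lemma diag_mul_neg_shiftOp {s : ℤ} {p : ℕ} {c : Arr → ℕ → ℂ⟦X⟧} {f : Arr → ℂ⟦X⟧} {z : ℂ⟦X⟧}
    (h : ∀ t, ∀ j < p, f (bump t s p j) = z * f t) :
    diag μ f * -shiftOp μ s p c = z • (-shiftOp μ s p c * diag μ f) := by
  rw [mul_neg, neg_mul, diag_mul_shiftOp h, smul_neg]

lemma kop_xop_self (p : ℕ) (a : ℤ) : kop μ p a * xop μ p = qz (2 * a) • (xop μ p * kop μ p a) :=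
  diag_mul_shiftOp fun t j hj => by rw [hw_bump_self t 1 hj, ← qz_add]; congr 1; ring

lemma kop_xop_succ (p : ℕ) (a : ℤ) :
    kop μ p a * xop μ (p + 1) = qz (-a) • (xop μ (p + 1) * kop μ p a) :=
  diag_mul_shiftOp fun t j hj => by rw [hw_bump_succ t 1 hj, ← qz_add]; congr 1; ring

lemma kop_yop_self (p : ℕ) (a : ℤ) : kop μ p a * yop μ p = qz (-2 * a) • (yop μ p * kop μ p a) :=
  diag_mul_neg_shiftOp fun t j hj => by rw [hw_bump_self t (-1) hj, ← qz_add]; congr 1; ring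

lemma kop_yop_succ (p : ℕ) (a : ℤ) :
    kop μ p a * yop μ (p + 1) = qz a • (yop μ (p + 1) * kop μ p a) :=
  diag_mul_neg_shiftOp fun t j hj => by rw [hw_bump_succ t (-1) hj, ← qz_add]; congr 1; ring

lemma kop_yop_pred (p : ℕ) (a : ℤ) :
    kop μ (p + 1) a * yop μ p = qz a • (yop μ p * kop μ (p + 1) a) :=
  diag_mul_neg_shiftOp fun t j hj => by rw [hw_bump_pred t (-1) hj, ← qz_add]; congr 1; ring

lemma rop_xop (a : ℤ) : rop μ a * xop μ 1 = qz a • (xop μ 1 * rop μ a) :=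
  diag_mul_shiftOp fun t j hj => by rw [rs_bump_self t 1 hj, ← qz_add]; congr 1; ring

lemma rop_yop (a : ℤ) : rop μ a * yop μ 1 = qz (-a) • (yop μ 1 * rop μ a) :=
  diag_mul_neg_shiftOp fun t j hj => by rw [rs_bump_self t (-1) hj, ← qz_add]; congr 1; ring

lemma commute_rop_xop (a : ℤ) {p : ℕ} (hp : p ≠ 1) : Commute (rop μ a) (xop μ p) :=
  commute_diag_shiftOp fun t j _ => by rw [rs_bump_ne t 1 j hp.symm]

lemma commute_rop_yop (a : ℤ) {p : ℕ} (hp : p ≠ 1) : Commute (rop μ a) (yop μ p) :=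
  Commute.neg_right (commute_diag_shiftOp fun t j _ => by rw [rs_bump_ne t (-1) j hp.symm])

lemma rop_mul_rop (a : ℤ) : rop μ a * rop μ (-a) = 1 := by
  rw [rop, rop, diag_mul, ← diag_one]
  exact diag_congr fun t _ => by rw [neg_mul, qz_mul_neg]

/-- A neighbouring root vector shifts the weight by one, so the q-commutator with [h] has the
coefficient [x + 1] - q^{±1} [x], a single power of q. The other relations of `bop` with neighbours
are of the same kind. -/
lemma bop_xop_succ (p : ℕ) {ε : ℤ} (h : ε = 1 ∨ ε = -1) :
    bop μ p * xop μ (p + 1) - qz ε • (xop μ (p + 1) * bop μ p) = -(xop μ (p + 1) * kop μ p ε) := by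
  rw [bop, kop, ← mul_smul_comm, ← mul_neg, diag_smul, diag_neg]
  refine diag_shiftOp_sub fun t j hj => ?_
  have := qnum_succ_sub_qz h (-hw t p)
  rw [hw_bump_succ t 1 hj]
  rw [show -hw t p + 1 = -(hw t p - 1) by ring, qnum_neg, qnum_neg,
    show -ε * -hw t p = ε * hw t p by ring] at this
  linear_combination -this

lemma xop_bop_succ (p : ℕ) {ε : ℤ} (h : ε = 1 ∨ ε = -1) :
    xop μ p * bop μ (p + 1) - qz ε • (bop μ (p + 1) * xop μ p) =
      qz ε • (xop μ p * kop μ (p + 1) (-ε)) := by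
  have e : diag μ (fun t => qz ε * qnum (hw t (p + 1))) * xop μ p - xop μ p * bop μ (p + 1) =
      xop μ p * diag μ (fun t => -(qz ε * qz (-ε * hw t (p + 1)))) := by
    refine diag_shiftOp_sub fun t j hj => ?_
    have := qnum_succ_sub_qz h (hw t (p + 1) - 1)
    rw [hw_bump_pred t 1 hj]
    rw [sub_add_cancel, show -ε * (hw t (p + 1) - 1) = ε + -ε * hw t (p + 1) by ring, qz_add] at this
    linear_combination -this
  rw [← diag_neg, ← diag_smul, ← diag_smul, mul_neg, mul_smul_comm, smul_mul_assoc] at e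
  rw [bop] at e
  rw [kop, ← neg_sub, bop, e, neg_neg]

lemma bop_yop_pred (p : ℕ) {ε : ℤ} (h : ε = 1 ∨ ε = -1) :
    bop μ (p + 1) * yop μ p - qz ε • (yop μ p * bop μ (p + 1)) = yop μ p * kop μ (p + 1) (-ε) := by
  have e : bop μ (p + 1) * shiftOp μ (-1) p (cg p (p - 1)) - shiftOp μ (-1) p (cg p (p - 1)) *
      diag μ (fun t => qz ε * qnum (hw t (p + 1))) =
      shiftOp μ (-1) p (cg p (p - 1)) * kop μ (p + 1) (-ε) := by
    refine diag_shiftOp_sub fun t j hj => ?_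
    rw [hw_bump_pred t (-1) hj, sub_neg_eq_add, qnum_succ_sub_qz h]
  rw [← diag_smul, mul_smul_comm] at e
  rw [yop, mul_neg, neg_mul, neg_mul, ← e, bop, smul_neg]
  abel

lemma bop_yop_succ (p : ℕ) {ε : ℤ} (h : ε = 1 ∨ ε = -1) :
    bop μ p * yop μ (p + 1) - qz ε • (yop μ (p + 1) * bop μ p) = yop μ (p + 1) * kop μ p (-ε) := by
  have e : bop μ p * shiftOp μ (-1) (p + 1) (cg (p + 1) p) - shiftOp μ (-1) (p + 1) (cg (p + 1) p) *
      diag μ (fun t => qz ε * qnum (hw t p)) =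
      shiftOp μ (-1) (p + 1) (cg (p + 1) p) * kop μ p (-ε) := by
    refine diag_shiftOp_sub fun t j hj => ?_
    rw [hw_bump_succ t (-1) hj, sub_neg_eq_add, qnum_succ_sub_qz h]
  rw [← diag_smul, mul_smul_comm] at e
  rw [yop, add_tsub_cancel_right, mul_neg, neg_mul, neg_mul, ← e, bop, smul_neg]
  abel

end TwoRows

/-! ### Relations between the operators that move entries of two neighbouring rows -/

section TwoRowRelations

variable {μ : ℤ → ℤ}

lemma qnum_two_smul_eq_zero {x : Module.End ℂ⟦X⟧ (Mod μ)} (h : qnum 2 • x = 0) : x = 0 := by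
  have h1 := congrArg (fun z => (qnum 2)⁻¹ • z) h
  simp only [smul_zero, smul_smul] at h1
  rwa [mul_comm, qnum_mul_inv (by norm_num), one_smul] at h1

lemma one_add_sq_smul_eq_zero {ε : ℤ} (hε : ε = 1 ∨ ε = -1) {x : Module.End ℂ⟦X⟧ (Mod μ)}
    (h : (1 + qz ε ^ 2) • x = 0) : x = 0 := by
  refine qnum_two_smul_eq_zero ?_
  have h1 := congrArg (fun z => qz (-ε) • z) h
  simp only [smul_zero, smul_smul] at h1
  rw [← h1, ← qz_add_qz_neg hε]
  congr 1
  linear_combination -qz ε * qz_mul_neg ε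

lemma qz_mul_neg' (a : ℤ) : qz (-a) * qz a = 1 := by rw [mul_comm, qz_mul_neg]

lemma commute_eop_of {z : Module.End ℂ⟦X⟧ (Mod μ)} {p : ℕ}
    (h : ∀ r, 1 ≤ r → r = p ∨ r = p + 1 → Commute z (xop μ r))
    (h0 : p = 0 → Commute z (rop μ (eps 1))) : Commute z (eop μ p) := by
  rcases p with _ | p
  · exact (h0 rfl).mul_right (h 1 le_rfl (Or.inr rfl))
  · exact Commute.qComm_right (h _ (by omega) (Or.inl rfl)) (h _ (by omega) (Or.inr rfl)) _

lemma commute_fop_of {z : Module.End ℂ⟦X⟧ (Mod μ)} {p : ℕ}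
    (h : ∀ r, 1 ≤ r → r = p ∨ r = p + 1 → Commute z (yop μ r))
    (h0 : p = 0 → Commute z (rop μ (-eps 1))) : Commute z (fop μ p) := by
  rcases p with _ | p
  · exact (h 1 le_rfl (Or.inr rfl)).mul_right (h0 rfl)
  · exact Commute.qComm_right (h _ (by omega) (Or.inr rfl)) (h _ (by omega) (Or.inl rfl)) _

lemma commute_rop_eop (a : ℤ) {p : ℕ} (hp : 2 ≤ p) : Commute (rop μ a) (eop μ p) :=
  commute_eop_of (fun r _ h => commute_rop_xop a (by omega)) (by omega)

lemma commute_rop_fop (a : ℤ) {p : ℕ} (hp : 2 ≤ p) : Commute (rop μ a) (fop μ p) :=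
  commute_fop_of (fun r _ h => commute_rop_yop a (by omega)) (by omega)

lemma commute_xop_eop {r p : ℕ} (h : r + 2 ≤ p) : Commute (xop μ r) (eop μ p) :=
  commute_eop_of (fun r' _ h' => commute_xop (by omega)) (by omega)

lemma commute_yop_fop {r p : ℕ} (h : r + 2 ≤ p) : Commute (yop μ r) (fop μ p) :=
  commute_fop_of (fun r' _ h' => commute_yop (by omega)) (by omega)

lemma commute_xop_fop {r p : ℕ} (h : r < p) : Commute (xop μ r) (fop μ p) :=
  commute_fop_of (fun r' _ h' => commute_xop_yop (by omega)) (by omega)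

lemma commute_yop_eop {r p : ℕ} (h : r < p) : Commute (yop μ r) (eop μ p) :=
  commute_eop_of (fun r' _ h' => (commute_xop_yop (by omega)).symm) (by omega)

lemma commute_eop_far {p p' : ℕ} (h : p + 3 ≤ p') : Commute (eop μ p) (eop μ p') :=
  (commute_eop_of (fun _ _ _ => (commute_xop_eop (by omega)).symm)
    fun _ => (commute_rop_eop _ (by omega)).symm).symm

lemma commute_fop_far {p p' : ℕ} (h : p + 3 ≤ p') : Commute (fop μ p) (fop μ p') :=
  (commute_fop_of (fun _ _ _ => (commute_yop_fop (by omega)).symm)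
    fun _ => (commute_rop_fop _ (by omega)).symm).symm

lemma commute_eop_fop_far {p p' : ℕ} (h : p + 2 ≤ p') : Commute (eop μ p) (fop μ p') :=
  (commute_eop_of (fun _ _ _ => (commute_xop_fop (by omega)).symm)
    fun _ => (commute_rop_fop _ (by omega)).symm).symm

lemma commute_fop_eop_far {p p' : ℕ} (h : p + 2 ≤ p') : Commute (fop μ p) (eop μ p') :=
  (commute_fop_of (fun _ _ _ => (commute_yop_eop (by omega)).symm)
    fun _ => (commute_rop_eop _ (by omega)).symm).symm

lemma serre_xop_qz (p m : ℕ) : Serre (qz (eps p) + qz (-eps p)) (xop μ m) (xop μ (m + 1)) := by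
  rw [qz_add_qz_neg (eps_sign p)]; exact serre_xop m

lemma serre_xop_qz' (p m : ℕ) : Serre (qz (eps p) + qz (-eps p)) (xop μ (m + 1)) (xop μ m) := by
  rw [qz_add_qz_neg (eps_sign p)]; exact serre_xop' m

lemma serre_yop_qz (p m : ℕ) : Serre (qz (eps p) + qz (-eps p)) (yop μ (m + 2)) (yop μ (m + 1)) := by
  rw [qz_add_qz_neg (eps_sign p)]; exact serre_yop m

lemma serre_yop_qz' (p m : ℕ) : Serre (qz (eps p) + qz (-eps p)) (yop μ (m + 1)) (yop μ (m + 2)) := by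
  rw [qz_add_qz_neg (eps_sign p)]; exact serre_yop' m

lemma rop_eop (a : ℤ) : rop μ a * eop μ 1 = qz a • (eop μ 1 * rop μ a) := by
  have h : rop μ a * xop μ 2 = (1 : ℂ⟦X⟧) • (xop μ 2 * rop μ a) := by
    rw [one_smul]; exact (commute_rop_xop a (by omega)).eq
  have h' : rop μ a * eop μ 1 = (qz a * 1) • (eop μ 1 * rop μ a) := qComm_scale (rop_xop a) h _
  rw [h', mul_one]

lemma rop_fop (a : ℤ) : rop μ a * fop μ 1 = qz (-a) • (fop μ 1 * rop μ a) := by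
  have h : rop μ a * yop μ 2 = (1 : ℂ⟦X⟧) • (yop μ 2 * rop μ a) := by
    rw [one_smul]; exact (commute_rop_yop a (by omega)).eq
  have h' : rop μ a * fop μ 1 = (1 * qz (-a)) • (fop μ 1 * rop μ a) := qComm_scale h (rop_yop a) _
  rw [h', one_mul]

/-- The two operators share a row. Away from the apex this is `commute_qComm_qComm` with inverse
parameters. At the apex, moving `xop 1` past `eop 1` costs a power of q by the Serre relation, and
`rop` restores it. -/
lemma commute_eop_succ (p : ℕ) : Commute (eop μ p) (eop μ (p + 1)) := by
  rcases p with _ | p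
  · have h1 : xop μ 1 * eop μ 1 = qz (-eps 1) • (eop μ 1 * xop μ 1) :=
      mul_qComm_left (qz_mul_neg _) (serre_xop_qz 1 1)
    have h2 := rop_eop (μ := μ) (eps 1)
    show rop μ (eps 1) * xop μ 1 * eop μ 1 = eop μ 1 * (rop μ (eps 1) * xop μ 1)
    rw [mul_assoc, h1, mul_smul_comm, ← mul_assoc, h2, smul_mul_assoc, smul_smul, qz_mul_neg',
      one_smul, mul_assoc]
  · show Commute (qComm (qz (eps (p + 1))) _ _) (qComm (qz (eps (p + 2))) _ _)
    rw [eps_succ (p + 1)]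
    exact commute_qComm_qComm (qz_mul_neg _) (fun x => one_add_sq_smul_eq_zero (eps_sign _))
      (serre_xop_qz' _ _) (serre_xop_qz _ _) (commute_xop le_rfl)

lemma commute_fop_succ (p : ℕ) : Commute (fop μ p) (fop μ (p + 1)) := by
  rcases p with _ | p
  · have h1 : fop μ 1 * yop μ 1 = qz (eps 1) • (yop μ 1 * fop μ 1) :=
      qComm_mul_right (qz_mul_neg' _) (by rw [add_comm]; exact serre_yop_qz' 1 0)
    have h2 := rop_fop (μ := μ) (-eps 1)
    show yop μ 1 * rop μ (-eps 1) * fop μ 1 = fop μ 1 * (yop μ 1 * rop μ (-eps 1))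
    rw [mul_assoc, h2, mul_smul_comm, ← mul_assoc, ← mul_assoc, h1, neg_neg, smul_mul_assoc]
  · refine Commute.symm ?_
    show Commute (qComm (qz (-eps (p + 2))) _ _) (qComm (qz (-eps (p + 1))) _ _)
    rw [eps_succ (p + 1), neg_neg]
    exact commute_qComm_qComm (qz_mul_neg _) (fun x => one_add_sq_smul_eq_zero (eps_sign _))
      (serre_yop_qz' _ _) (serre_yop_qz _ _) (commute_yop le_rfl).symm

/-- The weight of `eop p`. -/
def ew (t : Arr) : ℕ → ℤ
  | 0 => hw t 1
  | p + 1 => hw t (p + 1) + hw t (p + 2)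

/-- At the apex the factors `rop` cancel. Otherwise `qComm_comm_qComm` applies, and [a] q^{-εb} +
[b] q^{εa} = [a + b] for ε = ±1. -/
lemma eop_comm_fop (p : ℕ) :
    eop μ p * fop μ p - fop μ p * eop μ p = diag μ fun t => qnum (ew t p) := by
  rcases p with _ | p
  · have h1 : rop μ (eps 1) * xop μ 1 * (yop μ 1 * rop μ (-eps 1)) =
        xop μ 1 * yop μ 1 := by
      have h2 : rop μ (eps 1) * (xop μ 1 * yop μ 1) = xop μ 1 * yop μ 1 * rop μ (eps 1) := by
        rw [← mul_assoc, rop_xop, smul_mul_assoc, mul_assoc, rop_yop, mul_smul_comm, smul_smul,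
          qz_mul_neg, one_smul, mul_assoc]
      rw [← mul_assoc, mul_assoc (rop μ (eps 1)), h2, mul_assoc, rop_mul_rop, mul_one]
    have h2 : yop μ 1 * rop μ (-eps 1) * (rop μ (eps 1) * xop μ 1) = yop μ 1 * xop μ 1 := by
      have := rop_mul_rop (μ := μ) (-eps 1)
      rw [neg_neg] at this
      rw [← mul_assoc, mul_assoc (yop μ 1), this, mul_one]
    exact (congrArg₂ (· - ·) h1 h2).trans (xop_comm_yop 1 one_pos)
  · have h := qComm_comm_qComm (qz_mul_neg (eps (p + 1))) (bop_eq (μ := μ) (p + 1) (by omega))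
      (bop_eq (p + 2) (by omega)) (commute_xop_yop (by omega)) (commute_xop_yop (by omega))
      (bop_xop_succ (p + 1) (eps_sign _)) (xop_bop_succ (p + 1) (eps_sign _))
      (kop_yop_pred (p + 1) _) (kop_yop_succ (p + 1) _)
    refine h.trans ?_
    rw [bop, bop, kop, kop, diag_mul, diag_mul, diag_add]
    refine diag_congr fun t _ => ?_
    apply mul_left_cancel₀ qdiff_ne_zero
    rw [mul_add, ← mul_assoc, ← mul_assoc, qdiff_mul_qnum, qdiff_mul_qnum, qdiff_mul_qnum, ew]
    rcases eps_sign (p + 1) with h | h <;> rw [h] <;>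
      simp only [one_mul, neg_mul, neg_neg, neg_add, qz_add] <;> ring

lemma commute_eop_fop_succ (p : ℕ) : Commute (eop μ (p + 1)) (fop μ (p + 2)) := by
  show Commute (qComm (qz (eps (p + 1))) _ _) (qComm (qz (-eps (p + 2))) _ _)
  rw [eps_succ (p + 1), neg_neg]
  refine commute_qComm_y (bop_eq (μ := μ) (p + 2) (by omega)) (commute_xop_yop (by omega))
    (xop_bop_succ (p + 1) (eps_sign _)) (commute_xop_yop (by omega)) (commute_xop_yop (by omega)) ?_
  rw [kop_yop_succ, smul_smul, qz_mul_neg, one_smul]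

lemma commute_fop_eop_succ (p : ℕ) : Commute (fop μ (p + 1)) (eop μ (p + 2)) := by
  show Commute (qComm (qz (-eps (p + 1))) _ _) (qComm (qz (eps (p + 2))) _ _)
  rw [eps_succ (p + 1)]
  refine commute_qComm_x (bop_eq (μ := μ) (p + 2) (by omega)) (commute_xop_yop (by omega))
    (bop_yop_pred (p + 1) (by rw [← eps_succ]; exact eps_sign _)) (commute_xop_yop (by omega))
    (commute_xop_yop (by omega)) ?_
  rw [kop_xop_succ, neg_neg]

/-- These are neighbouring nodes of a_∞ on the same side of the apex: the pairs of rows are adjacent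
and disjoint. The second factor of the later operator commutes with the earlier one, so only the
first factor enters, and `serre_qComm_left` handles it. -/
lemma serre_eop (p : ℕ) : Serre (qnum 2) (eop μ p) (eop μ (p + 2)) := by
  rcases p with _ | p
  · refine Serre.scaled_left ?_ (rop_xop _) (commute_rop_eop _ le_rfl)
    exact (serre_xop 1).qComm_right (commute_xop le_rfl) _
  · have h : Commute (eop μ (p + 1)) (xop μ (p + 4)) :=
      (commute_eop_of (fun r _ h => (commute_xop (by omega)).symm) (by omega)).symm
    rw [← qz_add_qz_neg (eps_sign (p + 1))]
    refine Serre.qComm_right ?_ h _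
    exact serre_qComm_left (qz_mul_neg _) (fun x => by
      rw [qz_add_qz_neg (eps_sign _)]; exact qnum_two_smul_eq_zero)
      (serre_xop_qz _ _) (serre_xop_qz _ _) (commute_xop le_rfl)

lemma serre_eop' (p : ℕ) : Serre (qnum 2) (eop μ (p + 2)) (eop μ p) := by
  have key : Serre (qnum 2) (eop μ (p + 2)) (xop μ (p + 1)) := by
    show Serre _ (qComm (qz (eps (p + 2))) _ _) _
    rw [qComm_eq_smul (qz_mul_neg _)]
    refine Serre.smul_left ?_ _
    rw [← qz_add_qz_neg (eps_sign (p + 2)), add_comm]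
    exact serre_qComm_left (qz_mul_neg' _) (fun x => by
      rw [add_comm, qz_add_qz_neg (eps_sign _)]; exact qnum_two_smul_eq_zero)
      (by rw [add_comm]; exact serre_xop_qz' _ _) (by rw [add_comm]; exact serre_xop_qz' _ _)
      (commute_xop le_rfl).symm
  rcases p with _ | p
  · exact key.scaled_right (commute_rop_eop _ le_rfl)
  · show Serre _ _ (qComm (qz (eps (p + 1))) _ _)
    rw [qComm_eq_smul (qz_mul_neg _)]
    exact (key.qComm_right (commute_xop_eop (by omega)).symm _).smul_right _

lemma serre_fop' (p : ℕ) : Serre (qnum 2) (fop μ (p + 2)) (fop μ p) := by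
  have key : Serre (qnum 2) (fop μ (p + 2)) (yop μ (p + 1)) := by
    show Serre _ (qComm (qz (-eps (p + 2))) _ _) _
    rw [← qz_add_qz_neg (eps_sign (p + 2)), add_comm]
    exact serre_qComm_left (qz_mul_neg' _) (fun x => by
      rw [add_comm, qz_add_qz_neg (eps_sign _)]; exact qnum_two_smul_eq_zero)
      (by rw [add_comm]; exact serre_yop_qz _ _) (by rw [add_comm]; exact serre_yop_qz _ _)
      (commute_yop le_rfl).symm
  rcases p with _ | p
  · show Serre _ _ (yop μ 1 * rop μ (-eps 1))
    have : yop μ 1 * rop μ (-eps 1) = qz (-eps 1) • (rop μ (-eps 1) * yop μ 1) := by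
      rw [rop_yop, smul_smul, neg_neg, qz_mul_neg', one_smul]
    rw [this]
    exact (key.scaled_right (commute_rop_fop _ le_rfl)).smul_right _
  · exact key.qComm_right (commute_yop_fop (by omega)).symm _

lemma serre_fop (p : ℕ) : Serre (qnum 2) (fop μ p) (fop μ (p + 2)) := by
  have key (h : Serre (qnum 2) (fop μ p) (yop μ (p + 2))) (h' : Commute (fop μ p) (yop μ (p + 3))) :
      Serre (qnum 2) (fop μ p) (fop μ (p + 2)) := by
    show Serre _ _ (qComm (qz (-eps (p + 2))) _ _)
    rw [qComm_eq_smul (qz_mul_neg' _)]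
    exact (h.qComm_right h' _).smul_right _
  have h' : Commute (fop μ p) (yop μ (p + 3)) :=
    (commute_fop_of (fun r _ h => (commute_yop (by omega)).symm)
      fun _ => (commute_rop_yop _ (by omega)).symm).symm
  refine key ?_ h'
  rcases p with _ | p
  · show Serre _ (yop μ 1 * rop μ (-eps 1)) _
    have : yop μ 1 * rop μ (-eps 1) = qz (-eps 1) • (rop μ (-eps 1) * yop μ 1) := by
      rw [rop_yop, smul_smul, neg_neg, qz_mul_neg', one_smul]
    rw [this]
    exact ((serre_yop' 0).scaled_left (rop_yop _) (commute_rop_yop _ (by omega))).smul_left _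
  · show Serre _ (qComm (qz (-eps (p + 1))) _ _) _
    rw [qComm_eq_smul (qz_mul_neg' _)]
    refine Serre.smul_left ?_ _
    rw [← qz_add_qz_neg (eps_sign (p + 1))]
    exact serre_qComm_left (qz_mul_neg _) (fun x => by
      rw [qz_add_qz_neg (eps_sign _)]; exact qnum_two_smul_eq_zero)
      (serre_yop_qz' _ _) (serre_yop_qz' _ _) (commute_yop le_rfl)

lemma eop_one_comm : eop μ 1 * yop μ 1 - yop μ 1 * eop μ 1 = -(xop μ 2 * kop μ 1 (eps 1)) :=
  qComm_comm_y₁ (bop_eq 1 one_pos) (commute_xop_yop (by omega)) (bop_xop_succ 1 (eps_sign _))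

lemma fop_one_comm : fop μ 1 * xop μ 1 - xop μ 1 * fop μ 1 =
    qz (-eps 1) • (yop μ 2 * kop μ 1 (-eps 1)) := by
  have hb : -bop μ 1 * yop μ 2 - qz (eps 1) • (yop μ 2 * -bop μ 1) =
      -(yop μ 2 * kop μ 1 (-eps 1)) := by
    rw [← bop_yop_succ 1 (eps_sign _), neg_mul, mul_neg, smul_neg]
    abel
  have h := qComm_comm_y₁ (bop_eq' (μ := μ) 1 one_pos) (commute_xop_yop (by omega)).symm hb
  show qComm (qz (-eps 1)) _ _ * _ - _ * qComm (qz (-eps 1)) _ _ = _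
  rw [qComm_eq_smul (qz_mul_neg' _), smul_mul_assoc, mul_smul_comm, ← smul_sub, h, smul_neg,
    neg_smul, neg_neg]

lemma kop_eop_one (a : ℤ) : kop μ 1 a * eop μ 1 = qz a • (eop μ 1 * kop μ 1 a) := by
  have := qComm_scale (kop_xop_self (μ := μ) 1 a) (kop_xop_succ 1 a) (qz (eps 1))
  rwa [← qz_add, show 2 * a + -a = a by ring] at this

lemma kop_fop_one (a : ℤ) : kop μ 1 a * fop μ 1 = qz (-a) • (fop μ 1 * kop μ 1 a) := by
  have := qComm_scale (kop_yop_succ (μ := μ) 1 a) (kop_yop_self 1 a) (qz (-eps 1))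
  rwa [← qz_add, show a + -2 * a = -a by ring] at this

/-- The nodes -1 and 0 of a_∞ meet at the apex: e_{-1} lowers the first row and e_0 raises the rows
1 and 2. The inner q-commutator is known from `eop_one_comm`, and the boundary criteria apply. -/
lemma serre_fop_eop : Serre (qnum 2) (fop μ 0) (eop μ 1) := by
  rw [← qz_add_qz_neg (eps_sign 1)]
  refine serre_boundary (qz_mul_neg _) eop_one_comm (rop_eop _) ?_ ?_ (commute_xop_yop (by omega))
    (commute_rop_xop _ (by omega)) (commute_diag _ _)
  · rw [kop_yop_self, ← qz_add]; congr 2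
  · rw [rop_yop, neg_neg]

lemma serre_eop_fop : Serre (qnum 2) (eop μ 1) (fop μ 0) := by
  rw [← qz_add_qz_neg (eps_sign 1)]
  exact serre_boundary' (qz_mul_neg _) eop_one_comm (rop_eop _)
    (qComm_mul_right (qz_mul_neg _) (serre_xop_qz' _ _)) (kop_eop_one _)

lemma serre_eop_fop_one : Serre (qnum 2) (eop μ 0) (fop μ 1) := by
  rw [← qz_add_qz_neg (eps_sign 1)]
  refine serre_boundary_left (qz_mul_neg _) fop_one_comm (rop_fop _) ?_ (rop_xop _)
    (commute_xop_yop (by omega)) (commute_rop_yop _ (by omega)) (commute_diag _ _)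
  rw [kop_xop_self, ← qz_add]; congr 2

lemma serre_fop_one_eop : Serre (qnum 2) (fop μ 1) (eop μ 0) := by
  rw [← qz_add_qz_neg (eps_sign 1)]
  refine serre_boundary_left' (qz_mul_neg _) fop_one_comm (rop_fop _) ?_ ?_
  · have : yop μ 2 * fop μ 1 = qz (eps 1) • (fop μ 1 * yop μ 2) :=
      mul_qComm_left (qz_mul_neg' _) (by rw [add_comm]; exact serre_yop_qz _ _)
    rw [this, smul_smul, qz_mul_neg', one_smul]
  · rw [kop_fop_one, neg_neg]

end TwoRowRelations

/-! ### Signs and absolute values of products of `q`-numbers -/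

section Signs

open Finset

/-- The `q`-number `[|n|]`. -/
def aq (n : ℤ) : ℂ⟦X⟧ := qnum |n|

lemma aq_neg (n : ℤ) : aq (-n) = aq n := by rw [aq, aq, abs_neg]

lemma aq_sub_comm (a b : ℤ) : aq (a - b) = aq (b - a) := by rw [← aq_neg, neg_sub]

lemma IsPos.aq {n : ℤ} (h : n ≠ 0) : IsPos (aq n) := IsPos.qnum (abs_pos.2 h)

/-- The sign of a product whose factors are positive exactly for the indices below `m`. -/
def sgp (s : Finset ℕ) (m : ℕ) : ℂ⟦X⟧ := ∏ k ∈ s, if k < m then 1 else -1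

/-- Interlacing makes the differences nonnegative up to an index and nonpositive from there on, so
the sign of the product depends on that index alone. Zero factors do no harm. -/
lemma prod_qnum_eq {s : Finset ℕ} {m : ℕ} {f : ℕ → ℤ} (h1 : ∀ k ∈ s, k < m → 0 ≤ f k)
    (h2 : ∀ k ∈ s, m ≤ k → f k ≤ 0) :
    ∏ k ∈ s, qnum (f k) = sgp s m * ∏ k ∈ s, aq (f k) := by
  rw [sgp, ← prod_mul_distrib]
  refine prod_congr rfl fun k hk => ?_
  split_ifs with h
  · rw [one_mul, aq, abs_of_nonneg (h1 k hk h)]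
  · rw [aq, abs_of_nonpos (h2 k hk (not_lt.1 h)), qnum_neg, neg_one_mul, neg_neg]

lemma sgp_range {n m : ℕ} (h : m ≤ n) : sgp (range n) m = (-1) ^ (n - m) := by
  induction n, h using Nat.le_induction with
  | base =>
    rw [Nat.sub_self, pow_zero, sgp]
    exact prod_eq_one fun k hk => if_pos (mem_range.1 hk)
  | succ n hn ih =>
    rw [sgp, prod_range_succ, if_neg (not_lt.2 hn), Nat.succ_sub hn, pow_succ, ← ih, sgp]

lemma sgp_erase {n m l : ℕ} (h : m ≤ n) (hl : l < n) :
    sgp ((range n).erase l) m = (-1) ^ (n - m) * if l < m then 1 else -1 := by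
  rw [← sgp_range h, sgp, sgp, ← mul_prod_erase _ _ (mem_range.2 hl)]
  split_ifs <;> ring

lemma neg_one_pow_sq (n : ℕ) : ((-1 : ℂ⟦X⟧) ^ n) * (-1) ^ n = 1 := by
  rw [← mul_pow]; simp

lemma sgp_mul_self (s : Finset ℕ) (m : ℕ) : sgp s m * sgp s m = 1 := by
  rw [sgp, ← prod_mul_distrib]
  exact prod_eq_one fun k _ => by split_ifs <;> ring

lemma inv_of_mul_self {x : ℂ⟦X⟧} (h : x * x = 1) : x⁻¹ = x := by
  have hx : PowerSeries.constantCoeff x ≠ 0 := by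
    intro h0
    have := congrArg PowerSeries.constantCoeff h
    rw [map_mul, h0, mul_zero, map_one] at this
    exact zero_ne_one this
  calc x⁻¹ = x⁻¹ * (x * x) := by rw [h, mul_one]
    _ = x := by rw [← mul_assoc, PowerSeries.inv_mul_cancel _ hx, one_mul]

/-- `∏ [|a k - u|] / ∏ [|b k - u|]`. -/
def axg (N : Finset ℕ) (a : ℕ → ℤ) (D : Finset ℕ) (b : ℕ → ℤ) (u : ℤ) : ℂ⟦X⟧ :=
  (∏ k ∈ N, aq (a k - u)) * (∏ k ∈ D, aq (b k - u))⁻¹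

lemma xg_eq_axg {N D : Finset ℕ} {a b : ℕ → ℤ} {u : ℤ} {m m' : ℕ}
    (h1 : ∀ k ∈ N, k < m → u ≤ a k) (h2 : ∀ k ∈ N, m ≤ k → a k ≤ u)
    (h3 : ∀ k ∈ D, k < m' → u ≤ b k) (h4 : ∀ k ∈ D, m' ≤ k → b k ≤ u) :
    xg N a D b u = -(sgp N m * sgp D m') * axg N a D b u := by
  rw [xg, axg, prod_qnum_eq (fun k hk h => sub_nonneg.2 (h1 k hk h))
    (fun k hk h => sub_nonpos.2 (h2 k hk h)), prod_qnum_eq (fun k hk h => sub_nonneg.2 (h3 k hk h))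
    (fun k hk h => sub_nonpos.2 (h4 k hk h)), PowerSeries.mul_inv_rev,
    inv_of_mul_self (sgp_mul_self D m')]
  ring

lemma IsPos.axg {N D : Finset ℕ} {a b : ℕ → ℤ} {u : ℤ} (h1 : ∀ k ∈ N, a k ≠ u)
    (h2 : ∀ k ∈ D, b k ≠ u) : IsPos (axg N a D b u) :=
  (IsPos.prod fun k hk => IsPos.aq (sub_ne_zero.2 (h1 k hk))).mul
    (IsPos.prod fun k hk => IsPos.aq (sub_ne_zero.2 (h2 k hk))).inv

variable {μ : ℤ → ℤ} {t : Arr}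

lemma IsGT.lv_le (h : IsGT μ t) {p a k : ℕ} (ha : a < p) (hk : k ≤ a) :
    lv t p a ≤ lv t (p + 1) k := by
  have h1 := h.upper p a ha
  have h2 := h.antitone (p := p + 1) hk (by omega)
  simp only [lv]; omega

lemma IsGT.lv_lt (h : IsGT μ t) {p a k : ℕ} (hk : a < k) (hp : k < p + 1) :
    lv t (p + 1) k < lv t p a := by
  have h1 := h.lower p a (by omega)
  have h2 := h.antitone (p := p + 1) (show a + 1 ≤ k from hk) hp
  simp only [lv]; omega

lemma IsGT.lv_lt_row (h : IsGT μ t) {p a b : ℕ} (hab : a < b) (hb : b < p) :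
    lv t p b < lv t p a := by
  have h1 := h.antitone hab.le hb
  simp only [lv]; omega

end Signs

/-! ### The coefficients of the operators in two rows -/

section TwoRowCoefficients

open Finset

variable {μ : ℤ → ℤ} {t T : Arr} {p j l : ℕ}

/-- The coefficient for raising, without its power of `q`. -/
def coefC (p : ℕ) (t : Arr) (j l : ℕ) : ℂ⟦X⟧ :=
  cg (p + 1) (p + 2) t l *
    xg ((range (p + 1)).erase l) (lv t (p + 1)) ((range p).erase j) (lv t p) (lv t p j)

/-- The coefficient for lowering, without its power of `q`. -/
def coefD (p : ℕ) (t : Arr) (j l : ℕ) : ℂ⟦X⟧ :=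
  cg p (p - 1) t j *
    xg ((range p).erase j) (lv t p) ((range (p + 1)).erase l) (lv t (p + 1)) (lv t (p + 1) l)

/-- The absolute value of `coefC`. -/
def absC (p : ℕ) (t : Arr) (j l : ℕ) : ℂ⟦X⟧ :=
  axg (range (p + 2)) (lv t (p + 2)) ((range (p + 1)).erase l) (lv t (p + 1)) (lv t (p + 1) l) *
    axg ((range (p + 1)).erase l) (lv t (p + 1)) ((range p).erase j) (lv t p) (lv t p j)

/-- The absolute value of `coefD`. -/
def absD (p : ℕ) (t : Arr) (j l : ℕ) : ℂ⟦X⟧ :=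
  axg (range (p - 1)) (lv t (p - 1)) ((range p).erase j) (lv t p) (lv t p j) *
    axg ((range p).erase j) (lv t p) ((range (p + 1)).erase l) (lv t (p + 1)) (lv t (p + 1) l)

/-- The sign of `coefC`. -/
def sg (j l : ℕ) : ℂ⟦X⟧ := if l ≤ j then 1 else -1

lemma sg_mul_self (j l : ℕ) : sg j l * sg j l = 1 := by
  rw [sg]; split_ifs <;> ring

/-- A transition: both arrays interlace, and the second one arises by raising the entry `j` of the
row `p` and the entry `l` of the row `p + 1`. -/
structure Raise (μ : ℤ → ℤ) (p j l : ℕ) (t T : Arr) : Prop where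
  lt : j < p
  lt' : l < p + 1
  left : IsGT μ t
  right : IsGT μ T
  eq : T = bump (bump t 1 p j) 1 (p + 1) l

namespace Raise

lemma lv_p (h : Raise μ p j l t T) : lv T p j = lv t p j + 1 := by
  rw [h.eq, lv_bump_row_ne _ _ _ (by omega), lv_bump_self]

lemma lv_p_ne (h : Raise μ p j l t T) {k : ℕ} (hk : k ≠ j) : lv T p k = lv t p k := by
  rw [h.eq, lv_bump_row_ne _ _ _ (by omega), lv_bump_ne _ _ _ hk]

lemma lv_succ (h : Raise μ p j l t T) : lv T (p + 1) l = lv t (p + 1) l + 1 := by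
  rw [h.eq, lv_bump_self, lv_bump_row_ne _ _ _ (by omega)]

lemma lv_succ_ne (h : Raise μ p j l t T) {k : ℕ} (hk : k ≠ l) : lv T (p + 1) k = lv t (p + 1) k := by
  rw [h.eq, lv_bump_ne _ _ _ hk, lv_bump_row_ne _ _ _ (by omega)]

lemma lv_ne (h : Raise μ p j l t T) {r : ℕ} (h1 : r ≠ p) (h2 : r ≠ p + 1) : lv T r = lv t r := by
  rw [h.eq, lv_bump_row_ne _ _ _ h2, lv_bump_row_ne _ _ _ h1]

/-- On one side strictness comes from interlacing in `t`, on the other from interlacing in `T`,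
whose two moved entries are larger by one. Together these inequalities determine all signs and show
that no factor of `absC` or `absD` vanishes. -/
lemma above_lt (h : Raise μ p j l t T) {k : ℕ} (hk : k ≤ l) : lv t (p + 1) l < lv t (p + 2) k := by
  have : lv T (p + 1) l ≤ lv T (p + 2) k := h.right.lv_le h.lt' hk
  rw [h.lv_succ, h.lv_ne (by omega) (by omega)] at this
  omega

lemma above_gt (h : Raise μ p j l t T) {k : ℕ} (hk : l < k) (hk' : k < p + 2) :
    lv t (p + 2) k < lv t (p + 1) l := h.left.lv_lt hk hk'

lemma mid_lt (h : Raise μ p j l t T) {k : ℕ} (hl : k ≠ l) (hk : k ≤ j) :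
    lv t p j < lv t (p + 1) k := by
  have := h.right.lv_le h.lt hk
  rw [h.lv_p, h.lv_succ_ne hl] at this
  omega

lemma mid_gt (h : Raise μ p j l t T) {k : ℕ} (hk : j < k) (hk' : k < p + 1) :
    lv t (p + 1) k < lv t p j := h.left.lv_lt hk hk'

lemma below_gt (h : Raise μ p j l t T) {k : ℕ} (hk : j ≤ k) (hk' : k < p - 1) :
    lv T (p - 1) k < lv T p j := by
  have := h.left.lv_le hk' hk
  rw [Nat.sub_add_cancel (by omega)] at this
  rw [h.lv_p, h.lv_ne (by omega) (by omega)]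
  omega

lemma below_lt (h : Raise μ p j l t T) {k : ℕ} (hk : k < j) : lv T p j < lv T (p - 1) k := by
  have := h.right.lv_lt (p := p - 1) hk (by have := h.lt; omega)
  rwa [Nat.sub_add_cancel (by have := h.lt; omega)] at this

lemma mid_lt' (h : Raise μ p j l t T) {k : ℕ} (hk : k < l) :
    lv T (p + 1) l < lv T p k := h.right.lv_lt hk h.lt'

lemma mid_gt' (h : Raise μ p j l t T) {k : ℕ} (hk : l ≤ k) (hkj : k ≠ j) (hk' : k < p) :
    lv T p k < lv T (p + 1) l := by
  have := h.left.lv_le hk' hk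
  rw [h.lv_succ, h.lv_p_ne hkj]
  omega

/-- The powers of -1 depending on `j` or on `l` occur in pairs. Only the sign of the omitted factor
`l` in the row `p + 1`, seen from the entry `j`, survives. -/
lemma coefC_eq (h : Raise μ p j l t T) : coefC p t j l = sg j l * absC p t j l := by
  have hj := h.lt
  have hl := h.lt'
  rw [coefC, absC, cg, xg_eq_axg (m := l + 1) (m' := l), xg_eq_axg (m := j + 1) (m' := j),
    sgp_range (by omega), sgp_erase (by omega) hl, sgp_erase (by omega) hl, sgp_erase hj.le hj,
    sg, show p + 2 - (l + 1) = p + 1 - l by omega,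
    Nat.add_sub_add_right p 1 j, if_neg (lt_irrefl l), if_neg (lt_irrefl j)]
  · have e1 := neg_one_pow_sq (p + 1 - l)
    have e2 := neg_one_pow_sq (p - j)
    simp only [Nat.lt_succ_iff]
    generalize (if l ≤ j then (1 : ℂ⟦X⟧) else -1) = σ
    linear_combination (σ * axg (range (p + 2)) (lv t (p + 2)) ((range (p + 1)).erase l)
      (lv t (p + 1)) (lv t (p + 1) l) *
      axg ((range (p + 1)).erase l) (lv t (p + 1)) ((range p).erase j) (lv t p) (lv t p j)) *
      (e1 * (-1) ^ (p - j) * (-1) ^ (p - j) + e2)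
  · intro k hk hkj; exact (h.mid_lt (ne_of_mem_erase hk) (by omega)).le
  · intro k hk hkj; exact (h.mid_gt hkj (mem_range.1 (mem_of_mem_erase hk))).le
  · intro k hk hkj; exact (h.left.lv_lt_row hkj hj).le
  · intro k hk hkj
    have := ne_of_mem_erase hk
    exact (h.left.lv_lt_row (by omega) (mem_range.1 (mem_of_mem_erase hk))).le
  · intro k hk hkl; exact (h.above_lt (by omega)).le
  · intro k hk hkl; exact (h.above_gt hkl (mem_range.1 hk)).le
  · intro k hk hkl; exact (h.left.lv_lt_row hkl hl).le
  · intro k hk hkl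
    have := ne_of_mem_erase hk
    exact (h.left.lv_lt_row (by omega) (mem_range.1 (mem_of_mem_erase hk))).le

lemma coefD_eq (h : Raise μ p j l t T) : coefD p T j l = -sg j l * absD p T j l := by
  have hj := h.lt
  have hl := h.lt'
  rw [coefD, absD, cg, xg_eq_axg (m := j) (m' := j), xg_eq_axg (m := l) (m' := l),
    sgp_range (by omega), sgp_erase (by omega) hj, sgp_erase (by omega) hl, sgp_erase (by omega) hj,
    sg, if_neg (lt_irrefl l), if_neg (lt_irrefl j), Nat.succ_sub (show l ≤ p by omega),
    show p - j = p - 1 - j + 1 by omega]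
  · have e1 := neg_one_pow_sq (p - l)
    have e2 := neg_one_pow_sq (p - 1 - j)
    have e3 : (if l ≤ j then (1 : ℂ⟦X⟧) else -1) = -(if j < l then 1 else -1) := by
      split_ifs <;> first | omega | ring
    rw [e3]
    generalize (if j < l then (1 : ℂ⟦X⟧) else -1) = σ
    rw [Nat.succ_eq_add_one, pow_succ, pow_succ]
    linear_combination (σ * axg (range (p - 1)) (lv T (p - 1)) ((range p).erase j) (lv T p)
      (lv T p j) * axg ((range p).erase j) (lv T p) ((range (p + 1)).erase l) (lv T (p + 1))
      (lv T (p + 1) l)) * (e1 * (-1) ^ (p - 1 - j) * (-1) ^ (p - 1 - j) + e2)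
  · intro k hk hkl; exact (h.mid_lt' hkl).le
  · intro k hk hkl
    exact (h.mid_gt' hkl (ne_of_mem_erase hk) (mem_range.1 (mem_of_mem_erase hk))).le
  · intro k hk hkl; exact (h.right.lv_lt_row hkl hl).le
  · intro k hk hkl
    have := ne_of_mem_erase hk
    exact (h.right.lv_lt_row (by omega) (mem_range.1 (mem_of_mem_erase hk))).le
  · intro k hk hkj; exact (h.below_lt hkj).le
  · intro k hk hkj; exact (h.below_gt hkj (mem_range.1 hk)).le
  · intro k hk hkj; exact (h.right.lv_lt_row hkj hj).le
  · intro k hk hkj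
    have := ne_of_mem_erase hk
    exact (h.right.lv_lt_row (by omega) (mem_range.1 (mem_of_mem_erase hk))).le

lemma above_ne (h : Raise μ p j l t T) {k : ℕ} (hk : k < p + 2) :
    lv t (p + 2) k ≠ lv t (p + 1) l := by
  rcases le_or_gt k l with h1 | h1
  · exact (h.above_lt h1).ne'
  · exact (h.above_gt h1 hk).ne

lemma mid_ne (h : Raise μ p j l t T) {k : ℕ} (hl : k ≠ l) (hk : k < p + 1) :
    lv t (p + 1) k ≠ lv t p j := by
  rcases le_or_gt k j with h1 | h1
  · exact (h.mid_lt hl h1).ne'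
  · exact (h.mid_gt h1 hk).ne

lemma below_ne (h : Raise μ p j l t T) {k : ℕ} (hk : k < p - 1) :
    lv T (p - 1) k ≠ lv T p j := by
  rcases le_or_gt j k with h1 | h1
  · exact (h.below_gt h1 hk).ne
  · exact (h.below_lt h1).ne'

lemma mid_ne' (h : Raise μ p j l t T) {k : ℕ} (hj : k ≠ j) (hk : k < p) :
    lv T p k ≠ lv T (p + 1) l := by
  rcases le_or_gt l k with h1 | h1
  · exact (h.mid_gt' h1 hj hk).ne
  · exact (h.mid_lt' h1).ne'

lemma isPos_absC (h : Raise μ p j l t T) : IsPos (absC p t j l) := by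
  refine (IsPos.axg ?_ ?_).mul (IsPos.axg ?_ ?_)
  · intro k hk; exact h.above_ne (mem_range.1 hk)
  · intro k hk
    exact h.left.lv_ne (mem_range.1 (mem_of_mem_erase hk)) h.lt' (ne_of_mem_erase hk)
  · intro k hk; exact h.mid_ne (ne_of_mem_erase hk) (mem_range.1 (mem_of_mem_erase hk))
  · intro k hk
    exact h.left.lv_ne (mem_range.1 (mem_of_mem_erase hk)) h.lt (ne_of_mem_erase hk)

lemma isPos_absD (h : Raise μ p j l t T) : IsPos (absD p T j l) := by
  refine (IsPos.axg ?_ ?_).mul (IsPos.axg ?_ ?_)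
  · intro k hk; exact h.below_ne (mem_range.1 hk)
  · intro k hk
    exact h.right.lv_ne (mem_range.1 (mem_of_mem_erase hk)) h.lt (ne_of_mem_erase hk)
  · intro k hk; exact h.mid_ne' (ne_of_mem_erase hk) (mem_range.1 (mem_of_mem_erase hk))
  · intro k hk
    exact h.right.lv_ne (mem_range.1 (mem_of_mem_erase hk)) h.lt' (ne_of_mem_erase hk)

end Raise

end TwoRowCoefficients

/-! ### The gauge factor -/

section Products

open Finset

variable {R : Type*} [CommMonoid R]

lemma prod_rect_row {m n : ℕ} {f f' : ℕ → ℕ → R} {a : ℕ → R} {j : ℕ} (hj : j < m)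
    (h : ∀ i, i ≠ j → ∀ k, f' i k = f i k) (h' : ∀ k < n, f' j k = f j k * a k) :
    ∏ i ∈ range m, ∏ k ∈ range n, f' i k =
      (∏ i ∈ range m, ∏ k ∈ range n, f i k) * ∏ k ∈ range n, a k := by
  rw [← mul_prod_erase _ _ (mem_range.2 hj), ← mul_prod_erase (range m) _ (mem_range.2 hj),
    prod_congr rfl fun k hk => h' k (mem_range.1 hk), prod_mul_distrib,
    prod_congr rfl fun i hi => prod_congr rfl fun k _ => h i (ne_of_mem_erase hi) k]
  rw [mul_right_comm]

lemma prod_rect_col {m n : ℕ} {f f' : ℕ → ℕ → R} {a : ℕ → R} {l : ℕ} (hl : l < n)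
    (h : ∀ i k, k ≠ l → f' i k = f i k) (h' : ∀ i < m, f' i l = f i l * a i) :
    ∏ i ∈ range m, ∏ k ∈ range n, f' i k =
      (∏ i ∈ range m, ∏ k ∈ range n, f i k) * ∏ i ∈ range m, a i := by
  rw [prod_comm, prod_rect_row hl (fun k hk i => h i k hk) h', prod_comm]

lemma prod_rect_cross {m n : ℕ} {f f' : ℕ → ℕ → R} {a b : ℕ → R} {j l : ℕ} (hj : j < m)
    (hl : l < n) (h : ∀ i k, i ≠ j → k ≠ l → f' i k = f i k) (h0 : f' j l = f j l)
    (ha : ∀ k < n, k ≠ l → f' j k = f j k * a k) (hb : ∀ i < m, i ≠ j → f' i l * b i = f i l) :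
    (∏ i ∈ range m, ∏ k ∈ range n, f' i k) * ∏ i ∈ (range m).erase j, b i =
      (∏ i ∈ range m, ∏ k ∈ range n, f i k) * ∏ k ∈ (range n).erase l, a k := by
  have hj' := mem_range.2 hj
  have hl' := mem_range.2 hl
  have e1 : ∏ k ∈ range n, f' j k = (∏ k ∈ range n, f j k) * ∏ k ∈ (range n).erase l, a k := by
    rw [← mul_prod_erase _ _ hl', ← mul_prod_erase (range n) _ hl', h0, mul_assoc,
      ← prod_mul_distrib]
    exact congrArg _ (prod_congr rfl fun k hk =>
      ha k (mem_range.1 (mem_of_mem_erase hk)) (ne_of_mem_erase hk))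
  have e2 : (∏ i ∈ (range m).erase j, ∏ k ∈ range n, f' i k) * ∏ i ∈ (range m).erase j, b i =
      ∏ i ∈ (range m).erase j, ∏ k ∈ range n, f i k := by
    rw [← prod_mul_distrib]
    refine prod_congr rfl fun i hi => ?_
    rw [← mul_prod_erase _ _ hl', ← mul_prod_erase (range n) _ hl', mul_right_comm,
      hb i (mem_range.1 (mem_of_mem_erase hi)) (ne_of_mem_erase hi)]
    exact congrArg _ (prod_congr rfl fun k hk =>
      h i k (ne_of_mem_erase hi) (ne_of_mem_erase hk))
  rw [← mul_prod_erase _ _ hj', ← mul_prod_erase (range m) _ hj', mul_assoc, e2, e1,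
    mul_right_comm]

/-- Only the pairs containing `j` change, and symmetry allows writing all of them with `j` in second
place. The second part, for triangles not reaching `j`, starts the induction. -/
lemma prod_triangle {n : ℕ} {g g' : ℕ → ℕ → R} {j : ℕ} (hs : ∀ a b, g a b = g b a)
    (hs' : ∀ a b, g' a b = g' b a) (h : ∀ a b, a ≠ j → b ≠ j → g' a b = g a b) :
    (j < n → (∏ a ∈ range n, ∏ b ∈ range a, g' a b) * ∏ k ∈ (range n).erase j, g k j =
      (∏ a ∈ range n, ∏ b ∈ range a, g a b) * ∏ k ∈ (range n).erase j, g' k j) ∧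
    (n ≤ j → ∏ a ∈ range n, ∏ b ∈ range a, g' a b = ∏ a ∈ range n, ∏ b ∈ range a, g a b) := by
  have hrow : ∀ a, a < j → ∏ b ∈ range a, g' a b = ∏ b ∈ range a, g a b := fun a ha =>
    prod_congr rfl fun b hb => h a b (by omega) (by have := mem_range.1 hb; omega)
  induction n with
  | zero => simp
  | succ n ih =>
    refine ⟨fun hj => ?_, fun hj => ?_⟩
    · rcases Nat.lt_succ_iff_lt_or_eq.1 hj with h1 | h1
      · have e := ih.1 h1
        have e1 : (range (n + 1)).erase j = insert n ((range n).erase j) := by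
          rw [range_add_one, erase_insert_of_ne (by omega)]
        have e2 : (∏ b ∈ range n, g' n b) * g n j = (∏ b ∈ range n, g n b) * g' n j := by
          rw [← mul_prod_erase _ _ (mem_range.2 h1), ← mul_prod_erase (range n) _ (mem_range.2 h1),
            prod_congr rfl fun b hb => h n b (by omega) (ne_of_mem_erase hb)]
          rw [mul_right_comm, mul_comm (g' n j), mul_right_comm]
        rw [prod_range_succ, prod_range_succ, e1, prod_insert (by simp), prod_insert (by simp)]
        rw [mul_comm (g n j), mul_comm (g' n j), mul_mul_mul_comm, e, e2, mul_mul_mul_comm]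
      · subst h1
        rw [prod_range_succ, prod_range_succ, ih.2 le_rfl]
        have e1 : (range (j + 1)).erase j = range j := by
          rw [range_add_one, erase_insert (by simp)]
        rw [e1, prod_congr rfl fun b _ => hs' j b, prod_congr rfl fun b _ => hs b j, mul_right_comm]
    · rw [prod_range_succ, prod_range_succ, ih.2 (by omega), hrow n (by omega)]

end Products

/-! ### The squared gauge factor and its change along a transition -/

section Gauge

open Finset

/-- A product of factorials, with `wt (d - 1) = [|d|] wt d` for `d ≠ 0`. -/
def wt (d : ℤ) : ℂ⟦X⟧ :=
  if 0 ≤ d then (∏ i ∈ range d.toNat, qnum (i + 1))⁻¹ else ∏ i ∈ range (-d - 1).toNat, qnum (i + 1)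

lemma IsPos.wt (d : ℤ) : IsPos (wt d) := by
  have h (n : ℕ) : IsPos (∏ i ∈ range n, UhaInfinity.qnum ((i : ℤ) + 1)) :=
    IsPos.prod fun i _ => IsPos.qnum (by positivity)
  rw [UhaInfinity.wt]
  split_ifs
  · exact (h _).inv
  · exact h _

lemma wt_sub_one {d : ℤ} (hd : d ≠ 0) : wt (d - 1) = wt d * aq d := by
  rcases lt_or_gt_of_ne hd with h | h
  · rw [wt, wt, if_neg (by omega), if_neg (by omega), aq, abs_of_neg h,
      show (-(d - 1) - 1).toNat = (-d - 1).toNat + 1 by omega, prod_range_succ]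
    congr 2
    omega
  · have e : ∏ i ∈ range d.toNat, qnum ((i : ℤ) + 1) =
        (∏ i ∈ range (d - 1).toNat, qnum ((i : ℤ) + 1)) * aq d := by
      rw [show d.toNat = (d - 1).toNat + 1 by omega, prod_range_succ, aq, abs_of_pos h]
      congr 2
      omega
    rw [wt, wt, if_pos (by omega), if_pos h.le, e, PowerSeries.mul_inv_rev, mul_comm (aq d)⁻¹,
      mul_assoc, PowerSeries.inv_mul_cancel _ (IsPos.aq h.ne').constantCoeff_ne_zero, mul_one]

lemma wt_add_one_mul {d : ℤ} (hd : d + 1 ≠ 0) : wt (d + 1) * aq (d + 1) = wt d := by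
  rw [← wt_sub_one hd, add_sub_cancel_right]

/-- The contribution of the row `r`. -/
def gaugeA (r : ℕ) (t : Arr) : ℂ⟦X⟧ := ∏ a ∈ range r, ∏ b ∈ range a, aq (lv t r a - lv t r b)

/-- The contribution of the rows `r` and `r + 1`. -/
def gaugeB (r : ℕ) (t : Arr) : ℂ⟦X⟧ :=
  ∏ j ∈ range r, ∏ k ∈ range (r + 1), wt (lv t (r + 1) k - lv t r j)

/-- The square of the gauge factor. -/
def gaugeSq (P : ℕ) (t : Arr) : ℂ⟦X⟧ := ∏ r ∈ range P, gaugeA r t * gaugeB r t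

variable {μ : ℤ → ℤ} {t T : Arr} {p j l : ℕ}

lemma IsGT.isPos_gaugeSq (h : IsGT μ t) (P : ℕ) : IsPos (gaugeSq P t) :=
  IsPos.prod fun r _ => (IsPos.prod fun a ha => IsPos.prod fun b hb => IsPos.aq (sub_ne_zero.2
    (h.lv_ne (mem_range.1 ha) (by have := mem_range.1 ha; have := mem_range.1 hb; omega)
      (by have := mem_range.1 hb; omega)))).mul
    (IsPos.prod fun _ _ => IsPos.prod fun _ _ => IsPos.wt _)

lemma gaugeA_congr {r : ℕ} (h : lv T r = lv t r) : gaugeA r T = gaugeA r t := by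
  rw [gaugeA, gaugeA, h]

lemma gaugeB_congr {r : ℕ} (h : lv T r = lv t r) (h' : lv T (r + 1) = lv t (r + 1)) :
    gaugeB r T = gaugeB r t := by
  rw [gaugeB, gaugeB, h, h']

lemma gaugeA_move {r : ℕ} (hj : j < r) (h : ∀ k, k ≠ j → lv T r k = lv t r k) :
    gaugeA r T * ∏ k ∈ (range r).erase j, aq (lv t r k - lv t r j) =
      gaugeA r t * ∏ k ∈ (range r).erase j, aq (lv t r k - lv T r j) := by
  have := (prod_triangle (n := r) (j := j) (g := fun a b => aq (lv t r a - lv t r b))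
    (g' := fun a b => aq (lv T r a - lv T r b)) (fun _ _ => aq_sub_comm _ _)
    (fun _ _ => aq_sub_comm _ _) (fun a b ha hb => by simp only [h a ha, h b hb])).1 hj
  have e : ∏ k ∈ (range r).erase j, aq (lv T r k - lv T r j) =
      ∏ k ∈ (range r).erase j, aq (lv t r k - lv T r j) :=
    prod_congr rfl fun k hk => by rw [h k (ne_of_mem_erase hk)]
  rw [e] at this
  exact this

/-- Raising an entry of the lower row. -/
lemma gaugeB_lower {r : ℕ} (hj : j < r) (h : ∀ k, k ≠ j → lv T r k = lv t r k)
    (hj' : lv T r j = lv t r j + 1) (h' : lv T (r + 1) = lv t (r + 1))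
    (hne : ∀ k < r + 1, lv t (r + 1) k ≠ lv t r j) :
    gaugeB r T = gaugeB r t * ∏ k ∈ range (r + 1), aq (lv t (r + 1) k - lv t r j) := by
  refine prod_rect_row hj (fun i hi k => by rw [h i hi, h']) fun k hk => ?_
  rw [hj', h', ← wt_sub_one (sub_ne_zero.2 (hne k hk)), sub_add_eq_sub_sub]

/-- Raising an entry of the upper row. -/
lemma gaugeB_upper {r : ℕ} (hl : l < r + 1) (h : ∀ k, k ≠ l → lv T (r + 1) k = lv t (r + 1) k)
    (hl' : lv T (r + 1) l = lv t (r + 1) l + 1) (h' : lv T r = lv t r)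
    (hne : ∀ k < r, lv T r k ≠ lv T (r + 1) l) :
    gaugeB r T * ∏ k ∈ range r, aq (lv T r k - lv T (r + 1) l) = gaugeB r t := by
  refine (prod_rect_col hl (fun i k hk => by rw [h k hk, h']) fun i hi => ?_).symm
  have h1 := hne i hi
  rw [hl', h'] at h1 ⊢
  rw [aq_sub_comm, show lv t (r + 1) l + 1 - lv t r i = lv t (r + 1) l - lv t r i + 1 by ring,
    wt_add_one_mul (by omega)]

/-- Both `j` and `l` move, so the factor of this pair is unchanged; the rest of row `j` and of
column `l` of the rectangle each change by one q-number per factor. -/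
lemma Raise.gaugeB_mid (h : Raise μ p j l t T) :
    gaugeB p T * ∏ k ∈ (range p).erase j, aq (lv T p k - lv T (p + 1) l) =
      gaugeB p t * ∏ k ∈ (range (p + 1)).erase l, aq (lv t (p + 1) k - lv t p j) := by
  refine prod_rect_cross h.lt h.lt' (fun i k hi hk => by rw [h.lv_p_ne hi, h.lv_succ_ne hk])
    (by rw [h.lv_p, h.lv_succ, add_sub_add_right_eq_sub]) (fun k hk hkl => ?_) fun i hi hij => ?_
  · rw [h.lv_p, h.lv_succ_ne hkl, ← wt_sub_one (sub_ne_zero.2 (h.mid_ne hkl hk)),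
      sub_add_eq_sub_sub]
  · have h1 := h.mid_ne' hij hi
    rw [h.lv_succ, h.lv_p_ne hij] at h1 ⊢
    rw [aq_sub_comm, show lv t (p + 1) l + 1 - lv t p i = lv t (p + 1) l - lv t p i + 1 by ring,
      wt_add_one_mul (by omega)]

lemma prod_range_three {R : Type*} [CommMonoid R] {P : ℕ} (hp : 1 ≤ p) (hP : p + 2 ≤ P)
    (f : ℕ → R) : ∏ r ∈ range P, f r = f (p - 1) * (f p * (f (p + 1) *
      ∏ r ∈ (((range P).erase (p - 1)).erase p).erase (p + 1), f r)) := by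
  rw [mul_prod_erase, mul_prod_erase, mul_prod_erase] <;> simp <;> omega

/-- A transition changes the factors of the rows `p` and `p + 1` and of the three pairs of rows
containing one of them. Their quotients are the denominators and numerators of `absC` and `absD`.
The bound on `P` ensures that all these factors are present. -/
lemma Raise.gaugeSq_mul (h : Raise μ p j l t T) {P : ℕ} (hP : p + 2 ≤ P) :
    gaugeSq P T * absD p T j l = gaugeSq P t * absC p t j l := by
  have hp : 1 ≤ p := by have := h.lt; omega
  have a1 := gaugeA_move h.lt fun k hk => h.lv_p_ne hk
  have a2 := gaugeA_move h.lt' fun k hk => h.lv_succ_ne hk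
  have a0 : gaugeA (p - 1) T = gaugeA (p - 1) t := gaugeA_congr (h.lv_ne (by omega) (by omega))
  have b0 := gaugeB_upper (T := T) (t := t) (r := p - 1) (l := j) (by have := h.lt; omega)
    (fun k hk => by rw [Nat.sub_add_cancel hp, h.lv_p_ne hk])
    (by rw [Nat.sub_add_cancel hp, h.lv_p]) (h.lv_ne (by omega) (by omega))
    (fun k hk => by rw [Nat.sub_add_cancel hp]; exact h.below_ne hk)
  have b1 := h.gaugeB_mid
  have b2 := gaugeB_lower (T := T) (t := t) h.lt' (fun k hk => h.lv_succ_ne hk) h.lv_succ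
    (h.lv_ne (by omega) (by omega)) (fun k hk => h.above_ne hk)
  rw [Nat.sub_add_cancel hp] at b0
  have hrest : ∏ r ∈ (((range P).erase (p - 1)).erase p).erase (p + 1), gaugeA r T * gaugeB r T =
      ∏ r ∈ (((range P).erase (p - 1)).erase p).erase (p + 1), gaugeA r t * gaugeB r t := by
    refine prod_congr rfl fun r hr => ?_
    have h1 := ne_of_mem_erase hr
    have h2 := ne_of_mem_erase (mem_of_mem_erase hr)
    have h3 := ne_of_mem_erase (mem_of_mem_erase (mem_of_mem_erase hr))
    rw [gaugeA_congr (h.lv_ne h2 h1), gaugeB_congr (h.lv_ne h2 h1)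
      (h.lv_ne (by omega) (by omega))]
  have e1 : ∏ k ∈ (range p).erase j, aq (lv T p k - lv T p j) =
      ∏ k ∈ (range p).erase j, aq (lv t p k - lv T p j) :=
    prod_congr rfl fun k hk => by rw [h.lv_p_ne (ne_of_mem_erase hk)]
  have e2 : ∏ k ∈ (range (p + 1)).erase l, aq (lv T (p + 1) k - lv T (p + 1) l) =
      ∏ k ∈ (range (p + 1)).erase l, aq (lv t (p + 1) k - lv T (p + 1) l) :=
    prod_congr rfl fun k hk => by rw [h.lv_succ_ne (ne_of_mem_erase hk)]
  have n1 : IsPos (∏ k ∈ (range p).erase j, aq (lv t p k - lv t p j)) :=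
    IsPos.prod fun k hk => IsPos.aq (sub_ne_zero.2
      (h.left.lv_ne (mem_range.1 (mem_of_mem_erase hk)) h.lt (ne_of_mem_erase hk)))
  have n2 : IsPos (∏ k ∈ (range (p + 1)).erase l, aq (lv t (p + 1) k - lv t (p + 1) l)) :=
    IsPos.prod fun k hk => IsPos.aq (sub_ne_zero.2
      (h.left.lv_ne (mem_range.1 (mem_of_mem_erase hk)) h.lt' (ne_of_mem_erase hk)))
  have n3 : IsPos (∏ k ∈ (range p).erase j, aq (lv T p k - lv T p j)) :=
    IsPos.prod fun k hk => IsPos.aq (sub_ne_zero.2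
      (h.right.lv_ne (mem_range.1 (mem_of_mem_erase hk)) h.lt (ne_of_mem_erase hk)))
  have n4 : IsPos (∏ k ∈ (range (p + 1)).erase l, aq (lv T (p + 1) k - lv T (p + 1) l)) :=
    IsPos.prod fun k hk => IsPos.aq (sub_ne_zero.2
      (h.right.lv_ne (mem_range.1 (mem_of_mem_erase hk)) h.lt' (ne_of_mem_erase hk)))
  rw [gaugeSq, gaugeSq, prod_range_three hp hP, prod_range_three hp hP, hrest, absC, absD, axg, axg,
    axg, axg, a0]
  rw [← e1] at a1
  rw [← e2] at a2
  have m1 := PowerSeries.mul_inv_cancel _ n1.constantCoeff_ne_zero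
  have m2 := PowerSeries.mul_inv_cancel _ n2.constantCoeff_ne_zero
  have m3 := PowerSeries.mul_inv_cancel _ n3.constantCoeff_ne_zero
  have m4 := PowerSeries.mul_inv_cancel _ n4.constantCoeff_ne_zero
  generalize (∏ k ∈ (range p).erase j, aq (lv t p k - lv t p j))⁻¹ = i1 at *
  generalize (∏ k ∈ (range (p + 1)).erase l, aq (lv t (p + 1) k - lv t (p + 1) l))⁻¹ = i2 at *
  generalize (∏ k ∈ (range p).erase j, aq (lv T p k - lv T p j))⁻¹ = i3 at *
  generalize (∏ k ∈ (range (p + 1)).erase l, aq (lv T (p + 1) k - lv T (p + 1) l))⁻¹ = i4 at *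
  generalize (∏ k ∈ (range p).erase j, aq (lv t p k - lv t p j)) = x1 at *
  generalize (∏ k ∈ (range (p + 1)).erase l, aq (lv t (p + 1) k - lv t (p + 1) l)) = x2 at *
  generalize (∏ k ∈ (range p).erase j, aq (lv T p k - lv T p j)) = x3 at *
  generalize (∏ k ∈ (range (p + 1)).erase l, aq (lv T (p + 1) k - lv T (p + 1) l)) = x4 at *
  have c1 : gaugeA p T * i3 = gaugeA p t * i1 := by
    linear_combination i1 * i3 * a1 + gaugeA p t * i1 * m3 - gaugeA p T * i3 * m1
  have c2 : gaugeA (p + 1) T * i4 = gaugeA (p + 1) t * i2 := by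
    linear_combination i2 * i4 * a2 + gaugeA (p + 1) t * i2 * m4 - gaugeA (p + 1) T * i4 * m2
  generalize ∏ r ∈ (((range P).erase (p - 1)).erase p).erase (p + 1), gaugeA r t * gaugeB r t = rest
  generalize ∏ k ∈ range (p - 1), aq (lv T (p - 1) k - lv T p j) = y0 at *
  generalize ∏ k ∈ (range p).erase j, aq (lv T p k - lv T (p + 1) l) = y1 at *
  generalize ∏ k ∈ (range (p + 1)).erase l, aq (lv t (p + 1) k - lv t p j) = y2 at *
  generalize ∏ k ∈ range (p + 1 + 1), aq (lv t (p + 1 + 1) k - lv t (p + 1) l) = y3 at *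
  calc _ = gaugeA (p - 1) t * (gaugeB (p - 1) T * y0) * (gaugeA p T * i3) * (gaugeB p T * y1) *
        (gaugeA (p + 1) T * i4) * gaugeB (p + 1) T * rest := by ring
    _ = _ := by rw [b0, c1, b1, c2, b2]; ring

/-- The transitions in the first row. -/
lemma gaugeSq_first (h : IsGT μ t) (h' : IsGT μ (bump t 1 1 0)) {P : ℕ} (hP : 2 ≤ P) :
    gaugeSq P (bump t 1 1 0) = gaugeSq P t * ∏ k ∈ range 2, aq (lv t 2 k - lv t 1 0) := by
  have b := gaugeB_lower (T := bump t 1 1 0) (t := t) (r := 1) (j := 0) one_pos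
    (fun k hk => lv_bump_ne _ _ _ hk) (lv_bump_self _ _ _ _) (lv_bump_row_ne _ _ _ (by omega))
    (fun k hk => by
      rcases Nat.lt_or_ge 0 k with h1 | h1
      · exact (h.lv_lt h1 hk).ne
      · have := h'.lv_le (p := 1) one_pos h1
        rw [lv_bump_self, lv_bump_row_ne _ _ _ (by omega)] at this
        have h2 : lv t (1 + 1) k = lv t 2 k := rfl
        omega)
  rw [gaugeSq, gaugeSq, ← mul_prod_erase _ _ (mem_range.2 (show 1 < P by omega)), b,
    ← mul_prod_erase (range P) _ (mem_range.2 (show 1 < P by omega))]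
  have e1 : gaugeA 1 (bump t 1 1 0) = gaugeA 1 t := by simp [gaugeA]
  have e2 : ∏ r ∈ (range P).erase 1, gaugeA r (bump t 1 1 0) * gaugeB r (bump t 1 1 0) =
      ∏ r ∈ (range P).erase 1, gaugeA r t * gaugeB r t := by
    refine prod_congr rfl fun r hr => ?_
    have h1 := ne_of_mem_erase hr
    rw [gaugeA_congr (lv_bump_row_ne _ _ _ h1)]
    rcases Nat.eq_zero_or_pos r with rfl | h2
    · simp [gaugeB]
    · rw [gaugeB_congr (lv_bump_row_ne _ _ _ h1) (lv_bump_row_ne _ _ _ (by omega))]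
  rw [e1, e2]
  ring

end Gauge

/-! ### The operators with symmetric coefficients -/

section Symmetric

open Finset

variable {μ : ℤ → ℤ} {t T : Arr} {p j l P : ℕ}

/-- The triangular numbers. -/
def tri (n : ℤ) : ℤ := n * (n + 1) / 2

lemma tri_succ (n : ℤ) : tri (n + 1) = tri n + (n + 1) := by
  rw [tri, tri, show (n + 1) * (n + 1 + 1) = n * (n + 1) + (n + 1) * 2 by ring,
    Int.add_mul_ediv_right _ _ (by norm_num)]

/-- The exponent of `q` in the gauge factor. -/
def phase (P : ℕ) (t : Arr) : ℤ := ∑ r ∈ range P, eps r * ∑ a ∈ range r, tri (lv t r a)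

lemma sum_tri_move {r : ℕ} (hj : j < r) (h : ∀ k, k ≠ j → lv T r k = lv t r k)
    (hj' : lv T r j = lv t r j + 1) :
    ∑ a ∈ range r, tri (lv T r a) = ∑ a ∈ range r, tri (lv t r a) + (lv t r j + 1) := by
  rw [← add_sum_erase _ _ (mem_range.2 hj), ← add_sum_erase (range r) _ (mem_range.2 hj), hj',
    tri_succ, sum_congr rfl fun k hk => by rw [h k (ne_of_mem_erase hk)]]
  ring

/-- Triangular numbers grow linearly under a unit step. As the rows `p` and `p + 1` carry opposite
signs, the growth is the difference of the two moved entries, the exponent of q in the matrix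
coefficients of `eop`. -/
lemma Raise.phase_eq (h : Raise μ p j l t T) (hP : p + 2 ≤ P) :
    phase P T = phase P t + -eps p * (lv t (p + 1) l - lv t p j) := by
  have h1 := sum_tri_move h.lt (fun k hk => h.lv_p_ne hk) h.lv_p
  have h2 := sum_tri_move h.lt' (fun k hk => h.lv_succ_ne hk) h.lv_succ
  have m1 : p ∈ range P := mem_range.2 (by omega)
  have m2 : p + 1 ∈ (range P).erase p := mem_erase.2 ⟨by omega, mem_range.2 (by omega)⟩
  have h3 : ∑ r ∈ ((range P).erase p).erase (p + 1), eps r * ∑ a ∈ range r, tri (lv T r a) =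
      ∑ r ∈ ((range P).erase p).erase (p + 1), eps r * ∑ a ∈ range r, tri (lv t r a) :=
    sum_congr rfl fun r hr => by
      rw [h.lv_ne (ne_of_mem_erase (mem_of_mem_erase hr)) (ne_of_mem_erase hr)]
  rw [phase, phase, ← add_sum_erase _ _ m1, ← add_sum_erase _ _ m2, ← add_sum_erase (range P) _ m1,
    ← add_sum_erase ((range P).erase p) _ m2, h1, h2, h3, eps_succ]
  ring

lemma phase_first (t : Arr) (hP : 2 ≤ P) :
    phase P (bump t 1 1 0) = phase P t + eps 1 * (t 1 0 + 1) := by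
  have h1 := sum_tri_move (T := bump t 1 1 0) (t := t) (r := 1) (j := 0) one_pos
    (fun k hk => lv_bump_ne _ _ _ hk) (lv_bump_self _ _ _ _)
  have m1 : 1 ∈ range P := mem_range.2 (by omega)
  have h3 : ∑ r ∈ (range P).erase 1, eps r * ∑ a ∈ range r, tri (lv (bump t 1 1 0) r a) =
      ∑ r ∈ (range P).erase 1, eps r * ∑ a ∈ range r, tri (lv t r a) :=
    sum_congr rfl fun r hr => by rw [lv_bump_row_ne _ _ _ (ne_of_mem_erase hr)]
  rw [phase, phase, ← add_sum_erase _ _ m1, ← add_sum_erase (range P) _ m1, h1, h3]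
  simp only [lv]
  push_cast
  ring

/-- The gauge factor for the first `P` rows. -/
def gauge (P : ℕ) (t : Arr) : ℂ⟦X⟧ := psSqrt (gaugeSq P t) * qz (phase P t)

lemma IsGT.isPos_gauge (h : IsGT μ t) (P : ℕ) : IsPos (gauge P t) :=
  (h.isPos_gaugeSq P).psSqrt.mul (IsPos.qz _)

/-- The operator with `kz t ↦ ∑ c t j l • kz (t + s δ_{p,j} + s δ_{p+1,l})`. -/
def pairOp (μ : ℤ → ℤ) (s : ℤ) (p : ℕ) (c : Arr → ℕ → ℕ → ℂ⟦X⟧) : Module.End ℂ⟦X⟧ (Mod μ) :=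
  Finsupp.linearCombination ℂ⟦X⟧ fun g : GT μ => ∑ j ∈ range p, ∑ l ∈ range (p + 1),
    c g.1 j l • kz μ (bump (bump g.1 s p j) s (p + 1) l)

lemma pairOp_kz (s : ℤ) (p : ℕ) (c : Arr → ℕ → ℕ → ℂ⟦X⟧) (h : IsGT μ t) :
    pairOp μ s p c (kz μ t) = ∑ j ∈ range p, ∑ l ∈ range (p + 1),
      c t j l • kz μ (bump (bump t s p j) s (p + 1) l) := by
  rw [show t = (⟨t, h⟩ : GT μ).1 from rfl, kz_of, pairOp, Finsupp.linearCombination_single,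
    one_smul]

/-- Raise entries of the rows `p` and `p + 1`, with symmetric coefficients. -/
def eact (μ : ℤ → ℤ) : ℕ → Module.End ℂ⟦X⟧ (Mod μ)
  | 0 => shiftOp μ 1 1 fun t _ => psSqrt (∏ k ∈ range 2, aq (lv t 2 k - lv t 1 0))
  | p + 1 => pairOp μ 1 (p + 1) fun t j l => sg j l * psSqrt (absC (p + 1) t j l *
      absD (p + 1) (bump (bump t 1 (p + 1) j) 1 (p + 2) l) j l)

/-- Lower entries of the rows `p` and `p + 1`, with symmetric coefficients. -/
def fact (μ : ℤ → ℤ) : ℕ → Module.End ℂ⟦X⟧ (Mod μ)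
  | 0 => shiftOp μ (-1) 1 fun t _ => psSqrt (∏ k ∈ range 2, aq (lv t 2 k - (lv t 1 0 - 1)))
  | p + 1 => pairOp μ (-1) (p + 1) fun t j l => sg j l *
      psSqrt (absC (p + 1) (bump (bump t (-1) (p + 1) j) (-1) (p + 2) l) j l * absD (p + 1) t j l)

/-- The two orders of the moves have the same coefficients except for one q-number, which is [d + 1]
or [d]. Their q-commutator replaces it by q^{-εd}. -/
lemma eop_kz (ht : IsGT μ t) (p : ℕ) : eop μ (p + 1) (kz μ t) =
    ∑ j ∈ range (p + 1), ∑ l ∈ range (p + 2), (coefC (p + 1) t j l *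
      qz (-eps (p + 1) * (lv t (p + 2) l - lv t (p + 1) j))) •
        kz μ (bump (bump t 1 (p + 1) j) 1 (p + 2) l) := by
  have hG : Governs 1 (p + 1) (p + 1) (p + 2) (p + 3) := Or.inl ⟨rfl, rfl, rfl, rfl⟩
  rw [eop, qComm, LinearMap.sub_apply, LinearMap.smul_apply, xop, xop, shiftOp_mul_kz,
    shiftOp_mul_kz, sum_comm (s := range (p + 2)), smul_sum, ← sum_sub_distrib]
  refine sum_congr rfl fun j hj => ?_
  rw [smul_sum, ← sum_sub_distrib]
  refine sum_congr rfl fun l hl => ?_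
  rw [mem_range] at hj hl
  rw [bump_comm t 1 1 (p + 2)]
  by_cases hT : IsGT μ (bump (bump t 1 (p + 1) j) 1 (p + 2) l)
  swap
  · simp [kz_eq_zero hT]
  have hT' := hT
  rw [bump_comm] at hT'
  rw [smul_smul, ← sub_smul]
  congr 1
  have e1 : hat μ 1 (p + 2) (cg (p + 2) (p + 2 + 1)) t l *
      hat μ 1 (p + 1) (cg (p + 1) (p + 1 + 1)) (bump t 1 (p + 2) l) j = _ :=
    hat_mul_hat ht hT' fun a b =>
      Step.isGT_mid hG.sign (hG.step' hl t _) (hG.step hj _) ht hT' a b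
  have e2 : hat μ 1 (p + 1) (cg (p + 1) (p + 1 + 1)) t j *
      hat μ 1 (p + 2) (cg (p + 2) (p + 2 + 1)) (bump t 1 (p + 1) j) l = _ :=
    hat_mul_hat ht hT fun a b =>
      Step.isGT_mid hG.sign (hG.step hj t) (hG.step' hl _ _) ht hT a b
  have c1 : cg (p + 1) (p + 2) t j = _ :=
    cg_split_left (t := t) (j := j) hl (fun _ _ => rfl) fun _ _ => rfl
  have c2 : cg (p + 1) (p + 2) (bump t 1 (p + 2) l) j = _ := cg_split_left (t := t) (j := j) hl
    (fun k hk => lv_bump_ne t 1 (p + 2) hk) (fun k hk => by rw [lv_bump_row_ne t _ l (by omega)])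
  have c3 : cg (p + 2) (p + 2 + 1) (bump t 1 (p + 1) j) l = cg (p + 2) (p + 2 + 1) t l :=
    cg_bump_row_ne 1 (by omega) (by omega) l
  rw [e1, e2, c3, coefC, c1, c2, lv_bump_self, lv_bump_row_ne t _ l (by omega)]
  have e := qnum_succ_sub_qz (eps_sign (p + 1)) (lv t (p + 2) l - lv t (p + 1) j)
  rw [show lv t (p + 2) l + 1 - lv t (p + 1) j = lv t (p + 2) l - lv t (p + 1) j + 1 by ring]
  generalize xg _ _ _ _ (lv t (p + 1) j) = x
  linear_combination (cg (p + 2) (p + 3) t l * x) * e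

lemma fop_kz (ht : IsGT μ t) (p : ℕ) : fop μ (p + 1) (kz μ t) =
    ∑ j ∈ range (p + 1), ∑ l ∈ range (p + 2), (-(coefD (p + 1) t j l) *
      qz (eps (p + 1) * (lv t (p + 2) l - lv t (p + 1) j))) •
        kz μ (bump (bump t (-1) (p + 1) j) (-1) (p + 2) l) := by
  rw [fop, qComm, LinearMap.sub_apply, LinearMap.smul_apply, yop, yop, neg_mul_neg, neg_mul_neg,
    shiftOp_mul_kz, shiftOp_mul_kz, sum_comm (s := range (p + 2)), smul_sum, ← sum_sub_distrib]
  refine sum_congr rfl fun j hj => ?_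
  rw [smul_sum, ← sum_sub_distrib]
  refine sum_congr rfl fun l hl => ?_
  rw [mem_range] at hj hl
  rw [bump_comm t (-1) (-1) (p + 2)]
  by_cases hT : IsGT μ (bump (bump t (-1) (p + 1) j) (-1) (p + 2) l)
  swap
  · simp [kz_eq_zero hT]
  have hT' := hT
  rw [bump_comm] at hT'
  rw [smul_smul, ← sub_smul]
  congr 1
  have hG : Governs (-1) (p + 1) (p + 2) (p + 1) p := Or.inr ⟨rfl, rfl, rfl, rfl⟩
  have e1 : hat μ (-1) (p + 2) (cg (p + 2) (p + 2 - 1)) t l *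
      hat μ (-1) (p + 1) (cg (p + 1) (p + 1 - 1)) (bump t (-1) (p + 2) l) j = _ :=
    hat_mul_hat ht hT' fun a b =>
      Step.isGT_mid hG.sign (hG.step hl t) (hG.step' hj _ _) ht hT' a b
  have e2 : hat μ (-1) (p + 1) (cg (p + 1) (p + 1 - 1)) t j *
      hat μ (-1) (p + 2) (cg (p + 2) (p + 2 - 1)) (bump t (-1) (p + 1) j) l = _ :=
    hat_mul_hat ht hT fun a b =>
      Step.isGT_mid hG.sign (hG.step' hj t _) (hG.step hl _) ht hT a b
  have c1 : cg (p + 2) (p + 1) t l = _ :=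
    cg_split_left (t := t) (j := l) hj (fun _ _ => rfl) fun _ _ => rfl
  have c2 : cg (p + 2) (p + 1) (bump t (-1) (p + 1) j) l = _ := cg_split_left (t := t) (j := l) hj
    (fun k hk => lv_bump_ne t (-1) (p + 1) hk) (fun k hk => by rw [lv_bump_row_ne t _ j (by omega)])
  have c3 : cg (p + 1) (p + 1 - 1) (bump t (-1) (p + 2) l) j = cg (p + 1) (p + 1 - 1) t j :=
    cg_bump_row_ne (-1) (by omega) (by omega) j
  rw [e1, e2, c3, coefD, show p + 2 - 1 = p + 1 from rfl,
    c1, c2, lv_bump_self, lv_bump_row_ne t _ j (by omega)]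
  have e := qnum_succ_sub_qz (ε := -eps (p + 1)) (by have := eps_sign (p + 1); omega)
    (lv t (p + 2) l - lv t (p + 1) j)
  rw [show lv t (p + 1) j + -1 - lv t (p + 2) l = -(lv t (p + 2) l - lv t (p + 1) j + 1) by ring,
    show lv t (p + 1) j - lv t (p + 2) l = -(lv t (p + 2) l - lv t (p + 1) j) by ring, qnum_neg,
    qnum_neg]
  rw [neg_neg] at e
  generalize xg _ _ _ _ (lv t (p + 2) l) = x
  linear_combination (-cg (p + 1) (p + 1 - 1) t j * x) * e

/-- The passage from an unsymmetric pair of coefficients `c`, `d` to their geometric mean, with `a`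
and `b` the squared gauge factors at the two ends. Both sides have positive constant term and equal
squares. -/
lemma mul_psSqrt_eq {a b c d : ℂ⟦X⟧} (ha : IsPos a) (hb : IsPos b) (hc : IsPos c) (hd : IsPos d)
    (h : b * d = a * c) : psSqrt b * psSqrt (c * d) = psSqrt a * c := by
  refine IsPos.eq_of_sq (hb.psSqrt.mul (hc.mul hd).psSqrt) (ha.psSqrt.mul hc) ?_
  rw [mul_pow, mul_pow, psSqrt_sq hb, psSqrt_sq (hc.mul hd), psSqrt_sq ha]
  linear_combination c * h

lemma Raise.gauge_mul (h : Raise μ p j l t T) (hP : p + 2 ≤ P) :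
    gauge P T * psSqrt (absC p t j l * absD p T j l) =
      gauge P t * (absC p t j l * qz (-eps p * (lv t (p + 1) l - lv t p j))) := by
  have := mul_psSqrt_eq (h.left.isPos_gaugeSq P) (h.right.isPos_gaugeSq P) h.isPos_absC h.isPos_absD
    (h.gaugeSq_mul hP)
  rw [gauge, gauge, h.phase_eq hP, qz_add]
  linear_combination qz (phase P t) * qz (-eps p * (lv t (p + 1) l - lv t p j)) * this

lemma Raise.gauge_mul' (h : Raise μ p j l t T) (hP : p + 2 ≤ P) :
    gauge P t * psSqrt (absC p t j l * absD p T j l) =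
      gauge P T * (absD p T j l * qz (eps p * (lv T (p + 1) l - lv T p j))) := by
  have := mul_psSqrt_eq (h.right.isPos_gaugeSq P) (h.left.isPos_gaugeSq P) h.isPos_absD h.isPos_absC
    (h.gaugeSq_mul hP).symm
  rw [gauge, gauge, h.phase_eq hP, qz_add, h.lv_p, h.lv_succ, mul_comm (absC p t j l),
    add_sub_add_right_eq_sub]
  have e := qz_mul_neg' (eps p * (lv t (p + 1) l - lv t p j))
  rw [← neg_mul] at e
  linear_combination qz (phase P t) * this -
    psSqrt (gaugeSq P T) * qz (phase P t) * absD p T j l * e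

lemma cg_first (h : IsGT μ t) : cg 1 2 t 0 = ∏ k ∈ range 2, aq (lv t 2 k - lv t 1 0) := by
  rw [cg, xg, prod_qnum_eq (m := 1), sgp_range (by omega)]
  · simp
  · intro k _ hk
    have : lv t 1 0 ≤ lv t 2 k := h.lv_le one_pos (by omega)
    omega
  · intro k hk hk'
    have : lv t 2 k < lv t 1 0 := h.lv_lt (p := 1) (by omega) (mem_range.1 hk)
    omega

lemma isPos_first (h : IsGT μ t) (h' : IsGT μ (bump t 1 1 0)) :
    IsPos (∏ k ∈ range 2, aq (lv t 2 k - lv t 1 0)) :=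
  IsPos.of_mul_left (h.isPos_gaugeSq 2) (by
    rw [← gaugeSq_first h h' le_rfl]; exact h'.isPos_gaugeSq 2)

lemma gauge_first (h : IsGT μ t) (h' : IsGT μ (bump t 1 1 0)) (hP : 2 ≤ P) :
    gauge P (bump t 1 1 0) * psSqrt (∏ k ∈ range 2, aq (lv t 2 k - lv t 1 0)) =
      gauge P t * ((∏ k ∈ range 2, aq (lv t 2 k - lv t 1 0)) * qz (eps 1 * (t 1 0 + 1))) := by
  have := mul_psSqrt_eq (h.isPos_gaugeSq P) (h'.isPos_gaugeSq P) (isPos_first h h') IsPos.one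
    (by rw [mul_one, gaugeSq_first h h' hP])
  rw [mul_one] at this
  rw [gauge, gauge, phase_first t hP, qz_add]
  linear_combination qz (phase P t) * qz (eps 1 * (t 1 0 + 1)) * this

lemma gauge_first' (h : IsGT μ t) (h' : IsGT μ (bump t 1 1 0)) (hP : 2 ≤ P) :
    gauge P t * psSqrt (∏ k ∈ range 2, aq (lv t 2 k - lv t 1 0)) =
      gauge P (bump t 1 1 0) * qz (-eps 1 * (t 1 0 + 1)) := by
  have := mul_psSqrt_eq (h'.isPos_gaugeSq P) (h.isPos_gaugeSq P) IsPos.one (isPos_first h h')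
    (by rw [mul_one, gaugeSq_first h h' hP])
  rw [one_mul, mul_one] at this
  rw [gauge, gauge, phase_first t hP, qz_add]
  have e := qz_mul_neg (eps 1 * (t 1 0 + 1))
  rw [← neg_mul] at e
  linear_combination qz (phase P t) * this - psSqrt (gaugeSq P (bump t 1 1 0)) * qz (phase P t) * e

lemma diag_gauge_eact (hP : p + 2 ≤ P) :
    diag μ (gauge P) * eact μ p = eop μ p * diag μ (gauge P) := by
  refine Mod.hom_ext fun t ht => ?_
  rcases p with _ | p
  · simp only [Module.End.mul_apply, diag_kz, map_smul, eact, eop, shiftOp_kz, rop, xop,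
      sum_range_one]
    rw [smul_smul, smul_smul, smul_smul]
    by_cases hT : IsGT μ (bump t 1 1 0)
    swap
    · rw [kz_eq_zero hT, smul_zero, smul_zero]
    rw [hat_of ht hT, hat_of ht hT, mul_comm, gauge_first ht hT hP, cg_first ht,
      rs_bump_self t 1 one_pos, mul_assoc]
    simp [rs]
  · simp only [Module.End.mul_apply, diag_kz, map_smul, eact]
    rw [pairOp_kz _ _ _ ht, eop_kz ht, map_sum, smul_sum]
    refine sum_congr rfl fun j hj => ?_
    rw [map_sum, smul_sum]
    refine sum_congr rfl fun l hl => ?_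
    rw [map_smul, diag_kz, smul_smul, smul_smul]
    by_cases hT : IsGT μ (bump (bump t 1 (p + 1) j) 1 (p + 2) l)
    swap
    · rw [kz_eq_zero hT, smul_zero, smul_zero]
    have h : Raise μ (p + 1) j l t _ := ⟨mem_range.1 hj, mem_range.1 hl, ht, hT, rfl⟩
    rw [h.coefC_eq, mul_assoc (sg j l), mul_comm (psSqrt _), h.gauge_mul hP]
    congr 1
    ring

lemma diag_gauge_fact (hP : p + 2 ≤ P) :
    diag μ (gauge P) * fact μ p = fop μ p * diag μ (gauge P) := by
  refine Mod.hom_ext fun t ht => ?_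
  rcases p with _ | p
  · simp only [Module.End.mul_apply, diag_kz, map_smul, fact, fop, shiftOp_kz, rop, yop,
      sum_range_one, LinearMap.neg_apply]
    by_cases hT : IsGT μ (bump t (-1) 1 0)
    swap
    · rw [kz_eq_zero hT]; simp
    have h1 := gauge_first' (t := bump t (-1) 1 0) hT (by rwa [bump_neg_bump]) hP
    rw [bump_neg_bump, lv_bump_self, lv_bump_row_ne _ _ _ (by omega)] at h1
    have h2 : bump t (-1) 1 0 1 0 + 1 = t 1 0 := by simp [bump]
    have h3 : cg 1 (1 - 1) t 0 = -1 := by simp [cg, xg]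
    rw [h2, ← sub_eq_add_neg] at h1
    rw [hat_of ht hT, hat_of ht hT, h3, neg_one_smul, neg_neg, smul_smul, smul_smul, mul_comm, h1]
    simp [rs]
  · simp only [Module.End.mul_apply, diag_kz, map_smul, fact]
    rw [pairOp_kz _ _ _ ht, fop_kz ht, map_sum, smul_sum]
    refine sum_congr rfl fun j hj => ?_
    rw [map_sum, smul_sum]
    refine sum_congr rfl fun l hl => ?_
    rw [map_smul, diag_kz, smul_smul, smul_smul]
    by_cases hT : IsGT μ (bump (bump t (-1) (p + 1) j) (-1) (p + 2) l)
    swap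
    · rw [kz_eq_zero hT, smul_zero, smul_zero]
    have h : Raise μ (p + 1) j l _ t := ⟨mem_range.1 hj, mem_range.1 hl, hT, ht, by
      rw [bump_comm _ _ 1, bump_neg_bump, bump_neg_bump]⟩
    rw [h.coefD_eq, mul_assoc (sg j l), mul_comm (psSqrt _), h.gauge_mul' hP]
    congr 1
    ring

/-- Conjugation by the gauge factor. -/
def gaugeHom (μ : ℤ → ℤ) (P : ℕ) : Module.End ℂ⟦X⟧ (Mod μ) →ₐ[ℂ⟦X⟧] Module.End ℂ⟦X⟧ (Mod μ) :=
  have h : diag μ (gauge P) * diag μ (fun t => (gauge P t)⁻¹) = 1 := by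
    rw [diag_mul, ← diag_one]
    exact diag_congr fun t ht => PowerSeries.mul_inv_cancel _ (ht.isPos_gauge P).constantCoeff_ne_zero
  have h' : diag μ (fun t => (gauge P t)⁻¹) * diag μ (gauge P) = 1 := by
    rw [diag_mul, ← diag_one]
    exact diag_congr fun t ht => PowerSeries.inv_mul_cancel _ (ht.isPos_gauge P).constantCoeff_ne_zero
  AlgHom.ofLinearMap
    { toFun := fun a => diag μ (fun t => (gauge P t)⁻¹) * a * diag μ (gauge P)
      map_add' := fun a b => by rw [mul_add, add_mul]
      map_smul' := fun c a => by rw [mul_smul_comm, smul_mul_assoc]; rfl }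
    (by simp [h'])
    (fun a b => by
      simp only [LinearMap.coe_mk, AddHom.coe_mk]
      rw [mul_assoc (_ * a), ← mul_assoc (diag μ (gauge P)), ← mul_assoc (diag μ (gauge P)), h,
        one_mul, mul_assoc, mul_assoc, mul_assoc])

lemma gaugeHom_apply (P : ℕ) (a : Module.End ℂ⟦X⟧ (Mod μ)) :
    gaugeHom μ P a = diag μ (fun t => (gauge P t)⁻¹) * a * diag μ (gauge P) := rfl

lemma gaugeHom_of_semiconj {a b : Module.End ℂ⟦X⟧ (Mod μ)}
    (h : diag μ (gauge P) * a = b * diag μ (gauge P)) : gaugeHom μ P b = a := by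
  have h' : diag μ (fun t => (gauge P t)⁻¹) * diag μ (gauge P) = 1 := by
    rw [diag_mul, ← diag_one]
    exact diag_congr fun t ht => PowerSeries.inv_mul_cancel _ (ht.isPos_gauge P).constantCoeff_ne_zero
  rw [gaugeHom_apply, mul_assoc, ← h, ← mul_assoc, h', one_mul]

lemma gaugeHom_eop (hP : p + 2 ≤ P) : gaugeHom μ P (eop μ p) = eact μ p :=
  gaugeHom_of_semiconj (diag_gauge_eact hP)

lemma gaugeHom_fop (hP : p + 2 ≤ P) : gaugeHom μ P (fop μ p) = fact μ p :=
  gaugeHom_of_semiconj (diag_gauge_fact hP)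

lemma gaugeHom_diag (f : Arr → ℂ⟦X⟧) : gaugeHom μ P (diag μ f) = diag μ f :=
  gaugeHom_of_semiconj (commute_diag _ _).eq

end Symmetric

/-! ### The Chevalley generators as operators on arrays -/

section Chevalley

variable {μ : ℤ → ℤ} {p p' : ℕ}

lemma commute_eop (h : p' ≠ p + 2) (h' : p ≠ p' + 2) : Commute (eop μ p) (eop μ p') := by
  rcases lt_trichotomy p p' with h1 | rfl | h1
  · rcases Nat.lt_or_ge (p + 1) p' with h2 | h2
    · exact commute_eop_far (by omega)
    · obtain rfl : p' = p + 1 := by omega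
      exact commute_eop_succ p
  · exact Commute.refl _
  · rcases Nat.lt_or_ge (p' + 1) p with h2 | h2
    · exact (commute_eop_far (by omega)).symm
    · obtain rfl : p = p' + 1 := by omega
      exact (commute_eop_succ p').symm

lemma commute_fop (h : p' ≠ p + 2) (h' : p ≠ p' + 2) : Commute (fop μ p) (fop μ p') := by
  rcases lt_trichotomy p p' with h1 | rfl | h1
  · rcases Nat.lt_or_ge (p + 1) p' with h2 | h2
    · exact commute_fop_far (by omega)
    · obtain rfl : p' = p + 1 := by omega
      exact commute_fop_succ p
  · exact Commute.refl _
  · rcases Nat.lt_or_ge (p' + 1) p with h2 | h2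
    · exact (commute_fop_far (by omega)).symm
    · obtain rfl : p = p' + 1 := by omega
      exact (commute_fop_succ p').symm

lemma commute_eop_fop (h : p ≠ p') (h1 : ¬(p = 0 ∧ p' = 1)) (h2 : ¬(p = 1 ∧ p' = 0)) :
    Commute (eop μ p) (fop μ p') := by
  rcases lt_or_gt_of_ne h with h3 | h3
  · rcases Nat.lt_or_ge (p + 1) p' with h4 | h4
    · exact commute_eop_fop_far (by omega)
    · obtain ⟨r, rfl⟩ : ∃ r, p = r + 1 := ⟨p - 1, by omega⟩
      obtain rfl : p' = r + 2 := by omega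
      exact commute_eop_fop_succ r
  · rcases Nat.lt_or_ge (p' + 1) p with h4 | h4
    · exact (commute_fop_eop_far (by omega)).symm
    · obtain ⟨r, rfl⟩ : ∃ r, p' = r + 1 := ⟨p' - 1, by omega⟩
      obtain rfl : p = r + 2 := by omega
      exact (commute_fop_eop_succ r).symm

/-- The generators `e_i` before the change of gauge. -/
def eGen (μ : ℤ → ℤ) : ℤ → Module.End ℂ⟦X⟧ (Mod μ)
  | Int.ofNat n => eop μ (2 * n + 1)
  | Int.negSucc n => fop μ (2 * n)

/-- The generators `f_i` before the change of gauge. -/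
def fGen (μ : ℤ → ℤ) : ℤ → Module.End ℂ⟦X⟧ (Mod μ)
  | Int.ofNat n => fop μ (2 * n + 1)
  | Int.negSucc n => eop μ (2 * n)

/-- The generators `e_i`. -/
def eAct (μ : ℤ → ℤ) : ℤ → Module.End ℂ⟦X⟧ (Mod μ)
  | Int.ofNat n => eact μ (2 * n + 1)
  | Int.negSucc n => fact μ (2 * n)

/-- The generators `f_i`. -/
def fAct (μ : ℤ → ℤ) : ℤ → Module.End ℂ⟦X⟧ (Mod μ)
  | Int.ofNat n => fact μ (2 * n + 1)
  | Int.negSucc n => eact μ (2 * n)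

lemma gaugeHom_eGen {i : ℤ} {P : ℕ} (h : 2 * i.natAbs + 3 ≤ P) :
    gaugeHom μ P (eGen μ i) = eAct μ i := by
  rcases i with n | n
  · exact gaugeHom_eop (by simp at h; omega)
  · exact gaugeHom_fop (by simp at h; omega)

lemma gaugeHom_fGen {i : ℤ} {P : ℕ} (h : 2 * i.natAbs + 3 ≤ P) :
    gaugeHom μ P (fGen μ i) = fAct μ i := by
  rcases i with n | n
  · exact gaugeHom_fop (by simp at h; omega)
  · exact gaugeHom_eop (by simp at h; omega)

lemma Serre.map {R A B : Type*} [CommRing R] [Ring A] [Algebra R A] [Ring B] [Algebra R B]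
    (φ : A →ₐ[R] B) {c : R} {a b : A} (h : Serre c a b) : Serre c (φ a) (φ b) := by
  have := congrArg φ h
  simp only [map_add, map_sub, map_smul, map_mul, map_zero] at this
  exact this

lemma commute_eGen {i j : ℤ} (h : |i - j| ≠ 1) : Commute (eGen μ i) (eGen μ j) := by
  rcases i with m | m <;> rcases j with n | n <;> simp only [Int.negSucc_eq, Int.ofNat_eq_natCast] at h
  · exact commute_eop (by rintro h1; apply h; rw [abs_eq] <;> omega)
      (by rintro h1; apply h; rw [abs_eq] <;> omega)
  · exact commute_eop_fop (by omega) (by omega) (by rintro h1; apply h; rw [abs_eq] <;> omega)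
  · exact (commute_eop_fop (by omega) (by omega)
      (by rintro h1; apply h; rw [abs_eq] <;> omega)).symm
  · exact commute_fop (by rintro h1; apply h; rw [abs_eq] <;> omega)
      (by rintro h1; apply h; rw [abs_eq] <;> omega)

lemma commute_fGen {i j : ℤ} (h : |i - j| ≠ 1) : Commute (fGen μ i) (fGen μ j) := by
  rcases i with m | m <;> rcases j with n | n <;> simp only [Int.negSucc_eq, Int.ofNat_eq_natCast] at h
  · exact commute_fop (by rintro h1; apply h; rw [abs_eq] <;> omega)
      (by rintro h1; apply h; rw [abs_eq] <;> omega)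
  · exact (commute_eop_fop (by omega) (by rintro h1; apply h; rw [abs_eq] <;> omega)
      (by omega)).symm
  · exact commute_eop_fop (by omega) (by rintro h1; apply h; rw [abs_eq] <;> omega) (by omega)
  · exact commute_eop (by rintro h1; apply h; rw [abs_eq] <;> omega)
      (by rintro h1; apply h; rw [abs_eq] <;> omega)

lemma commute_eGen_fGen {i j : ℤ} (h : i ≠ j) : Commute (eGen μ i) (fGen μ j) := by
  rcases i with m | m <;> rcases j with n | n <;> simp only [Int.negSucc_eq, Int.ofNat_eq_natCast] at h
  · exact commute_eop_fop (by omega) (by omega) (by omega)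
  · exact commute_eop (by omega) (by omega)
  · exact commute_fop (by omega) (by omega)
  · exact (commute_eop_fop (by omega) (by omega) (by omega)).symm

lemma serre_eGen {i j : ℤ} (h : |i - j| = 1) : Serre (qnum 2) (eGen μ i) (eGen μ j) := by
  rw [abs_eq (by norm_num)] at h
  rcases i with m | m <;> rcases j with n | n <;> simp only [Int.negSucc_eq, Int.ofNat_eq_natCast] at h
  · rcases h with h | h
    · obtain rfl : m = n + 1 := by omega
      exact serre_eop' (2 * n + 1)
    · obtain rfl : n = m + 1 := by omega
      exact serre_eop (2 * m + 1)
  · obtain ⟨rfl, rfl⟩ : m = 0 ∧ n = 0 := by omega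
    exact serre_eop_fop
  · obtain ⟨rfl, rfl⟩ : m = 0 ∧ n = 0 := by omega
    exact serre_fop_eop
  · rcases h with h | h
    · obtain rfl : n = m + 1 := by omega
      exact serre_fop (2 * m)
    · obtain rfl : m = n + 1 := by omega
      exact serre_fop' (2 * n)

lemma serre_fGen {i j : ℤ} (h : |i - j| = 1) : Serre (qnum 2) (fGen μ i) (fGen μ j) := by
  rw [abs_eq (by norm_num)] at h
  rcases i with m | m <;> rcases j with n | n <;> simp only [Int.negSucc_eq, Int.ofNat_eq_natCast] at h
  · rcases h with h | h
    · obtain rfl : m = n + 1 := by omega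
      exact serre_fop' (2 * n + 1)
    · obtain rfl : n = m + 1 := by omega
      exact serre_fop (2 * m + 1)
  · obtain ⟨rfl, rfl⟩ : m = 0 ∧ n = 0 := by omega
    exact serre_fop_one_eop
  · obtain ⟨rfl, rfl⟩ : m = 0 ∧ n = 0 := by omega
    exact serre_eop_fop_one
  · rcases h with h | h
    · obtain rfl : n = m + 1 := by omega
      exact serre_eop (2 * m)
    · obtain rfl : m = n + 1 := by omega
      exact serre_eop' (2 * n)

/-- The row that determines the weight `h_i`. -/
def wrow : ℤ → ℕ
  | Int.ofNat n => 2 * n + 1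
  | Int.negSucc n => 2 * n + 2

/-- The integral part of the weight `h_i`. -/
def wint (t : Arr) (i : ℤ) : ℤ := rs t (wrow i) - rs t (wrow i - 1)

lemma eGen_comm_fGen (i : ℤ) : eGen μ i * fGen μ i - fGen μ i * eGen μ i =
    diag μ fun t => qnum (wint t i - wint t (i + 1)) := by
  rcases i with n | n
  · refine (eop_comm_fop (μ := μ) (2 * n + 1)).trans (diag_congr fun t _ => ?_)
    rw [show Int.ofNat n + 1 = Int.ofNat (n + 1) from rfl, ew, wint, wint, wrow, wrow, hw, hw]
    simp only [add_tsub_cancel_right, show 2 * (n + 1) + 1 = 2 * n + 3 by ring,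
      show 2 * n + 3 - 1 = 2 * n + 2 from rfl, show 2 * n + 2 - 1 = 2 * n + 1 from rfl,
      show 2 * n + 1 + 1 = 2 * n + 2 from rfl, show 2 * n + 2 + 1 = 2 * n + 3 from rfl]
    congr 1
    ring
  · have h := congrArg Neg.neg (eop_comm_fop (μ := μ) (2 * n))
    rw [neg_sub, diag_neg] at h
    refine h.trans (diag_congr fun t _ => ?_)
    rw [← qnum_neg]
    congr 1
    rcases n with _ | n
    · show -hw t 1 = (rs t 2 - rs t 1) - (rs t 1 - rs t 0)
      rw [hw]; ring
    · show -(hw t (2 * n + 2) + hw t (2 * n + 3)) =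
        (rs t (2 * n + 4) - rs t (2 * n + 3)) - (rs t (2 * n + 2) - rs t (2 * n + 1))
      rw [hw, hw]
      show -(2 * rs t (2 * n + 2) - rs t (2 * n + 1) - rs t (2 * n + 3) +
        (2 * rs t (2 * n + 3) - rs t (2 * n + 2) - rs t (2 * n + 4))) = _
      ring

/-- No gauge factor is available for all rows at once, since the product over the rows is infinite.
A relation between the generators `i` and `j` involves finitely many rows, and one truncated
conjugation serves all of them. -/
lemma exists_gauge (i j : ℤ) : ∃ φ : Module.End ℂ⟦X⟧ (Mod μ) →ₐ[ℂ⟦X⟧] Module.End ℂ⟦X⟧ (Mod μ),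
    φ (eGen μ i) = eAct μ i ∧ φ (eGen μ j) = eAct μ j ∧ φ (fGen μ i) = fAct μ i ∧
    φ (fGen μ j) = fAct μ j ∧ ∀ f, φ (diag μ f) = diag μ f :=
  ⟨gaugeHom μ (2 * i.natAbs + 2 * j.natAbs + 3), gaugeHom_eGen (by omega), gaugeHom_eGen (by omega),
    gaugeHom_fGen (by omega), gaugeHom_fGen (by omega), gaugeHom_diag⟩

lemma commute_eAct {i j : ℤ} (h : |i - j| ≠ 1) : Commute (eAct μ i) (eAct μ j) := by
  obtain ⟨φ, h1, h2, -⟩ := exists_gauge (μ := μ) i j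
  rw [← h1, ← h2]
  exact (commute_eGen h).map φ

lemma commute_fAct {i j : ℤ} (h : |i - j| ≠ 1) : Commute (fAct μ i) (fAct μ j) := by
  obtain ⟨φ, -, -, h1, h2, -⟩ := exists_gauge (μ := μ) i j
  rw [← h1, ← h2]
  exact (commute_fGen h).map φ

lemma commute_eAct_fAct {i j : ℤ} (h : i ≠ j) : Commute (eAct μ i) (fAct μ j) := by
  obtain ⟨φ, h1, -, -, h2, -⟩ := exists_gauge (μ := μ) i j
  rw [← h1, ← h2]
  exact (commute_eGen_fGen h).map φ

lemma serre_eAct {i j : ℤ} (h : |i - j| = 1) : Serre (qnum 2) (eAct μ i) (eAct μ j) := by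
  obtain ⟨φ, h1, h2, -⟩ := exists_gauge (μ := μ) i j
  rw [← h1, ← h2]
  exact (serre_eGen h).map φ

lemma serre_fAct {i j : ℤ} (h : |i - j| = 1) : Serre (qnum 2) (fAct μ i) (fAct μ j) := by
  obtain ⟨φ, -, -, h1, h2, -⟩ := exists_gauge (μ := μ) i j
  rw [← h1, ← h2]
  exact (serre_fGen h).map φ

lemma eAct_comm_fAct (i : ℤ) : eAct μ i * fAct μ i - fAct μ i * eAct μ i =
    diag μ fun t => qnum (wint t i - wint t (i + 1)) := by
  obtain ⟨φ, h1, -, h2, -, h3⟩ := exists_gauge (μ := μ) i i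
  rw [← h1, ← h2, ← h3, ← eGen_comm_fGen, map_sub, map_mul, map_mul]

/-- Commutators of diagonal operators with operators in two rows. -/
lemma diag_comm_pairOp {s : ℤ} {c : Arr → ℕ → ℕ → ℂ⟦X⟧} {f : Arr → ℂ⟦X⟧} {z : ℂ⟦X⟧}
    (h : ∀ t, ∀ j < p, ∀ l < p + 1, f (bump (bump t s p j) s (p + 1) l) = f t + z) :
    diag μ f * pairOp μ s p c - pairOp μ s p c * diag μ f = z • pairOp μ s p c := by
  refine Mod.hom_ext fun t ht => ?_
  rw [LinearMap.sub_apply, Module.End.mul_apply, Module.End.mul_apply, diag_kz, map_smul,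
    LinearMap.smul_apply, pairOp_kz _ _ _ ht, map_sum, Finset.smul_sum, Finset.smul_sum,
    ← Finset.sum_sub_distrib]
  refine Finset.sum_congr rfl fun j hj => ?_
  rw [map_sum, Finset.smul_sum, Finset.smul_sum, ← Finset.sum_sub_distrib]
  refine Finset.sum_congr rfl fun l hl => ?_
  rw [map_smul, diag_kz, h t j (Finset.mem_range.1 hj) l (Finset.mem_range.1 hl), add_smul,
    smul_add, smul_comm (f t), add_sub_cancel_left, smul_comm]

lemma diag_comm_shiftOp {s : ℤ} {c : Arr → ℕ → ℂ⟦X⟧} {f : Arr → ℂ⟦X⟧} {z : ℂ⟦X⟧}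
    (h : ∀ t, ∀ j < p, f (bump t s p j) = f t + z) :
    diag μ f * shiftOp μ s p c - shiftOp μ s p c * diag μ f = z • shiftOp μ s p c := by
  have := diag_shiftOp_sub (μ := μ) (s := s) (p := p) (c := c) (f := f) (f' := f) (g := fun _ => z)
    fun t j hj => by rw [h t j hj, add_sub_cancel_left]
  rw [this]
  refine Mod.hom_ext fun t _ => ?_
  rw [Module.End.mul_apply, diag_kz, map_smul, LinearMap.smul_apply]

lemma rs_pair (t : Arr) (s : ℤ) {j l : ℕ} (hj : j < p) (hl : l < p + 1) (r : ℕ) :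
    rs (bump (bump t s p j) s (p + 1) l) r = rs t r + if r = p ∨ r = p + 1 then s else 0 := by
  rcases eq_or_ne r p with rfl | h1
  · rw [rs_bump_ne _ _ _ (by omega), rs_bump_self _ _ hj, if_pos (Or.inl rfl)]
  rcases eq_or_ne r (p + 1) with rfl | h2
  · rw [rs_bump_self _ _ hl, rs_bump_ne _ _ _ (by omega), if_pos (Or.inr rfl)]
  · rw [rs_bump_ne _ _ _ h2, rs_bump_ne _ _ _ h1, if_neg (by omega), add_zero]

/-- The weight of the root vector `e_j` with respect to `h_i`. -/
def root (i j : ℤ) : ℤ := (if i = j then 1 else 0) - (if i = j + 1 then 1 else 0)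

lemma wint_pair_ofNat (t : Arr) (s i : ℤ) (n : ℕ) {j l : ℕ} (hj : j < 2 * n + 1)
    (hl : l < 2 * n + 1 + 1) :
    wint (bump (bump t s (2 * n + 1) j) s (2 * n + 1 + 1) l) i = wint t i + s * root i n := by
  rw [wint, wint, rs_pair _ _ hj hl, rs_pair _ _ hj hl, root]
  rcases i with m | m <;> simp only [wrow, Int.negSucc_eq, Int.ofNat_eq_natCast, mul_sub, mul_ite,
    mul_one, mul_zero] <;> push_cast <;> omega

lemma wint_pair_negSucc (t : Arr) (s i : ℤ) (n : ℕ) {j l : ℕ} (hj : j < 2 * n + 2)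
    (hl : l < 2 * n + 2 + 1) :
    wint (bump (bump t s (2 * n + 2) j) s (2 * n + 2 + 1) l) i =
      wint t i - s * root i (Int.negSucc (n + 1)) := by
  rw [wint, wint, rs_pair _ _ hj hl, rs_pair _ _ hj hl, root]
  rcases i with m | m <;> simp only [wrow, Int.negSucc_eq, Int.ofNat_eq_natCast, mul_sub, mul_ite,
    mul_one, mul_zero] <;> push_cast <;> omega

lemma wint_first (t : Arr) (s i : ℤ) :
    wint (bump t s 1 0) i = wint t i - s * root i (-1) := by
  have h (r : ℕ) : rs (bump t s 1 0) r = rs t r + if r = 1 then s else 0 := by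
    rcases eq_or_ne r 1 with rfl | h1
    · rw [rs_bump_self _ _ one_pos, if_pos rfl]
    · rw [rs_bump_ne _ _ _ h1, if_neg h1, add_zero]
  rw [wint, wint, h, h, root]
  rcases i with m | m <;> simp only [wrow, Int.negSucc_eq, Int.ofNat_eq_natCast, mul_sub, mul_ite,
    mul_one, mul_zero] <;> push_cast <;> omega

/-- The diagonal operators whose eigenvalues are the weights up to a constant. -/
def hAct (μ : ℤ → ℤ) (κ : ℂ⟦X⟧) (i : ℤ) : Module.End ℂ⟦X⟧ (Mod μ) :=
  diag μ fun t => κ + ((wint t i : ℤ) : ℂ⟦X⟧)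

lemma exists_pairOp (n : ℕ) : ∃ c c', eact μ (n + 1) = pairOp μ 1 (n + 1) c ∧
    fact μ (n + 1) = pairOp μ (-1) (n + 1) c' := by
  rw [eact, fact]
  exact ⟨_, _, rfl, rfl⟩

lemma exists_shiftOp : ∃ c c', eact μ 0 = shiftOp μ 1 1 c ∧ fact μ 0 = shiftOp μ (-1) 1 c' := by
  rw [eact, fact]
  exact ⟨_, _, rfl, rfl⟩

lemma hAct_comm (κ : ℂ⟦X⟧) (i j : ℤ) :
    hAct μ κ i * eAct μ j - eAct μ j * hAct μ κ i = ((root i j : ℤ) : ℂ⟦X⟧) • eAct μ j ∧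
    hAct μ κ i * fAct μ j - fAct μ j * hAct μ κ i = (-(root i j : ℤ) : ℂ⟦X⟧) • fAct μ j := by
  rcases j with n | n
  · obtain ⟨c, c', h, h'⟩ := exists_pairOp (μ := μ) (2 * n)
    rw [eAct, fAct, h, h', hAct]
    constructor
    · refine diag_comm_pairOp fun t j hj l hl => ?_
      rw [wint_pair_ofNat t 1 i n hj hl, Int.ofNat_eq_natCast]
      push_cast
      ring
    · refine diag_comm_pairOp fun t j hj l hl => ?_
      rw [wint_pair_ofNat t (-1) i n hj hl, Int.ofNat_eq_natCast]
      push_cast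
      ring
  rcases n with _ | n
  · obtain ⟨c, c', h, h'⟩ := exists_shiftOp (μ := μ)
    rw [eAct, fAct, mul_zero, h, h', hAct, show Int.negSucc 0 = -1 from rfl]
    constructor
    · refine diag_comm_shiftOp fun t j hj => ?_
      obtain rfl : j = 0 := by omega
      rw [wint_first]
      push_cast
      ring
    · refine diag_comm_shiftOp fun t j hj => ?_
      obtain rfl : j = 0 := by omega
      rw [wint_first]
      push_cast
      ring
  · obtain ⟨c, c', h, h'⟩ := exists_pairOp (μ := μ) (2 * n + 1)
    rw [eAct, fAct, show 2 * (n + 1) = 2 * n + 1 + 1 by ring, h, h', hAct]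
    constructor
    · refine diag_comm_pairOp fun t j hj l hl => ?_
      rw [wint_pair_negSucc t (-1) i n hj hl]
      push_cast
      ring
    · refine diag_comm_pairOp fun t j hj l hl => ?_
      rw [wint_pair_negSucc t 1 i n hj hl]
      push_cast
      ring

end Chevalley

/-! ### Topologically free modules -/

section TopFree

open PowerSeries

/-- `ℂ⟦h⟧`-modules without `h`-torsion that are `h`-adically separated and complete. -/
class IsTopFree (V : Type*) [AddCommGroup V] [Module ℂ⟦X⟧ V] : Prop where
  eq_zero_of_smul : ∀ v : V, (X : ℂ⟦X⟧) • v = 0 → v = 0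
  eq_zero_of_forall : ∀ v : V, (∀ n : ℕ, ∃ w : V, v = (X : ℂ⟦X⟧) ^ n • w) → v = 0
  exists_sum : ∀ a : ℕ → V, ∃ s : V, ∀ n : ℕ, ∃ w : V,
    s = ∑ k ∈ Finset.range n, (X : ℂ⟦X⟧) ^ k • a k + (X : ℂ⟦X⟧) ^ n • w

section Sum

variable {V : Type*} [AddCommGroup V] [Module ℂ⟦X⟧ V] [IsTopFree V]

/-- Separatedness in the form used throughout: limits are compared modulo each power of h. -/
lemma eq_of_forall_pow {v w : V} (h : ∀ n : ℕ, ∃ z : V, v = w + (X : ℂ⟦X⟧) ^ n • z) : v = w := by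
  refine sub_eq_zero.1 (IsTopFree.eq_zero_of_forall _ fun n => ?_)
  obtain ⟨z, hz⟩ := h n
  exact ⟨z, by rw [hz, add_sub_cancel_left]⟩

lemma X_smul_cancel {v w : V} (h : (X : ℂ⟦X⟧) • v = (X : ℂ⟦X⟧) • w) : v = w :=
  sub_eq_zero.1 (IsTopFree.eq_zero_of_smul _ (by rw [smul_sub, h, sub_self]))

/-- The sum of the series with terms `h ^ k • a k`. -/
def hsum (a : ℕ → V) : V := (IsTopFree.exists_sum a).choose

lemma hsum_spec (a : ℕ → V) (n : ℕ) : ∃ w : V,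
    hsum a = ∑ k ∈ Finset.range n, (X : ℂ⟦X⟧) ^ k • a k + (X : ℂ⟦X⟧) ^ n • w :=
  (IsTopFree.exists_sum a).choose_spec n

lemma hsum_eq_of_forall {a : ℕ → V} {s : V} (h : ∀ n : ℕ, ∃ w : V,
    s = ∑ k ∈ Finset.range n, (X : ℂ⟦X⟧) ^ k • a k + (X : ℂ⟦X⟧) ^ n • w) : hsum a = s := by
  refine eq_of_forall_pow fun n => ?_
  obtain ⟨w, hw⟩ := h n
  obtain ⟨w', hw'⟩ := hsum_spec a n
  exact ⟨w' - w, by rw [hw, hw', smul_sub]; abel⟩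

lemma hsum_add (a b : ℕ → V) : hsum (fun k => a k + b k) = hsum a + hsum b := by
  refine hsum_eq_of_forall fun n => ?_
  obtain ⟨w, hw⟩ := hsum_spec a n
  obtain ⟨w', hw'⟩ := hsum_spec b n
  refine ⟨w + w', ?_⟩
  simp only [hw, hw', smul_add, Finset.sum_add_distrib]
  abel

lemma map_hsum {W : Type*} [AddCommGroup W] [Module ℂ⟦X⟧ W] [IsTopFree W] (φ : V →ₗ[ℂ⟦X⟧] W)
    (a : ℕ → V) : hsum (fun k => φ (a k)) = φ (hsum a) := by
  refine hsum_eq_of_forall fun n => ?_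
  obtain ⟨w, hw⟩ := hsum_spec a n
  exact ⟨φ w, by rw [hw]; simp⟩

lemma hsum_succ (a : ℕ → V) : hsum a = a 0 + (X : ℂ⟦X⟧) • hsum fun k => a (k + 1) := by
  refine hsum_eq_of_forall fun n => ?_
  rcases n with _ | n
  · exact ⟨_, by simp; rfl⟩
  obtain ⟨w, hw⟩ := hsum_spec (fun k => a (k + 1)) n
  refine ⟨w, ?_⟩
  rw [hw, Finset.sum_range_succ', smul_add, Finset.smul_sum, pow_zero, one_smul]
  simp only [smul_smul, ← pow_succ']
  abel

end Sum

/-- Sums of operators are formed pointwise. The remainder must be a single linear operator rather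
than a vector for each argument; it is the sum of the shifted sequence. -/
instance {V : Type*} [AddCommGroup V] [Module ℂ⟦X⟧ V] [IsTopFree V] :
    IsTopFree (Module.End ℂ⟦X⟧ V) where
  eq_zero_of_smul T h := LinearMap.ext fun v =>
    IsTopFree.eq_zero_of_smul _ (LinearMap.congr_fun h v)
  eq_zero_of_forall T h := LinearMap.ext fun v => IsTopFree.eq_zero_of_forall _ fun n =>
    let ⟨S, hS⟩ := h n
    ⟨S v, LinearMap.congr_fun hS v⟩
  exists_sum a := by
    let s : (ℕ → Module.End ℂ⟦X⟧ V) → Module.End ℂ⟦X⟧ V := fun a =>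
      { toFun := fun v => hsum fun k => a k v
        map_add' := fun v w => by simp only [map_add, hsum_add]
        map_smul' := fun c v => by
          simp only [map_smul, RingHom.id_apply]
          exact map_hsum (LinearMap.lsmul ℂ⟦X⟧ V c) _ }
    have hs (n : ℕ) : ∀ a, s a = ∑ k ∈ Finset.range n, (X : ℂ⟦X⟧) ^ k • a k +
        (X : ℂ⟦X⟧) ^ n • s fun k => a (k + n) := by
      induction n with
      | zero => simp
      | succ n ih =>
        intro a
        have h1 : (s fun k => a (k + n)) = a n + (X : ℂ⟦X⟧) • s fun k => a (k + (n + 1)) := by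
          refine LinearMap.ext fun v => ?_
          refine (hsum_succ _).trans ?_
          simp only [zero_add, add_assoc, add_comm 1 n]
          rfl
        rw [ih, h1, Finset.sum_range_succ, smul_add, smul_smul, ← pow_succ]
        abel
    exact ⟨s a, fun n => ⟨_, hs n a⟩⟩

/-! ### The completed free module -/

section Completion

variable {B : Type*} [AddCommGroup B] [Module ℂ⟦X⟧ B]

lemma mem_X_pow_smul_top (n : ℕ) (v : B) :
    v ∈ (Ideal.span {(X : ℂ⟦X⟧)} ^ n • ⊤ : Submodule ℂ⟦X⟧ B) ↔ ∃ w, v = (X : ℂ⟦X⟧) ^ n • w := by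
  rw [Ideal.span_singleton_pow, Submodule.ideal_span_singleton_smul,
    Submodule.mem_smul_pointwise_iff_exists]
  simp [eq_comm]

lemma eval_eq_zero_iff (n : ℕ) (v : AdicCompletion (Ideal.span {(X : ℂ⟦X⟧)}) B) :
    AdicCompletion.eval _ _ n v = 0 ↔ ∃ w, v = (X : ℂ⟦X⟧) ^ n • w := by
  rw [← mem_X_pow_smul_top, AdicCompletion.pow_smul_top_eq_ker_eval ⟨{X}, by simp⟩,
    LinearMap.mem_ker]

lemma exists_of_add (n : ℕ) (v : AdicCompletion (Ideal.span {(X : ℂ⟦X⟧)}) B) :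
    ∃ (x : B) (w : AdicCompletion (Ideal.span {(X : ℂ⟦X⟧)}) B),
      v = AdicCompletion.of _ _ x + (X : ℂ⟦X⟧) ^ n • w := by
  obtain ⟨x, hx⟩ := Submodule.mkQ_surjective _ (AdicCompletion.eval _ _ n v)
  obtain ⟨w, hw⟩ := (eval_eq_zero_iff n (v - AdicCompletion.of _ _ x)).1
    (by rw [map_sub, AdicCompletion.eval_of, hx, sub_self])
  exact ⟨x, w, by rw [← hw, add_sub_cancel]⟩

/-- Completion does not create divisibility: an element of the original module which becomes a
multiple of h^n was already one. -/
lemma of_eq_smul {n : ℕ} {x : B} {w : AdicCompletion (Ideal.span {(X : ℂ⟦X⟧)}) B}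
    (h : AdicCompletion.of _ _ x = (X : ℂ⟦X⟧) ^ n • w) : ∃ y, x = (X : ℂ⟦X⟧) ^ n • y := by
  rw [← mem_X_pow_smul_top, ← Submodule.Quotient.mk_eq_zero]
  exact (eval_eq_zero_iff n _).2 ⟨w, h⟩

lemma isTopFree_completion (hB : ∀ x : B, (X : ℂ⟦X⟧) • x = 0 → x = 0) :
    IsTopFree (AdicCompletion (Ideal.span {(X : ℂ⟦X⟧)}) B) where
  eq_zero_of_smul v h := by
    refine IsHausdorff.haus (I := Ideal.span {(X : ℂ⟦X⟧)}) inferInstance v fun n => ?_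
    rw [SModEq.zero, mem_X_pow_smul_top]
    obtain ⟨x, w, rfl⟩ := exists_of_add n v
    rw [smul_add, ← map_smul] at h
    -- With `v = x + h^n w`, the equation `h v = 0` makes `h x` a multiple of h^{n+1}. This descends
    -- to the original module, where h can be cancelled; so `v` is a multiple of h^n for every `n`.
    obtain ⟨y, hy⟩ := of_eq_smul (n := n + 1) (x := (X : ℂ⟦X⟧) • x) (w := -w) (by
      rw [eq_neg_of_add_eq_zero_left h, pow_succ', mul_smul, smul_neg, smul_neg])
    rw [pow_succ', mul_smul] at hy
    have := sub_eq_zero.1 (hB (x - (X : ℂ⟦X⟧) ^ n • y) (by rw [smul_sub, hy, sub_self]))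
    exact ⟨AdicCompletion.of _ _ y + w, by rw [this, smul_add, map_smul]⟩
  eq_zero_of_forall v h := by
    refine IsHausdorff.haus (I := Ideal.span {(X : ℂ⟦X⟧)}) inferInstance v fun n => ?_
    rw [SModEq.zero, mem_X_pow_smul_top]
    exact h n
  exists_sum a := by
    have : IsAdicComplete (Ideal.span {(X : ℂ⟦X⟧)})
        (AdicCompletion (Ideal.span {(X : ℂ⟦X⟧)}) B) :=
      AdicCompletion.isAdicComplete ⟨{X}, by simp⟩
    obtain ⟨s, hs⟩ := IsPrecomplete.prec (I := Ideal.span {(X : ℂ⟦X⟧)}) inferInstance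
      (f := fun n => ∑ k ∈ Finset.range n, (X : ℂ⟦X⟧) ^ k • a k) (by
        intro m n hmn
        symm
        rw [SModEq.sub_mem, Finset.sum_range_sub_sum_range hmn, mem_X_pow_smul_top]
        refine ⟨∑ k ∈ Finset.range n with m ≤ k, (X : ℂ⟦X⟧) ^ (k - m) • a k, ?_⟩
        rw [Finset.smul_sum]
        refine Finset.sum_congr rfl fun k hk => ?_
        rw [smul_smul, ← pow_add, Nat.add_sub_cancel' (Finset.mem_filter.1 hk).2])
    refine ⟨s, fun n => ?_⟩
    obtain ⟨w, hw⟩ := (mem_X_pow_smul_top n _).1 (SModEq.sub_mem.1 (hs n).symm)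
    exact ⟨w, by rw [← hw, add_sub_cancel]⟩

instance (ι : Type*) :
    IsTopFree (AdicCompletion (Ideal.span {(X : ℂ⟦X⟧)}) (ι →₀ ℂ⟦X⟧)) :=
  isTopFree_completion fun x h => by
    refine Finsupp.ext fun i => ?_
    have := DFunLike.congr_fun h i
    simpa using this

/-- Endomorphisms of a completion are determined by their values on a dense submodule. -/
lemma completion_hom_ext {W : Type*} [AddCommGroup W] [Module ℂ⟦X⟧ W] [IsTopFree W]
    {S T : AdicCompletion (Ideal.span {(X : ℂ⟦X⟧)}) B →ₗ[ℂ⟦X⟧] W}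
    (h : ∀ x, S (AdicCompletion.of _ _ x) = T (AdicCompletion.of _ _ x)) : S = T := by
  refine LinearMap.ext fun v => eq_of_forall_pow fun n => ?_
  obtain ⟨x, w, rfl⟩ := exists_of_add n v
  exact ⟨S w - T w, by simp only [map_add, map_smul, h, smul_sub]; abel⟩

end Completion

/-! ### Evaluation of power series at operators -/

section Evaluation

variable {V : Type*} [AddCommGroup V] [Module ℂ⟦X⟧ V] [IsTopFree V]
variable {A : Type*} [Ring A] [Algebra ℂ A]

/-- The continuous extension of a homomorphism to power series. -/
def evalSeries (φ : A →+* Module.End ℂ⟦X⟧ V) : A⟦X⟧ →+* Module.End ℂ⟦X⟧ V :=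
  let Φ : A⟦X⟧ →+ Module.End ℂ⟦X⟧ V :=
    AddMonoidHom.mk' (fun f => hsum fun k => φ (coeff k f)) fun f g => by
      simp only [map_add, hsum_add]
  have hX (f : A⟦X⟧) : Φ (X * f) = (X : ℂ⟦X⟧) • Φ f := by
    refine (hsum_succ _).trans ?_
    simp only [coeff_succ_X_mul, coeff_zero_X_mul, map_zero, zero_add]
    rfl
  have hC (a : A) (f : A⟦X⟧) : Φ (C a * f) = φ a * Φ f := by
    refine Eq.trans ?_ (map_hsum (LinearMap.mulLeft ℂ⟦X⟧ (φ a)) fun k => φ (coeff k f))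
    show (hsum fun k => φ (coeff k (C a * f))) = _
    simp only [coeff_C_mul, map_mul]
    rfl
  have h1 : Φ 1 = 1 := by
    refine hsum_eq_of_forall fun n => ?_
    rcases n with _ | n
    · exact ⟨1, by simp⟩
    · exact ⟨0, by simp [coeff_one]⟩
  RingHom.mk ⟨⟨Φ, h1⟩, fun f g => by
    show Φ (f * g) = Φ f * Φ g
    -- Multiplicativity modulo h^n, by splitting off the constant coefficient of `f`. The shifted
    -- series is multiplied by h, so precision modulo h^n for it is enough.
    have key (n : ℕ) : ∀ f, ∃ S, Φ (f * g) = Φ f * Φ g + (X : ℂ⟦X⟧) ^ n • S := by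
      induction n with
      | zero => exact fun f => ⟨Φ (f * g) - Φ f * Φ g, by simp⟩
      | succ n ih =>
        intro f
        obtain ⟨S, hS⟩ := ih (mk fun p => coeff (p + 1) f)
        refine ⟨S, ?_⟩
        have hCf : Φ (C (constantCoeff f)) = φ (constantCoeff f) := by
          have := hC (constantCoeff f) 1
          rwa [mul_one, h1, mul_one] at this
        rw [eq_X_mul_shift_add_const f, add_mul, map_add, map_add, mul_assoc, hX, hX, hS, hC, hCf,
          add_mul, smul_mul_assoc, smul_add, smul_smul, ← pow_succ']
        abel
    exact eq_of_forall_pow fun n => key n f⟩ (map_zero Φ) (map_add Φ)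

lemma evalSeries_apply (φ : A →+* Module.End ℂ⟦X⟧ V) (f : A⟦X⟧) :
    evalSeries φ f = hsum fun k => φ (coeff k f) := rfl

lemma evalSeries_C (φ : A →+* Module.End ℂ⟦X⟧ V) (a : A) : evalSeries φ (C a) = φ a := by
  rw [evalSeries_apply]
  refine hsum_eq_of_forall fun n => ?_
  rcases n with _ | n
  · exact ⟨φ a, by simp⟩
  · exact ⟨0, by simp [Finset.sum_range_succ', coeff_C]⟩

lemma trunc_series (f : A⟦X⟧) (n : ℕ) :
    ∃ g : A⟦X⟧, f = ∑ k ∈ Finset.range n, X ^ k * C (coeff k f) + X ^ n * g := by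
  induction n with
  | zero => exact ⟨f, by simp⟩
  | succ n ih =>
    obtain ⟨g, hg⟩ := ih
    refine ⟨mk fun p => coeff (p + 1) g, ?_⟩
    have h1 : coeff n f = constantCoeff g := by
      conv_lhs => rw [hg]
      rw [map_add, map_sum, Finset.sum_eq_zero, zero_add]
      · rw [← coeff_zero_eq_constantCoeff_apply]
        simpa using coeff_X_pow_mul g n 0
      · intro k hk
        rw [coeff_X_pow_mul', coeff_C]
        have := Finset.mem_range.1 hk
        simp [this.le, show n - k ≠ 0 by omega]
    conv_lhs => rw [hg, eq_X_mul_shift_add_const g]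
    rw [Finset.sum_range_succ, h1, mul_add, pow_succ, mul_assoc]
    abel

lemma evalSeries_map (φ : A →+* Module.End ℂ⟦X⟧ V)
    (hφ : ∀ a : ℂ, φ (algebraMap ℂ A a) = algebraMap ℂ⟦X⟧ _ (C a)) (c : ℂ⟦X⟧) :
    evalSeries φ (PowerSeries.map (algebraMap ℂ A) c) = algebraMap ℂ⟦X⟧ _ c := by
  rw [evalSeries_apply]
  refine hsum_eq_of_forall fun n => ?_
  obtain ⟨g, hg⟩ := trunc_series c n
  refine ⟨algebraMap _ _ g, ?_⟩
  conv_lhs => rw [hg]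
  simp only [map_add, map_sum, map_mul, coeff_map, hφ, Algebra.smul_def]

lemma trunc_qPow (x : A⟦X⟧) (n : ℕ) : ∃ y : A⟦X⟧, qPow x =
    ∑ k ∈ Finset.range n, C (algebraMap ℂ A ((2 : ℂ) ^ k * (k.factorial : ℂ))⁻¹) * (X ^ k * x ^ k) +
      X ^ n * y := by
  have : X ^ n ∣ qPow x -
      ∑ k ∈ Finset.range n, C (algebraMap ℂ A ((2 : ℂ) ^ k * (k.factorial : ℂ))⁻¹) *
        (X ^ k * x ^ k) := by
    rw [X_pow_dvd_iff]
    intro m hm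
    rw [map_sub, qPow, coeff_mk, map_sum, sub_eq_zero,
      ← Finset.sum_subset (Finset.range_subset_range.2 (Nat.succ_le_of_lt hm))]
    · refine Finset.sum_congr rfl fun k _ => ?_
      rw [coeff_C_mul, Algebra.smul_def, ((commute_X x).symm.mul_pow k)]
    · intro k _ hk
      rw [Finset.mem_range, not_lt] at hk
      rw [coeff_C_mul, coeff_X_pow_mul', if_neg (by omega), mul_zero]
  obtain ⟨y, hy⟩ := this
  exact ⟨y, by rw [← hy]; abel⟩

end Evaluation

end TopFree

/-! ### Representations in topologically free modules -/

section Representations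

open PowerSeries

variable {V : Type*} [AddCommGroup V] [Module ℂ⟦X⟧ V] [IsTopFree V]

section Eigenvectors

variable {A : Type*} [Ring A] [Algebra ℂ A] {φ : A →+* Module.End ℂ⟦X⟧ V}

lemma evalSeries_X (hφ : ∀ a : ℂ, φ (algebraMap ℂ A a) = algebraMap ℂ⟦X⟧ _ (C a)) :
    evalSeries φ X = algebraMap ℂ⟦X⟧ _ X := by
  rw [← evalSeries_map φ hφ X, map_X]

/-- Modulo h^n the exponential is a polynomial in `x`, which acts on an eigenvector by the same
polynomial in the eigenvalue. -/
lemma evalSeries_qPow (hφ : ∀ a : ℂ, φ (algebraMap ℂ A a) = algebraMap ℂ⟦X⟧ _ (C a))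
    {x : A⟦X⟧} {v : V} {z : ℂ⟦X⟧} (h : evalSeries φ x v = z • v) :
    evalSeries φ (qPow x) v = qPow z • v := by
  have hpow (k : ℕ) : evalSeries φ (x ^ k) v = z ^ k • v := by
    induction k with
    | zero => simp
    | succ k ih => rw [pow_succ, map_mul, Module.End.mul_apply, h, map_smul, ih, smul_smul,
        ← pow_succ']
  refine eq_of_forall_pow fun n => ?_
  obtain ⟨y, hy⟩ := trunc_qPow x n
  obtain ⟨y', hy'⟩ := trunc_qPow z n
  refine ⟨evalSeries φ y v - y' • v, ?_⟩
  rw [hy, hy', map_add, map_sum, LinearMap.add_apply, LinearMap.sum_apply, add_smul,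
    Finset.sum_smul, map_mul, map_pow, evalSeries_X hφ, ← map_pow, Module.End.mul_apply,
    Module.algebraMap_end_apply, smul_sub, smul_smul]
  rw [Finset.sum_congr rfl fun k _ => show evalSeries φ (C (algebraMap ℂ A
    ((2 : ℂ) ^ k * (k.factorial : ℂ))⁻¹) * (X ^ k * x ^ k)) v = _ from ?_]
  · abel
  · rw [map_mul, map_mul, map_pow, evalSeries_X hφ, ← map_pow, evalSeries_C, hφ,
      Module.End.mul_apply, Module.End.mul_apply, hpow, Module.algebraMap_end_apply,
      Module.algebraMap_end_apply, smul_smul, smul_smul, ← mul_assoc]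
    rfl

lemma evalSeries_qBracket (hφ : ∀ a : ℂ, φ (algebraMap ℂ A a) = algebraMap ℂ⟦X⟧ _ (C a))
    {x : A⟦X⟧} {v : V} {z : ℂ⟦X⟧} (h : evalSeries φ x v = z • v) :
    evalSeries φ (qBracket x) v = qBracket z • v := by
  have hd {B : Type} [Ring B] [Algebra ℂ B] (y : B⟦X⟧) :
      X * divH (qPow y - qPow (-y)) = qPow y - qPow (-y) :=
    X_mul_divH _ (by rw [map_sub, constantCoeff_qPow, constantCoeff_qPow, sub_self])
  have hd' : X * divH (qPow x - qPow (-x)) = qPow x - qPow (-x) :=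
    X_mul_divH _ (by rw [map_sub, constantCoeff_qPow, constantCoeff_qPow, sub_self])
  have key : evalSeries φ (divH (qPow x - qPow (-x))) v = divH (qPow z - qPow (-z)) • v := by
    -- Division by h is not continuous evaluation of a formula; the identity is multiplied by h and
    -- cancelled in the torsion-free module.
    refine X_smul_cancel ?_
    have h1 := congrArg (fun T => evalSeries φ T v) hd'
    simp only [map_mul, evalSeries_X hφ, Module.End.mul_apply, Module.algebraMap_end_apply] at h1
    rw [h1, smul_smul, hd, map_sub, LinearMap.sub_apply, evalSeries_qPow hφ h,
      evalSeries_qPow hφ (z := -z) (by rw [map_neg, LinearMap.neg_apply, h, neg_smul]), sub_smul]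
  rw [qBracket, qBracket, map_mul, evalSeries_map φ hφ, Module.End.mul_apply, key,
    Module.algebraMap_end_apply, smul_smul]
  congr 2

end Eigenvectors

/-- The `ℂ`-linear part of a representation of the free algebra. -/
def freeAlg (g : Gen → Module.End ℂ⟦X⟧ V) : FreeAlgebra ℂ Gen →+* Module.End ℂ⟦X⟧ V :=
  letI : Algebra ℂ (Module.End ℂ⟦X⟧ V) := Algebra.compHom _ (C : ℂ →+* ℂ⟦X⟧)
  (FreeAlgebra.lift ℂ g : FreeAlgebra ℂ Gen →ₐ[ℂ] Module.End ℂ⟦X⟧ V).toRingHom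

lemma freeAlg_algebraMap (g : Gen → Module.End ℂ⟦X⟧ V) (a : ℂ) :
    freeAlg g (algebraMap ℂ _ a) = algebraMap ℂ⟦X⟧ _ (C a) :=
  letI : Algebra ℂ (Module.End ℂ⟦X⟧ V) := Algebra.compHom _ (C : ℂ →+* ℂ⟦X⟧)
  (FreeAlgebra.lift ℂ g).commutes a

lemma freeAlg_ι (g : Gen → Module.End ℂ⟦X⟧ V) (x : Gen) : freeAlg g (FreeAlgebra.ι ℂ x) = g x :=
  letI : Algebra ℂ (Module.End ℂ⟦X⟧ V) := Algebra.compHom _ (C : ℂ →+* ℂ⟦X⟧)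
  FreeAlgebra.lift_ι_apply g x

/-- The representation of the completed free algebra with prescribed operators. -/
def freeHom (g : Gen → Module.End ℂ⟦X⟧ V) : FreeSeries →ₐ[ℂ⟦X⟧] Module.End ℂ⟦X⟧ V :=
  { evalSeries (freeAlg g) with
    commutes' := evalSeries_map (freeAlg g) (freeAlg_algebraMap g) }

lemma freeHom_gen (g : Gen → Module.End ℂ⟦X⟧ V) (x : Gen) : freeHom g (gen x) = g x :=
  (evalSeries_C (freeAlg g) _).trans (freeAlg_ι g x)

lemma freeHom_qBracket (g : Gen → Module.End ℂ⟦X⟧ V) {x : FreeSeries} {v : V} {z : ℂ⟦X⟧}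
    (h : freeHom g x v = z • v) : freeHom g (qBracket x) v = qBracket z • v :=
  evalSeries_qBracket (freeAlg_algebraMap g) h

lemma freeSeries_X_pow (n : ℕ) (f : FreeSeries) : X ^ n * f = (X : ℂ⟦X⟧) ^ n • f := by
  rw [Algebra.smul_def, map_pow]
  congr 2
  exact (PowerSeries.map_X _).symm

/-- The elements that act by a multiple of `h ^ n`. -/
def divIdeal (Φ : FreeSeries →ₐ[ℂ⟦X⟧] Module.End ℂ⟦X⟧ V) (n : ℕ) : TwoSidedIdeal FreeSeries :=
  TwoSidedIdeal.mk' {x | ∃ T, Φ x = (X : ℂ⟦X⟧) ^ n • T} ⟨0, by simp⟩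
    (by rintro x y ⟨S, hS⟩ ⟨T, hT⟩; exact ⟨S + T, by rw [map_add, hS, hT, smul_add]⟩)
    (by rintro x ⟨S, hS⟩; exact ⟨-S, by rw [map_neg, hS, smul_neg]⟩)
    (by rintro x y ⟨S, hS⟩; exact ⟨Φ x * S, by rw [map_mul, hS, mul_smul_comm]⟩)
    (by rintro x y ⟨S, hS⟩; exact ⟨S * Φ y, by rw [map_mul, hS, smul_mul_assoc]⟩)

lemma mem_divIdeal {Φ : FreeSeries →ₐ[ℂ⟦X⟧] Module.End ℂ⟦X⟧ V} {n : ℕ} {x : FreeSeries} :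
    x ∈ divIdeal Φ n ↔ ∃ T, Φ x = (X : ℂ⟦X⟧) ^ n • T :=
  TwoSidedIdeal.mem_mk' ..

/-- An element of the closure lies in the ideal of relations plus h^n for every `n`, so its image is
divisible by every h^n and vanishes by separatedness. -/
lemma map_relIdeal {Φ : FreeSeries →ₐ[ℂ⟦X⟧] Module.End ℂ⟦X⟧ V}
    (h : ∀ x, IsRelator x → Φ x = 0) {x : FreeSeries} (hx : x ∈ relIdeal) : Φ x = 0 := by
  refine IsTopFree.eq_zero_of_forall _ fun n => mem_divIdeal.1 ?_
  have hx := (TwoSidedIdeal.mem_iInf _).1 hx n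
  refine (sup_le ?_ ?_ : _ ≤ divIdeal Φ n) hx
  · rw [TwoSidedIdeal.span_le]
    exact fun y hy => mem_divIdeal.2 ⟨0, by rw [h y hy, smul_zero]⟩
  · rw [TwoSidedIdeal.span_le, Set.singleton_subset_iff]
    exact mem_divIdeal.2 ⟨1, by
      rw [← mul_one ((X : FreeSeries) ^ n), freeSeries_X_pow, map_smul, map_one]⟩

/-- The projection to `U_h(a_∞)`. -/
def Uh.proj : FreeSeries →ₐ[ℂ⟦X⟧] Uh := relIdeal.ringCon.mkₐ ℂ⟦X⟧

lemma Uh.proj_surjective : Function.Surjective Uh.proj := fun u =>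
  Quotient.inductionOn u fun f => ⟨f, rfl⟩

/-- Operators that satisfy the relations define a representation. -/
lemma exists_rep (g : Gen → Module.End ℂ⟦X⟧ V) (h : ∀ x, IsRelator x → freeHom g x = 0) :
    ∃ ρ : Uh →ₐ[ℂ⟦X⟧] Module.End ℂ⟦X⟧ V, ∀ x, ρ (Uh.of x) = g x :=
  ⟨relIdeal.ringCon.liftₐ (freeHom g) fun x y hxy => by
    rw [TwoSidedIdeal.rel_iff] at hxy
    have := map_relIdeal h hxy
    rwa [map_sub, sub_eq_zero] at this, freeHom_gen g⟩

lemma freeSeries_trunc (f : FreeSeries) (n : ℕ) : ∃ g : FreeSeries,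
    f = ∑ k ∈ Finset.range n, (X : ℂ⟦X⟧) ^ k • C (coeff k f) + (X : ℂ⟦X⟧) ^ n • g := by
  obtain ⟨g, hg⟩ := trunc_series f n
  simp only [freeSeries_X_pow] at hg
  exact ⟨g, hg⟩

/-- Representations are determined by the images of the generators. -/
lemma rep_ext {ρ ρ' : Uh →ₐ[ℂ⟦X⟧] Module.End ℂ⟦X⟧ V}
    (h : ∀ x, ρ (Uh.of x) = ρ' (Uh.of x)) : ρ = ρ' := by
  have hC (a : FreeAlgebra ℂ Gen) : ρ (Uh.proj (C a)) = ρ' (Uh.proj (C a)) := by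
    induction a using FreeAlgebra.induction with
    | grade0 r =>
      have : (C (algebraMap ℂ (FreeAlgebra ℂ Gen) r) : FreeSeries) = algebraMap ℂ⟦X⟧ _ (C r) :=
        (PowerSeries.map_C _ _).symm
      rw [this, AlgHom.commutes, AlgHom.commutes, AlgHom.commutes]
    | grade1 x => exact h x
    | mul a b ha hb => rw [map_mul, map_mul, map_mul, map_mul, ha, hb]
    | add a b ha hb => rw [map_add, map_add, map_add, map_add, ha, hb]
  refine AlgHom.ext fun u => ?_
  obtain ⟨f, rfl⟩ := Uh.proj_surjective u
  refine eq_of_forall_pow fun n => ?_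
  obtain ⟨g, hg⟩ := freeSeries_trunc f n
  refine ⟨ρ (Uh.proj g) - ρ' (Uh.proj g), ?_⟩
  rw [hg]
  simp only [map_add, map_sum, map_smul, hC, smul_sub]
  abel

/-- The image of a representation is closed under `h`-adically convergent sums. -/
lemma exists_hsum (ρ : Uh →ₐ[ℂ⟦X⟧] Module.End ℂ⟦X⟧ V) (u : ℕ → Uh) :
    ∃ w, ρ w = hsum fun k => ρ (u k) := by
  choose f hf using fun k => Uh.proj_surjective (u k)
  -- The series ∑ h^k f_k: its `n`-th coefficient involves only the `f k` with `k ≤ n`, so the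
  -- infinite sum of lifts exists as a formal series.
  let F : FreeSeries := mk fun n => ∑ k ∈ Finset.range (n + 1), coeff (n - k) (f k)
  refine ⟨Uh.proj F, (hsum_eq_of_forall fun n => ?_).symm⟩
  have : (X : FreeSeries) ^ n ∣ F - ∑ k ∈ Finset.range n, X ^ k * f k := by
    rw [X_pow_dvd_iff]
    intro m hm
    rw [map_sub, coeff_mk, map_sum, sub_eq_zero,
      ← Finset.sum_subset (Finset.range_subset_range.2 (Nat.succ_le_of_lt hm))]
    · refine Finset.sum_congr rfl fun k hk => ?_
      rw [coeff_X_pow_mul', if_pos (Nat.lt_succ_iff.1 (Finset.mem_range.1 hk))]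
    · intro k _ hk
      rw [Finset.mem_range, not_lt] at hk
      rw [coeff_X_pow_mul', if_neg (by omega)]
  obtain ⟨g, hg⟩ := this
  refine ⟨ρ (Uh.proj g), ?_⟩
  rw [sub_eq_iff_eq_add'] at hg
  rw [hg]
  simp only [freeSeries_X_pow, map_add, map_sum, map_smul, hf]

end Representations

/-! ### `C`-patterns and arrays -/

section Patterns

variable {M : ℤ → ℂ[X]} {μ : ℤ → ℤ} {t t' : Arr}

/-- The polynomial part `M 0` is common to all entries and cancels in every difference. What remains
is an integral signature. -/
lemma exists_signature (hM : ∀ i j : ℤ, i < j → IsNatConst (M i - M j)) :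
    ∃ μ : ℤ → ℤ, ∀ i, M i = M 0 + ((μ i : ℤ) : ℂ[X]) := by
  have (i : ℤ) : ∃ z : ℤ, M i = M 0 + ((z : ℤ) : ℂ[X]) := by
    rcases lt_trichotomy i 0 with h | rfl | h
    · obtain ⟨n, hn⟩ := hM _ _ h
      exact ⟨n, by rw [Int.cast_natCast, ← hn]; ring⟩
    · exact ⟨0, by simp⟩
    · obtain ⟨n, hn⟩ := hM _ _ h
      exact ⟨-n, by rw [Int.cast_neg, Int.cast_natCast, ← hn]; ring⟩
  choose μ hμ using this
  exact ⟨μ, hμ⟩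

/-- The column of the entry `a` of the row `p`. -/
def col (p : ℕ) : ℕ ↪ ℤ := ⟨fun a => (a : ℤ) - ((p / 2 : ℕ) : ℤ), fun a b h => by
  simp only at h; omega⟩

lemma col_apply (p a : ℕ) : col p a = (a : ℤ) - ((p / 2 : ℕ) : ℤ) := rfl

lemma rowIdx_eq (p : ℕ) : rowIdx (p : ℤ) = (Finset.range p).map (col p) := by
  ext i
  simp only [rowIdx, Finset.mem_Icc, Finset.mem_map, Finset.mem_range, col_apply]
  constructor
  · intro h
    exact ⟨(i + ((p / 2 : ℕ) : ℤ)).toNat, by omega, by omega⟩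
  · rintro ⟨a, ha, rfl⟩
    omega

lemma col_mem {p a : ℕ} (h : a < p) : col p a ∈ rowIdx (p : ℤ) := by
  rw [rowIdx_eq]
  exact Finset.mem_map_of_mem _ (Finset.mem_range.2 h)

lemma mem_rowIdx {i p : ℤ} (h : i ∈ rowIdx p) : ∃ r a : ℕ, a < r ∧ p = r ∧ i = col r a := by
  have h' := h
  rw [rowIdx, Finset.mem_Icc] at h'
  obtain ⟨r, rfl⟩ : ∃ r : ℕ, p = r := ⟨p.toNat, by omega⟩
  rw [rowIdx_eq, Finset.mem_map] at h
  obtain ⟨a, ha, rfl⟩ := h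
  exact ⟨r, a, Finset.mem_range.1 ha, rfl, rfl⟩

/-- The array of polynomials that belongs to an integral array. -/
def toC (M : ℤ → ℂ[X]) (t : Arr) : ℤ → ℤ → ℂ[X] := fun i p =>
  if i ∈ rowIdx p then M 0 + ((t p.toNat (i + ((p.toNat / 2 : ℕ) : ℤ)).toNat : ℤ) : ℂ[X]) else M i

lemma toC_col (M : ℤ → ℂ[X]) (t : Arr) {p a : ℕ} (h : a < p) :
    toC M t (col p a) p = M 0 + ((t p a : ℤ) : ℂ[X]) := by
  rw [toC, if_pos (col_mem h), Int.toNat_natCast, col_apply, sub_add_cancel, Int.toNat_natCast]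

lemma toC_bump (M : ℤ → ℂ[X]) (t : Arr) (s : ℤ) {p a : ℕ} (h : a < p) :
    toC M (bump t s p a) = shift (toC M t) s (col p a) p := by
  funext i r
  by_cases hi : i ∈ rowIdx r
  · obtain ⟨r, b, hb, rfl, rfl⟩ := mem_rowIdx hi
    rw [toC_col _ _ hb, shift, toC_col _ _ hb, bump]
    have : (col r b = col p a ∧ (r : ℤ) = p) ↔ (r = p ∧ b = a) := by
      constructor
      · rintro ⟨h1, h2⟩
        obtain rfl : r = p := by exact_mod_cast h2
        exact ⟨rfl, (col r).injective h1⟩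
      · rintro ⟨rfl, rfl⟩
        exact ⟨rfl, rfl⟩
    simp only [this]
    split_ifs
    · push_cast; ring
    · rfl
  · have : ¬ (i = col p a ∧ r = (p : ℤ)) := by
      rintro ⟨rfl, rfl⟩
      exact hi (col_mem h)
    rw [shift, if_neg this, toC, toC, if_neg hi, if_neg hi]

lemma isNatConst_sub_iff (a b : ℤ) :
    IsNatConst ((M 0 + (a : ℂ[X])) - (M 0 + (b : ℂ[X]))) ↔ b ≤ a := by
  rw [add_sub_add_left_eq_sub]
  constructor
  · rintro ⟨n, hn⟩
    have : a - b = n := by exact_mod_cast hn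
    omega
  · intro h
    obtain ⟨n, hn⟩ := Int.eq_ofNat_of_zero_le (sub_nonneg.2 h)
    refine ⟨n, ?_⟩
    rw [← Int.cast_sub, hn]
    simp

/-- With `p = 2k + θ - 1` the dependence on the parity θ is absorbed by the origin `p / 2` of the
column numbering, and the interlacing conditions become uniform in `p`. -/
lemma isNatConst_iff_of_interlace {m : ℤ → ℤ → ℂ[X]} :
    (∀ k θ : ℤ, 1 ≤ k → (θ = 0 ∨ θ = 1) → ∀ i ∈ Finset.Icc (1 - θ - k) (k - 1),
      IsNatConst (m (i + θ - 1) (2 * k + θ) - m i (2 * k + θ - 1)) ∧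
      IsNatConst (m i (2 * k + θ - 1) - m (i + θ) (2 * k + θ))) ↔
    ∀ p a : ℕ, a < p → IsNatConst (m (col (p + 1) a) ((p + 1 : ℕ) : ℤ) - m (col p a) p) ∧
      IsNatConst (m (col p a) p - m (col (p + 1) (a + 1)) ((p + 1 : ℕ) : ℤ)) := by
  constructor
  · intro h p a ha
    have := h (((p + 1) / 2 : ℕ) : ℤ) (((p + 1) % 2 : ℕ) : ℤ) (by omega) (by omega) (col p a)
      (by rw [Finset.mem_Icc, col_apply]; omega)
    convert this using 3
    · congr 1
      · rw [col_apply, col_apply]; omega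
      · omega
    · congr 1; omega
    · congr 1; omega
    · congr 1
      · rw [col_apply, col_apply]; omega
      · omega
  · intro h k θ hk hθ i hi
    rw [Finset.mem_Icc] at hi
    have h1 : i ∈ rowIdx (2 * k + θ - 1) := by
      rw [rowIdx, Finset.mem_Icc]; omega
    obtain ⟨p, a, ha, h2, rfl⟩ := mem_rowIdx h1
    have := h p a ha
    rw [col_apply] at hi
    have e1 : col p a + θ - 1 = col (p + 1) a := by rw [col_apply, col_apply]; omega
    have e2 : col p a + θ = col (p + 1) (a + 1) := by rw [col_apply, col_apply]; push_cast; omega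
    rwa [h2, e1, e2, show 2 * k + θ = ((p + 1 : ℕ) : ℤ) by push_cast; omega]

lemma isGT_iff (hμ : ∀ i, M i = M 0 + ((μ i : ℤ) : ℂ[X])) (ht : IsFrame μ t) :
    IsCPattern M (toC M t) ↔ IsGT μ t := by
  have key : (∀ p a : ℕ, a < p →
      IsNatConst (toC M t (col (p + 1) a) ((p + 1 : ℕ) : ℤ) - toC M t (col p a) p) ∧
      IsNatConst (toC M t (col p a) p - toC M t (col (p + 1) (a + 1)) ((p + 1 : ℕ) : ℤ))) ↔
      ∀ p a : ℕ, a < p → t p a ≤ t (p + 1) a ∧ t (p + 1) (a + 1) ≤ t p a := by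
    refine forall_congr' fun p => forall_congr' fun a => forall_congr' fun ha => ?_
    rw [toC_col _ _ ha, toC_col _ _ (Nat.lt_succ_of_lt ha), toC_col _ _ (Nat.succ_lt_succ ha),
      isNatConst_sub_iff, isNatConst_sub_iff]
  constructor
  · intro h
    have := key.1 (isNatConst_iff_of_interlace.1 h.interlace)
    exact ⟨ht, fun p a ha => (this p a ha).1, fun p a ha => (this p a ha).2⟩
  · intro h
    refine ⟨fun i p hi => if_neg hi, ?_, isNatConst_iff_of_interlace.2
      (key.2 fun p a ha => ⟨h.upper p a ha, h.lower p a ha⟩)⟩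
    obtain ⟨N, hN⟩ := ht.stable
    -- The summand 2 serves the requirement that the bound exceed 1.
    refine ⟨N + 2, by omega, fun p hp i hi => ?_⟩
    obtain ⟨r, a, ha, rfl, rfl⟩ := mem_rowIdx hi
    rw [toC_col _ _ ha, hN r (by omega) a ha, hμ (col r a), col_apply]

lemma toC_injective (ht : IsFrame μ t) (ht' : IsFrame μ t') (h : toC M t = toC M t') : t = t' := by
  funext p a
  rcases lt_or_ge a p with ha | ha
  · have := congrFun (congrFun h (col p a)) p
    rw [toC_col _ _ ha, toC_col _ _ ha] at this
    exact_mod_cast add_left_cancel this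
  · rw [ht.outside p a ha, ht'.outside p a ha]

/-- Entries in the stable rows are `M 0` plus an integer. Since neighbouring entries differ by
natural numbers, this descends row by row to the apex. -/
lemma exists_toC (hμ : ∀ i, M i = M 0 + ((μ i : ℤ) : ℂ[X])) {m : ℤ → ℤ → ℂ[X]}
    (hm : IsCPattern M m) : ∃ t, IsGT μ t ∧ toC M t = m := by
  obtain ⟨N, -, hN⟩ := hm.stable
  have hI := isNatConst_iff_of_interlace.1 hm.interlace
  have hint (n : ℕ) : ∀ p a : ℕ, a < p → N ≤ p + n →
      ∃ z : ℤ, m (col p a) p = M 0 + (z : ℂ[X]) := by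
    induction n with
    | zero =>
      intro p a ha hp
      exact ⟨μ (col p a), by rw [hN p (by omega) _ (col_mem ha), ← hμ]⟩
    | succ n ih =>
      intro p a ha hp
      obtain ⟨z, hz⟩ := ih (p + 1) a (by omega) (by push_cast at hp ⊢; omega)
      obtain ⟨k, hk⟩ := (hI p a ha).1
      exact ⟨z - k, by push_cast; rw [← hk, hz]; ring⟩
  have hint' (p a : ℕ) (ha : a < p) : ∃ z : ℤ, m (col p a) p = M 0 + (z : ℂ[X]) :=
    hint N.toNat p a ha (by omega)
  classical
  let t : Arr := fun p a => if h : a < p then (hint' p a h).choose else 0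
  have ht (p a : ℕ) (h : a < p) : m (col p a) p = M 0 + ((t p a : ℤ) : ℂ[X]) := by
    simp only [t, dif_pos h]
    exact (hint' p a h).choose_spec
  have hF : IsFrame μ t := by
    refine ⟨fun p a h => dif_neg (not_lt.2 h), N.toNat, fun p hp a ha => ?_⟩
    have h1 := ht p a ha
    rw [hN p (by omega) _ (col_mem ha), hμ] at h1
    exact Int.cast_injective (add_left_cancel h1).symm
  have hC : toC M t = m := by
    funext i p
    by_cases hi : i ∈ rowIdx p
    · obtain ⟨r, a, ha, rfl, rfl⟩ := mem_rowIdx hi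
      rw [toC_col _ _ ha, ht r a ha]
    · rw [toC, if_neg hi, hm.outside i p hi]
  exact ⟨t, (isGT_iff hμ hF).1 (hC ▸ hm), hC⟩

/-- Arrays are the same as `C`-patterns. -/
def patternEquiv (hμ : ∀ i, M i = M 0 + ((μ i : ℤ) : ℂ[X])) : GT μ ≃ CPattern M :=
  Equiv.ofBijective (fun g => ⟨toC M g.1, (isGT_iff hμ g.2.toIsFrame).2 g.2⟩)
    ⟨fun g g' h => Subtype.ext (toC_injective g.2.toIsFrame g'.2.toIsFrame (congrArg Subtype.val h)),
      fun m => let ⟨t, ht, h⟩ := exists_toC hμ m.2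
        ⟨⟨t, ht⟩, Subtype.ext h⟩⟩

/-- The identification of the free modules. -/
def patternLin (hμ : ∀ i, M i = M 0 + ((μ i : ℤ) : ℂ[X])) :
    Mod μ ≃ₗ[ℂ⟦X⟧] (CPattern M →₀ ℂ⟦X⟧) :=
  Finsupp.domLCongr (patternEquiv hμ)

/-- The inclusion of the free module on the arrays. -/
def emb (hμ : ∀ i, M i = M 0 + ((μ i : ℤ) : ℂ[X])) : Mod μ →ₗ[ℂ⟦X⟧] V M :=
  AdicCompletion.of _ _ ∘ₗ (patternLin hμ).toLinearMap

lemma emb_apply (hμ : ∀ i, M i = M 0 + ((μ i : ℤ) : ℂ[X])) (x : Mod μ) :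
    emb hμ x = AdicCompletion.of _ _ (patternLin hμ x) := rfl

lemma emb_kz (hμ : ∀ i, M i = M 0 + ((μ i : ℤ) : ℂ[X])) (ht : IsFrame μ t) :
    emb hμ (kz μ t) = ket M (toC M t) := by
  by_cases h : IsGT μ t
  · rw [ket, dif_pos ((isGT_iff hμ ht).2 h), kz, dif_pos h, emb_apply, patternLin,
      Finsupp.domLCongr_single]
    rfl
  · rw [ket, dif_neg (fun h' => h ((isGT_iff hμ ht).1 h')), kz_eq_zero h, map_zero]

/-- The extension of an operator to the completion. -/
def extend (hμ : ∀ i, M i = M 0 + ((μ i : ℤ) : ℂ[X])) (T : Module.End ℂ⟦X⟧ (Mod μ)) :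
    Module.End ℂ⟦X⟧ (V M) :=
  (AdicCompletion.map (Ideal.span {(PowerSeries.X : ℂ⟦X⟧)}) ((patternLin hμ).toLinearMap ∘ₗ T ∘ₗ
    (patternLin hμ).symm.toLinearMap)).restrictScalars ℂ⟦X⟧

lemma extend_emb (hμ : ∀ i, M i = M 0 + ((μ i : ℤ) : ℂ[X])) (T : Module.End ℂ⟦X⟧ (Mod μ))
    (x : Mod μ) : extend hμ T (emb hμ x) = emb hμ (T x) := by
  rw [emb_apply, extend, LinearMap.restrictScalars_apply, AdicCompletion.map_of]
  simp only [LinearMap.comp_apply, LinearEquiv.coe_coe, LinearEquiv.symm_apply_apply]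
  rfl

lemma emb_hom_ext (hμ : ∀ i, M i = M 0 + ((μ i : ℤ) : ℂ[X])) {S T : Module.End ℂ⟦X⟧ (V M)}
    (h : ∀ x, S (emb hμ x) = T (emb hμ x)) : S = T :=
  completion_hom_ext fun x => by
    have := h ((patternLin hμ).symm x)
    rwa [emb_apply, LinearEquiv.apply_symm_apply] at this

/-- The extension of operators to the completion. -/
def extendHom (hμ : ∀ i, M i = M 0 + ((μ i : ℤ) : ℂ[X])) :
    Module.End ℂ⟦X⟧ (Mod μ) →ₐ[ℂ⟦X⟧] Module.End ℂ⟦X⟧ (V M) :=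
  AlgHom.ofLinearMap
    { toFun := extend hμ
      map_add' := fun S T => emb_hom_ext hμ fun x => by
        rw [LinearMap.add_apply, extend_emb, extend_emb, extend_emb, LinearMap.add_apply, map_add]
      map_smul' := fun c T => emb_hom_ext hμ fun x => by
        rw [RingHom.id_apply, LinearMap.smul_apply, extend_emb, extend_emb, LinearMap.smul_apply,
          map_smul] }
    (emb_hom_ext hμ fun x => extend_emb hμ 1 x)
    (fun S T => emb_hom_ext hμ fun x => by
      show extend hμ (S * T) (emb hμ x) = extend hμ S (extend hμ T (emb hμ x))
      rw [extend_emb, extend_emb, extend_emb]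
      rfl)

lemma extendHom_emb (hμ : ∀ i, M i = M 0 + ((μ i : ℤ) : ℂ[X])) (T : Module.End ℂ⟦X⟧ (Mod μ))
    (x : Mod μ) : extendHom hμ T (emb hμ x) = emb hμ (T x) := extend_emb hμ T x

lemma exists_emb (hμ : ∀ i, M i = M 0 + ((μ i : ℤ) : ℂ[X])) (n : ℕ) (v : V M) :
    ∃ (x : Mod μ) (w : V M), v = emb hμ x + (PowerSeries.X : ℂ⟦X⟧) ^ n • w := by
  obtain ⟨x, w, h⟩ := exists_of_add n v
  exact ⟨(patternLin hμ).symm x, w, by rwa [emb_apply, LinearEquiv.apply_symm_apply]⟩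

lemma emb_eq_smul (hμ : ∀ i, M i = M 0 + ((μ i : ℤ) : ℂ[X])) {x : Mod μ} {n : ℕ} {w : V M}
    (h : emb hμ x = (PowerSeries.X : ℂ⟦X⟧) ^ n • w) :
    ∃ y : Mod μ, x = (PowerSeries.X : ℂ⟦X⟧) ^ n • y := by
  obtain ⟨y, hy⟩ := of_eq_smul h
  exact ⟨(patternLin hμ).symm y, by
    rw [← map_smul, ← hy, LinearEquiv.coe_coe, LinearEquiv.symm_apply_apply]⟩

lemma V_hom_ext (hμ : ∀ i, M i = M 0 + ((μ i : ℤ) : ℂ[X])) {S T : Module.End ℂ⟦X⟧ (V M)}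
    (h : ∀ t, IsGT μ t → S (ket M (toC M t)) = T (ket M (toC M t))) : S = T := by
  have h1 : S ∘ₗ emb hμ = T ∘ₗ emb hμ := Mod.hom_ext fun t ht => by
    rw [LinearMap.comp_apply, LinearMap.comp_apply, emb_kz hμ ht.toIsFrame, h t ht]
  exact emb_hom_ext hμ fun x => LinearMap.congr_fun h1 x

end Patterns

/-! ### The explicit formulas -/

section Formulas

open Finset

variable {M : ℤ → ℂ[X]} {μ : ℤ → ℤ} {t T : Arr} {p j l : ℕ}

lemma Icc_eq_map {a b : ℤ} (ha : a = -((p / 2 : ℕ) : ℤ)) (hb : b + 1 = (p : ℤ) - ((p / 2 : ℕ) : ℤ)) :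
    Icc a b = (range p).map (col p) := by
  rw [← rowIdx_eq, rowIdx]
  congr 1 <;> omega

lemma L_toC (M : ℤ → ℂ[X]) (t : Arr) {a : ℕ} (h : a < p) : L (toC M t) (col p a) p =
    M 0 + ((lv t p a + ((p / 2 : ℕ) : ℤ) : ℤ) : ℂ[X]) := by
  rw [L, toC_col _ _ h, col_apply, lv]
  push_cast
  ring

/-- The expression under the square root in terms of the entries of an integral array. -/
def rad (p : ℕ) (t : Arr) (j l : ℕ) (x y : ℤ) : ℂ⟦X⟧ :=
  -(((∏ k ∈ (range (p + 1)).erase l, qnum (lv t (p + 1) k - x)) *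
      (∏ k ∈ range (p - 1), qnum (lv t (p - 1) k - (x + 1)))) *
    (∏ k ∈ (range p).erase j, qnum (lv t p k - x) * qnum (lv t p k - (x + 1)))⁻¹ *
    ((∏ k ∈ range (p + 2), qnum (lv t (p + 2) k - y)) *
      (∏ k ∈ (range p).erase j, qnum (lv t p k - (y + 1)))) *
    (∏ k ∈ (range (p + 1)).erase l,
      qnum (lv t (p + 1) k - y) * qnum (lv t (p + 1) k - (y + 1)))⁻¹)

/-- The prescribed radicand is minus the product of the unsymmetric coefficients for raising and for
lowering back. Their signs are opposite, so it equals the product of the absolute values. -/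
lemma Raise.rad_eq (h : Raise μ p j l t T) :
    rad p t j l (lv t p j) (lv t (p + 1) l) = absC p t j l * absD p T j l := by
  have h1 : absC p t j l * absD p T j l = -(coefC p t j l * coefD p T j l) := by
    rw [h.coefC_eq, h.coefD_eq]
    linear_combination (-(absC p t j l * absD p T j l)) * sg_mul_self j l
  rw [h1, coefC, coefD, cg, cg, xg, xg, xg, xg, rad, h.lv_p, h.lv_succ,
    h.lv_ne (r := p - 1) (by have := h.lt; omega) (by omega), prod_mul_distrib, prod_mul_distrib,
    PowerSeries.mul_inv_rev, PowerSeries.mul_inv_rev]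
  have e1 (z : ℤ) : ∏ k ∈ (range p).erase j, qnum (lv T p k - z) =
      ∏ k ∈ (range p).erase j, qnum (lv t p k - z) :=
    prod_congr rfl fun k hk => by rw [h.lv_p_ne (ne_of_mem_erase hk)]
  have e2 (z : ℤ) : ∏ k ∈ (range (p + 1)).erase l, qnum (lv T (p + 1) k - z) =
      ∏ k ∈ (range (p + 1)).erase l, qnum (lv t (p + 1) k - z) :=
    prod_congr rfl fun k hk => by rw [h.lv_succ_ne (ne_of_mem_erase hk)]
  simp only [e1, e2]
  ring

/-- The products omit the moved entries, which enter through `x` and `y` only. Hence lowering has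
the radicand of the reverse raising transition. -/
lemma Raise.rad_right (h : Raise μ p j l t T) (x y : ℤ) :
    rad p T j l x y = rad p t j l x y := by
  have e1 (z : ℤ) : ∏ k ∈ (range p).erase j, qnum (lv T p k - z) =
      ∏ k ∈ (range p).erase j, qnum (lv t p k - z) :=
    prod_congr rfl fun k hk => by rw [h.lv_p_ne (ne_of_mem_erase hk)]
  have e2 (z : ℤ) : ∏ k ∈ (range (p + 1)).erase l, qnum (lv T (p + 1) k - z) =
      ∏ k ∈ (range (p + 1)).erase l, qnum (lv t (p + 1) k - z) :=
    prod_congr rfl fun k hk => by rw [h.lv_succ_ne (ne_of_mem_erase hk)]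
  simp only [rad, prod_mul_distrib, e1, e2,
    h.lv_ne (r := p - 1) (by have := h.lt; omega) (by omega),
    h.lv_ne (r := p + 2) (by omega) (by omega)]

lemma br_eq_qnum {x : ℂ[X]} {n : ℤ} (h : x = (n : ℂ[X])) : br x = qnum n := by rw [h, qnum]

/-- The common `M 0` and the column origins cancel in all differences. Raising is the case `m + ν =
1`; the shift δ makes the radicand refer, in both cases, to the moved entries in the smaller of the
two arrays. For lowering the two factors of each denominator exchange their roles. -/
lemma radicand_toC (M : ℤ → ℂ[X]) (t : Arr) {i δ : ℤ} {m ν : ℕ} (hm : m ≤ 1) (hν : ν ≤ 1)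
    (hp : (p : ℤ) = 2 * i + ν - 1) (hp1 : 1 ≤ p) (hδ : δ = if m + ν = 1 then 0 else 1) (hj : j < p)
    (hl : l < p + 1) :
    radicand (toC M t) i m ν (col p j) (col (p + 1) l) =
      rad p t j l (lv t p j - δ) (lv t (p + 1) l - δ) := by
  have r1 : 2 * i + (ν : ℤ) = ((p + 1 : ℕ) : ℤ) := by push_cast; omega
  have r3 : ((p + 1 : ℕ) : ℤ) - 2 = ((p - 1 : ℕ) : ℤ) := by omega
  have r4 : ((p + 1 : ℕ) : ℤ) + 1 = ((p + 2 : ℕ) : ℤ) := by push_cast; omega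
  have r5 : ((p + 1 : ℕ) : ℤ) - 1 = (p : ℤ) := by push_cast; omega
  have s0 : ((p / 2 : ℕ) : ℤ) = i - 1 + ν := by omega
  have s1 : (((p + 1) / 2 : ℕ) : ℤ) = i := by omega
  have s2 : (((p - 1) / 2 : ℕ) : ℤ) = i - 1 := by omega
  have s3 : (((p + 2) / 2 : ℕ) : ℤ) = i + ν := by omega
  have c0 : Icc (1 - i - (ν : ℤ)) (i - 1) = (range p).map (col p) := Icc_eq_map (by omega) (by omega)
  have c1 : Icc (-i) (i + (ν : ℤ) - 1) = (range (p + 1)).map (col (p + 1)) :=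
    Icc_eq_map (by omega) (by omega)
  have c2 : Icc (1 - i) (i + (ν : ℤ) - 2) = (range (p - 1)).map (col (p - 1)) :=
    Icc_eq_map (by omega) (by omega)
  have c3 : Icc (-i - (ν : ℤ)) i = (range (p + 2)).map (col (p + 2)) :=
    Icc_eq_map (by omega) (by omega)
  rw [radicand, r1, r3, r4, r5, c0, c1, c2, c3, ← map_erase, ← map_erase]
  simp only [prod_map]
  rw [rad, L_toC M t hj, L_toC M t hl, s0, s1]
  have q1 : ∀ k ∈ (range (p + 1)).erase l, br (L (toC M t) (col (p + 1) k) ((p + 1 : ℕ) : ℤ) -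
      (M 0 + ((lv t p j + (i - 1 + ν) : ℤ) : ℂ[X])) - (-1) ^ ν * (m : ℂ[X])) =
      qnum (lv t (p + 1) k - (lv t p j - δ)) := by
    intro k hk
    rw [L_toC M t (mem_range.1 (mem_of_mem_erase hk)), s1]
    refine br_eq_qnum ?_
    rw [hδ]
    interval_cases m <;> interval_cases ν <;> push_cast <;> simp <;> ring
  have q2 : ∀ k ∈ range (p - 1), br (L (toC M t) (col (p - 1) k) ((p - 1 : ℕ) : ℤ) -
      (M 0 + ((lv t p j + (i - 1 + ν) : ℤ) : ℂ[X])) - (-1) ^ ν * (m : ℂ[X])) =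
      qnum (lv t (p - 1) k - (lv t p j - δ + 1)) := by
    intro k hk
    rw [L_toC M t (mem_range.1 hk), s2]
    refine br_eq_qnum ?_
    rw [hδ]
    interval_cases m <;> interval_cases ν <;> push_cast <;> simp <;> ring
  have q3 : ∀ k ∈ (range p).erase j, br (L (toC M t) (col p k) (p : ℤ) -
      (M 0 + ((lv t p j + (i - 1 + ν) : ℤ) : ℂ[X]))) *
      br (L (toC M t) (col p k) (p : ℤ) -
      (M 0 + ((lv t p j + (i - 1 + ν) : ℤ) : ℂ[X])) + (-1) ^ (m + ν)) =
      qnum (lv t p k - (lv t p j - δ)) * qnum (lv t p k - (lv t p j - δ + 1)) := by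
    intro k hk
    rw [L_toC M t (mem_range.1 (mem_of_mem_erase hk)), s0]
    by_cases h : m + ν = 1
    · rw [br_eq_qnum (n := lv t p k - (lv t p j - δ)),
        br_eq_qnum (n := lv t p k - (lv t p j - δ + 1))]
      · rw [h, hδ, if_pos h]; push_cast; ring
      · rw [hδ, if_pos h]; push_cast; ring
    · rw [mul_comm, br_eq_qnum (n := lv t p k - (lv t p j - δ)),
        br_eq_qnum (n := lv t p k - (lv t p j - δ + 1))]
      · rw [hδ, if_neg h]; push_cast; ring
      · rw [hδ, if_neg h, Even.neg_one_pow (by rw [Nat.even_iff]; omega)]; push_cast; ring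
  have q4 : ∀ k ∈ range (p + 2), br (L (toC M t) (col (p + 2) k) ((p + 2 : ℕ) : ℤ) -
      (M 0 + ((lv t (p + 1) l + i : ℤ) : ℂ[X])) + (-1) ^ ν * (1 - (m : ℂ[X]))) =
      qnum (lv t (p + 2) k - (lv t (p + 1) l - δ)) := by
    intro k hk
    rw [L_toC M t (mem_range.1 hk), s3]
    refine br_eq_qnum ?_
    rw [hδ]
    interval_cases m <;> interval_cases ν <;> push_cast <;> simp <;> ring
  have q5 : ∀ k ∈ (range p).erase j, br (L (toC M t) (col p k) (p : ℤ) -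
      (M 0 + ((lv t (p + 1) l + i : ℤ) : ℂ[X])) + (-1) ^ ν * (1 - (m : ℂ[X]))) =
      qnum (lv t p k - (lv t (p + 1) l - δ + 1)) := by
    intro k hk
    rw [L_toC M t (mem_range.1 (mem_of_mem_erase hk)), s0]
    refine br_eq_qnum ?_
    rw [hδ]
    interval_cases m <;> interval_cases ν <;> push_cast <;> simp <;> ring
  have q6 : ∀ k ∈ (range (p + 1)).erase l, br (L (toC M t) (col (p + 1) k) ((p + 1 : ℕ) : ℤ) -
      (M 0 + ((lv t (p + 1) l + i : ℤ) : ℂ[X]))) *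
      br (L (toC M t) (col (p + 1) k) ((p + 1 : ℕ) : ℤ) -
      (M 0 + ((lv t (p + 1) l + i : ℤ) : ℂ[X])) + (-1) ^ (m + ν)) =
      qnum (lv t (p + 1) k - (lv t (p + 1) l - δ)) *
        qnum (lv t (p + 1) k - (lv t (p + 1) l - δ + 1)) := by
    intro k hk
    rw [L_toC M t (mem_range.1 (mem_of_mem_erase hk)), s1]
    by_cases h : m + ν = 1
    · rw [br_eq_qnum (n := lv t (p + 1) k - (lv t (p + 1) l - δ)),
        br_eq_qnum (n := lv t (p + 1) k - (lv t (p + 1) l - δ + 1))]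
      · rw [h, hδ, if_pos h]; push_cast; ring
      · rw [hδ, if_pos h]; push_cast; ring
    · rw [mul_comm, br_eq_qnum (n := lv t (p + 1) k - (lv t (p + 1) l - δ)),
        br_eq_qnum (n := lv t (p + 1) k - (lv t (p + 1) l - δ + 1))]
      · rw [hδ, if_neg h]; push_cast; ring
      · rw [hδ, if_neg h, Even.neg_one_pow (by rw [Nat.even_iff]; omega)]; push_cast; ring
  rw [prod_congr rfl q1, prod_congr rfl q2, prod_congr rfl q3, prod_congr rfl q4,
    prod_congr rfl q5, prod_congr rfl q6]

/-- The origins of the columns in the rows `p` and `p + 1` differ for ν = 0 and agree for ν = 1.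
Equal columns therefore mean `l = j + 1` or `l = j`, which explains the sign (-1)^ν on the diagonal.
-/
lemma S_col {i : ℤ} {ν : ℕ} (hν : ν ≤ 1) (hp : (p : ℤ) = 2 * i + ν - 1) :
    (S (col p j) (col (p + 1) l) ν : ℂ⟦X⟧) = -sg j l := by
  rw [S, sg, col_apply, col_apply]
  interval_cases ν
  · split_ifs <;> first | omega | (push_cast; ring)
  · split_ifs <;> first | omega | (push_cast; ring)

/-- The formula for the operators in two rows, with `s = 1` for raising and `s = -1` for
lowering. -/
lemma emb_pair (hμ : ∀ i, M i = M 0 + ((μ i : ℤ) : ℂ[X])) (ht : IsGT μ t) {i s : ℤ} {m ν : ℕ}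
    (hm : m ≤ 1) (hν : ν ≤ 1) (hp : ((p + 1 : ℕ) : ℤ) = 2 * i + ν - 1)
    (hs : s = -(-1) ^ (m + ν)) :
    emb hμ ((if m + ν = 1 then eact μ (p + 1) else fact μ (p + 1)) (kz μ t)) =
      -∑ j ∈ Icc (1 - i - ν) (i - 1), ∑ l ∈ Icc (-i) (i + ν - 1),
        S j l ν • psSqrt (radicand (toC M t) i m ν j l) •
          ket M (shift (shift (toC M t) s j (2 * i - 1 + ν)) s l (2 * i + ν)) := by
  have c0 : Icc (1 - i - (ν : ℤ)) (i - 1) = (range (p + 1)).map (col (p + 1)) :=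
    Icc_eq_map (by omega) (by omega)
  have c1 : Icc (-i) (i + (ν : ℤ) - 1) = (range (p + 2)).map (col (p + 2)) :=
    Icc_eq_map (by omega) (by omega)
  have r0 : 2 * i - 1 + (ν : ℤ) = ((p + 1 : ℕ) : ℤ) := by omega
  have r1 : 2 * i + (ν : ℤ) = ((p + 2 : ℕ) : ℤ) := by omega
  rw [c0, c1, r0, r1, sum_map, ← sum_neg_distrib]
  have key (c : Arr → ℕ → ℕ → ℂ⟦X⟧) (h : ∀ j < p + 1, ∀ l < p + 2,
      IsGT μ (bump (bump t s (p + 1) j) s (p + 2) l) → c t j l = sg j l *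
        psSqrt (radicand (toC M t) i m ν (col (p + 1) j) (col (p + 2) l))) :
      emb hμ (pairOp μ s (p + 1) c (kz μ t)) = ∑ x ∈ range (p + 1),
        -∑ y ∈ (range (p + 2)).map (col (p + 2)), S (col (p + 1) x) y ν •
          psSqrt (radicand (toC M t) i m ν (col (p + 1) x) y) •
            ket M (shift (shift (toC M t) s (col (p + 1) x) ((p + 1 : ℕ) : ℤ)) s y
              ((p + 2 : ℕ) : ℤ)) := by
    rw [pairOp_kz _ _ _ ht, map_sum]
    refine sum_congr rfl fun j hj => ?_
    rw [map_sum, sum_map, ← sum_neg_distrib]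
    refine sum_congr rfl fun l hl => ?_
    rw [mem_range] at hj hl
    have hF := (ht.toIsFrame.bump s hj).bump s hl
    rw [map_smul, emb_kz hμ hF, toC_bump _ _ _ hl, toC_bump _ _ _ hj,
      ← Int.cast_smul_eq_zsmul ℂ⟦X⟧, S_col hν hp]
    by_cases hT : IsGT μ (bump (bump t s (p + 1) j) s (p + 2) l)
    · rw [h j hj l hl hT, neg_smul, neg_neg, smul_smul]
    · have : ket M (toC M (bump (bump t s (p + 1) j) s (p + 2) l)) = 0 := by
        rw [← emb_kz hμ hF, kz_eq_zero hT, map_zero]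
      rw [toC_bump _ _ _ hl, toC_bump _ _ _ hj] at this
      rw [this, smul_zero, smul_zero, smul_zero, neg_zero]
  split_ifs with h
  · obtain rfl : s = 1 := by rw [hs, h]; norm_num
    rw [eact]
    refine key _ fun j hj l hl hT => ?_
    have hR : Raise μ (p + 1) j l t _ := ⟨hj, hl, ht, hT, rfl⟩
    rw [radicand_toC M t hm hν hp (by omega) rfl hj hl, if_pos h, sub_zero, sub_zero, hR.rad_eq]
  · obtain rfl : s = -1 := by
      rw [hs, Even.neg_one_pow (by rw [Nat.even_iff]; omega)]
    rw [fact]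
    refine key _ fun j hj l hl hT => ?_
    have hR : Raise μ (p + 1) j l (bump (bump t (-1) (p + 1) j) (-1) (p + 2) l) t :=
      ⟨hj, hl, hT, ht, by rw [bump_comm, bump_neg_bump, bump_neg_bump]⟩
    rw [radicand_toC M t hm hν hp (by omega) rfl hj hl, if_neg h, ← hR.rad_eq, hR.rad_right,
      hR.lv_p, hR.lv_succ, add_sub_cancel_right, add_sub_cancel_right]

lemma radicandMid_toC (ht : IsGT μ t) {m : ℕ} {δ : ℤ} (hm : m ≤ 1) (hδ : δ = 1 - m) :
    radicandMid (toC M t) m = ∏ k ∈ range 2, aq (lv t 2 k - (lv t 1 0 - δ)) := by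
  have h0 : L (toC M t) (-1) 2 = M 0 + ((lv t 2 0 + 1 : ℤ) : ℂ[X]) := by
    have := L_toC M t (p := 2) (a := 0) (by norm_num)
    rwa [col_apply, Nat.div_self two_pos, Nat.cast_zero, Nat.cast_one, zero_sub,
      Nat.cast_ofNat] at this
  have h1 : L (toC M t) 0 1 = M 0 + ((lv t 1 0 + 0 : ℤ) : ℂ[X]) := by
    have := L_toC M t (p := 1) (a := 0) (by norm_num)
    rwa [col_apply, show 1 / 2 = 0 from rfl, Nat.cast_zero, Nat.cast_one, sub_zero] at this
  have h2 : L (toC M t) 0 2 = M 0 + ((lv t 2 1 + 1 : ℤ) : ℂ[X]) := by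
    have := L_toC M t (p := 2) (a := 1) (by norm_num)
    rwa [col_apply, Nat.div_self two_pos, Nat.cast_one, sub_self, Nat.cast_ofNat] at this
  have e1 : lv t 1 0 ≤ lv t 2 0 := ht.lv_le one_pos le_rfl
  have e2 : lv t 2 1 < lv t 1 0 := ht.lv_lt (p := 1) one_pos (by norm_num)
  rw [radicandMid, h0, h1, h2, prod_range_succ, prod_range_one, aq, aq,
    abs_of_nonneg (show 0 ≤ lv t 2 0 - (lv t 1 0 - δ) by omega),
    abs_of_nonpos (show lv t 2 1 - (lv t 1 0 - δ) ≤ 0 by omega),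
    br_eq_qnum (n := lv t 2 0 - (lv t 1 0 - δ)), br_eq_qnum (n := -(lv t 2 1 - (lv t 1 0 - δ)))]
  · rw [hδ]; push_cast; ring
  · rw [hδ]; push_cast; ring

lemma emb_first (hμ : ∀ i, M i = M 0 + ((μ i : ℤ) : ℂ[X])) (ht : IsGT μ t) {m : ℕ} (hm : m ≤ 1) :
    emb hμ ((if m = 1 then eact μ 0 else fact μ 0) (kz μ t)) =
      psSqrt (radicandMid (toC M t) m) • ket M (shift (toC M t) (-(-1) ^ m) 0 1) := by
  have key (s : ℤ) (c : Arr → ℕ → ℂ⟦X⟧) (h : c t 0 = psSqrt (radicandMid (toC M t) m)) :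
      emb hμ (shiftOp μ s 1 c (kz μ t)) =
        psSqrt (radicandMid (toC M t) m) • ket M (shift (toC M t) s 0 1) := by
    have h1 := toC_bump M t s (p := 1) (a := 0) one_pos
    have h2 := emb_kz hμ (ht.toIsFrame.bump s (p := 1) (a := 0) one_pos)
    rw [h1] at h2
    rw [shiftOp_kz, range_one, sum_singleton, map_smul, h2]
    by_cases hT : IsGT μ (bump t s 1 0)
    · rw [hat_of ht hT, h]
      rfl
    · rw [kz_eq_zero hT, map_zero] at h2
      have h3 : ket M (shift (toC M t) s 0 1) = 0 := h2.symm
      rw [← h2, h3, smul_zero, smul_zero]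
  interval_cases m
  · rw [if_neg (by norm_num), fact]
    exact key _ _ (by rw [radicandMid_toC ht (δ := 1) (by norm_num) (by norm_num)])
  · rw [if_pos rfl, eact, show (-(-1) ^ 1 : ℤ) = 1 by norm_num]
    exact key _ _ (by
      rw [radicandMid_toC ht (δ := 0) (by norm_num) (by norm_num)]
      simp only [sub_zero])

lemma sum_toC (M : ℤ → ℂ[X]) (t : Arr) (p : ℕ) :
    ∑ j ∈ (range p).map (col p), toC M t j p = p * M 0 + ((rs t p : ℤ) : ℂ[X]) := by
  rw [sum_map, sum_congr rfl fun a ha => toC_col M t (mem_range.1 ha), sum_add_distrib, rs]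
  simp

lemma weight_toC (M : ℤ → ℂ[X]) (ξ₀ ξ₁ : ℂ[X]) (t : Arr) (i : ℤ) : weight ξ₀ ξ₁ (toC M t) i =
    M 0 + (ξ₁ - ξ₀) * (theta (-i) : ℂ[X]) - ξ₁ + ((wint t i : ℤ) : ℂ[X]) := by
  have h0 : (wrow i : ℤ) = 2 * |i| + theta i := by
    rcases i with n | n
    · rw [wrow, theta, Int.ofNat_eq_natCast, if_pos (Int.natCast_nonneg n), Nat.abs_cast]
      push_cast; ring
    · rw [wrow, theta, if_neg (by omega), abs_of_neg (by omega), Int.negSucc_eq]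
      push_cast; ring
  have hθ : theta i = 0 ∨ theta i = 1 := by rw [theta]; split_ifs <;> simp
  have h1 : 1 ≤ wrow i := by rcases i with n | n <;> simp [wrow]
  have hi := abs_nonneg i
  have c0 : Icc (-|i|) (|i| + theta i - 1) = (range (wrow i)).map (col (wrow i)) :=
    Icc_eq_map (by omega) (by omega)
  have c1 : Icc (-|i| + 1 - theta i) (|i| - 1) = (range (wrow i - 1)).map (col (wrow i - 1)) :=
    Icc_eq_map (by omega) (by omega)
  rw [weight, c0, c1, ← h0, show (wrow i : ℤ) - 1 = ((wrow i - 1 : ℕ) : ℤ) by omega, sum_toC, sum_toC,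
    wint, Nat.cast_sub h1]
  push_cast
  ring

end Formulas

/-! ### The representation -/

section Representation

variable {M : ℤ → ℂ[X]} {μ : ℤ → ℤ} {t : Arr}

lemma coe_intCast (n : ℤ) : (((n : ℤ) : ℂ[X]) : ℂ⟦X⟧) = (n : ℂ⟦X⟧) :=
  map_intCast (Polynomial.coeToPowerSeries.ringHom (R := ℂ)) n

/-- The constant part of the weight. -/
def hconst (M : ℤ → ℂ[X]) (ξ₀ ξ₁ : ℂ[X]) (i : ℤ) : ℂ⟦X⟧ :=
  ((M 0 + (ξ₁ - ξ₀) * (theta (-i) : ℂ[X]) - ξ₁ : ℂ[X]) : ℂ⟦X⟧)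

/-- The operators of the generators. -/
def genAct (hμ : ∀ i, M i = M 0 + ((μ i : ℤ) : ℂ[X])) (ξ₀ ξ₁ : ℂ[X]) :
    Gen → Module.End ℂ⟦X⟧ (V M)
  | Gen.e i => extendHom hμ (eAct μ i)
  | Gen.f i => extendHom hμ (fAct μ i)
  | Gen.h i => extendHom hμ (hAct μ (hconst M ξ₀ ξ₁ i) i)
  | Gen.c => algebraMap ℂ⟦X⟧ _ ((ξ₀ - ξ₁ : ℂ[X]) : ℂ⟦X⟧)

variable (hμ : ∀ i, M i = M 0 + ((μ i : ℤ) : ℂ[X])) (ξ₀ ξ₁ : ℂ[X])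

lemma extendHom_diag (ht : IsGT μ t) (f : Arr → ℂ⟦X⟧) :
    extendHom hμ (diag μ f) (ket M (toC M t)) = f t • ket M (toC M t) := by
  rw [← emb_kz hμ ht.toIsFrame, extendHom_emb, diag_kz, map_smul]

lemma genAct_h (ht : IsGT μ t) (i : ℤ) : genAct hμ ξ₀ ξ₁ (Gen.h i) (ket M (toC M t)) =
    (weight ξ₀ ξ₁ (toC M t) i : ℂ⟦X⟧) • ket M (toC M t) := by
  rw [genAct, hAct, extendHom_diag hμ ht, weight_toC, hconst]
  rw [← coe_intCast, ← Polynomial.coe_add]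

lemma qBracket_intCast (n : ℤ) : qBracket ((n : ℤ) : ℂ⟦X⟧) = qnum n := by
  rw [qnum, br, coe_intCast]

lemma commute_relator {x y : Gen} (h : Commute (genAct hμ ξ₀ ξ₁ x) (genAct hμ ξ₀ ξ₁ y)) :
    freeHom (genAct hμ ξ₀ ξ₁) (gen x * gen y - gen y * gen x) = 0 := by
  rw [map_sub, map_mul, map_mul, freeHom_gen, freeHom_gen, h.eq, sub_self]

lemma serre_relator {x y : Gen}
    (h : Serre (qnum 2) (genAct hμ ξ₀ ξ₁ x) (genAct hμ ξ₀ ξ₁ y)) :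
    freeHom (genAct hμ ξ₀ ξ₁) (gen x ^ 2 * gen y -
      (qPow (1 : ℂ⟦X⟧) + qPow (-1 : ℂ⟦X⟧)) • (gen x * gen y * gen x) + gen y * gen x ^ 2) = 0 := by
  rw [Serre, qnum_two, qz_one, qz_neg_one] at h
  simp only [map_add, map_sub, map_mul, map_smul, freeHom_gen, pow_two, ← mul_assoc]
  exact h

lemma genAct_relator (x : FreeSeries) (hx : IsRelator x) : freeHom (genAct hμ ξ₀ ξ₁) x = 0 := by
  rcases hx with i | i | i | ⟨i, j⟩ | ⟨i, j⟩ | ⟨i, j⟩ | i | ⟨i, j, hij⟩ | ⟨i, j, hij⟩ |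
    ⟨i, j, hij⟩ | ⟨i, j, hij⟩ | ⟨i, j, hij⟩
  · exact commute_relator hμ ξ₀ ξ₁ (Algebra.commutes _ _)
  · exact commute_relator hμ ξ₀ ξ₁ (Algebra.commutes _ _)
  · exact commute_relator hμ ξ₀ ξ₁ (Algebra.commutes _ _)
  · exact commute_relator hμ ξ₀ ξ₁ ((commute_diag _ _).map (extendHom hμ))
  · rw [map_sub, map_sub, map_mul, map_mul, map_zsmul, freeHom_gen, freeHom_gen, genAct, genAct,
      ← map_mul, ← map_mul, ← map_sub, (hAct_comm (hconst M ξ₀ ξ₁ i) i j).1, map_smul,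
      Int.cast_smul_eq_zsmul]
    exact sub_self _
  · rw [map_add, map_sub, map_mul, map_mul, map_zsmul, freeHom_gen, freeHom_gen, genAct, genAct,
      ← map_mul, ← map_mul, ← map_sub, (hAct_comm (hconst M ξ₀ ξ₁ i) i j).2, map_smul, neg_smul,
      Int.cast_smul_eq_zsmul]
    exact neg_add_cancel _
  · rw [map_sub, map_sub, map_mul, map_mul, freeHom_gen, freeHom_gen, sub_eq_zero]
    refine V_hom_ext hμ fun t ht => ?_
    -- The argument of the q-bracket acts on a pattern by an integer: the term with `c` cancels the
    -- contributions of `ξ₀` and `ξ₁`, and `M 0` drops out of the difference.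
    have key : freeHom (genAct hμ ξ₀ ξ₁)
        (gen (Gen.h i) - gen (Gen.h (i + 1)) + (theta (-i) - theta (-i - 1)) • gen Gen.c)
        (ket M (toC M t)) = ((wint t i - wint t (i + 1) : ℤ) : ℂ⟦X⟧) • ket M (toC M t) := by
      rw [map_add, map_sub, map_zsmul, freeHom_gen, freeHom_gen, freeHom_gen, LinearMap.add_apply,
        LinearMap.sub_apply, LinearMap.smul_apply, genAct_h _ _ _ ht, genAct_h _ _ _ ht, genAct,
        Module.algebraMap_end_apply, weight_toC, weight_toC, ← Int.cast_smul_eq_zsmul ℂ⟦X⟧,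
        smul_smul, ← sub_smul, ← add_smul]
      congr 1
      rw [show -(i + 1) = -i - 1 by ring]
      simp only [Polynomial.coe_add, Polynomial.coe_sub, Polynomial.coe_mul, coe_intCast,
        Int.cast_sub]
      ring
    rw [freeHom_qBracket _ key, qBracket_intCast, genAct, genAct, ← map_mul, ← map_mul, ← map_sub,
      eAct_comm_fAct, extendHom_diag hμ ht]
  · exact commute_relator hμ ξ₀ ξ₁ ((commute_eAct_fAct hij).map (extendHom hμ))
  · exact commute_relator hμ ξ₀ ξ₁ ((commute_eAct hij).map (extendHom hμ))
  · exact serre_relator hμ ξ₀ ξ₁ ((serre_eAct hij).map (extendHom hμ))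
  · exact commute_relator hμ ξ₀ ξ₁ ((commute_fAct hij).map (extendHom hμ))
  · exact serre_relator hμ ξ₀ ξ₁ ((serre_fAct hij).map (extendHom hμ))

/-- The representation of `U_h(a_∞)` in `V`. -/
def repn : Rep M := (exists_rep (genAct hμ ξ₀ ξ₁) (genAct_relator hμ ξ₀ ξ₁)).choose

lemma repn_of (x : Gen) : repn hμ ξ₀ ξ₁ (Uh.of x) = genAct hμ ξ₀ ξ₁ x :=
  (exists_rep (genAct hμ ξ₀ ξ₁) (genAct_relator hμ ξ₀ ξ₁)).choose_spec x

lemma repn_chev {m : ℕ} (hm : m ≤ 1) (i : ℤ) :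
    repn hμ ξ₀ ξ₁ (Uh.chev m i) = extendHom hμ (if m = 1 then eAct μ i else fAct μ i) := by
  interval_cases m
  · exact repn_of hμ ξ₀ ξ₁ (Gen.f i)
  · exact repn_of hμ ξ₀ ξ₁ (Gen.e i)

lemma actsOnBasis_repn : ActsOnBasis ξ₀ ξ₁ (repn hμ ξ₀ ξ₁) where
  mid := by
    rintro ⟨m, hm⟩ k hk
    obtain ⟨t, ht, rfl⟩ := exists_toC hμ hm
    rw [repn_chev hμ ξ₀ ξ₁ (by omega), ← emb_first hμ ht hk, ← emb_kz hμ ht.toIsFrame,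
      extendHom_emb, show (-1 : ℤ) = Int.negSucc 0 from rfl]
    interval_cases k <;> rfl
  outer := by
    rintro ⟨m, hm⟩ i k ν hi hk hν
    obtain ⟨t, ht, rfl⟩ := exists_toC hμ hm
    obtain ⟨n, rfl⟩ : ∃ n : ℕ, i = n + 1 := ⟨(i - 1).toNat, by omega⟩
    rw [repn_chev hμ ξ₀ ξ₁ hk,
      ← emb_pair hμ ht hk hν (p := 2 * n + ν) (by push_cast; ring) rfl,
      ← emb_kz hμ ht.toIsFrame, extendHom_emb]
    congr 2
    interval_cases ν
    · rw [show (-1 : ℤ) ^ 0 * ((n : ℤ) + 1) - 1 = Int.ofNat n by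
        rw [Int.ofNat_eq_natCast]; ring, eAct, fAct, add_zero, add_zero]
    · rw [show (-1 : ℤ) ^ 1 * ((n : ℤ) + 1) - 1 = Int.negSucc (n + 1) by
        rw [Int.negSucc_eq]; push_cast; ring, eAct, fAct, show 2 * (n + 1) = 2 * n + 1 + 1 by ring]
      interval_cases k <;> simp
  cartan := by
    rintro ⟨m, hm⟩ i
    obtain ⟨t, ht, rfl⟩ := exists_toC hμ hm
    rw [repn_of, genAct_h hμ ξ₀ ξ₁ ht]
  central m := by rw [repn_of, genAct, Module.algebraMap_end_apply]

/-- The formulas prescribe every generator on the patterns, whose span is dense: ν = 1 covers the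
indices below -1, ν = 0 those above, and the middle formula covers -1. -/
lemma ActsOnBasis.eq (hμ : ∀ i, M i = M 0 + ((μ i : ℤ) : ℂ[X])) {ξ₀ ξ₁ : ℂ[X]} {ρ ρ' : Rep M} (h : ActsOnBasis ξ₀ ξ₁ ρ) (h' : ActsOnBasis ξ₀ ξ₁ ρ') :
    ρ = ρ' := by
  have hchev (m : ℕ) (hm : m ≤ 1) (i : ℤ) : ρ (Uh.chev m i) = ρ' (Uh.chev m i) := by
    refine V_hom_ext hμ fun t ht => ?_
    let g : CPattern M := ⟨toC M t, (isGT_iff hμ ht.toIsFrame).2 ht⟩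
    rcases lt_trichotomy i (-1) with hi | rfl | hi
    · have h1 := h.outer g (-i - 1) m 1 (by omega) hm le_rfl
      have h2 := h'.outer g (-i - 1) m 1 (by omega) hm le_rfl
      rw [show (-1 : ℤ) ^ 1 * (-i - 1) - 1 = i by ring] at h1 h2
      exact h1.trans h2.symm
    · have h1 := h.mid g (1 - m) (by omega)
      have h2 := h'.mid g (1 - m) (by omega)
      rw [Nat.sub_sub_self hm] at h1 h2
      exact h1.trans h2.symm
    · have h1 := h.outer g (i + 1) m 0 (by omega) hm (by norm_num)
      have h2 := h'.outer g (i + 1) m 0 (by omega) hm (by norm_num)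
      rw [show (-1 : ℤ) ^ 0 * (i + 1) - 1 = i by ring] at h1 h2
      exact h1.trans h2.symm
  refine rep_ext fun x => ?_
  rcases x with i | i | i | _
  · exact hchev 1 le_rfl i
  · exact hchev 0 (by norm_num) i
  · refine V_hom_ext hμ fun t ht => ?_
    exact (h.cartan ⟨_, (isGT_iff hμ ht.toIsFrame).2 ht⟩ i).trans
      (h'.cartan ⟨_, (isGT_iff hμ ht.toIsFrame).2 ht⟩ i).symm
  · refine V_hom_ext hμ fun t ht => ?_
    exact (h.central ⟨_, (isGT_iff hμ ht.toIsFrame).2 ht⟩).trans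
      (h'.central ⟨_, (isGT_iff hμ ht.toIsFrame).2 ht⟩).symm

lemma isHAdicContinuous (ρ : Rep M) : IsHAdicContinuous ρ :=
  fun u n => ⟨n, fun w => ⟨ρ w, by rw [map_add, map_smul]⟩⟩

end Representation

/-! ### The highest weight vector -/

section HighestWeight

variable {M : ℤ → ℂ[X]} {μ : ℤ → ℤ}

/-- The array with the largest entries. -/
def top (μ : ℤ → ℤ) : Arr := fun p a => if a < p then μ ((a : ℤ) - ((p / 2 : ℕ) : ℤ)) else 0

lemma top_of_lt {p a : ℕ} (h : a < p) : top μ p a = μ ((a : ℤ) - ((p / 2 : ℕ) : ℤ)) := if_pos h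

lemma isGT_top (hμ : Antitone μ) : IsGT μ (top μ) where
  outside p a h := if_neg (not_lt.2 h)
  stable := ⟨0, fun p _ a h => top_of_lt h⟩
  upper p a h := by
    rw [top_of_lt h, top_of_lt (Nat.lt_succ_of_lt h)]
    exact hμ (by omega)
  lower p a h := by
    rw [top_of_lt h, top_of_lt (Nat.succ_lt_succ h)]
    exact hμ (by push_cast; omega)

lemma antitone_signature (hM : ∀ i j : ℤ, i < j → IsNatConst (M i - M j))
    (hμ : ∀ i, M i = M 0 + ((μ i : ℤ) : ℂ[X])) : Antitone μ := by
  intro i j hij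
  rcases hij.eq_or_lt with rfl | h
  · exact le_rfl
  · have := hM i j h
    rwa [hμ i, hμ j, isNatConst_sub_iff] at this

lemma toC_top (hμ : ∀ i, M i = M 0 + ((μ i : ℤ) : ℂ[X])) : toC M (top μ) = fun i _ => M i := by
  funext i p
  by_cases hi : i ∈ rowIdx p
  · obtain ⟨r, a, ha, rfl, rfl⟩ := mem_rowIdx hi
    rw [toC_col _ _ ha, top_of_lt ha, hμ (col r a), col_apply]
  · rw [toC, if_neg hi]

/-- In the largest array equal columns have equal entries. Each e_i with i ≥ 0 raises an entry of
row 2i + 2 that equals its upper bound, and each e_i with i < 0 lowers an entry of row -2i - 1 that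
equals its lower bound. No target array interlaces. -/
lemma eAct_top (hμ : Antitone μ) (i : ℤ) : eAct μ i (kz μ (top μ)) = 0 := by
  have ht := isGT_top hμ
  rcases i with n | n
  · obtain ⟨c, c', h, -⟩ := exists_pairOp (μ := μ) (2 * n)
    rw [eAct, h, pairOp_kz _ _ _ ht]
    refine Finset.sum_eq_zero fun j hj => Finset.sum_eq_zero fun l hl => ?_
    rw [Finset.mem_range] at hj hl
    rw [kz_eq_zero, smul_zero]
    intro hT
    have := hT.upper (2 * n + 1 + 1) l hl
    simp only [bump] at this
    rw [if_pos (by trivial), if_neg (by omega), if_neg (by omega), if_neg (by omega), top_of_lt hl,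
      top_of_lt (by omega), show (2 * n + 1 + 1) / 2 = (2 * n + 1 + 1 + 1) / 2 by omega] at this
    omega
  rcases n with _ | n
  · obtain ⟨c, c', -, h⟩ := exists_shiftOp (μ := μ)
    rw [eAct, mul_zero, h, shiftOp_kz, Finset.range_one, Finset.sum_singleton, kz_eq_zero,
      smul_zero]
    intro hT
    have := hT.lower 1 0 one_pos
    simp only [bump] at this
    rw [if_neg (by omega), if_pos (by trivial), top_of_lt one_pos, top_of_lt (by omega)] at this
    norm_num at this
  · obtain ⟨c, c', -, h⟩ := exists_pairOp (μ := μ) (2 * n + 1)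
    rw [eAct, show 2 * (n + 1) = 2 * n + 1 + 1 by ring, h, pairOp_kz _ _ _ ht]
    refine Finset.sum_eq_zero fun j hj => Finset.sum_eq_zero fun l hl => ?_
    rw [Finset.mem_range] at hj hl
    rw [kz_eq_zero, smul_zero]
    intro hT
    have := hT.lower (2 * n + 1 + 1 + 1) l hl
    simp only [bump] at this
    rw [if_neg (by omega), if_neg (by omega), if_pos (by trivial), if_neg (by omega), top_of_lt hl,
      top_of_lt (by omega), show ((l + 1 : ℕ) : ℤ) - (((2 * n + 1 + 1 + 1 + 1) / 2 : ℕ) : ℤ) =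
        (l : ℤ) - (((2 * n + 1 + 1 + 1) / 2 : ℕ) : ℤ) by push_cast; omega] at this
    omega

lemma weight_top (M : ℤ → ℂ[X]) (ξ₀ ξ₁ : ℂ[X]) (i : ℤ) : weight ξ₀ ξ₁ (fun i _ => M i) i =
    M i + (ξ₁ - ξ₀) * (theta (-i) : ℂ[X]) - ξ₁ := by
  have key : ∑ j ∈ Finset.Icc (-|i|) (|i| + theta i - 1), M j =
      M i + ∑ j ∈ Finset.Icc (-|i| + 1 - theta i) (|i| - 1), M j := by
    rw [← Finset.sum_insert]
    · congr 1
      ext j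
      rw [Finset.mem_insert, Finset.mem_Icc, Finset.mem_Icc, theta]
      rcases le_or_gt 0 i with h | h
      · rw [if_pos h, abs_of_nonneg h]; omega
      · rw [if_neg (not_le.2 h), abs_of_neg h]; omega
    · rw [Finset.mem_Icc, theta]
      rcases le_or_gt 0 i with h | h
      · rw [if_pos h, abs_of_nonneg h]; omega
      · rw [if_neg (not_le.2 h), abs_of_neg h]; omega
  rw [weight, key]
  ring

end HighestWeight

/-! ### Submodules that are invariant under moves in the rows below a given one -/

section Invariant

open Finset

variable {μ : ℤ → ℤ} {t : Arr} {N p j : ℕ}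

/-- The coefficient of an array in an element of the free module. -/
def co (t : Arr) : Mod μ →ₗ[ℂ⟦X⟧] ℂ⟦X⟧ := by
  classical
  exact if h : IsGT μ t then Finsupp.lapply ⟨t, h⟩ else 0

lemma co_of (x : Mod μ) (h : IsGT μ t) : co t x = x ⟨t, h⟩ := by
  rw [co, dif_pos h, Finsupp.lapply_apply]

lemma co_of_not (x : Mod μ) (h : ¬ IsGT μ t) : co t x = 0 := by
  rw [co, dif_neg h, LinearMap.zero_apply]

open Classical in
lemma co_kz {T : Arr} (h : IsGT μ t) : co (μ := μ) T (kz μ t) = if t = T then 1 else 0 := by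
  by_cases hT : IsGT μ T
  · rw [co_of _ hT, kz, dif_pos h, Finsupp.single_apply]
    simp only [Subtype.mk.injEq]
  · rw [co_of_not _ hT, if_neg]
    rintro rfl
    exact hT h

lemma co_diag (f : Arr → ℂ⟦X⟧) (x : Mod μ) (t : Arr) : co t (diag μ f x) = f t * co t x := by
  suffices H : co t ∘ₗ diag μ f = f t • co (μ := μ) t from LinearMap.congr_fun H x
  refine Mod.hom_ext fun T hT => ?_
  rw [LinearMap.comp_apply, diag_kz, map_smul, LinearMap.smul_apply, co_kz hT, smul_eq_mul,
    smul_eq_mul]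
  split_ifs with h
  · rw [h]
  · rw [mul_zero, mul_zero]

lemma co_shiftOp (s : ℤ) (p : ℕ) (c : Arr → ℕ → ℂ⟦X⟧) (x : Mod μ) (h : IsGT μ t) :
    co t (shiftOp μ s p c x) =
      ∑ j ∈ range p, c (bump t (-s) p j) j * co (bump t (-s) p j) x := by
  suffices H : co t ∘ₗ shiftOp μ s p c =
      ∑ j ∈ range p, c (bump t (-s) p j) j • co (μ := μ) (bump t (-s) p j) by
    have := LinearMap.congr_fun H x
    rw [LinearMap.sum_apply] at this
    exact this
  refine Mod.hom_ext fun T hT => ?_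
  rw [LinearMap.comp_apply, shiftOp_kz, map_sum, LinearMap.sum_apply]
  refine sum_congr rfl fun j _ => ?_
  rw [map_smul, LinearMap.smul_apply, co_kz hT]
  by_cases hb : IsGT μ (bump T s p j)
  · rw [co_kz hb, hat_of hT hb]
    by_cases e : bump T s p j = t
    · have e' : T = bump t (-s) p j := by rw [← e, bump_bump_neg]
      rw [if_pos e, if_pos e', ← e']
    · rw [if_neg e, if_neg, smul_zero, smul_zero]
      rintro rfl
      exact e (bump_neg_bump t s p j)
  · rw [kz_eq_zero hb, map_zero, smul_zero, if_neg, smul_zero]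
    rintro rfl
    rw [bump_neg_bump] at hb
    exact hb h

lemma exists_eq_X_smul {x : Mod μ} (h : ∀ t, PowerSeries.constantCoeff (co t x) = 0) :
    ∃ y : Mod μ, x = (PowerSeries.X : ℂ⟦X⟧) • y := by
  refine ⟨x.mapRange divH (by ext; simp [divH]), Finsupp.ext fun g => ?_⟩
  rw [Finsupp.smul_apply, Finsupp.mapRange_apply, smul_eq_mul, X_mul_divH]
  have := h g.1
  rwa [co_of x g.2] at this

/-- The rows from `N` on are given by the signature. -/
def Stable (μ : ℤ → ℤ) (N : ℕ) (t : Arr) : Prop :=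
  ∀ r, N ≤ r → ∀ a < r, t r a = μ ((a : ℤ) - ((r / 2 : ℕ) : ℤ))

/-- The first row that differs from the beginning of the next one. -/
def FirstJump (t : Arr) (p : ℕ) : Prop :=
  (∃ a < p, t p a ≠ t (p + 1) a) ∧ ∀ r < p, ∀ a < r, t r a = t (r + 1) a

/-- The rows up to `N` are the beginnings of each other. -/
def Flat (N : ℕ) (t : Arr) : Prop := ∀ p < N, ∀ a < p, t p a = t (p + 1) a

lemma exists_firstJump {a : ℕ} (ha : a < p) (h : t p a ≠ t (p + 1) a) :
    ∃ r ≤ p, FirstJump t r := by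
  classical
  have hex : ∃ r, ∃ a < r, t r a ≠ t (r + 1) a := ⟨p, a, ha, h⟩
  refine ⟨Nat.find hex, Nat.find_min' hex ⟨a, ha, h⟩, Nat.find_spec hex, fun r hr a ha => ?_⟩
  by_contra hne
  exact Nat.find_min hex hr ⟨a, ha, hne⟩

lemma exists_firstJump_of_not_flat (h : ¬ Flat N t) : ∃ p < N, FirstJump t p := by
  simp only [Flat, not_forall] at h
  obtain ⟨p, hp, a, ha, h⟩ := h
  obtain ⟨r, hr, hj⟩ := exists_firstJump ha h
  exact ⟨r, by omega, hj⟩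

/-- An array with a jump has a raised neighbour all of whose other lowered neighbours jump
earlier. -/
lemma FirstJump.exists_bump (h : FirstJump t p) (ht : IsGT μ t) : ∃ j < p,
    IsGT μ (bump t 1 p j) ∧ ∀ j' < p, j' ≠ j →
      ∃ r < p, FirstJump (bump (bump t 1 p j) (-1) p j') r := by
  obtain ⟨⟨j, hj, hne⟩, hflat⟩ := h
  refine ⟨j, hj, ht.bump_one hj ?_ hne.symm, fun j' hj' hjj => ?_⟩
  · rintro r a rfl rfl h
    have h1 := hflat r (by omega) a (by omega)
    have h2 := ht.lower (r + 1) a (by omega)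
    have h3 := ht.upper (r + 1) (a + 1) hj
    omega
  -- The row `q = p - 1` agreed with the beginning of row `p`. After the two moves it disagrees, at
  -- `j'` if `j' < q`, and at `j` if `j' = q`; so there is a jump in row `q` or earlier.
  · obtain ⟨q, rfl⟩ : ∃ q, p = q + 1 := ⟨p - 1, by omega⟩
    suffices H : ∃ a < q, bump (bump t 1 (q + 1) j) (-1) (q + 1) j' q a ≠
        bump (bump t 1 (q + 1) j) (-1) (q + 1) j' (q + 1) a by
      obtain ⟨a, ha, hb⟩ := H
      obtain ⟨r, hr, h⟩ := exists_firstJump ha hb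
      exact ⟨r, by omega, h⟩
    rcases lt_or_ge j' q with h | h
    · refine ⟨j', h, ?_⟩
      have := hflat q (by omega) j' h
      simp only [bump, true_and]
      split_ifs <;> omega
    · refine ⟨j, by omega, ?_⟩
      have := hflat q (by omega) j (by omega)
      simp only [bump, true_and]
      split_ifs <;> omega

lemma Flat.eq (h : Flat N t) {t' : Arr} (h' : Flat N t') (hs : Stable μ N t) (hs' : Stable μ N t')
    (ht : IsGT μ t) (ht' : IsGT μ t') : t = t' := by
  have key (k : ℕ) : ∀ p, p + k = N → ∀ a < p, t p a = t' p a := by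
    induction k with
    | zero =>
      rintro p rfl a ha
      rw [hs p (by omega) a ha, hs' p (by omega) a ha]
    | succ k ih =>
      intro p hp a ha
      rw [h p (by omega) a ha, h' p (by omega) a ha, ih (p + 1) (by omega) a (by omega)]
  funext p a
  rcases lt_or_ge a p with ha | ha
  · rcases le_or_gt p N with hp | hp
    · exact key (N - p) p (by omega) a ha
    · rw [hs p hp.le a ha, hs' p hp.le a ha]
  · rw [ht.outside p a ha, ht'.outside p a ha]

lemma Stable.bump (h : Stable μ N t) (s : ℤ) (hp : p < N) (j : ℕ) :
    Stable μ N (bump t s p j) := by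
  intro r hr a ha
  rw [bump_row_ne t s j (by omega)]
  exact h r hr a ha

lemma Stable.mono (h : Stable μ N t) {N' : ℕ} (hN : N ≤ N') : Stable μ N' t :=
  fun r hr => h r (hN.trans hr)

/-- The sum of the entries of the rows below `N`. -/
def total (N : ℕ) (t : Arr) : ℤ := ∑ r ∈ range N, rs t r

lemma total_bump (s : ℤ) (hp : p < N) (hj : j < p) :
    total N (bump t s p j) = total N t + s := by
  rw [total, total, ← add_sum_erase _ _ (mem_range.2 hp), ← add_sum_erase _ _ (mem_range.2 hp),
    rs_bump_self t s hj, sum_congr rfl fun r hr => rs_bump_ne t s j (ne_of_mem_erase hr)]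
  ring

/-- An upper bound for `total`. -/
def totalBound (μ : ℤ → ℤ) (N : ℕ) : ℤ :=
  ∑ r ∈ range N, ∑ a ∈ range r, μ ((a : ℤ) - ((N / 2 : ℕ) : ℤ))

lemma total_le (ht : IsGT μ t) (hs : Stable μ N t) : total N t ≤ totalBound μ N := by
  have key (k : ℕ) : ∀ p, p + k = N → ∀ a < p, t p a ≤ μ ((a : ℤ) - ((N / 2 : ℕ) : ℤ)) := by
    induction k with
    | zero =>
      rintro p rfl a ha
      exact (hs p (by omega) a ha).le
    | succ k ih =>
      intro p hp a ha
      exact (ht.upper p a ha).trans (ih (p + 1) (by omega) a (by omega))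
  refine sum_le_sum fun r hr => sum_le_sum fun a ha => ?_
  rw [mem_range] at hr ha
  exact key (N - r) r (by omega) a ha

lemma constantCoeff_xg_ne_zero {A D : Finset ℕ} {a b : ℕ → ℤ} {u : ℤ} (h1 : ∀ k ∈ A, a k ≠ u)
    (h2 : ∀ k ∈ D, b k ≠ u) : PowerSeries.constantCoeff (xg A a D b u) ≠ 0 := by
  rw [xg, map_mul, map_neg, PowerSeries.constantCoeff_inv, map_prod, map_prod]
  refine mul_ne_zero (neg_ne_zero.2 (prod_ne_zero_iff.2 fun k hk => ?_))
    (inv_ne_zero (prod_ne_zero_iff.2 fun k hk => ?_))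
  · rw [constantCoeff_qnum]
    exact_mod_cast sub_ne_zero.2 (h1 k hk)
  · rw [constantCoeff_qnum]
    exact_mod_cast sub_ne_zero.2 (h2 k hk)

lemma constantCoeff_cg_up (ht : IsGT μ t) (hj : j < p) (hT : IsGT μ (bump t 1 p j)) :
    PowerSeries.constantCoeff (cg p (p + 1) t j) ≠ 0 := by
  refine constantCoeff_xg_ne_zero (fun k hk => ?_) fun k hk =>
    ht.lv_ne (mem_range.1 (mem_of_mem_erase hk)) hj (ne_of_mem_erase hk)
  rcases le_or_gt k j with h | h
  · have := hT.lv_le hj h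
    rw [lv_bump_self, lv_bump_row_ne t 1 j (by omega)] at this
    omega
  · exact (ht.lv_lt h (mem_range.1 hk)).ne

lemma constantCoeff_cg_down (ht : IsGT μ t) (hj : j < p) (hT : IsGT μ (bump t (-1) p j)) :
    PowerSeries.constantCoeff (cg p (p - 1) t j) ≠ 0 := by
  refine constantCoeff_xg_ne_zero (fun k hk => ?_) fun k hk =>
    ht.lv_ne (mem_range.1 (mem_of_mem_erase hk)) hj (ne_of_mem_erase hk)
  obtain ⟨q, rfl⟩ : ∃ q, p = q + 1 := ⟨p - 1, by omega⟩
  rw [add_tsub_cancel_right] at hk ⊢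
  rw [mem_range] at hk
  rcases le_or_gt j k with h | h
  · have := hT.lv_le hk h
    rw [lv_bump_self, lv_bump_row_ne t (-1) j (by omega)] at this
    omega
  · exact (ht.lv_lt h hj).ne'

/-- A submodule that is invariant under lowering and contains the largest array contains all
arrays. -/
lemma kz_mem_of_lower {R : Submodule ℂ⟦X⟧ (Mod μ)} (hR : ∀ p < N, ∀ y ∈ R, yop μ p y ∈ R)
    {t₀ : Arr} (h₀ : IsGT μ t₀) (hs₀ : Stable μ N t₀) (hf₀ : Flat N t₀) (hmem : kz μ t₀ ∈ R)
    (ht : IsGT μ t) (hs : Stable μ N t) : kz μ t ∈ R := by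
  have key (n : ℕ) : ∀ t, IsGT μ t → Stable μ N t → totalBound μ N ≤ total N t + n →
      kz μ t ∈ R := by
    -- The outer induction is on the distance of the total from its upper bound. At distance 0 the
    -- array must be flat, since a jump would allow raising beyond the bound.
    induction n with
    | zero =>
      intro t ht hs hn
      by_cases hf : Flat N t
      · rwa [hf.eq hf₀ hs hs₀ ht h₀]
      · obtain ⟨p, hp, hj⟩ := exists_firstJump_of_not_flat hf
        obtain ⟨j, hj, hT, -⟩ := hj.exists_bump ht
        have := total_le hT (hs.bump 1 hp j)
        rw [total_bump 1 hp hj] at this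
        omega
    | succ n ih =>
      -- The inner induction is on the first jump. Lowering row `p` of the raised neighbour gives a
      -- unit times `kz t`, plus arrays of the same total that jump earlier.
      have inner (p : ℕ) : ∀ t, IsGT μ t → Stable μ N t →
          totalBound μ N ≤ total N t + (n + 1 : ℕ) → p < N → FirstJump t p → kz μ t ∈ R := by
        induction p using Nat.strong_induction_on with
        | _ p ihp =>
        intro t ht hs hn hp hJ
        obtain ⟨j, hj, hT, hb⟩ := hJ.exists_bump ht
        have hTR := hR p hp _ (ih _ hT (hs.bump 1 hp j) (by
          rw [total_bump 1 hp hj]; push_cast at hn; omega))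
        rw [yop, LinearMap.neg_apply, Submodule.neg_mem_iff, shiftOp_kz,
          ← add_sum_erase _ _ (mem_range.2 hj), Submodule.add_mem_iff_left] at hTR
        · rw [bump_bump_neg, hat_of hT (by rwa [bump_bump_neg])] at hTR
          have hu : IsUnit (cg p (p - 1) (bump t 1 p j) j) :=
            PowerSeries.isUnit_iff_constantCoeff.2 (isUnit_iff_ne_zero.2
              (constantCoeff_cg_down hT hj (by rwa [bump_bump_neg])))
          exact (Submodule.smul_mem_iff_of_isUnit R hu).1 hTR
        · refine Submodule.sum_mem _ fun j' hj' => Submodule.smul_mem _ _ ?_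
          have hj1 := mem_range.1 (mem_of_mem_erase hj')
          by_cases hG : IsGT μ (bump (bump t 1 p j) (-1) p j')
          · obtain ⟨r, hr, hJr⟩ := hb j' hj1 (ne_of_mem_erase hj')
            refine ihp r hr _ hG ((hs.bump 1 hp j).bump (-1) hp j') ?_ (hr.trans hp) hJr
            rw [total_bump (-1) hp hj1, total_bump 1 hp hj]
            omega
          · rw [kz_eq_zero hG]
            exact Submodule.zero_mem _
      intro t ht hs hn
      by_cases hf : Flat N t
      · rwa [hf.eq hf₀ hs hs₀ ht h₀]
      · obtain ⟨p, hp, hJ⟩ := exists_firstJump_of_not_flat hf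
        exact inner p t ht hs hn hp hJ
  exact key (totalBound μ N - total N t).toNat t ht hs (by omega)

/-- A vector that is killed by raising modulo `h` is a multiple of the largest array modulo
`h`. -/
lemma flat_of_raise {x : Mod μ}
    (h : ∀ p < N, ∀ t, PowerSeries.constantCoeff (co t (xop μ p x)) = 0)
    (ht : PowerSeries.constantCoeff (co t x) ≠ 0) : Flat N t := by
  have hGT {t} (ht : PowerSeries.constantCoeff (co t x) ≠ 0) : IsGT μ t := by
    by_contra hn
    exact ht (by rw [co_of_not x hn, map_zero])
  -- The coefficient of `xop p x` at the raised neighbour of `t` is a unit times that of `x` at `t`,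
  -- plus contributions of arrays that jump earlier; modulo h the latter vanish by induction.
  have key (p : ℕ) : ∀ t, PowerSeries.constantCoeff (co t x) ≠ 0 → p < N → ¬ FirstJump t p := by
    induction p using Nat.strong_induction_on with
    | _ p ihp =>
    intro t ht hp hJ
    obtain ⟨j, hj, hT, hb⟩ := hJ.exists_bump (hGT ht)
    have h1 := h p hp (bump t 1 p j)
    rw [xop, co_shiftOp _ _ _ _ hT, map_sum, ← add_sum_erase _ _ (mem_range.2 hj),
      bump_bump_neg, sum_eq_zero, add_zero, map_mul] at h1
    · exact mul_ne_zero (constantCoeff_cg_up (hGT ht) hj hT) ht h1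
    · intro j' hj'
      obtain ⟨r, hr, hJr⟩ := hb j' (mem_range.1 (mem_of_mem_erase hj')) (ne_of_mem_erase hj')
      rw [map_mul]
      by_contra hne
      exact ihp r hr _ (right_ne_zero_of_mul hne) (hr.trans hp) hJr
  by_contra hf
  obtain ⟨p, hp, hJ⟩ := exists_firstJump_of_not_flat hf
  exact key p t ht hp hJ

/-- A submodule that is invariant under raising contains the largest array, if it is nonzero
modulo `h`. -/
lemma exists_flat_mem {R : Submodule ℂ⟦X⟧ (Mod μ)} (hR : ∀ p < N, ∀ y ∈ R, xop μ p y ∈ R)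
    (hX : ∀ y, (PowerSeries.X : ℂ⟦X⟧) • y ∈ R) {x : Mod μ} (hxR : x ∈ R)
    (hx : ∀ t, co t x ≠ 0 → Stable μ N t) (hne : ∃ t, PowerSeries.constantCoeff (co t x) ≠ 0) :
    ∃ t₀, IsGT μ t₀ ∧ Stable μ N t₀ ∧ Flat N t₀ ∧ kz μ t₀ ∈ R := by
  have hcc {x : Mod μ} {t : Arr} (h : PowerSeries.constantCoeff (co t x) ≠ 0) : co t x ≠ 0 :=
    fun h0 => h (by rw [h0, map_zero])
  have hGT {x : Mod μ} {t : Arr} (h : co t x ≠ 0) : IsGT μ t := by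
    by_contra hn
    exact h (co_of_not x hn)
  -- If all raisings vanish modulo h, then `x` is a unit times the largest array modulo h, and `R`
  -- contains all multiples of h. Otherwise `x` is replaced by a raised vector, whose totals are
  -- larger by one; the bound on totals makes this stop.
  have key (n : ℕ) : ∀ x ∈ R, (∀ t, co t x ≠ 0 → Stable μ N t ∧
      totalBound μ N ≤ total N t + n) → (∃ t, PowerSeries.constantCoeff (co t x) ≠ 0) →
      ∃ t₀, IsGT μ t₀ ∧ Stable μ N t₀ ∧ Flat N t₀ ∧ kz μ t₀ ∈ R := by
    induction n with
    | zero | succ n ih =>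
      intro x hxR hx hne
      by_cases hk : ∀ p < N, ∀ t, PowerSeries.constantCoeff (co t (xop μ p x)) = 0
      · obtain ⟨t₀, h₀⟩ := hne
        have hs₀ := (hx t₀ (hcc h₀)).1
        have hf₀ := flat_of_raise hk h₀
        have hg₀ := hGT (hcc h₀)
        refine ⟨t₀, hg₀, hs₀, hf₀, ?_⟩
        obtain ⟨y, hy⟩ := exists_eq_X_smul (x := x - co t₀ x • kz μ t₀) (by
          intro t
          rw [map_sub, map_smul, co_kz hg₀]
          split_ifs with h
          · rw [h, smul_eq_mul, mul_one, sub_self, map_zero]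
          · rw [smul_zero, sub_zero]
            by_contra hc
            exact h (hf₀.eq (flat_of_raise hk hc) hs₀ (hx t (hcc hc)).1 hg₀
              (hGT (hcc hc))))
        have h1 : co t₀ x • kz μ t₀ ∈ R := by
          rw [show co t₀ x • kz μ t₀ = x - (PowerSeries.X : ℂ⟦X⟧) • y by rw [← hy]; abel]
          exact R.sub_mem hxR (hX y)
        exact (Submodule.smul_mem_iff_of_isUnit R (PowerSeries.isUnit_iff_constantCoeff.2
          (isUnit_iff_ne_zero.2 h₀))).1 h1
      · simp only [not_forall] at hk
        obtain ⟨p, hp, T, hT⟩ := hk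
        have hx' (t : Arr) (ht : co t (xop μ p x) ≠ 0) : Stable μ N t ∧
            ∃ t', IsGT μ t' ∧ co t' x ≠ 0 ∧ total N t = total N t' + 1 := by
          have h1 := ht
          rw [xop, co_shiftOp _ _ _ _ (hGT ht)] at h1
          obtain ⟨j, hj, h2⟩ := exists_ne_zero_of_sum_ne_zero h1
          have h3 := right_ne_zero_of_mul h2
          have h4 := (hx _ h3).1.bump 1 hp j
          rw [bump_neg_bump] at h4
          refine ⟨h4, _, hGT h3, h3, ?_⟩
          rw [total_bump (-1) hp (mem_range.1 hj)]
          ring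
        -- The first alternative is the successor case. For `n = 0` the totals are maximal already,
        -- and raising contradicts `total_le`.
        first
        | exact ih _ (hR p hp _ hxR) (fun t ht => by
            obtain ⟨h1, t', -, h2, h3⟩ := hx' t ht
            have h4 := (hx t' h2).2
            push_cast at h4
            exact ⟨h1, by omega⟩) ⟨T, hT⟩
        | exfalso
          obtain ⟨h1, t', -, h2, h3⟩ := hx' T (hcc hT)
          have h4 := (hx t' h2).2
          have h5 := total_le (hGT (hcc hT)) h1
          push_cast at h4
          omega
  obtain ⟨n, hn⟩ : ∃ n : ℕ, ∀ g ∈ x.support, totalBound μ N ≤ total N g.1 + n := by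
    refine ⟨∑ g ∈ x.support, (totalBound μ N - total N g.1).toNat, fun g hg => ?_⟩
    have := single_le_sum (f := fun g : GT μ => (totalBound μ N - total N g.1).toNat)
      (fun _ _ => Nat.zero_le _) hg
    omega
  refine key n x hxR (fun t ht => ⟨hx t ht, ?_⟩) hne
  refine hn ⟨t, hGT ht⟩ (Finsupp.mem_support_iff.2 ?_)
  rwa [co_of x (hGT ht)] at ht

end Invariant

/-! ### Irreducibility -/

section Generation

variable {μ : ℤ → ℤ} {P : ℕ}

lemma shiftOp_zero (s : ℤ) (c : Arr → ℕ → ℂ⟦X⟧) : shiftOp μ s 0 c = 0 := by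
  refine Mod.hom_ext fun t _ => ?_
  rw [shiftOp_kz, Finset.range_zero, Finset.sum_empty, LinearMap.zero_apply]

/-- Diagonal operators whose eigenvalues agree modulo `h`. -/
lemma exists_diag_eq {f g : Arr → ℂ⟦X⟧}
    (h : ∀ t, PowerSeries.constantCoeff (f t) = PowerSeries.constantCoeff (g t)) :
    ∃ d, diag μ f = diag μ g + (PowerSeries.X : ℂ⟦X⟧) • d := by
  refine ⟨diag μ fun t => divH (f t - g t), ?_⟩
  rw [diag_smul, diag_add]
  refine diag_congr fun t _ => ?_
  rw [X_mul_divH _ (by rw [map_sub, h, sub_self]), add_sub_cancel]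

lemma exists_qz_eq (n : ℤ) : ∃ r, qz n = 1 + PowerSeries.X * r :=
  ⟨divH (qz n - 1), by
    rw [X_mul_divH _ (by rw [map_sub, constantCoeff_qz, map_one, sub_self]), add_sub_cancel]⟩

lemma exists_bop_eq (p : ℕ) : ∃ d, bop μ p =
    diag μ (fun t => ((hw t p : ℤ) : ℂ⟦X⟧)) + (PowerSeries.X : ℂ⟦X⟧) • d :=
  exists_diag_eq fun t => by rw [constantCoeff_qnum, map_intCast]

lemma exists_rop_eq (a : ℤ) : ∃ d, rop μ a = 1 + (PowerSeries.X : ℂ⟦X⟧) • d := by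
  rw [← diag_one]
  exact exists_diag_eq fun t => by rw [constantCoeff_qz, map_one]

lemma hw_comm_xop (p : ℕ) : diag μ (fun t => ((hw t p : ℤ) : ℂ⟦X⟧)) * xop μ (p + 1) =
    xop μ (p + 1) * diag μ (fun t => ((hw t p : ℤ) : ℂ⟦X⟧)) - xop μ (p + 1) := by
  have := diag_comm_shiftOp (μ := μ) (s := 1) (p := p + 1) (c := cg (p + 1) (p + 2))
    (f := fun t => ((hw t p : ℤ) : ℂ⟦X⟧)) (z := -1) fun t j hj => by
      rw [hw_bump_succ t 1 hj]; push_cast; ring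
  rw [sub_eq_iff_eq_add] at this
  rw [xop, this, neg_one_smul]
  abel

lemma hw_comm_yop (p : ℕ) : diag μ (fun t => ((hw t p : ℤ) : ℂ⟦X⟧)) * yop μ (p + 1) =
    yop μ (p + 1) * diag μ (fun t => ((hw t p : ℤ) : ℂ⟦X⟧)) + yop μ (p + 1) := by
  have := diag_comm_shiftOp (μ := μ) (s := -1) (p := p + 1) (c := cg (p + 1) p)
    (f := fun t => ((hw t p : ℤ) : ℂ⟦X⟧)) (z := 1) fun t j hj => by
      rw [hw_bump_succ t (-1) hj]; push_cast; ring
  rw [sub_eq_iff_eq_add] at this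
  rw [yop, mul_neg, add_tsub_cancel_right, this, one_smul]
  noncomm_ring

/-- The next raising operator is, modulo `h`, a commutator of the generators. -/
lemma exists_xop_eq (p : ℕ) : ∃ Z, xop μ (p + 2) =
    yop μ (p + 1) * eop μ (p + 1) - eop μ (p + 1) * yop μ (p + 1) +
      (PowerSeries.X : ℂ⟦X⟧) • Z := by
  obtain ⟨r, hr⟩ := exists_qz_eq (eps (p + 1))
  obtain ⟨d, hd⟩ := exists_bop_eq (μ := μ) (p + 1)
  have hb := bop_eq (μ := μ) (p + 1) (by omega)
  have hc := (commute_xop_yop (μ := μ) (p := p + 2) (p' := p + 1) (by omega)).eq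
  have hh := hw_comm_xop (μ := μ) (p + 1)
  set x := xop μ (p + 1)
  set y := yop μ (p + 1)
  set x' := xop μ (p + 2)
  set D := diag μ fun t => ((hw t (p + 1) : ℤ) : ℂ⟦X⟧)
  -- At h = 0 the right-hand side becomes the commutator of `x'` with the integral weight of row `p
  -- + 1`. That weight drops by one under `x'`, so the commutator is `x'` itself.
  have key : y * eop μ (p + 1) - eop μ (p + 1) * y =
      qz (eps (p + 1)) • (x' * bop μ (p + 1)) - bop μ (p + 1) * x' := by
    rw [eop, qComm, ← hb]
    simp only [mul_sub, sub_mul, mul_smul_comm, smul_mul_assoc, smul_sub]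
    rw [show y * (x' * x) = x' * (y * x) by rw [← mul_assoc, ← hc, mul_assoc],
      show x * x' * y = x * y * x' by rw [mul_assoc, hc, mul_assoc], mul_assoc y x x',
      mul_assoc x' x y]
    abel
  refine ⟨-(x' * d - d * x' + r • (x' * D + (PowerSeries.X : ℂ⟦X⟧) • (x' * d))), ?_⟩
  rw [key, hd, hr, mul_add, add_mul, hh, mul_smul_comm, smul_mul_assoc]
  simp only [smul_add, add_smul, one_smul, smul_smul, smul_sub, smul_neg, add_mul, one_mul, mul_assoc]
  abel

/-- The next lowering operator is, modulo `h`, a commutator of the generators. -/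
lemma exists_yop_eq (p : ℕ) : ∃ Z, yop μ (p + 2) =
    fop μ (p + 1) * xop μ (p + 1) - xop μ (p + 1) * fop μ (p + 1) +
      (PowerSeries.X : ℂ⟦X⟧) • Z := by
  obtain ⟨r, hr⟩ := exists_qz_eq (-eps (p + 1))
  obtain ⟨d, hd⟩ := exists_bop_eq (μ := μ) (p + 1)
  have hb := bop_eq (μ := μ) (p + 1) (by omega)
  have hc := (commute_xop_yop (μ := μ) (p := p + 1) (p' := p + 2) (by omega)).eq
  have hh := hw_comm_yop (μ := μ) (p + 1)
  set x := xop μ (p + 1)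
  set y := yop μ (p + 1)
  set y' := yop μ (p + 2)
  set D := diag μ fun t => ((hw t (p + 1) : ℤ) : ℂ⟦X⟧)
  have key : fop μ (p + 1) * x - x * fop μ (p + 1) =
      qz (-eps (p + 1)) • (bop μ (p + 1) * y') - y' * bop μ (p + 1) := by
    rw [fop, qComm, ← hb]
    simp only [mul_sub, sub_mul, mul_smul_comm, smul_mul_assoc, smul_sub]
    rw [show x * (y' * y) = y' * (x * y) by rw [← mul_assoc, hc, mul_assoc],
      show y * y' * x = y * x * y' by rw [mul_assoc, ← hc, mul_assoc], mul_assoc y' y x,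
      mul_assoc x y y']
    abel
  refine ⟨-(d * y' - y' * d + r • (D * y' + (PowerSeries.X : ℂ⟦X⟧) • (d * y'))), ?_⟩
  rw [key, hd, hr, mul_add, add_mul, hh, mul_smul_comm, smul_mul_assoc]
  simp only [smul_add, add_smul, one_smul, smul_smul, smul_sub, smul_neg, add_mul, one_mul, mul_assoc]
  abel

/-- Modulo `h`, the generators generate the operators that move one entry. -/
lemma xop_yop_mem {B : Subalgebra ℂ⟦X⟧ (Module.End ℂ⟦X⟧ (Mod μ))}
    (hX : ∀ T, (PowerSeries.X : ℂ⟦X⟧) • T ∈ B) (he : ∀ p, p + 2 ≤ P → eop μ p ∈ B)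
    (hf : ∀ p, p + 2 ≤ P → fop μ p ∈ B) (p : ℕ) (hp : p < P) : xop μ p ∈ B ∧ yop μ p ∈ B := by
  induction p with
  | zero =>
    rw [xop, yop, shiftOp_zero, shiftOp_zero, neg_zero]
    exact ⟨B.zero_mem, B.zero_mem⟩
  | succ p ih =>
    obtain ⟨hx, hy⟩ := ih (by omega)
    rcases p with _ | p
    · obtain ⟨d, hd⟩ := exists_rop_eq (μ := μ) (eps 1)
      obtain ⟨d', hd'⟩ := exists_rop_eq (μ := μ) (-eps 1)
      have h1 := he 0 (by omega)
      have h2 := hf 0 (by omega)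
      rw [eop, hd, add_mul, one_mul, smul_mul_assoc] at h1
      rw [fop, hd', mul_add, mul_one, mul_smul_comm] at h2
      have h3 := B.sub_mem h1 (hX (d * xop μ 1))
      have h4 := B.sub_mem h2 (hX (yop μ 1 * d'))
      rw [add_sub_cancel_right] at h3 h4
      exact ⟨h3, h4⟩
    · have h1 := he (p + 1) (by omega)
      have h2 := hf (p + 1) (by omega)
      obtain ⟨Z, hZ⟩ := exists_xop_eq (μ := μ) p
      obtain ⟨Z', hZ'⟩ := exists_yop_eq (μ := μ) p
      rw [show p + 1 + 1 = p + 2 from rfl, hZ, hZ']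
      exact ⟨B.add_mem (B.sub_mem (B.mul_mem hy h1) (B.mul_mem h1 hy)) (hX Z),
        B.add_mem (B.sub_mem (B.mul_mem h2 hx) (B.mul_mem hx h2)) (hX Z')⟩

/-- The vectors that are reached from `x` modulo `h`. -/
def reach (B : Subalgebra ℂ⟦X⟧ (Module.End ℂ⟦X⟧ (Mod μ))) (x : Mod μ) :
    Submodule ℂ⟦X⟧ (Mod μ) where
  carrier := {y | ∃ T ∈ B, ∃ z, T x = y + (PowerSeries.X : ℂ⟦X⟧) • z}
  zero_mem' := ⟨0, B.zero_mem, 0, by simp⟩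
  add_mem' := by
    rintro y y' ⟨T, hT, z, h⟩ ⟨T', hT', z', h'⟩
    exact ⟨T + T', B.add_mem hT hT', z + z', by rw [LinearMap.add_apply, h, h', smul_add]; abel⟩
  smul_mem' := by
    rintro c y ⟨T, hT, z, h⟩
    exact ⟨c • T, B.smul_mem hT c, c • z, by rw [LinearMap.smul_apply, h, smul_add, smul_comm]⟩

lemma apply_mem_reach {B : Subalgebra ℂ⟦X⟧ (Module.End ℂ⟦X⟧ (Mod μ))} {x y : Mod μ}
    {T : Module.End ℂ⟦X⟧ (Mod μ)} (hT : T ∈ B) (hy : y ∈ reach B x) : T y ∈ reach B x := by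
  obtain ⟨S, hS, z, h⟩ := hy
  exact ⟨T * S, B.mul_mem hT hS, T z, by rw [Module.End.mul_apply, h, map_add, map_smul]⟩

lemma mem_of_forall_co {R : Submodule ℂ⟦X⟧ (Mod μ)} {y : Mod μ}
    (h : ∀ t, IsGT μ t → co t y ≠ 0 → kz μ t ∈ R) : y ∈ R := by
  rw [← Finsupp.sum_single y]
  refine Submodule.sum_mem _ fun g hg => ?_
  rw [← mul_one (y g), ← smul_eq_mul, ← Finsupp.smul_single, ← kz_of]
  refine R.smul_mem _ (h _ g.2 ?_)
  rw [co_of y g.2]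
  exact Finsupp.mem_support_iff.1 hg

/-- The operators that move one entry act irreducibly modulo `h`. -/
lemma exists_operator {B : Subalgebra ℂ⟦X⟧ (Module.End ℂ⟦X⟧ (Mod μ))}
    (hX : ∀ T, (PowerSeries.X : ℂ⟦X⟧) • T ∈ B) (he : ∀ p, p + 2 ≤ P → eop μ p ∈ B)
    (hf : ∀ p, p + 2 ≤ P → fop μ p ∈ B) {x y : Mod μ} (hx : ∀ t, co t x ≠ 0 → Stable μ P t)
    (hy : ∀ t, co t y ≠ 0 → Stable μ P t) (hne : ¬ ∃ z, x = (PowerSeries.X : ℂ⟦X⟧) • z) :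
    ∃ T ∈ B, ∃ z, T x = y + (PowerSeries.X : ℂ⟦X⟧) • z := by
  have hxy := xop_yop_mem hX he hf
  have h1 : ∃ t, PowerSeries.constantCoeff (co t x) ≠ 0 := by
    by_contra hn
    push Not at hn
    exact hne (exists_eq_X_smul hn)
  -- The submodule reached from `x` modulo h contains all multiples of h and is invariant under `B`,
  -- in particular under all `xop` and `yop` of the first rows.
  obtain ⟨t₀, h₀, hs₀, hf₀, hmem⟩ := exists_flat_mem (R := reach B x)
    (fun p hp y hy => apply_mem_reach (hxy p hp).1 hy)
    (fun y => ⟨0, B.zero_mem, -y, by simp⟩) ⟨1, B.one_mem, 0, by simp⟩ hx h1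
  exact mem_of_forall_co (R := reach B x) fun t ht hty => kz_mem_of_lower
    (fun p hp y hy => apply_mem_reach (hxy p hp).2 hy) h₀ hs₀ hf₀ hmem ht (hy t hty)

lemma exists_stable (x : Mod μ) : ∃ N, ∀ N' ≥ N, ∀ t, co t x ≠ 0 → Stable μ N' t := by
  choose n hn using fun g : GT μ => g.2.stable
  refine ⟨∑ g ∈ x.support, n g, fun N' hN t ht => ?_⟩
  have hGT : IsGT μ t := by
    by_contra h
    exact ht (co_of_not x h)
  rw [co_of x hGT] at ht
  have := Finset.single_le_sum (f := n) (fun _ _ => Nat.zero_le _) (Finsupp.mem_support_iff.2 ht)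
  exact Stable.mono (hn ⟨t, hGT⟩) (this.trans hN)

end Generation

/-! ### From approximation modulo h to irreducibility -/

section Irreducible

variable {M : ℤ → ℂ[X]} {μ : ℤ → ℤ} (hμ : ∀ i, M i = M 0 + ((μ i : ℤ) : ℂ[X])) (ξ₀ ξ₁ : ℂ[X])

/-- The operators that agree modulo `h` with an element of `U_h(a_∞)`. -/
def imageMod : Subalgebra ℂ⟦X⟧ (Module.End ℂ⟦X⟧ (Mod μ)) where
  carrier := {T | ∃ u R, repn hμ ξ₀ ξ₁ u = extendHom hμ T + (PowerSeries.X : ℂ⟦X⟧) • R}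
  mul_mem' := by
    rintro S T ⟨u, R, h⟩ ⟨u', R', h'⟩
    refine ⟨u * u', extendHom hμ S * R' + R * (extendHom hμ T + (PowerSeries.X : ℂ⟦X⟧) • R'), ?_⟩
    rw [map_mul, map_mul, h, h']
    simp only [mul_add, add_mul, smul_mul_assoc, mul_smul_comm, smul_add]
    abel
  add_mem' := by
    rintro S T ⟨u, R, h⟩ ⟨u', R', h'⟩
    exact ⟨u + u', R + R', by rw [map_add, map_add, h, h', smul_add]; abel⟩
  algebraMap_mem' c := ⟨algebraMap _ _ c, 0, by rw [AlgHom.commutes, AlgHom.commutes]; simp⟩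

lemma eact_mem (p : ℕ) : eact μ p ∈ imageMod hμ ξ₀ ξ₁ ∧ fact μ p ∈ imageMod hμ ξ₀ ξ₁ := by
  obtain ⟨n, rfl | rfl⟩ : ∃ n, p = 2 * n ∨ p = 2 * n + 1 := ⟨p / 2, by omega⟩
  · exact ⟨⟨Uh.of (Gen.f (Int.negSucc n)), 0, by rw [repn_of, genAct, fAct]; simp⟩,
      ⟨Uh.of (Gen.e (Int.negSucc n)), 0, by rw [repn_of, genAct, eAct]; simp⟩⟩
  · exact ⟨⟨Uh.of (Gen.e (Int.ofNat n)), 0, by rw [repn_of, genAct, eAct]; simp⟩,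
      ⟨Uh.of (Gen.f (Int.ofNat n)), 0, by rw [repn_of, genAct, fAct]; simp⟩⟩

lemma X_smul_mem (T : Module.End ℂ⟦X⟧ (Mod μ)) :
    (PowerSeries.X : ℂ⟦X⟧) • T ∈ imageMod hμ ξ₀ ξ₁ :=
  ⟨0, -extendHom hμ T, by rw [map_zero, map_smul, smul_neg, add_neg_cancel]⟩

/-- Modulo h both vectors may be taken in the free module, where only finitely many rows matter.
Conjugation by the gauge factor turns the symmetric generators into `eop` and `fop`, for which
`exists_operator` applies. -/
lemma exists_repn_mod {w : V M} (hw : ¬ ∃ z, w = (PowerSeries.X : ℂ⟦X⟧) • z) (v : V M) :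
    ∃ u z, repn hμ ξ₀ ξ₁ u w = v + (PowerSeries.X : ℂ⟦X⟧) • z := by
  obtain ⟨x, w', rfl⟩ := exists_emb hμ 1 w
  obtain ⟨y, v', rfl⟩ := exists_emb hμ 1 v
  rw [pow_one] at hw ⊢
  obtain ⟨N, hN⟩ := exists_stable x
  obtain ⟨N', hN'⟩ := exists_stable y
  -- From row `P` on, all arrays occurring in `x` and `y` are given by the signature, so operators
  -- moving entries below row `P` suffice, and the truncated gauge factor is valid for them.
  set P := max N N'
  set Γ := diag μ (gauge P)
  set Γ' := diag μ fun t => (gauge P t)⁻¹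
  have hΓ : Γ' * Γ = 1 := by
    rw [diag_mul, ← diag_one]
    exact diag_congr fun t ht =>
      PowerSeries.inv_mul_cancel _ (ht.isPos_gauge P).constantCoeff_ne_zero
  have hΓx (z : Mod μ) : Γ' (Γ z) = z := LinearMap.congr_fun hΓ z
  obtain ⟨T, ⟨u, R, hu⟩, z, hz⟩ := exists_operator (P := P)
    (B := (imageMod hμ ξ₀ ξ₁).comap (gaugeHom μ P)) (x := Γ x) (y := Γ y)
    (fun T => by
      rw [Subalgebra.mem_comap, map_smul]
      exact X_smul_mem hμ ξ₀ ξ₁ _)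
    (fun p hp => by
      rw [Subalgebra.mem_comap, gaugeHom_eop hp]
      exact (eact_mem hμ ξ₀ ξ₁ p).1)
    (fun p hp => by
      rw [Subalgebra.mem_comap, gaugeHom_fop hp]
      exact (eact_mem hμ ξ₀ ξ₁ p).2)
    (fun t ht => by
      rw [co_diag] at ht
      exact hN P (le_max_left _ _) t (right_ne_zero_of_mul ht))
    (fun t ht => by
      rw [co_diag] at ht
      exact hN' P (le_max_right _ _) t (right_ne_zero_of_mul ht))
    (by
      rintro ⟨z, hz⟩
      refine hw ⟨emb hμ (Γ' z) + w', ?_⟩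
      rw [← hΓx x, hz, map_smul, map_smul, smul_add])
  have h1 : gaugeHom μ P T x = y + (PowerSeries.X : ℂ⟦X⟧) • Γ' z := by
    rw [gaugeHom_apply, Module.End.mul_apply, Module.End.mul_apply, hz, map_add, map_smul, hΓx]
  refine ⟨u, emb hμ (Γ' z) + R (emb hμ x) + repn hμ ξ₀ ξ₁ u w' - v', ?_⟩
  have hu' : repn hμ ξ₀ ξ₁ u = extendHom hμ (gaugeHom μ P T) + (PowerSeries.X : ℂ⟦X⟧) • R := hu
  rw [map_add, map_smul]
  nth_rewrite 1 [hu']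
  rw [LinearMap.add_apply, extendHom_emb, h1, LinearMap.smul_apply, map_add, map_smul]
  simp only [smul_add, smul_sub]
  abel

/-- Successive approximation: the error of a solution modulo h is h times a vector, which is treated
in the same way. The corrections form an h-adically convergent series, and its sum comes from
`U_h(a_∞)` by `exists_hsum`. -/
lemma exists_repn {w : V M} (hw : ¬ ∃ z, w = (PowerSeries.X : ℂ⟦X⟧) • z) (v : V M) :
    ∃ u, repn hμ ξ₀ ξ₁ u w = v := by
  choose u z hz using exists_repn_mod hμ ξ₀ ξ₁ hw
  -- After `n` corrections the error is h^n times `s n`.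
  let s : ℕ → V M := fun n => Nat.rec v (fun _ y => -z y) n
  obtain ⟨U, hU⟩ := exists_hsum (repn hμ ξ₀ ξ₁) fun k => u (s k)
  refine ⟨U, eq_of_forall_pow fun n => ?_⟩
  have key : ∑ k ∈ Finset.range n, (PowerSeries.X : ℂ⟦X⟧) ^ k • repn hμ ξ₀ ξ₁ (u (s k)) w =
      v - (PowerSeries.X : ℂ⟦X⟧) ^ n • s n := by
    induction n with
    | zero => simp [s]
    | succ n ih =>
      have hs : s (n + 1) = -z (s n) := rfl
      rw [Finset.sum_range_succ, ih, hz, hs, pow_succ, mul_smul, smul_neg, smul_add, smul_neg]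
      abel
  obtain ⟨T, hT⟩ := hsum_spec (fun k => repn hμ ξ₀ ξ₁ (u (s k))) n
  refine ⟨T w - s n, ?_⟩
  rw [hU, hT, LinearMap.add_apply, LinearMap.sum_apply, LinearMap.smul_apply, smul_sub]
  simp only [LinearMap.smul_apply]
  rw [key]
  abel

/-- Nonzero vectors are divisible by a largest power of `h`. -/
lemma exists_max_pow {w : V M} (hw : w ≠ 0) :
    ∃ (n : ℕ) (z : V M), w = (PowerSeries.X : ℂ⟦X⟧) ^ n • z ∧
      ¬ ∃ y, z = (PowerSeries.X : ℂ⟦X⟧) • y := by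
  classical
  have hex : ∃ n : ℕ, ¬ ∃ y, w = (PowerSeries.X : ℂ⟦X⟧) ^ n • y := by
    by_contra h
    push Not at h
    exact hw (IsTopFree.eq_zero_of_forall w h)
  obtain ⟨n, hn⟩ : ∃ n, Nat.find hex = n + 1 :=
    Nat.exists_eq_succ_of_ne_zero fun h => by
      have := Nat.find_spec hex
      rw [h] at this
      exact this ⟨w, by simp⟩
  have h1 := Nat.find_min hex (m := n) (by omega)
  push Not at h1
  obtain ⟨z, hz⟩ := h1
  refine ⟨n, z, hz, ?_⟩
  rintro ⟨y, rfl⟩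
  have := Nat.find_spec hex
  rw [hn] at this
  exact this ⟨y, by rw [hz, smul_smul, ← pow_succ]⟩

lemma ket_not_smul (hμ : ∀ i, M i = M 0 + ((μ i : ℤ) : ℂ[X])) {t : Arr} (ht : IsGT μ t) :
    ¬ ∃ z, ket M (toC M t) = (PowerSeries.X : ℂ⟦X⟧) • z := by
  rintro ⟨z, hz⟩
  rw [← emb_kz hμ ht.toIsFrame] at hz
  obtain ⟨y, hy⟩ := emb_eq_smul hμ (n := 1) (by rw [hz, pow_one])
  have h1 := congrArg (fun x => PowerSeries.constantCoeff (co t x)) hy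
  simp only [pow_one, map_smul, co_kz ht, if_pos, smul_eq_mul, map_mul,
    PowerSeries.constantCoeff_X, zero_mul, map_one] at h1
  exact one_ne_zero h1

/-- The exponent is the least power of h dividing a nonzero vector of `W` exactly. Such a vector is
h^n z with `z` not divisible by h; since `z` is sent to every vector, the orbit of h^n z is all of
h^n V. -/
lemma isIrreducible_repn {t : Arr} (ht : IsGT μ t) : IsIrreducible (repn hμ ξ₀ ξ₁) where
  nontrivial := ⟨⟨ket M (toC M t), 0, fun h => ket_not_smul hμ ht ⟨0, by rw [h, smul_zero]⟩⟩⟩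
  eq_hPow W hW hne := by
    classical
    have hex : ∃ n : ℕ, ∃ w ∈ W, ∃ z : V M, w = (PowerSeries.X : ℂ⟦X⟧) ^ n • z ∧
        ¬ ∃ y, z = (PowerSeries.X : ℂ⟦X⟧) • y := by
      obtain ⟨w, hw, h0⟩ := W.ne_bot_iff.1 hne
      obtain ⟨n, z, h⟩ := exists_max_pow h0
      exact ⟨n, w, hw, z, h⟩
    refine ⟨Nat.find hex, fun v => ⟨fun hv => ?_, ?_⟩⟩
    · by_cases h0 : v = 0
      · exact ⟨0, by rw [h0, smul_zero]⟩
      obtain ⟨n, z, rfl, hz⟩ := exists_max_pow h0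
      obtain ⟨k, rfl⟩ := Nat.exists_eq_add_of_le (Nat.find_min' hex ⟨_, hv, z, rfl, hz⟩)
      exact ⟨(PowerSeries.X : ℂ⟦X⟧) ^ k • z, by rw [smul_smul, ← pow_add]⟩
    · rintro ⟨y, rfl⟩
      obtain ⟨w, hw, z, h, hz⟩ := Nat.find_spec hex
      obtain ⟨u, hu⟩ := exists_repn hμ ξ₀ ξ₁ hz y
      rw [← hu, ← map_smul, ← h]
      exact hW u w hw

end Irreducible

end UhaInfinity

end

open UhaInfinity in
theorem proposition2 (M : ℤ → ℂ[X]) (ξ₀ ξ₁ : ℂ[X])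
    (hM : ∀ i j : ℤ, i < j → IsNatConst (M i - M j)) :
    ∃ ρ : Rep M,
      ActsOnBasis ξ₀ ξ₁ ρ ∧
      (∀ ρ' : Rep M, ActsOnBasis ξ₀ ξ₁ ρ' → ρ' = ρ) ∧
      IsHAdicContinuous ρ ∧
      IsHighestWeight ρ (ket M fun i _ => M i)
        (fun i => ((M i + (ξ₁ - ξ₀) * (theta (-i) : ℂ[X]) - ξ₁ : ℂ[X]) : ℂ⟦X⟧)) ∧
      IsIrreducible ρ ∧
      (∀ x y : V M, x ≠ 0 → ∃ (u : Uh) (a : ℂ⟦X⟧), a ≠ 0 ∧ ρ u x = a • y) := by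
  obtain ⟨μ, hμ⟩ := exists_signature hM
  have hanti := antitone_signature hM hμ
  have htop := isGT_top hanti
  have hact := actsOnBasis_repn hμ ξ₀ ξ₁
  have hns := ket_not_smul hμ htop
  refine ⟨repn hμ ξ₀ ξ₁, hact, fun ρ' h => h.eq hμ hact, isHAdicContinuous _, ?_,
    isIrreducible_repn hμ ξ₀ ξ₁ htop, fun x y hx => ?_⟩
  · rw [← toC_top hμ]
    refine ⟨fun h => hns ⟨0, by rw [h, smul_zero]⟩, fun i => ?_, fun i => ?_,
      exists_repn hμ ξ₀ ξ₁ hns⟩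
    · rw [repn_of, genAct, ← emb_kz hμ htop.toIsFrame, extendHom_emb, eAct_top hanti, map_zero]
    · rw [repn_of, genAct_h hμ ξ₀ ξ₁ htop, toC_top hμ, weight_top]
  -- After extraction of the largest power of h from `x`, the cofactor is sent exactly to `y`; the
  -- scalar is that power.
  · obtain ⟨n, z, rfl, hz⟩ := exists_max_pow hx
    obtain ⟨u, hu⟩ := exists_repn hμ ξ₀ ξ₁ hz y
    exact ⟨u, PowerSeries.X ^ n, pow_ne_zero _ PowerSeries.X_ne_zero, by rw [map_smul, hu]⟩
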